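/- Let $d\ge 0$ be an integer, let $I\subseteq\mathbb R$ be an open interval, let $X$ be either $\mathbb R^d$ or the torus $\mathbb T^d=\mathbb R^d/\mathbb Z^d$, and let $3\le r\le\infty$. Let $(v,p)$ be a weak solution of the incompressible Euler equations on $I\times X$, that is, $v:I\times X\to\mathbb R^d$ is measurable with $|v|^2\in L^1_{\mathrm{loc}}(I\times X)$, $p\in L^1_{\mathrm{loc}}(I\times X)$ is real-valued, and $$\partial_t v^\ell+\nabla_j(v^jv^\ell)+\nabla^\ell p=0,\qquad \nabla_j v^j=0$$ in the sense of distributions on $I\times X$. Suppose that $v\in L^r_tB^{1/3}_{r,\infty}(I\times X)$, that is, the function $t\mapsto\|v(t,\cdot)\|_{B^{1/3}_{r,\infty}(X)}$ belongs to $L^r(I)$, where $$\|f\|_{B^{1/3}_{r,\infty}(X)}=\|f\|_{L^r(X)}+\sup_{h\in\mathbb R^d\setminus\{0\}}|h|^{-1/3}\|f(\cdot-h)-f\|_{L^r(X)}.$$ (i) There is $c\in L^1_{\mathrm{loc}}(I)$ such that $(p-c(t))\,v\in L^1_{\mathrm{loc}}(I\times X)$. (Thus, after subtracting from the pressure a function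 of time alone, which does not affect the Euler equations, the distribution in (ii) is defined.) (ii) Suppose that $p\,v\in L^1_{\mathrm{loc}}(I\times X)$, so that the Duchon–Robert distribution $D[v,p]$ given by $$-D[v,p]=\partial_t\Big(\frac{|v|^2}{2}\Big)+\nabla_j\Big(\Big(\frac{|v|^2}{2}+p\Big)v^j\Big)$$ is defined on $I\times X$. Then $D[v,p]$ is a signed Radon measure on $I\times X$: there are mutually singular Borel measures $\nu_+,\nu_-$ on $I\times X$, finite on compact subsets of $I\times X$, such that $\langle\varphi,D[v,p]\rangle=\int\varphi\,d\nu_+-\int\varphi\,d\nu_-$ for every $\varphi\in C_c^\infty(I\times X)$. If moreover $r>3$, then this measure is absolutely continuous with respect to the Lebesgue measure on $I\times X$, and its Radon–Nikodym derivative belongs to $L^{r/3}(I\times X)$ (with $r/3=\infty$ if $r=\infty$). -/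

import Mathlib

open MeasureTheory Set
open scoped ENNReal ContDiff

/-! Space-time is `I × X`, where `I ⊆ ℝ` is an open interval and the space `X` is either
`ℝ^d` or the torus `𝕋^d = ℝ^d / ℤ^d`.  Both are handled at once through the projection
`π : ℝ^d → X`: the identity for `ℝ^d`, the quotient map for `𝕋^d`.  A point `h` of `ℝ^d` acts on
`X` by the translation `x ↦ x + π h`. -/

/-- The quotient map `ℝ^d → 𝕋^d = (ℝ / ℤ)^d`. -/
def torusProj (d : ℕ) (x : EuclideanSpace ℝ (Fin d)) : UnitAddTorus (Fin d) :=
  fun i => (x i : UnitAddCircle)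

section SpaceTime

variable {d : ℕ} {X : Type*} [AddCommGroup X] [TopologicalSpace X]

/-- Smooth real-valued functions on `ℝ × X` with compact support contained in `I × X`.
Smoothness on `X` means smoothness of the lift to `ℝ^d`. -/
def IsSpaceTimeTest (π : EuclideanSpace ℝ (Fin d) → X) (I : Set ℝ) (φ : ℝ × X → ℝ) : Prop :=
  ContDiff ℝ ∞ (fun z : ℝ × EuclideanSpace ℝ (Fin d) => φ (z.1, π z.2)) ∧
    HasCompactSupport φ ∧ tsupport φ ⊆ I ×ˢ (univ : Set X)

/-- The time derivative `∂ₜ φ`. -/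
noncomputable def timeDeriv (φ : ℝ × X → ℝ) (z : ℝ × X) : ℝ :=
  deriv (fun s : ℝ => φ (s, z.2)) z.1

/-- The spatial partial derivative `∇ⱼ φ`. -/
noncomputable def spaceDeriv (π : EuclideanSpace ℝ (Fin d) → X) (j : Fin d)
    (φ : ℝ × X → ℝ) (z : ℝ × X) : ℝ :=
  deriv (fun s : ℝ => φ (z.1, z.2 + π (s • EuclideanSpace.single j (1 : ℝ)))) 0

variable [MeasureSpace X]

/-- `(v, p)` is a weak solution of the incompressible Euler equations
`∂ₜ v^ℓ + ∇ⱼ (v^j v^ℓ) + ∇^ℓ p = 0`, `∇ⱼ v^j = 0` on `I × X`: the velocity `v` is locally square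
integrable, the pressure `p` is a (locally integrable) function, and the equations hold in the
sense of distributions on `I × X`. -/
structure IsWeakEulerSolution (π : EuclideanSpace ℝ (Fin d) → X) (I : Set ℝ)
    (v : ℝ × X → EuclideanSpace ℝ (Fin d)) (p : ℝ × X → ℝ) : Prop where
  aestronglyMeasurable : AEStronglyMeasurable v (volume.restrict (I ×ˢ (univ : Set X)))
  locallyIntegrable_sq : LocallyIntegrableOn (fun z => ‖v z‖ ^ 2) (I ×ˢ (univ : Set X))
  locallyIntegrable_pressure : LocallyIntegrableOn p (I ×ˢ (univ : Set X))
  momentum : ∀ φ : ℝ × X → ℝ, IsSpaceTimeTest π I φ → ∀ l : Fin d,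
    ∫ z in I ×ˢ (univ : Set X),
      (v z l * timeDeriv φ z + (∑ j, v z j * v z l * spaceDeriv π j φ z)
        + p z * spaceDeriv π l φ z) = 0
  incompressible : ∀ φ : ℝ × X → ℝ, IsSpaceTimeTest π I φ →
    ∫ z in I ×ˢ (univ : Set X), ∑ j, v z j * spaceDeriv π j φ z = 0

/-- The Besov norm of `B^s_{r,∞}(X)`, with values in `[0, ∞]`:
`‖f‖_{L^r} + sup_{h ≠ 0} |h|^{-s} ‖f(· - h) - f‖_{L^r}`. -/
noncomputable def besovNorm (π : EuclideanSpace ℝ (Fin d) → X) (s : ℝ) (r : ℝ≥0∞)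
    (f : X → EuclideanSpace ℝ (Fin d)) : ℝ≥0∞ :=
  eLpNorm f r volume +
    ⨆ (h : EuclideanSpace ℝ (Fin d)) (_ : h ≠ 0),
      ENNReal.ofReal (‖h‖ ^ (-s)) * eLpNorm (fun x => f (x - π h) - f x) r volume

/-- `v ∈ L^r_t B^s_{r,∞}` on `I × X`. -/
def MemLtBesov (π : EuclideanSpace ℝ (Fin d) → X) (I : Set ℝ) (s : ℝ) (r : ℝ≥0∞)
    (v : ℝ × X → EuclideanSpace ℝ (Fin d)) : Prop :=
  AEStronglyMeasurable v (volume.restrict (I ×ˢ (univ : Set X))) ∧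
    eLpNorm (fun t : ℝ => besovNorm π s r (fun x => v (t, x))) r (volume.restrict I) < ⊤

/-- The Duchon–Robert distribution `D[v,p]` on `I × X`, evaluated at a test function `φ`, where
`-D[v,p] = ∂ₜ (|v|²/2) + ∇ⱼ ((|v|²/2 + p) v^j)` in the sense of distributions. -/
noncomputable def dissipation (π : EuclideanSpace ℝ (Fin d) → X) (I : Set ℝ)
    (v : ℝ × X → EuclideanSpace ℝ (Fin d)) (p : ℝ × X → ℝ) (φ : ℝ × X → ℝ) : ℝ :=
  ∫ z in I ×ˢ (univ : Set X),
    (‖v z‖ ^ 2 / 2 * timeDeriv φ z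
      + ∑ j, (‖v z‖ ^ 2 / 2 + p z) * v z j * spaceDeriv π j φ z)

end SpaceTime

/-- A signed Radon measure on the open set `U`, given by its Jordan decomposition: two mutually
singular Borel measures living on `U` and finite on the compact subsets of `U`.  The total
variation need not be finite.  (In a locally compact, second countable space, regularity is
automatic.) -/
structure SignedRadonMeasure {Y : Type*} [TopologicalSpace Y] [MeasurableSpace Y]
    (U : Set Y) where
  pos : Measure Y
  neg : Measure Y
  pos_compl : pos Uᶜ = 0
  neg_compl : neg Uᶜ = 0
  pos_lt_top : ∀ K : Set Y, IsCompact K → K ⊆ U → pos K < ⊤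
  neg_lt_top : ∀ K : Set Y, IsCompact K → K ⊆ U → neg K < ⊤
  mutuallySingular : pos ⟂ₘ neg

namespace SignedRadonMeasure

variable {Y : Type*} [TopologicalSpace Y] [MeasurableSpace Y] {U : Set Y}

/-- The integral of a function against a signed Radon measure. -/
noncomputable def integral (ν : SignedRadonMeasure U) (φ : Y → ℝ) : ℝ :=
  ∫ z, φ z ∂ν.pos - ∫ z, φ z ∂ν.neg

/-- Absolute continuity of a signed Radon measure with respect to a positive measure. -/
def IsAbsolutelyContinuous (ν : SignedRadonMeasure U) (μ : Measure Y) : Prop :=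
  ν.pos ≪ μ ∧ ν.neg ≪ μ

/-- The Radon–Nikodym derivative of a signed Radon measure. -/
noncomputable def density (ν : SignedRadonMeasure U) (μ : Measure Y) (z : Y) : ℝ :=
  (ν.pos.rnDeriv μ z).toReal - (ν.neg.rnDeriv μ z).toReal

end SignedRadonMeasure

/-! Testing the momentum equation at one point against the velocity at a second point, and
symmetrizing, gives the Kármán–Howarth–Monin relation (`integral_prod_khm`, `integral_khm`). In it
all derivatives fall on the test function φ or on a kernel m of the increment, and the terms with
derivatives of m combine into |δv|² δv, where δv is the velocity increment. Shrinking m to the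
origin, first in time and then in space, yields the Duchon–Robert formula (`tendsto_dissipation`):
D[v,p] is the limit of -(1/4) ∫ ∇ρ_ε(h) · δ_h v |δ_h v|² dh.

With a third of a derivative in L^r, the cube |δ_h v|³ has norm O(|h|) in L^{r/3}, and ∫ |∇ρ_ε| |h|
dh is bounded independently of ε. So the approximations are bounded in L^{r/3}
(`lintegral_mul_increment_le`, `IsDyadicKernel.lintegral_partialD_le`). Their limit is a signed
Radon measure when r = 3. When r > 3 it has a density, because L^{r/3} is then a dual space
(`exists_mutuallySingular_tendsto_integral_mul`, `exists_signedRadonMeasure_of_tendsto`).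

The limit in the two-point relation requires ∫ p(z) v(z - y) dz to be continuous in y, so p and v
should lie locally in conjugate exponents, while p is only assumed locally integrable. It is
therefore shown that p - c(t) is locally in L^{3/2} for a suitable c, which also gives (i). Singular
integrals are avoided: mollifiers at consecutive dyadic scales differ by the Laplacian of a
compactly supported function (`exists_mollifier_laplacian`), so by -Δp = ∂_i ∂_j (v_i v_j)
consecutive averages of p differ by an explicit average of v_i v_j. Below unit scale the kernels
have mean zero and see only increments, so the differences form a geometric series in L^{3/2}
(`IsWeakEulerSolution.memLp_pressure_sub_mollify`). Above unit scale the gradients of the averages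
are summed instead. Their differences are O(2^{-n}), and the sum controls the unit-scale gradient
once the gradient averages vanish at infinity (`IsWeakEulerSolution.ae_abs_mollify_partialD_le`).
This decay comes from v ∈ L^r on ℝ^d with r < ∞, and from periodicity on the torus. On ℝ^d with r =
∞ it may fail, but there v is bounded and p ∈ L^1_loc suffices.

The torus is reduced to ℝ^d: periodic extensions of weak solutions are weak solutions, and every
test function on the torus is a periodization. Only the L^{r/3} bound is carried out on the torus
itself. -/

open Filter Topology
open scoped Pointwise CompactlySupported

/-! ### Weak limits of densities bounded as functionals on L^p -/

section WeakLimits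

variable {Ω : Type*} [TopologicalSpace Ω] [T2Space Ω] [LocallyCompactSpace Ω]
  [SecondCountableTopology Ω] [MeasurableSpace Ω] [BorelSpace Ω] {vol : Measure Ω}

omit [T2Space Ω] [LocallyCompactSpace Ω] [SecondCountableTopology Ω] in
lemma eLpNorm_lt_top_of_compactlySupported [IsFiniteMeasureOnCompacts vol] (p : ℝ≥0∞)
    (g : C_c(Ω, ℝ)) : eLpNorm g p vol < ⊤ :=
  (g.continuous.memLp_of_hasCompactSupport g.hasCompactSupport (p := p) (μ := vol)).2

/-- Nonnegative densities that are bounded as functionals on `L^p` have a weak limit along an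
ultrafilter. -/
theorem exists_measure_tendsto_integral_mul [IsFiniteMeasureOnCompacts vol] {p C : ℝ≥0∞}
    (hC : C ≠ ⊤) (l : Ultrafilter ℕ) (a : ℕ → Ω → ℝ) (ha : ∀ n x, 0 ≤ a n x)
    (hm : ∀ n, Measurable (a n))
    (hb : ∀ n (g : C_c(Ω, ℝ)), ∫⁻ x, ‖g x * a n x‖ₑ ∂vol ≤ C * eLpNorm g p vol) :
    ∃ μ : Measure Ω, IsFiniteMeasureOnCompacts μ ∧
      (∀ g : C_c(Ω, ℝ), Tendsto (fun n => ∫ x, g x * a n x ∂vol) l (𝓝 (∫ x, g x ∂μ))) ∧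
      ∀ g : C_c(Ω, ℝ), ENNReal.ofReal (∫ x, g x ∂μ) ≤ C * eLpNorm g p vol := by
  have hfin : ∀ g : C_c(Ω, ℝ), C * eLpNorm g p vol < ⊤ := fun g =>
    ENNReal.mul_lt_top hC.lt_top (eLpNorm_lt_top_of_compactlySupported p g)
  have hint : ∀ n (g : C_c(Ω, ℝ)), Integrable (fun x => g x * a n x) vol := fun n g =>
    ⟨(g.continuous.measurable.mul (hm n)).aestronglyMeasurable, (hb n g).trans_lt (hfin g)⟩
  have hbd : ∀ n (g : C_c(Ω, ℝ)),
      ‖∫ x, g x * a n x ∂vol‖ ≤ (C * eLpNorm g p vol).toReal := by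
    intro n g
    rw [← toReal_enorm]
    exact ENNReal.toReal_mono (hfin g).ne ((enorm_integral_le_lintegral_enorm _).trans (hb n g))
  -- The integrals stay in a fixed compact ball of ℝ. An ultrafilter makes them converge for all g
  -- at once, with no diagonal extraction.
  have hlim : ∀ g : C_c(Ω, ℝ), ∃ x, Tendsto (fun n => ∫ x, g x * a n x ∂vol) l (𝓝 x) := by
    intro g
    have hK := isCompact_closedBall (0 : ℝ) (C * eLpNorm g p vol).toReal
    obtain ⟨x, -, hx⟩ := hK.ultrafilter_le_nhds (l.map fun n => ∫ x, g x * a n x ∂vol) (by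
      rw [le_principal_iff]
      exact Filter.Eventually.of_forall (f := (l : Filter ℕ)) fun n => by simpa using hbd n g)
    exact ⟨x, hx⟩
  choose Λ hΛ using hlim
  let Λ' : C_c(Ω, ℝ) →ₗ[ℝ] ℝ :=
    { toFun := Λ
      map_add' := fun g h => by
        refine tendsto_nhds_unique (hΛ (g + h)) (((hΛ g).add (hΛ h)).congr fun n => ?_)
        rw [← integral_add (hint n g) (hint n h)]
        exact integral_congr_ae (.of_forall fun x => by simp [add_mul])
      map_smul' := fun c g => by
        refine tendsto_nhds_unique (hΛ (c • g)) (((hΛ g).const_mul c).congr fun n => ?_)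
        rw [← integral_const_mul]
        exact integral_congr_ae (.of_forall fun x => by simp [mul_assoc]) }
  let P : C_c(Ω, ℝ) →ₚ[ℝ] ℝ := PositiveLinearMap.mk₀ Λ' (fun g hg => by
    refine ge_of_tendsto' (hΛ g) fun n => integral_nonneg fun x => mul_nonneg (hg x) (ha n x))
  have hP : ∀ g : C_c(Ω, ℝ), ∫ x, g x ∂(RealRMK.rieszMeasure P) = Λ g := fun g =>
    RealRMK.integral_rieszMeasure P g
  refine ⟨RealRMK.rieszMeasure P, inferInstance, fun g => ?_, fun g => ?_⟩
  · rw [hP]; exact hΛ g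
  · rw [hP]
    refine ENNReal.ofReal_le_of_le_toReal ?_
    exact le_of_tendsto' (hΛ g) fun n => (le_abs_self _).trans (hbd n g)

/-- The two parts of the Jordan decomposition of `μ₁ - μ₂`, relative to `μ₁ + μ₂`. -/
theorem exists_mutuallySingular_sub (μ₁ μ₂ : Measure Ω) [SigmaFinite μ₁] [SigmaFinite μ₂] :
    ∃ ν₁ ν₂ κ : Measure Ω, ν₁ ⟂ₘ ν₂ ∧ ν₁ + κ = μ₁ ∧ ν₂ + κ = μ₂ := by
  set l := μ₁ + μ₂
  set f := μ₁.rnDeriv l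
  set g := μ₂.rnDeriv l
  have hf : Measurable f := Measure.measurable_rnDeriv _ _
  have hg : Measurable g := Measure.measurable_rnDeriv _ _
  have h1 : l.withDensity f = μ₁ :=
    Measure.withDensity_rnDeriv_eq _ _ (Measure.le_add_right le_rfl).absolutelyContinuous
  have h2 : l.withDensity g = μ₂ :=
    Measure.withDensity_rnDeriv_eq _ _ (Measure.le_add_left le_rfl).absolutelyContinuous
  -- The common part κ has density f ⊓ g. Truncated subtraction in `ℝ≥0∞` leaves f - g and g - f,
  -- which live on complementary sets.
  refine ⟨l.withDensity (f - g), l.withDensity (g - f), l.withDensity (f ⊓ g), ?_, ?_, ?_⟩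
  · refine ⟨{x | f x ≤ g x}, measurableSet_le hf hg, ?_, ?_⟩
    · rw [withDensity_apply _ (measurableSet_le hf hg)]
      refine (setLIntegral_congr_fun (measurableSet_le hf hg) (g := fun _ => 0) fun x hx => ?_).trans
        (by simp)
      exact tsub_eq_zero_of_le hx
    · rw [withDensity_apply _ (measurableSet_le hf hg).compl]
      refine (setLIntegral_congr_fun (measurableSet_le hf hg).compl (g := fun _ => 0)
        fun x hx => ?_).trans (by simp)
      exact tsub_eq_zero_of_le (not_le.1 (show ¬ f x ≤ g x from hx)).le
  · rw [← withDensity_add_left (hf.sub hg), ← h1]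
    congr 1; ext x
    exact tsub_add_min
  · rw [← withDensity_add_left (hg.sub hf), ← h2]
    congr 1; ext x
    simp only [Pi.add_apply, Pi.sub_apply, Pi.inf_apply]
    rw [inf_comm]
    exact tsub_add_min

/-- A bound against continuous functions with compact support extends to bounded functions. -/
theorem lintegral_le_of_compactlySupported [IsFiniteMeasureOnCompacts vol] {p C : ℝ≥0∞}
    (hC : C ≠ ⊤) (hp : p ≠ ⊤) (hp1 : 1 ≤ p) (ν : Measure Ω) [IsFiniteMeasureOnCompacts ν]
    (hν : ∀ g : C_c(Ω, ℝ), (∀ x, 0 ≤ g x) →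
      ENNReal.ofReal (∫ x, g x ∂ν) ≤ C * eLpNorm g p vol)
    {w : Ω → ℝ} (hw : Measurable w) (hw0 : ∀ x, 0 ≤ w x) {M : ℝ} (hwM : ∀ x, w x ≤ M)
    {K : Set Ω} (hK : IsCompact K) (hwK : ∀ x ∉ K, w x = 0) :
    ∫⁻ x, ENNReal.ofReal (w x) ∂ν ≤ C * eLpNorm w p vol := by
  -- Approximating w in L^p of the sum vol + ν produces one continuous function that is close to w
  -- for both measures.
  haveI : IsFiniteMeasureOnCompacts (vol + ν) :=
    ⟨fun K hK => by simpa using ⟨hK.measure_lt_top, hK.measure_lt_top⟩⟩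
  have hwi : K.indicator w = w := by
    ext x; by_cases hx : x ∈ K <;> simp [hx, hwK]
  have hwmem : MemLp w p (vol + ν) := by
    rw [← hwi, memLp_indicator_iff_restrict hK.measurableSet]
    haveI : IsFiniteMeasure ((vol + ν).restrict K) := ⟨by simpa using
      ⟨hK.measure_lt_top (μ := vol), hK.measure_lt_top (μ := ν)⟩⟩
    exact MemLp.of_bound hw.aestronglyMeasurable M (.of_forall fun x => by
      rw [Real.norm_of_nonneg (hw0 x)]; exact hwM x)
  -- The Hölder constant for passing from L^p(ν) to L^1(ν) on K.
  set c : ℝ≥0∞ := ν K ^ (1 / (1 : ℝ≥0∞).toReal - 1 / p.toReal) with hc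
  have hexp : 0 ≤ 1 / (1 : ℝ≥0∞).toReal - 1 / p.toReal := by
    have : 1 ≤ p.toReal := by
      simpa using ENNReal.toReal_mono hp hp1
    simp only [ENNReal.toReal_one, div_one, sub_nonneg]
    exact (div_le_one (by linarith)).2 this
  have hcfin : c ≠ ⊤ := ENNReal.rpow_ne_top_of_nonneg hexp hK.measure_lt_top.ne
  have key : ∀ ε : ℝ≥0∞, ε ≠ 0 →
      ∫⁻ x, ENNReal.ofReal (w x) ∂ν ≤ C * (eLpNorm w p vol + ε) + ε * c := by
    intro ε hε
    obtain ⟨g, hgs, hg, hgc, -⟩ := hwmem.exists_hasCompactSupport_eLpNorm_sub_le hp hε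
    have hgs' : HasCompactSupport fun x => max (g x) 0 :=
      hgs.comp_left (g := fun y : ℝ => max y 0) (by simp)
    let G : C_c(Ω, ℝ) := ⟨⟨fun x => max (g x) 0, by fun_prop⟩, hgs'⟩
    have hG : ∀ x, G x = max (g x) 0 := fun x => rfl
    have hle : ∀ x, ‖w x - G x‖ ≤ ‖(w - g) x‖ := by
      intro x
      rw [hG, Real.norm_eq_abs, Pi.sub_apply, Real.norm_eq_abs]
      have := abs_max_sub_max_le_abs (w x) (g x) 0
      rwa [max_eq_left (hw0 x)] at this
    have h1 : eLpNorm (fun x => w x - G x) p vol ≤ ε :=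
      (eLpNorm_mono hle).trans ((eLpNorm_mono_measure _ (Measure.le_add_right le_rfl)).trans hg)
    have h2 : eLpNorm (fun x => w x - G x) p ν ≤ ε :=
      (eLpNorm_mono hle).trans ((eLpNorm_mono_measure _ (Measure.le_add_left le_rfl)).trans hg)
    have hGm : Measurable G := G.continuous.measurable
    have h3 : ∫⁻ x in K, ‖w x - G x‖ₑ ∂ν ≤ ε * c := by
      rw [← eLpNorm_one_eq_lintegral_enorm]
      refine (eLpNorm_le_eLpNorm_mul_rpow_measure_univ hp1
        (hw.sub hGm).aestronglyMeasurable).trans ?_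
      rw [Measure.restrict_apply_univ]
      exact mul_le_mul_left ((eLpNorm_mono_measure _ Measure.restrict_le_self).trans h2) _
    have h4 : ∫⁻ x, ENNReal.ofReal (G x) ∂ν ≤ C * (eLpNorm w p vol + ε) := by
      rw [← ofReal_integral_eq_lintegral_ofReal (f := (G : Ω → ℝ))
        (G.continuous.integrable_of_hasCompactSupport G.hasCompactSupport)
        (.of_forall fun x => le_max_right _ _)]
      refine (hν G fun x => le_max_right _ _).trans (mul_le_mul_right ?_ _)
      have : (G : Ω → ℝ) = w - fun x => w x - G x := by ext x; simp
      rw [this]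
      exact (eLpNorm_sub_le hw.aestronglyMeasurable (hw.sub hGm).aestronglyMeasurable hp1).trans
        (add_le_add_right h1 _)
    calc ∫⁻ x, ENNReal.ofReal (w x) ∂ν = ∫⁻ x in K, ENNReal.ofReal (w x) ∂ν := by
          rw [← lintegral_indicator hK.measurableSet]
          refine lintegral_congr fun x => ?_
          by_cases hx : x ∈ K <;> simp [hx, hwK]
      _ ≤ ∫⁻ x in K, (ENNReal.ofReal (G x) + ‖w x - G x‖ₑ) ∂ν := by
          refine lintegral_mono fun x => ?_
          rw [Real.enorm_eq_ofReal_abs, ← ENNReal.ofReal_add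
            (show 0 ≤ G x from le_max_right _ _) (abs_nonneg _)]
          exact ENNReal.ofReal_le_ofReal (by linarith [le_abs_self (w x - G x)])
      _ ≤ ∫⁻ x, ENNReal.ofReal (G x) ∂ν + ε * c := by
          rw [lintegral_add_left (by fun_prop)]
          gcongr
          exact Measure.restrict_le_self
      _ ≤ _ := by gcongr
  have hlim : Tendsto (fun ε : ℝ≥0∞ => C * (eLpNorm w p vol + ε) + ε * c) (𝓝[≠] 0)
      (𝓝 (C * (eLpNorm w p vol + 0) + 0 * c)) := by
    refine Tendsto.add ?_ ?_
    · exact ENNReal.Tendsto.const_mul (tendsto_const_nhds.add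
        (tendsto_id.mono_left nhdsWithin_le_nhds)) (Or.inr hC)
    · exact ENNReal.Tendsto.mul_const (tendsto_id.mono_left nhdsWithin_le_nhds) (Or.inr hcfin)
  simp only [add_zero, zero_mul] at hlim
  exact ge_of_tendsto hlim (eventually_nhdsWithin_of_forall fun ε hε => key ε hε)

/-- A measure that is bounded as a functional on `L^p`, `p < ∞`, has a density in the dual space. -/
theorem absolutelyContinuous_of_integral_le [IsFiniteMeasureOnCompacts vol] {p q C : ℝ≥0∞}
    (hC : C ≠ ⊤) (hp : p ≠ ⊤) (hpq : ENNReal.HolderConjugate p q)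
    (ν : Measure Ω) [IsFiniteMeasureOnCompacts ν]
    (hν : ∀ g : C_c(Ω, ℝ), (∀ x, 0 ≤ g x) →
      ENNReal.ofReal (∫ x, g x ∂ν) ≤ C * eLpNorm g p vol) :
    ν ≪ vol ∧ eLpNorm (ν.rnDeriv vol) q vol ≤ C := by
  have hp1 : 1 ≤ p := hpq.one_le
  have hw := fun {w} => lintegral_le_of_compactlySupported hC hp hp1 ν hν (w := w)
  have hp0 : p ≠ 0 := (zero_lt_one.trans_le hp1).ne'
  let S : CompactExhaustion Ω := default
  -- Indicators of relatively compact sets as test functions. This already gives absolute continuity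
  -- because p is finite.
  have hA : ∀ n (A : Set Ω), MeasurableSet A → ν (A ∩ S n) ≤ C * vol (A ∩ S n) ^ (1 / p.toReal) := by
    intro n A hA
    have hm : MeasurableSet (A ∩ S n) := hA.inter (S.isCompact n).measurableSet
    have := hw (w := (A ∩ S n).indicator fun _ => 1) (measurable_const.indicator hm)
      (fun x => indicator_nonneg (fun _ _ => zero_le_one) _) (M := 1)
      (fun x => indicator_le_self' (fun _ _ => zero_le_one) x) (S.isCompact n)
      (fun x hx => indicator_of_notMem (fun h => hx h.2) _)
    rw [eLpNorm_indicator_const hm hp0 hp] at this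
    have h2 : ∫⁻ x, ENNReal.ofReal ((A ∩ S n).indicator (fun _ => (1 : ℝ)) x) ∂ν = ν (A ∩ S n) := by
      rw [← lintegral_indicator_one hm]
      refine lintegral_congr fun x => ?_
      by_cases hx : x ∈ A ∩ S n <;> simp [indicator, hx]
    rw [h2] at this
    simpa using this
  have hmono : ∀ A : Set Ω, Monotone fun n => A ∩ S n := fun A m n h =>
    inter_subset_inter_right _ (S.subset h)
  have hU : ∀ A : Set Ω, ⋃ n, A ∩ S n = A := fun A => by
    rw [← inter_iUnion, S.iUnion_eq, inter_univ]
  have hac : ν ≪ vol := by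
    refine Measure.AbsolutelyContinuous.mk fun A hAm hA0 => ?_
    rw [← hU A, measure_iUnion_null_iff]
    intro n
    refine le_antisymm ((hA n A hAm).trans ?_) zero_le
    rw [measure_mono_null inter_subset_left hA0, ENNReal.zero_rpow_of_pos, mul_zero]
    exact one_div_pos.2 (ENNReal.toReal_pos hp0 hp)
  refine ⟨hac, ?_⟩
  set f := ν.rnDeriv vol
  have hf : Measurable f := Measure.measurable_rnDeriv _ _
  have hd : vol.withDensity f = ν := Measure.withDensity_rnDeriv_eq _ _ hac
  by_cases hq : q = ⊤
  · subst hq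
    -- For p = 1 the bound on indicators says ν ≤ C • vol on every set, hence the density is at most
    -- C.
    have hp' : p = 1 := by simpa using hpq.inv_add_inv_eq_one
    subst hp'
    rw [eLpNorm_exponent_top]
    refine essSup_le_of_ae_le _ ?_
    refine ae_le_of_forall_setLIntegral_le_of_sigmaFinite hf fun A hAm _ => ?_
    simp only [enorm_eq_self]
    rw [setLIntegral_const, ← withDensity_apply _ hAm, hd, ← hU A]
    rw [(hmono A).measure_iUnion]
    refine iSup_le fun n => (hA n A hAm).trans ?_
    simp only [ENNReal.toReal_one, div_one, ENNReal.rpow_one]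
    gcongr
    exact subset_iUnion (fun n => A ∩ S n) n
  · have hq0 : q ≠ 0 := (zero_lt_one.trans_le hpq.symm.one_le).ne'
    have hconj : p.toReal.HolderConjugate q.toReal := by
      have := hpq
      exact ENNReal.HolderConjugate.toReal_of_ne_top hp hq
    set P := p.toReal
    set Q := q.toReal
    have hQ1 : 0 < Q - 1 := by linarith [hconj.symm.lt]
    -- Truncations in height and space make J below finite, so that it may be divided out.
    set F : ℕ → Ω → ℝ≥0∞ := fun n => (S n : Set Ω).indicator fun x => min (f x) n with hF
    have hFm : ∀ n, Measurable (F n) := fun n =>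
      (hf.min measurable_const).indicator (S.isCompact n).measurableSet
    have hFn : ∀ n x, F n x ≤ n := fun n x =>
      (indicator_le_self' (fun _ _ => zero_le) x).trans (min_le_right _ _)
    have hFf : ∀ n x, F n x ≤ f x := fun n x =>
      (indicator_le_self' (fun _ _ => zero_le) x).trans (min_le_left _ _)
    have hFtop : ∀ n x, F n x ≠ ⊤ := fun n x => ((hFn n x).trans_lt (by simp)).ne
    have key : ∀ n, ∫⁻ x, F n x ^ Q ∂vol ≤ C ^ Q := by
      intro n
      set J := ∫⁻ x, F n x ^ Q ∂vol with hJ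
      have hJfin : J ≠ ⊤ := by
        have : J ≤ ∫⁻ x in S n, (n : ℝ≥0∞) ^ Q ∂vol := by
          rw [← lintegral_indicator (S.isCompact n).measurableSet]
          refine lintegral_mono fun x => ?_
          by_cases hx : x ∈ S n
          · simp only [indicator_of_mem hx]
            exact ENNReal.rpow_le_rpow (hFn n x) hconj.symm.nonneg
          · simp [hF, indicator_of_notMem hx, hconj.symm.pos]
        refine (this.trans_lt ?_).ne
        rw [setLIntegral_const]
        exact ENNReal.mul_lt_top (ENNReal.rpow_lt_top_of_nonneg hconj.symm.nonneg (by simp))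
          (S.isCompact n).measure_lt_top
      -- The extremal function in Hölder's inequality: w^P = F^Q, while w F = F^Q, so the functional
      -- bound reads J ≤ C J^{1/P}.
      set w : Ω → ℝ := fun x => (F n x).toReal ^ (Q - 1)
      have hwF : ∀ x, ENNReal.ofReal (w x) = F n x ^ (Q - 1) := fun x => by
        rw [← ENNReal.ofReal_rpow_of_nonneg ENNReal.toReal_nonneg hQ1.le,
          ENNReal.ofReal_toReal (hFtop n x)]
      have h1 := hw (w := w) ((hFm n).ennreal_toReal.pow_const _) (fun x => by positivity)
        (M := (n : ℝ) ^ (Q - 1)) (fun x => by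
          refine Real.rpow_le_rpow ENNReal.toReal_nonneg ?_ hQ1.le
          simpa using ENNReal.toReal_mono (by simp) (hFn n x)) (S.isCompact n) (fun x hx => by
          simp [w, hF, indicator_of_notMem hx, hQ1.ne'])
      have h2 : eLpNorm w p vol = J ^ (1 / P) := by
        rw [eLpNorm_eq_lintegral_rpow_enorm_toReal hp0 hp]
        congr 1
        refine lintegral_congr fun x => ?_
        rw [Real.enorm_of_nonneg (by positivity), hwF, ← ENNReal.rpow_mul]
        congr 1
        exact hconj.symm.sub_one_mul_conj
      have h3 : J ≤ ∫⁻ x, ENNReal.ofReal (w x) ∂ν := by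
        rw [← hd, lintegral_withDensity_eq_lintegral_mul _ hf (by fun_prop)]
        refine lintegral_mono fun x => ?_
        rw [Pi.mul_apply, hwF]
        calc F n x ^ Q = F n x ^ (1 : ℝ) * F n x ^ (Q - 1) := by
              rw [← ENNReal.rpow_add_of_nonneg _ _ zero_le_one hQ1.le]; congr 1; ring
          _ ≤ f x * F n x ^ (Q - 1) := by
              rw [ENNReal.rpow_one]; gcongr; exact hFf n x
      rw [h2] at h1
      have h4 := h3.trans h1
      rcases eq_or_ne J 0 with h0 | h0
      · rw [h0]; exact zero_le
      have h5 : J ^ (1 / Q) ≤ C := by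
        have : J ^ (1 / Q) * J ^ (1 / P) = J := by
          rw [← ENNReal.rpow_add _ _ h0 hJfin]
          have := hconj.inv_add_inv_eq_one
          rw [one_div, one_div, add_comm, this, ENNReal.rpow_one]
        have h6 : J ^ (1 / Q) * J ^ (1 / P) ≤ C * J ^ (1 / P) := by rwa [this]
        refine (ENNReal.mul_le_mul_iff_left ?_ ?_).1 h6
        · simp [h0, hJfin]
        · exact ENNReal.rpow_ne_top_of_nonneg (by have := hconj.pos; positivity) hJfin
      calc J = (J ^ (1 / Q)) ^ Q := by
            rw [← ENNReal.rpow_mul, one_div, inv_mul_cancel₀ hconj.symm.ne_zero, ENNReal.rpow_one]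
        _ ≤ C ^ Q := ENNReal.rpow_le_rpow h5 hconj.symm.nonneg
    rw [eLpNorm_eq_lintegral_rpow_enorm_toReal hq0 hq]
    have hle : ∫⁻ x, f x ^ Q ∂vol ≤ C ^ Q := by
      have hFmono : ∀ x, Monotone fun n => F n x := by
        intro x m n hmn
        simp only [hF]
        by_cases hx : x ∈ S m
        · rw [indicator_of_mem hx, indicator_of_mem (S.subset hmn hx)]
          exact min_le_min le_rfl (by exact_mod_cast hmn)
        · rw [indicator_of_notMem hx]; exact zero_le
      have hsup : ∀ x, Tendsto (fun n => F n x) atTop (𝓝 (f x)) := by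
        intro x
        obtain ⟨N, hN⟩ := S.exists_mem x
        have : Tendsto (fun n : ℕ => min (f x) n) atTop (𝓝 (min (f x) ⊤)) :=
          tendsto_const_nhds.min ENNReal.tendsto_nat_nhds_top
        rw [min_top_right] at this
        refine this.congr' ?_
        filter_upwards [eventually_ge_atTop N] with n hn
        exact (indicator_of_mem (S.subset hn hN) fun x => min (f x) (n : ℝ≥0∞)).symm
      refine le_of_tendsto' (lintegral_tendsto_of_tendsto_of_monotone
        (fun n => ((hFm n).pow_const Q).aemeasurable) (.of_forall fun x m n hmn =>
          ENNReal.rpow_le_rpow (hFmono x hmn) hconj.symm.nonneg) (.of_forall fun x =>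
          (ENNReal.continuous_rpow_const.tendsto _).comp (hsup x))) key
    calc (∫⁻ x, ‖f x‖ₑ ^ Q ∂vol) ^ (1 / Q) ≤ (C ^ Q) ^ (1 / Q) :=
          ENNReal.rpow_le_rpow hle (one_div_nonneg.2 hconj.symm.nonneg)
      _ = C := by
          rw [← ENNReal.rpow_mul, one_div, mul_inv_cancel₀ hconj.symm.ne_zero, ENNReal.rpow_one]

/-- Densities that are bounded as functionals on `L^p` converge weakly, along a subfamily, to a
difference of mutually singular measures. -/
theorem exists_mutuallySingular_tendsto_integral_mul [IsFiniteMeasureOnCompacts vol]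
    {p q C : ℝ≥0∞} (hC : C ≠ ⊤) (hpq : ENNReal.HolderConjugate p q) (f : ℕ → Ω → ℝ)
    (hm : ∀ n, Measurable (f n))
    (hb : ∀ n (g : C_c(Ω, ℝ)), ∫⁻ x, ‖g x * f n x‖ₑ ∂vol ≤ C * eLpNorm g p vol) :
    ∃ ν₁ ν₂ : Measure Ω, IsFiniteMeasureOnCompacts ν₁ ∧ IsFiniteMeasureOnCompacts ν₂ ∧ ν₁ ⟂ₘ ν₂ ∧
      (∀ (g : C_c(Ω, ℝ)) (D : ℝ), Tendsto (fun n => ∫ x, g x * f n x ∂vol) atTop (𝓝 D) →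
        D = ∫ x, g x ∂ν₁ - ∫ x, g x ∂ν₂) ∧
      (p ≠ ⊤ → (ν₁ ≪ vol ∧ eLpNorm (ν₁.rnDeriv vol) q vol ≤ C) ∧
        (ν₂ ≪ vol ∧ eLpNorm (ν₂.rnDeriv vol) q vol ≤ C)) := by
  have hb1 : ∀ n (g : C_c(Ω, ℝ)), ∫⁻ x, ‖g x * max (f n x) 0‖ₑ ∂vol ≤ C * eLpNorm g p vol :=
    fun n g => (lintegral_mono fun x => by
      simp only [enorm_mul]
      gcongr
      rw [Real.enorm_eq_ofReal_abs, Real.enorm_eq_ofReal_abs]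
      exact ENNReal.ofReal_le_ofReal (by
        rw [abs_of_nonneg (le_max_right _ _)]
        exact max_le (le_abs_self _) (abs_nonneg _))).trans (hb n g)
  have hb2 : ∀ n (g : C_c(Ω, ℝ)), ∫⁻ x, ‖g x * max (-f n x) 0‖ₑ ∂vol ≤ C * eLpNorm g p vol :=
    fun n g => (lintegral_mono fun x => by
      simp only [enorm_mul]
      gcongr
      rw [Real.enorm_eq_ofReal_abs, Real.enorm_eq_ofReal_abs]
      exact ENNReal.ofReal_le_ofReal (by
        rw [abs_of_nonneg (le_max_right _ _)]
        exact max_le (neg_le_abs _) (abs_nonneg _))).trans (hb n g)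
  have hm1 : ∀ n, Measurable fun x => max (f n x) 0 := fun n => (hm n).max measurable_const
  have hm2 : ∀ n, Measurable fun x => max (-f n x) 0 := fun n => (hm n).neg.max measurable_const
  -- Positive and negative parts converge along the same ultrafilter, so their difference tests
  -- correctly. They may overlap in the limit, hence the removal of κ.
  obtain ⟨μ₁, i1, l1, c1⟩ := exists_measure_tendsto_integral_mul hC (hyperfilter ℕ)
    (fun n x => max (f n x) 0) (fun n x => le_max_right _ _) hm1 hb1
  obtain ⟨μ₂, i2, l2, c2⟩ := exists_measure_tendsto_integral_mul hC (hyperfilter ℕ)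
    (fun n x => max (-f n x) 0) (fun n x => le_max_right _ _) hm2 hb2
  obtain ⟨ν₁, ν₂, κ, hs, h1, h2⟩ := exists_mutuallySingular_sub μ₁ μ₂
  have hle1 : ν₁ ≤ μ₁ := h1 ▸ Measure.le_add_right le_rfl
  have hle2 : ν₂ ≤ μ₂ := h2 ▸ Measure.le_add_right le_rfl
  have hleκ : κ ≤ μ₁ := h1 ▸ Measure.le_add_left le_rfl
  have j1 : IsFiniteMeasureOnCompacts ν₁ := ⟨fun K hK => (hle1 K).trans_lt hK.measure_lt_top⟩
  have j2 : IsFiniteMeasureOnCompacts ν₂ := ⟨fun K hK => (hle2 K).trans_lt hK.measure_lt_top⟩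
  have jκ : IsFiniteMeasureOnCompacts κ := ⟨fun K hK => (hleκ K).trans_lt hK.measure_lt_top⟩
  have hgi : ∀ (g : C_c(Ω, ℝ)) (μ : Measure Ω) [IsFiniteMeasureOnCompacts μ],
      Integrable (fun x => g x) μ := fun g μ _ =>
    g.continuous.integrable_of_hasCompactSupport g.hasCompactSupport
  have hfin : ∀ g : C_c(Ω, ℝ), C * eLpNorm g p vol < ⊤ := fun g =>
    ENNReal.mul_lt_top hC.lt_top (eLpNorm_lt_top_of_compactlySupported p g)
  refine ⟨ν₁, ν₂, j1, j2, hs, fun g D hD => ?_, fun hp => ⟨?_, ?_⟩⟩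
  · have e1 : ∫ x, g x ∂μ₁ = ∫ x, g x ∂ν₁ + ∫ x, g x ∂κ := by
      rw [← h1, integral_add_measure (hgi g _) (hgi g _)]
    have e2 : ∫ x, g x ∂μ₂ = ∫ x, g x ∂ν₂ + ∫ x, g x ∂κ := by
      rw [← h2, integral_add_measure (hgi g _) (hgi g _)]
    have h3 : Tendsto (fun n => ∫ x, g x * f n x ∂vol) (hyperfilter ℕ)
        (𝓝 (∫ x, g x ∂μ₁ - ∫ x, g x ∂μ₂)) := by
      refine ((l1 g).sub (l2 g)).congr fun n => ?_
      rw [← integral_sub]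
      · refine integral_congr_ae (.of_forall fun x => ?_)
        have : max (f n x) 0 - max (-f n x) 0 = f n x := by
          rcases le_total 0 (f n x) with h | h
          · rw [max_eq_left h, max_eq_right (by linarith), sub_zero]
          · rw [max_eq_right h, max_eq_left (by linarith)]; ring
        simp only
        rw [← mul_sub, this]
      · exact ⟨(g.continuous.measurable.mul (hm1 n)).aestronglyMeasurable,
          (hb1 n g).trans_lt (hfin g)⟩
      · exact ⟨(g.continuous.measurable.mul (hm2 n)).aestronglyMeasurable,
          (hb2 n g).trans_lt (hfin g)⟩
    have h4 := tendsto_nhds_unique (hD.mono_left Nat.hyperfilter_le_atTop) h3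
    rw [h4, e1, e2]; ring
  · refine absolutelyContinuous_of_integral_le hC hp hpq ν₁ fun g hg => le_trans ?_ (c1 g)
    exact ENNReal.ofReal_le_ofReal (integral_mono_measure hle1 (.of_forall hg) (hgi g _))
  · refine absolutelyContinuous_of_integral_le hC hp hpq ν₂ fun g hg => le_trans ?_ (c2 g)
    exact ENNReal.ofReal_le_ofReal (integral_mono_measure hle2 (.of_forall hg) (hgi g _))

end WeakLimits

/-! ### Partial derivatives on ℝ^d -/

section PartialDerivatives

variable {d : ℕ}

/-- The partial derivative `∂ₗ f` of a function on `ℝ^d`. -/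
noncomputable def partialD (l : Fin d) (f : EuclideanSpace ℝ (Fin d) → ℝ)
    (x : EuclideanSpace ℝ (Fin d)) : ℝ :=
  fderiv ℝ f x (EuclideanSpace.single l 1)

/-- The Laplacian of a function on `ℝ^d`. -/
noncomputable def laplacian (f : EuclideanSpace ℝ (Fin d) → ℝ)
    (x : EuclideanSpace ℝ (Fin d)) : ℝ :=
  ∑ l, partialD l (partialD l f) x

lemma contDiff_partialD {f : EuclideanSpace ℝ (Fin d) → ℝ} (hf : ContDiff ℝ ∞ f) (l : Fin d) :
    ContDiff ℝ ∞ (partialD l f) :=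
  (hf.fderiv_right (m := ∞) (by simp)).clm_apply contDiff_const

lemma HasCompactSupport.partialD {f : EuclideanSpace ℝ (Fin d) → ℝ} (hf : HasCompactSupport f)
    (l : Fin d) : HasCompactSupport (partialD l f) :=
  hf.fderiv_apply ℝ _

lemma tsupport_partialD_subset {f : EuclideanSpace ℝ (Fin d) → ℝ} (l : Fin d) :
    tsupport (partialD l f) ⊆ tsupport f :=
  tsupport_fderiv_apply_subset ℝ _

lemma partialD_comp_normSq {g : ℝ → ℝ} {g' : ℝ} {x : EuclideanSpace ℝ (Fin d)}
    (hg : HasDerivAt g g' (‖x‖ ^ 2)) (l : Fin d) :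
    partialD l (fun x => g (‖x‖ ^ 2)) x = 2 * x l * g' := by
  have h := (hg.comp_hasFDerivAt x (hasStrictFDerivAt_norm_sq x).hasFDerivAt).fderiv
  unfold partialD
  rw [show (fun x : EuclideanSpace ℝ (Fin d) => g (‖x‖ ^ 2)) = g ∘ fun x => ‖x‖ ^ 2 from rfl, h]
  simp [EuclideanSpace.inner_single_right]
  ring

lemma partialD_mul {f g : EuclideanSpace ℝ (Fin d) → ℝ} {x : EuclideanSpace ℝ (Fin d)}
    (hf : DifferentiableAt ℝ f x) (hg : DifferentiableAt ℝ g x) (l : Fin d) :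
    partialD l (fun x => f x * g x) x = f x * partialD l g x + partialD l f x * g x := by
  unfold partialD
  rw [fderiv_fun_mul hf hg]
  simp; ring

lemma partialD_const_mul (f : EuclideanSpace ℝ (Fin d) → ℝ) (c : ℝ) (l : Fin d) :
    partialD l (fun x => c * f x) = fun x => c * partialD l f x := by
  ext x
  have : fderiv ℝ (fun x => c * f x) x = c • fderiv ℝ f x :=
    congrFun (fderiv_const_smul_field (f := f) c) x
  simp [partialD, this]

lemma partialD_coord (l j : Fin d) (x : EuclideanSpace ℝ (Fin d)) :
    partialD l (fun x => x j) x = if j = l then 1 else 0 := by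
  unfold partialD
  rw [show (fun x : EuclideanSpace ℝ (Fin d) => x j) = (EuclideanSpace.proj j : _ →L[ℝ] ℝ) from rfl,
    ContinuousLinearMap.fderiv]
  simp

end PartialDerivatives

/-! ### A mollifier whose dyadic difference is a Laplacian -/

section Kernels

/-- A smooth cutoff of `u ↦ u ^ (-d / 2)`. -/
noncomputable def radialProfile (d : ℕ) (u : ℝ) : ℝ :=
  Real.smoothTransition (2 * u - 1) * u ^ (-(d : ℝ) / 2)

lemma radialProfile_of_le {d : ℕ} {u : ℝ} (hu : u ≤ 1 / 2) : radialProfile d u = 0 := by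
  rw [radialProfile, Real.smoothTransition.zero_of_nonpos (by linarith), zero_mul]

lemma radialProfile_of_one_le {d : ℕ} {u : ℝ} (hu : 1 ≤ u) :
    radialProfile d u = u ^ (-(d : ℝ) / 2) := by
  rw [radialProfile, Real.smoothTransition.one_of_one_le (by linarith), one_mul]

lemma contDiff_radialProfile (d : ℕ) : ContDiff ℝ ∞ (radialProfile d) := by
  rw [contDiff_iff_contDiffAt]
  intro u
  rcases lt_or_ge u (1 / 2) with hu | hu
  · refine (contDiffAt_const (c := (0 : ℝ))).congr_of_eventuallyEq ?_
    filter_upwards [eventually_lt_nhds hu] with y hy using radialProfile_of_le hy.le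
  · refine ContDiffAt.mul ?_ ?_
    · exact (Real.smoothTransition.contDiff.comp (by fun_prop)).contDiffAt
    · exact contDiffAt_id.rpow_const_of_ne (by simp; linarith)

/-- `d b + 2 u b'` for the profile `b`: the divergence of `x b(|x|²)`, in terms of `u = |x|²`. -/
noncomputable def divProfile (d : ℕ) (u : ℝ) : ℝ :=
  d * radialProfile d u + 2 * u * deriv (radialProfile d) u

lemma contDiff_divProfile (d : ℕ) : ContDiff ℝ ∞ (divProfile d) := by
  have h := contDiff_radialProfile d
  have h' := (contDiff_infty_iff_deriv.1 h).2
  unfold divProfile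
  fun_prop

/-- The field x |x|^{-d} is divergence free away from the origin: d g + 2 u g' = 0 for g = u^{-d/2}.
Only the derivative of the cutoff survives, which gives both the sign and the support of the
mollifier. -/
lemma divProfile_eq {d : ℕ} {u : ℝ} (hu : 0 < u) :
    divProfile d u = 2 * u * deriv (fun u => Real.smoothTransition (2 * u - 1)) u
      * u ^ (-(d : ℝ) / 2) := by
  have h1 : DifferentiableAt ℝ (fun u => Real.smoothTransition (2 * u - 1)) u :=
    ((Real.smoothTransition.contDiff (n := 1)).comp
      (by fun_prop : ContDiff ℝ 1 fun u : ℝ => 2 * u - 1)).differentiable (by simp) u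
  have h2 := Real.hasDerivAt_rpow_const (x := u) (p := -(d : ℝ) / 2) (Or.inl hu.ne')
  have h3 : deriv (radialProfile d) u = _ := (h1.hasDerivAt.mul h2).deriv
  rw [divProfile, h3, radialProfile, Real.rpow_sub_one hu.ne']
  field_simp
  ring

lemma divProfile_of_one_lt {d : ℕ} {u : ℝ} (hu : 1 < u) : divProfile d u = 0 := by
  rw [divProfile_eq (by linarith)]
  have : deriv (fun u => Real.smoothTransition (2 * u - 1)) u = 0 := by
    have h : (fun u => Real.smoothTransition (2 * u - 1)) =ᶠ[𝓝 u] fun _ => 1 := by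
      filter_upwards [eventually_gt_nhds hu] with y hy
      exact Real.smoothTransition.one_of_one_le (by linarith)
    rw [h.deriv_eq, deriv_const]
  simp [this]

lemma divProfile_nonneg {d : ℕ} {u : ℝ} (hu : 0 ≤ u) : 0 ≤ divProfile d u := by
  rcases hu.eq_or_lt with rfl | hu
  · simp [divProfile, radialProfile_of_le (d := d) (u := 0) (by norm_num)]
  · rw [divProfile_eq hu]
    have : Monotone fun u : ℝ => Real.smoothTransition (2 * u - 1) := fun a b h =>
      Real.smoothTransition.monotone (by linarith)
    have := this.deriv_nonneg (x := u)
    positivity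

lemma exists_divProfile_pos (d : ℕ) : ∃ u : ℝ, 0 < u ∧ divProfile d u ≠ 0 := by
  by_contra! h
  have hdiff : Differentiable ℝ fun u : ℝ => Real.smoothTransition (2 * u - 1) :=
    ((Real.smoothTransition.contDiff (n := 1)).comp
      (by fun_prop : ContDiff ℝ 1 fun u : ℝ => 2 * u - 1)).differentiable (by simp)
  have h0 : ∀ u, deriv (fun u : ℝ => Real.smoothTransition (2 * u - 1)) u = 0 := by
    intro u
    rcases lt_or_ge 0 u with hu | hu
    · have := h u hu
      rw [divProfile_eq hu] at this
      have h2 : u ^ (-(d : ℝ) / 2) ≠ 0 := (Real.rpow_pos_of_pos hu _).ne'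
      simpa [hu.ne', h2] using this
    · have h : (fun u => Real.smoothTransition (2 * u - 1)) =ᶠ[𝓝 u] fun _ => 0 := by
        filter_upwards [eventually_lt_nhds (show u < 1 / 2 by linarith)] with y hy
        exact Real.smoothTransition.zero_of_nonpos (by linarith)
      rw [h.deriv_eq, deriv_const]
  have := is_const_of_deriv_eq_zero hdiff h0 0 1
  norm_num [Real.smoothTransition.zero_of_nonpos] at this

/-- The derivative of the radial potential. -/
noncomputable def potentialDeriv (d : ℕ) (u : ℝ) : ℝ :=
  (-radialProfile d u + 2⁻¹ ^ d * radialProfile d (u / 4)) / 2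

/-- The radial potential. -/
noncomputable def potentialProfile (d : ℕ) (u : ℝ) : ℝ :=
  ∫ s in (4 : ℝ)..u, potentialDeriv d s

lemma contDiff_potentialDeriv (d : ℕ) : ContDiff ℝ ∞ (potentialDeriv d) := by
  have h := contDiff_radialProfile d
  have h2 : ContDiff ℝ ∞ fun u : ℝ => radialProfile d (u / 4) := h.comp (by fun_prop)
  unfold potentialDeriv
  fun_prop

lemma hasDerivAt_potentialProfile (d : ℕ) (u : ℝ) :
    HasDerivAt (potentialProfile d) (potentialDeriv d u) u :=
  intervalIntegral.integral_hasDerivAt_right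
    ((contDiff_potentialDeriv d).continuous.intervalIntegrable _ _)
    ((contDiff_potentialDeriv d).continuous.stronglyMeasurableAtFilter _ _)
    (contDiff_potentialDeriv d).continuous.continuousAt

lemma contDiff_potentialProfile (d : ℕ) : ContDiff ℝ ∞ (potentialProfile d) := by
  rw [contDiff_infty_iff_deriv]
  refine ⟨fun u => (hasDerivAt_potentialProfile d u).differentiableAt, ?_⟩
  rw [show deriv (potentialProfile d) = potentialDeriv d from
    funext fun u => (hasDerivAt_potentialProfile d u).deriv]
  exact contDiff_potentialDeriv d

/-- By homogeneity u^{-d/2} and 2^{-d} (u/4)^{-d/2} agree, and both profiles have left their cutoff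
region once u / 4 ≥ 1. Integrating from 4 then makes the potential compactly supported. -/
lemma potentialDeriv_of_four_le {d : ℕ} {u : ℝ} (hu : 4 ≤ u) : potentialDeriv d u = 0 := by
  rw [potentialDeriv, radialProfile_of_one_le (by linarith), radialProfile_of_one_le (by linarith),
    Real.div_rpow (by linarith) (by norm_num)]
  have : (4 : ℝ) ^ (-(d : ℝ) / 2) = 2⁻¹ ^ d := by
    rw [show (4 : ℝ) = 2 ^ (2 : ℝ) by norm_num, ← Real.rpow_mul (by norm_num),
      show (2 : ℝ) * (-(d : ℝ) / 2) = -d by ring, Real.rpow_neg (by norm_num), Real.rpow_natCast,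
      inv_pow]
  rw [this]
  have h2 : (2⁻¹ : ℝ) ^ d ≠ 0 := by positivity
  field_simp
  ring

lemma potentialProfile_of_four_le {d : ℕ} {u : ℝ} (hu : 4 ≤ u) : potentialProfile d u = 0 := by
  rw [potentialProfile]
  refine intervalIntegral.integral_zero_ae (.of_forall fun s hs => ?_)
  rw [uIoc_of_le hu] at hs
  exact potentialDeriv_of_four_le hs.1.le

lemma laplacian_comp_normSq {d : ℕ} {g k : ℝ → ℝ} {k' : ℝ} (x : EuclideanSpace ℝ (Fin d))
    (hg : ∀ u, HasDerivAt g (k u) u) (hk : HasDerivAt k k' (‖x‖ ^ 2)) :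
    laplacian (fun x => g (‖x‖ ^ 2)) x = 2 * d * k (‖x‖ ^ 2) + 4 * ‖x‖ ^ 2 * k' := by
  have h1 : ∀ l, partialD l (fun x : EuclideanSpace ℝ (Fin d) => g (‖x‖ ^ 2)) =
      fun x => (2 * x l) * k (‖x‖ ^ 2) := fun l => funext fun x => partialD_comp_normSq (hg _) l
  have h2 : ∀ l, partialD l (fun x : EuclideanSpace ℝ (Fin d) => (2 * x l) * k (‖x‖ ^ 2)) x =
      2 * k (‖x‖ ^ 2) + 4 * (x l) ^ 2 * k' := by
    intro l
    have hc : DifferentiableAt ℝ (fun x : EuclideanSpace ℝ (Fin d) => x l) x := by fun_prop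
    have hkd : DifferentiableAt ℝ (fun x : EuclideanSpace ℝ (Fin d) => k (‖x‖ ^ 2)) x :=
      hk.differentiableAt.comp x (hasStrictFDerivAt_norm_sq x).hasFDerivAt.differentiableAt
    rw [partialD_mul (hc.const_mul 2) hkd, partialD_comp_normSq hk,
      partialD_mul (by fun_prop) hc, partialD_coord]
    simp [partialD]
    ring
  simp only [laplacian, h1, h2]
  rw [Finset.sum_add_distrib, EuclideanSpace.norm_sq_eq, Finset.mul_sum, Finset.sum_mul]
  simp
  ring

/-- There is a mollifier whose dyadic differences are Laplacians of functions with compact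
support. -/
theorem exists_mollifier_laplacian {d : ℕ} (hd : d ≠ 0) :
    ∃ ρ Ψ : EuclideanSpace ℝ (Fin d) → ℝ, ContDiff ℝ ∞ ρ ∧ ContDiff ℝ ∞ Ψ ∧
      tsupport ρ ⊆ Metric.closedBall 0 1 ∧ tsupport Ψ ⊆ Metric.closedBall 0 2 ∧
      (∀ x, 0 ≤ ρ x) ∧ ∫ x, ρ x = 1 ∧
      ∀ x, ρ x - 2⁻¹ ^ d * ρ ((2⁻¹ : ℝ) • x) = -laplacian Ψ x := by
  set E := EuclideanSpace ℝ (Fin d)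
  -- R is the divergence of x b(|x|²), with b = `radialProfile d`. Its difference with the dilate is
  -- the divergence of x (b(|x|²) - 2^{-d} b(|x|²/4)). This radial field has compact support and
  -- equals -∇S.
  let R : E → ℝ := fun x => divProfile d (‖x‖ ^ 2)
  let S : E → ℝ := fun x => potentialProfile d (‖x‖ ^ 2)
  have hn : ContDiff ℝ ∞ fun x : E => ‖x‖ ^ 2 := contDiff_norm_sq ℝ
  have hR : ContDiff ℝ ∞ R := (contDiff_divProfile d).comp hn
  have hS : ContDiff ℝ ∞ S := (contDiff_potentialProfile d).comp hn
  have hRs : tsupport R ⊆ Metric.closedBall 0 1 := by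
    refine closure_minimal (fun x hx => ?_) Metric.isClosed_closedBall
    rw [mem_closedBall_zero_iff]
    by_contra! h
    exact hx (divProfile_of_one_lt (by nlinarith))
  have hSs : tsupport S ⊆ Metric.closedBall 0 2 := by
    refine closure_minimal (fun x hx => ?_) Metric.isClosed_closedBall
    rw [mem_closedBall_zero_iff]
    by_contra! h
    exact hx (potentialProfile_of_four_le (by nlinarith))
  have hR0 : ∀ x, 0 ≤ R x := fun x => divProfile_nonneg (by positivity)
  have hRc : HasCompactSupport R :=
    (isCompact_closedBall 0 1).of_isClosed_subset (isClosed_tsupport _) hRs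
  have hpos : 0 < ∫ x, R x := by
    -- Positivity of the mass needs a point with |x|² = u, which exists because d ≠ 0.
    obtain ⟨u, hu, hu'⟩ := exists_divProfile_pos d
    refine hR.continuous.integral_pos_of_hasCompactSupport_nonneg_nonzero hRc hR0
      (x := EuclideanSpace.single ⟨0, Nat.pos_of_ne_zero hd⟩ √u) ?_
    have h1 : ‖(EuclideanSpace.single ⟨0, Nat.pos_of_ne_zero hd⟩ √u : EuclideanSpace ℝ (Fin d))‖ ^ 2
        = u := by
      rw [PiLp.norm_single, Real.norm_of_nonneg (by positivity), Real.sq_sqrt hu.le]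
    simpa only [R, E, h1] using hu'
  have hlap : ∀ x, R x - 2⁻¹ ^ d * R ((2⁻¹ : ℝ) • x) = -laplacian S x := by
    intro x
    have hb := (contDiff_radialProfile d).differentiable (by simp)
    have h4 : HasDerivAt (fun u : ℝ => radialProfile d (u / 4))
        (deriv (radialProfile d) (‖x‖ ^ 2 / 4) * (1 / 4)) (‖x‖ ^ 2) :=
      HasDerivAt.comp (‖x‖ ^ 2) (hb _).hasDerivAt ((hasDerivAt_id _).div_const 4)
    have hk : HasDerivAt (potentialDeriv d) ((-deriv (radialProfile d) (‖x‖ ^ 2) + 2⁻¹ ^ d *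
        (deriv (radialProfile d) (‖x‖ ^ 2 / 4) * (1 / 4))) / 2) (‖x‖ ^ 2) :=
      (((hb _).hasDerivAt.neg).add (h4.const_mul _)).div_const 2
    rw [laplacian_comp_normSq x (hasDerivAt_potentialProfile d) hk]
    have : ‖(2⁻¹ : ℝ) • x‖ ^ 2 = ‖x‖ ^ 2 / 4 := by rw [norm_smul]; norm_num; ring
    simp only [R, this, divProfile, potentialDeriv]
    ring
  refine ⟨fun x => (∫ x, R x)⁻¹ * R x, fun x => (∫ x, R x)⁻¹ * S x, by fun_prop, by fun_prop,
    (tsupport_mul_subset_right).trans hRs, (tsupport_mul_subset_right).trans hSs,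
    fun x => mul_nonneg (inv_nonneg.2 hpos.le) (hR0 x), ?_, fun x => ?_⟩
  · rw [integral_const_mul, inv_mul_cancel₀ hpos.ne']
  · have : laplacian (fun x => (∫ x, R x)⁻¹ * S x) x = (∫ x, R x)⁻¹ * laplacian S x := by
      simp only [laplacian, partialD_const_mul, Finset.mul_sum]
    rw [this]
    linear_combination (∫ x, R x)⁻¹ * hlap x

end Kernels

/-! ### The Kármán–Howarth–Monin relation by doubling of variables -/

section DoublingVariables

variable {d : ℕ}

section

variable {F : Type*} [NormedAddCommGroup F] [NormedSpace ℝ F] {φ m : F → ℝ}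

lemma fderiv_mul_comp_sub (hφ : ContDiff ℝ ∞ φ) (hm : ContDiff ℝ ∞ m) (z z' w : F) :
    fderiv ℝ (fun z => φ z * m (z - z')) z w =
      fderiv ℝ φ z w * m (z - z') + φ z * fderiv ℝ m (z - z') w := by
  have h1 : DifferentiableAt ℝ φ z := hφ.differentiable (by simp) z
  have h2 : DifferentiableAt ℝ (fun z => m (z - z')) z :=
    (hm.differentiable (by simp)).comp (differentiable_id.sub_const z') z
  rw [fderiv_fun_mul h1 h2, fderiv_comp_sub]
  simp; ring

lemma fderiv_comp_const_sub' (hm : ContDiff ℝ ∞ m) (z z' w : F) :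
    fderiv ℝ (fun z' => m (z - z')) z' w = -fderiv ℝ m (z - z') w := by
  have h : HasFDerivAt (fun z' => m (z - z')) _ z' :=
    ((hm.differentiable (by simp) (z - z')).hasFDerivAt).comp z' ((hasFDerivAt_id z').const_sub z)
  rw [h.fderiv]; simp

lemma integrable_mul_mul_of_bounded [MeasurableSpace F] [BorelSpace F] [SecondCountableTopology F]
    {μ : Measure F} [SFinite μ] {f g : F → ℝ} {k : F × F → ℝ} (hf : Integrable f μ)
    (hg : Integrable g μ) (hk : Continuous k) {C : ℝ} (hC : ∀ q, |k q| ≤ C) :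
    Integrable (fun q : F × F => f q.1 * g q.2 * k q) (μ.prod μ) :=
  (hf.mul_prod hg).mul_bdd hk.aestronglyMeasurable (.of_forall hC)

lemma integral_prod_eq_zero_of_left [MeasurableSpace F] {μ : Measure F} [SFinite μ]
    {f : F × F → ℝ} (hf : Integrable f (μ.prod μ)) (h : ∀ z, ∫ z', f (z, z') ∂μ = 0) :
    ∫ q, f q ∂(μ.prod μ) = 0 := by
  rw [integral_prod _ hf]; simp [h]

lemma integral_prod_eq_zero_of_right [MeasurableSpace F] {μ : Measure F} [SFinite μ]
    {f : F × F → ℝ} (hf : Integrable f (μ.prod μ)) (h : ∀ z', ∫ z, f (z, z') ∂μ = 0) :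
    ∫ q, f q ∂(μ.prod μ) = 0 := by
  rw [integral_prod_symm _ hf]; simp [h]

end

section

variable {F : Type*} [NormedAddCommGroup F] [NormedSpace ℝ F] [FiniteDimensional ℝ F]
  [MeasurableSpace F] [BorelSpace F] {μ : Measure F} [μ.IsAddHaarMeasure]

lemma integral_fderiv_apply_eq_zero {ψ : F → ℝ} (hψ : ContDiff ℝ ∞ ψ) (hc : HasCompactSupport ψ)
    (w : F) : ∫ z, fderiv ℝ ψ z w ∂μ = 0 := by
  have hi : Integrable (fun z => fderiv ℝ ψ z w) μ :=
    ((hψ.continuous_fderiv (by simp)).clm_apply continuous_const).integrable_of_hasCompactSupport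
      (hc.fderiv_apply ℝ w)
  have := integral_mul_fderiv_eq_neg_fderiv_mul_of_integrable (μ := μ) (𝕜 := ℝ) (f := fun _ => (1 : ℝ))
    (g := ψ) (v := w) (by simp) (by simpa using hi)
    (by simpa using hψ.continuous.integrable_of_hasCompactSupport hc)
    (fun x _ => by fun_prop) (fun x _ => hψ.differentiable (by simp) x)
  simpa using this

variable {ι : Type*} [Fintype ι]

section

variable {α : Type*} [MeasurableSpace α] {ν : Measure α} {f g : α → ℝ}

lemma integral_add_eq_zero (hf : Integrable f ν ∧ ∫ x, f x ∂ν = 0)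
    (hg : Integrable g ν ∧ ∫ x, g x ∂ν = 0) :
    Integrable (fun x => f x + g x) ν ∧ ∫ x, f x + g x ∂ν = 0 :=
  ⟨hf.1.add hg.1, by rw [integral_add hf.1 hg.1, hf.2, hg.2, add_zero]⟩

lemma integral_sub_eq_zero (hf : Integrable f ν ∧ ∫ x, f x ∂ν = 0)
    (hg : Integrable g ν ∧ ∫ x, g x ∂ν = 0) :
    Integrable (fun x => f x - g x) ν ∧ ∫ x, f x - g x ∂ν = 0 :=
  ⟨hf.1.sub hg.1, by rw [integral_sub hf.1 hg.1, hf.2, hg.2, sub_zero]⟩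

lemma integral_const_mul_eq_zero (c : ℝ) (hf : Integrable f ν ∧ ∫ x, f x ∂ν = 0) :
    Integrable (fun x => c * f x) ν ∧ ∫ x, c * f x ∂ν = 0 :=
  ⟨hf.1.const_mul c, by rw [integral_const_mul, hf.2, mul_zero]⟩

lemma integral_sum_eq_zero {f : ι → α → ℝ} (hf : ∀ i, Integrable (f i) ν ∧ ∫ x, f i x ∂ν = 0) :
    Integrable (fun x => ∑ i, f i x) ν ∧ ∫ x, ∑ i, f i x ∂ν = 0 :=
  ⟨integrable_finsetSum _ fun i _ => (hf i).1, by
    rw [integral_finsetSum _ fun i _ => (hf i).1]; simp [hf]⟩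

end

/-- The zeroth order part of the symmetrized Kármán–Howarth–Monin relation. -/
noncomputable def khmFlux (e₀ : F) (e : ι → F) (V : ι → F → ℝ) (P φ : F → ℝ) (z z' : F) : ℝ :=
  (∑ l, V l z * V l z') * fderiv ℝ φ z e₀
    + (∑ l, V l z * V l z') * ∑ j, V j z * fderiv ℝ φ z (e j)
    + P z * ∑ j, V j z' * fderiv ℝ φ z (e j) + P z' * ∑ j, V j z * fderiv ℝ φ z (e j)
    + 2⁻¹ * ((∑ l, V l z' ^ 2) * ∑ j, (V j z' - V j z) * fderiv ℝ φ z (e j))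

/-- The third order structure function of the increments, localized by `φ`. -/
noncomputable def khmThird (V : ι → F → ℝ) (φ : F → ℝ) (j : ι) (z z' : F) : ℝ :=
  φ z * ((∑ l, (V l z' - V l z) ^ 2) * (V j z' - V j z))

variable {e₀ : F} {e : ι → F} {V : ι → F → ℝ} {P φ m : F → ℝ} {W : Set F}

/-- The momentum equation at z is tested with φ(z) m(z - z') weighted by V(z'), and the one at z'
with m(z - z') weighted by φ(z) V(z). The time derivatives of m cancel. Incompressibility removes
the pressure terms that carry ∇m and completes the quadratic factor V · V' to |δV|². The condition
`hmW` makes m(z - ·) an admissible test function for z in the support of φ. -/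
theorem integral_prod_khm
    (h1 : ∀ l, Integrable (V l) μ) (h2 : ∀ j l, Integrable (fun z => V j z * V l z) μ)
    (h3 : ∀ j l, Integrable (fun z => V l z ^ 2 * V j z) μ) (hP : Integrable P μ)
    (hmom : ∀ ψ : F → ℝ, ContDiff ℝ ∞ ψ → HasCompactSupport ψ → tsupport ψ ⊆ W → ∀ l,
      ∫ z, (V l z * fderiv ℝ ψ z e₀ + ∑ j, V j z * V l z * fderiv ℝ ψ z (e j)
        + P z * fderiv ℝ ψ z (e l)) ∂μ = 0)
    (hinc : ∀ ψ : F → ℝ, ContDiff ℝ ∞ ψ → HasCompactSupport ψ → tsupport ψ ⊆ W →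
      ∫ z, ∑ j, V j z * fderiv ℝ ψ z (e j) ∂μ = 0)
    (hφ : ContDiff ℝ ∞ φ) (hφc : HasCompactSupport φ) (hφW : tsupport φ ⊆ W)
    (hm : ContDiff ℝ ∞ m) (hmc : HasCompactSupport m)
    (hmW : ∀ z ∈ tsupport φ, ∀ y ∈ tsupport m, z - y ∈ W) :
    ∫ q : F × F, (m (q.1 - q.2) * khmFlux e₀ e V P φ q.1 q.2
      + 2⁻¹ * ∑ j, fderiv ℝ m (q.1 - q.2) (e j) * khmThird V φ j q.1 q.2) ∂(μ.prod μ) = 0 := by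
  -- the test functions
  have hA : ∀ z', ContDiff ℝ ∞ (fun z => φ z * m (z - z')) := fun z' =>
    hφ.mul (hm.comp (contDiff_id.sub contDiff_const))
  have hAc : ∀ z', HasCompactSupport (fun z => φ z * m (z - z')) := fun z' => hφc.mul_right
  have hAW : ∀ z', tsupport (fun z => φ z * m (z - z')) ⊆ W := fun z' =>
    tsupport_mul_subset_left.trans hφW
  have hB : ∀ z, ContDiff ℝ ∞ (fun z' => m (z - z')) := fun z =>
    hm.comp (contDiff_const.sub contDiff_id)
  have hBc : ∀ z, HasCompactSupport (fun z' => m (z - z')) := fun z =>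
    hmc.comp_homeomorph (Homeomorph.subLeft z)
  have hBW : ∀ z ∈ tsupport φ, tsupport (fun z' => m (z - z')) ⊆ W := by
    intro z hz z' hz'
    have : z - z' ∈ tsupport m := by
      have := tsupport_comp_eq_preimage m (Homeomorph.subLeft z)
      exact (this ▸ hz' : z' ∈ Homeomorph.subLeft z ⁻¹' tsupport m)
    simpa using hmW z hz _ this
  -- bounded kernels
  have hDφ : ∀ w, Continuous fun z => fderiv ℝ φ z w := fun w =>
    (hφ.continuous_fderiv (by simp)).clm_apply continuous_const
  have hDm : ∀ w, Continuous fun z => fderiv ℝ m z w := fun w =>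
    (hm.continuous_fderiv (by simp)).clm_apply continuous_const
  obtain ⟨C1, hC1⟩ := hφc.exists_bound_of_continuous hφ.continuous
  obtain ⟨C2, hC2⟩ := hmc.exists_bound_of_continuous hm.continuous
  have hbφ : ∀ w, ∃ C, ∀ z, ‖fderiv ℝ φ z w‖ ≤ C := fun w =>
    (hφc.fderiv_apply ℝ w).exists_bound_of_continuous (hDφ w)
  have hbm : ∀ w, ∃ C, ∀ z, ‖fderiv ℝ m z w‖ ≤ C := fun w =>
    (hmc.fderiv_apply ℝ w).exists_bound_of_continuous (hDm w)
  have hk : ∀ {f g : F → ℝ} {k : F × F → ℝ}, Integrable f μ → Integrable g μ → Continuous k →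
      (∃ C, ∀ q, ‖k q‖ ≤ C) → Integrable (fun q : F × F => f q.1 * g q.2 * k q) (μ.prod μ) :=
    fun hf hg hk ⟨C, hC⟩ => integrable_mul_mul_of_bounded hf hg hk hC
  have kA : ∀ w, Continuous fun q : F × F =>
      fderiv ℝ φ q.1 w * m (q.1 - q.2) + φ q.1 * fderiv ℝ m (q.1 - q.2) w := fun w =>
    (((hDφ w).comp continuous_fst).mul (hm.continuous.comp (by fun_prop))).add
      ((hφ.continuous.comp continuous_fst).mul ((hDm w).comp (by fun_prop)))
  have kB : ∀ w, Continuous fun q : F × F => φ q.1 * fderiv ℝ m (q.1 - q.2) w := fun w =>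
    (hφ.continuous.comp continuous_fst).mul ((hDm w).comp (by fun_prop))
  have bB : ∀ w, ∃ C, ∀ q : F × F, ‖φ q.1 * fderiv ℝ m (q.1 - q.2) w‖ ≤ C := by
    intro w
    obtain ⟨C, hC⟩ := hbm w
    refine ⟨C1 * C, fun q => ?_⟩
    rw [norm_mul]
    exact mul_le_mul (hC1 _) (hC _) (norm_nonneg _) ((norm_nonneg _).trans (hC1 q.1))
  have bA : ∀ w, ∃ C, ∀ q : F × F,
      ‖fderiv ℝ φ q.1 w * m (q.1 - q.2) + φ q.1 * fderiv ℝ m (q.1 - q.2) w‖ ≤ C := by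
    intro w
    obtain ⟨C, hC⟩ := bB w
    obtain ⟨C', hC'⟩ := hbφ w
    refine ⟨C' * C2 + C, fun q => (norm_add_le _ _).trans (add_le_add ?_ (hC q))⟩
    rw [norm_mul]
    exact mul_le_mul (hC' _) (hC2 _) (norm_nonneg _) ((norm_nonneg _).trans (hC' q.1))
  have h2' : ∀ l, Integrable (fun z => V l z ^ 2) μ := fun l => by
    simpa only [sq] using h2 l l
  have hn : Integrable (fun z => ∑ l, V l z ^ 2) μ := integrable_finsetSum _ fun l _ => h2' l
  have hnV : ∀ j, Integrable (fun z => (∑ l, V l z ^ 2) * V j z) μ := fun j => by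
    simp only [Finset.sum_mul]; exact integrable_finsetSum _ fun l _ => h3 j l
  -- the vanishing integrals
  let M1 : F × F → ℝ := fun q => ∑ l, V l q.2 * (V l q.1 *
      (fderiv ℝ φ q.1 e₀ * m (q.1 - q.2) + φ q.1 * fderiv ℝ m (q.1 - q.2) e₀)
    + ∑ j, V j q.1 * V l q.1 *
      (fderiv ℝ φ q.1 (e j) * m (q.1 - q.2) + φ q.1 * fderiv ℝ m (q.1 - q.2) (e j))
    + P q.1 * (fderiv ℝ φ q.1 (e l) * m (q.1 - q.2) + φ q.1 * fderiv ℝ m (q.1 - q.2) (e l)))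
  have M1l : ∀ l, Integrable (fun q : F × F => V l q.2 * (V l q.1 *
      (fderiv ℝ φ q.1 e₀ * m (q.1 - q.2) + φ q.1 * fderiv ℝ m (q.1 - q.2) e₀)
    + ∑ j, V j q.1 * V l q.1 *
      (fderiv ℝ φ q.1 (e j) * m (q.1 - q.2) + φ q.1 * fderiv ℝ m (q.1 - q.2) (e j))
    + P q.1 * (fderiv ℝ φ q.1 (e l) * m (q.1 - q.2) + φ q.1 * fderiv ℝ m (q.1 - q.2) (e l))))
      (μ.prod μ) := by
    intro l
    refine (((hk (h1 l) (h1 l) (kA e₀) (bA e₀)).add (integrable_finsetSum Finset.univ fun j _ =>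
      hk (h2 j l) (h1 l) (kA (e j)) (bA (e j)))).add
      (hk hP (h1 l) (kA (e l)) (bA (e l)))).congr (.of_forall fun q => ?_)
    simp only [Pi.add_apply, mul_add, Finset.mul_sum]
    congr 1
    · congr 1
      · ring
      · exact Finset.sum_congr rfl fun j _ => by ring
    · ring
  have M1i : Integrable M1 (μ.prod μ) := integrable_finsetSum _ fun l _ => M1l l
  have M1z : ∫ q, M1 q ∂(μ.prod μ) = 0 := by
    rw [integral_finsetSum _ fun l _ => M1l l]
    refine Finset.sum_eq_zero fun l _ => integral_prod_eq_zero_of_right (M1l l) fun z' => ?_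
    have := hmom _ (hA z') (hAc z') (hAW z') l
    simp only [fderiv_mul_comp_sub hφ hm] at this
    simp only [integral_const_mul, this, mul_zero]
  let M2 : F × F → ℝ := fun q => ∑ l, φ q.1 * V l q.1 * (V l q.2 * -fderiv ℝ m (q.1 - q.2) e₀
    + ∑ j, V j q.2 * V l q.2 * -fderiv ℝ m (q.1 - q.2) (e j)
    + P q.2 * -fderiv ℝ m (q.1 - q.2) (e l))
  have M2l : ∀ l, Integrable (fun q : F × F =>
      φ q.1 * V l q.1 * (V l q.2 * -fderiv ℝ m (q.1 - q.2) e₀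
    + ∑ j, V j q.2 * V l q.2 * -fderiv ℝ m (q.1 - q.2) (e j)
    + P q.2 * -fderiv ℝ m (q.1 - q.2) (e l))) (μ.prod μ) := by
    intro l
    refine (((hk (h1 l) (h1 l) (kB e₀) (bB e₀)).add (integrable_finsetSum Finset.univ fun j _ =>
      hk (h1 l) (h2 j l) (kB (e j)) (bB (e j)))).add
      (hk (h1 l) hP (kB (e l)) (bB (e l)))).neg.congr (.of_forall fun q => ?_)
    simp only [Pi.add_apply, Pi.neg_apply, mul_add, neg_add, Finset.mul_sum,
      ← Finset.sum_neg_distrib]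
    congr 1
    · congr 1
      · ring
      · exact Finset.sum_congr rfl fun j _ => by ring
    · ring
  have M2i : Integrable M2 (μ.prod μ) := integrable_finsetSum _ fun l _ => M2l l
  have M2z : ∫ q, M2 q ∂(μ.prod μ) = 0 := by
    rw [integral_finsetSum _ fun l _ => M2l l]
    refine Finset.sum_eq_zero fun l _ => integral_prod_eq_zero_of_left (M2l l) fun z => ?_
    by_cases hz : z ∈ tsupport φ
    · have := hmom _ (hB z) (hBc z) (hBW z hz) l
      simp only [fderiv_comp_const_sub' hm] at this
      simp only [integral_const_mul, this, mul_zero]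
    · simp [image_eq_zero_of_notMem_tsupport hz]
  -- incompressibility in `z'`, with an integrable weight in `z`
  have I1 : ∀ f : F → ℝ, Integrable f μ →
      Integrable (fun q : F × F => f q.1 * φ q.1 * ∑ j, V j q.2 * -fderiv ℝ m (q.1 - q.2) (e j))
        (μ.prod μ) ∧ ∫ q : F × F, f q.1 * φ q.1 * ∑ j, V j q.2 * -fderiv ℝ m (q.1 - q.2) (e j)
        ∂(μ.prod μ) = 0 := by
    intro f hf
    have hi : Integrable (fun q : F × F => f q.1 * φ q.1 *
        ∑ j, V j q.2 * -fderiv ℝ m (q.1 - q.2) (e j)) (μ.prod μ) := by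
      refine (integrable_finsetSum Finset.univ fun j _ =>
        hk hf (h1 j) (kB (e j)) (bB (e j))).neg.congr (.of_forall fun q => ?_)
      simp only [Pi.neg_apply, Finset.mul_sum, ← Finset.sum_neg_distrib]
      exact Finset.sum_congr rfl fun j _ => by ring
    refine ⟨hi, integral_prod_eq_zero_of_left hi fun z => ?_⟩
    by_cases hz : z ∈ tsupport φ
    · have := hinc _ (hB z) (hBc z) (hBW z hz)
      simp only [fderiv_comp_const_sub' hm] at this
      simp only [integral_const_mul, this, mul_zero]
    · simp [image_eq_zero_of_notMem_tsupport hz]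
  -- incompressibility in `z`, with an integrable weight in `z'`
  have I2 : ∀ f : F → ℝ, Integrable f μ →
      Integrable (fun q : F × F => f q.2 * ∑ j, V j q.1 * (fderiv ℝ φ q.1 (e j) * m (q.1 - q.2) +
        φ q.1 * fderiv ℝ m (q.1 - q.2) (e j))) (μ.prod μ) ∧
      ∫ q : F × F, f q.2 * ∑ j, V j q.1 * (fderiv ℝ φ q.1 (e j) * m (q.1 - q.2) +
        φ q.1 * fderiv ℝ m (q.1 - q.2) (e j)) ∂(μ.prod μ) = 0 := by
    intro f hf
    have hi : Integrable (fun q : F × F => f q.2 * ∑ j, V j q.1 *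
        (fderiv ℝ φ q.1 (e j) * m (q.1 - q.2) + φ q.1 * fderiv ℝ m (q.1 - q.2) (e j)))
        (μ.prod μ) := by
      refine (integrable_finsetSum Finset.univ fun j _ =>
        hk (h1 j) hf (kA (e j)) (bA (e j))).congr (.of_forall fun q => ?_)
      simp only [Finset.mul_sum]
      exact Finset.sum_congr rfl fun j _ => by ring
    refine ⟨hi, integral_prod_eq_zero_of_right hi fun z' => ?_⟩
    have := hinc _ (hA z') (hAc z') (hAW z')
    simp only [fderiv_mul_comp_sub hφ hm] at this
    simp only [integral_const_mul, this, mul_zero]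
  -- In the terms cubic in one variable nothing depends on v in the other variable. The indicator of
  -- a compact set serves there as the integrable weight.
  have hone : ∀ K : Set F, IsCompact K → Integrable (K.indicator fun _ => (1 : ℝ)) μ := fun K hK =>
    (integrable_indicator_iff hK.measurableSet).2 (integrableOn_const hK.measure_lt_top.ne)
  have J5 : ∀ j, Integrable (fun q : F × F => (∑ l, V l q.2 ^ 2) * V j q.2 *
      (fderiv ℝ φ q.1 (e j) * m (q.1 - q.2) + φ q.1 * fderiv ℝ m (q.1 - q.2) (e j)))
      (μ.prod μ) ∧ ∫ q : F × F, (∑ l, V l q.2 ^ 2) * V j q.2 *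
      (fderiv ℝ φ q.1 (e j) * m (q.1 - q.2) + φ q.1 * fderiv ℝ m (q.1 - q.2) (e j))
      ∂(μ.prod μ) = 0 := by
    intro j
    have hi : Integrable (fun q : F × F => (∑ l, V l q.2 ^ 2) * V j q.2 *
        (fderiv ℝ φ q.1 (e j) * m (q.1 - q.2) + φ q.1 * fderiv ℝ m (q.1 - q.2) (e j)))
        (μ.prod μ) := by
      refine (hk (hone _ hφc) (hnV j) (kA (e j)) (bA (e j))).congr (.of_forall fun q => ?_)
      by_cases hq : q.1 ∈ tsupport φ
      · simp [hq]
      · have : fderiv ℝ φ q.1 (e j) = 0 :=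
          image_eq_zero_of_notMem_tsupport (f := fun z => fderiv ℝ φ z (e j))
            fun h => hq (tsupport_fderiv_apply_subset ℝ (e j) h)
        simp [image_eq_zero_of_notMem_tsupport hq, this]
    refine ⟨hi, integral_prod_eq_zero_of_right hi fun z' => ?_⟩
    have := integral_fderiv_apply_eq_zero (μ := μ) (hA z') (hAc z') (e j)
    simp only [fderiv_mul_comp_sub hφ hm] at this
    simp only [integral_const_mul, this, mul_zero]
  have J6 : ∀ j, Integrable (fun q : F × F => (∑ l, V l q.1 ^ 2) * V j q.1 * φ q.1 *
      -fderiv ℝ m (q.1 - q.2) (e j)) (μ.prod μ) ∧ ∫ q : F × F, (∑ l, V l q.1 ^ 2) * V j q.1 * φ q.1 *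
      -fderiv ℝ m (q.1 - q.2) (e j) ∂(μ.prod μ) = 0 := by
    intro j
    have hi : Integrable (fun q : F × F => (∑ l, V l q.1 ^ 2) * V j q.1 * φ q.1 *
        -fderiv ℝ m (q.1 - q.2) (e j)) (μ.prod μ) := by
      have hK : IsCompact (tsupport φ - tsupport m) := by
        rw [sub_eq_add_neg]
        exact hφc.isCompact.add hmc.isCompact.neg
      refine (hk (hnV j) (hone _ hK) (kB (e j)) (bB (e j))).neg.congr (.of_forall fun q => ?_)
      by_cases hq : q.2 ∈ tsupport φ - tsupport m
      · simp [hq]; ring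
      · by_cases hq1 : q.1 ∈ tsupport φ
        · have : fderiv ℝ m (q.1 - q.2) (e j) = 0 :=
            image_eq_zero_of_notMem_tsupport (f := fun z => fderiv ℝ m z (e j)) fun h => hq
              ⟨q.1, hq1, q.1 - q.2, tsupport_fderiv_apply_subset ℝ (e j) h, by simp⟩
          simp [this]
        · simp [image_eq_zero_of_notMem_tsupport hq1]
    refine ⟨hi, integral_prod_eq_zero_of_left hi fun z => ?_⟩
    have := integral_fderiv_apply_eq_zero (μ := μ) (hB z) (hBc z) (e j)
    simp only [fderiv_comp_const_sub' hm] at this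
    simp only [integral_const_mul, this, mul_zero]
  -- With n = |V|², the momentum terms leave -φ (V · V') δV · ∇m. Half of `J5` - `I2 n` - `I1 n` +
  -- `J6` adds (1/2) φ (n + n') δV · ∇m, and the total is (1/2) φ |δV|² δV · ∇m. `I1 P` and `I2 P`
  -- cancel the pressure terms with ∇m.
  have key := (integral_add_eq_zero (integral_add_eq_zero (integral_add_eq_zero
    (integral_add_eq_zero ⟨M1i, M1z⟩ ⟨M2i, M2z⟩) (I1 P hP)) (I2 P hP))
    (integral_const_mul_eq_zero 2⁻¹ (integral_add_eq_zero (integral_sub_eq_zero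
      (integral_sub_eq_zero (integral_sum_eq_zero J5) (I2 _ hn)) (I1 _ hn))
      (integral_sum_eq_zero J6)))).2
  rw [← key]
  refine integral_congr_ae (.of_forall fun q => ?_)
  have e1 : M1 q = (∑ l, V l q.1 * V l q.2) *
      (fderiv ℝ φ q.1 e₀ * m (q.1 - q.2) + φ q.1 * fderiv ℝ m (q.1 - q.2) e₀)
      + (∑ l, V l q.1 * V l q.2) * (m (q.1 - q.2) * ∑ j, V j q.1 * fderiv ℝ φ q.1 (e j)
        + φ q.1 * ∑ j, V j q.1 * fderiv ℝ m (q.1 - q.2) (e j))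
      + P q.1 * (m (q.1 - q.2) * ∑ j, V j q.2 * fderiv ℝ φ q.1 (e j)
        + φ q.1 * ∑ j, V j q.2 * fderiv ℝ m (q.1 - q.2) (e j)) := by
    simp only [M1]
    have a1 : ∀ l, ∑ j, V j q.1 * V l q.1 *
        (fderiv ℝ φ q.1 (e j) * m (q.1 - q.2) + φ q.1 * fderiv ℝ m (q.1 - q.2) (e j)) =
        V l q.1 * (m (q.1 - q.2) * ∑ j, V j q.1 * fderiv ℝ φ q.1 (e j)
        + φ q.1 * ∑ j, V j q.1 * fderiv ℝ m (q.1 - q.2) (e j)) := by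
      intro l
      simp only [Finset.mul_sum, ← Finset.sum_add_distrib]
      exact Finset.sum_congr rfl fun j _ => by ring
    simp only [a1]
    generalize m (q.1 - q.2) * ∑ j, V j q.1 * fderiv ℝ φ q.1 (e j)
        + φ q.1 * ∑ j, V j q.1 * fderiv ℝ m (q.1 - q.2) (e j) = S
    simp only [Finset.mul_sum, Finset.sum_mul, ← Finset.sum_add_distrib]
    exact Finset.sum_congr rfl fun j _ => by ring
  have e2 : M2 q = -φ q.1 * ((∑ l, V l q.1 * V l q.2) * fderiv ℝ m (q.1 - q.2) e₀
      + (∑ l, V l q.1 * V l q.2) * ∑ j, V j q.2 * fderiv ℝ m (q.1 - q.2) (e j)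
      + P q.2 * ∑ j, V j q.1 * fderiv ℝ m (q.1 - q.2) (e j)) := by
    simp only [M2]
    have a1 : ∀ l, ∑ j, V j q.2 * V l q.2 * -fderiv ℝ m (q.1 - q.2) (e j) =
        -V l q.2 * ∑ j, V j q.2 * fderiv ℝ m (q.1 - q.2) (e j) := by
      intro l
      simp only [Finset.mul_sum]
      exact Finset.sum_congr rfl fun j _ => by ring
    simp only [a1]
    generalize ∑ j, V j q.2 * fderiv ℝ m (q.1 - q.2) (e j) = S
    simp only [Finset.mul_sum, Finset.sum_mul, ← Finset.sum_add_distrib]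
    exact Finset.sum_congr rfl fun j _ => by ring
  have e3 : ∑ j, V j q.2 * -fderiv ℝ m (q.1 - q.2) (e j) =
      -∑ j, V j q.2 * fderiv ℝ m (q.1 - q.2) (e j) := by
    simp
  have e4 : ∀ f : ι → ℝ, ∑ j, f j *
      (fderiv ℝ φ q.1 (e j) * m (q.1 - q.2) + φ q.1 * fderiv ℝ m (q.1 - q.2) (e j)) =
      m (q.1 - q.2) * ∑ j, f j * fderiv ℝ φ q.1 (e j)
        + φ q.1 * ∑ j, f j * fderiv ℝ m (q.1 - q.2) (e j) := by
    intro f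
    simp only [Finset.mul_sum, ← Finset.sum_add_distrib]
    exact Finset.sum_congr rfl fun j _ => by ring
  have e5 : ∀ c : ℝ, ∑ j, c * V j q.2 *
      (fderiv ℝ φ q.1 (e j) * m (q.1 - q.2) + φ q.1 * fderiv ℝ m (q.1 - q.2) (e j)) =
      c * (m (q.1 - q.2) * ∑ j, V j q.2 * fderiv ℝ φ q.1 (e j)
        + φ q.1 * ∑ j, V j q.2 * fderiv ℝ m (q.1 - q.2) (e j)) := by
    intro c
    rw [← e4, Finset.mul_sum]
    exact Finset.sum_congr rfl fun j _ => by ring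
  have e6 : ∀ c : ℝ, ∑ j, c * V j q.1 * φ q.1 * -fderiv ℝ m (q.1 - q.2) (e j) =
      -c * φ q.1 * ∑ j, V j q.1 * fderiv ℝ m (q.1 - q.2) (e j) := by
    intro c
    rw [Finset.mul_sum]
    exact Finset.sum_congr rfl fun j _ => by ring
  have e7 : ∑ l, (V l q.2 - V l q.1) ^ 2 =
      ∑ l, V l q.2 ^ 2 - 2 * (∑ l, V l q.1 * V l q.2) + ∑ l, V l q.1 ^ 2 := by
    rw [Finset.mul_sum, ← Finset.sum_sub_distrib, ← Finset.sum_add_distrib]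
    exact Finset.sum_congr rfl fun j _ => by ring
  have e8 : ∀ c : ℝ, ∑ j, fderiv ℝ m (q.1 - q.2) (e j) * (φ q.1 * (c * (V j q.2 - V j q.1))) =
      φ q.1 * c * (∑ j, V j q.2 * fderiv ℝ m (q.1 - q.2) (e j)
        - ∑ j, V j q.1 * fderiv ℝ m (q.1 - q.2) (e j)) := by
    intro c
    rw [← Finset.sum_sub_distrib, Finset.mul_sum]
    exact Finset.sum_congr rfl fun j _ => by ring
  have e9 : ∑ j, (V j q.2 - V j q.1) * fderiv ℝ φ q.1 (e j) =
      ∑ j, V j q.2 * fderiv ℝ φ q.1 (e j) - ∑ j, V j q.1 * fderiv ℝ φ q.1 (e j) := by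
    rw [← Finset.sum_sub_distrib]
    exact Finset.sum_congr rfl fun j _ => by ring
  simp only [e1, e2, e3, e5]
  simp only [e4, e6, e8, e9, khmFlux, khmThird]
  rw [e7]
  ring

/-- A two-point function whose translates are integrable, with integral continuous in the shift. -/
def IsTranslationContinuous (μ : Measure F) (H : F → F → ℝ) : Prop :=
  (∀ y, Integrable (fun z => H z (z - y)) μ) ∧ (Continuous fun y => ∫ z, H z (z - y) ∂μ) ∧
    ∀ k : F → ℝ, Continuous k → HasCompactSupport k →
      Integrable (fun q : F × F => k q.2 * H q.1 (q.1 - q.2)) (μ.prod μ)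

lemma IsTranslationContinuous.add {H K : F → F → ℝ} (hH : IsTranslationContinuous μ H)
    (hK : IsTranslationContinuous μ K) :
    IsTranslationContinuous μ fun z z' => H z z' + K z z' :=
  ⟨fun y => (hH.1 y).add (hK.1 y), by
    simp only [fun y => integral_add (hH.1 y) (hK.1 y)]; exact hH.2.1.add hK.2.1,
    fun k hk hkc => by
      simp only [mul_add]; exact (hH.2.2 k hk hkc).add (hK.2.2 k hk hkc)⟩

lemma IsTranslationContinuous.const_mul {H : F → F → ℝ} (hH : IsTranslationContinuous μ H)
    (c : ℝ) : IsTranslationContinuous μ fun z z' => c * H z z' :=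
  ⟨fun y => (hH.1 y).const_mul c, by
    simpa only [integral_const_mul] using hH.2.1.const_mul c, fun k hk hkc => by
      simpa only [mul_left_comm] using (hH.2.2 k hk hkc).const_mul c⟩

lemma IsTranslationContinuous.sum {H : ι → F → F → ℝ}
    (hH : ∀ i, IsTranslationContinuous μ (H i)) :
    IsTranslationContinuous μ fun z z' => ∑ i, H i z z' :=
  ⟨fun y => integrable_finsetSum _ fun i _ => (hH i).1 y, by
    simpa only [fun y => integral_finsetSum Finset.univ fun i _ => (hH i).1 y] using
      continuous_finsetSum _ fun i _ => (hH i).2.1, fun k hk hkc => by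
      simp only [Finset.mul_sum]
      exact integrable_finsetSum _ fun i _ => (hH i).2.2 k hk hkc⟩

/-- Translation acts continuously on L^q for q < ∞, and the duality pairing with L^p is continuous.
-/
lemma continuous_integral_mul_translate_of_ne_top {p q : ℝ≥0∞} [hpq : ENNReal.HolderConjugate p q]
    (hq : q ≠ ⊤) {f g : F → ℝ} (hf : MemLp f p μ) (hg : MemLp g q μ) :
    (∀ y, Integrable (fun z => f z * g (z - y)) μ) ∧
      Continuous fun y => ∫ z, f z * g (z - y) ∂μ := by
  have hp1 : Fact (1 ≤ p) := ⟨hpq.one_le⟩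
  have hq1 : Fact (1 ≤ q) := ⟨hpq.symm.one_le⟩
  have hmp : ∀ y : F, MeasurePreserving (fun z => z - y) μ μ := fun y =>
    measurePreserving_sub_right μ y
  have hgy : ∀ y, MemLp (fun z => g (z - y)) q μ := fun y => hg.comp_measurePreserving (hmp y)
  refine ⟨fun y => hf.integrable_mul (hgy y), ?_⟩
  let T : F → C(F, F) := fun y => ⟨fun z => z - y, by fun_prop⟩
  have hT : Continuous T := ContinuousMap.continuous_of_continuous_uncurry T (by
    simp only [T, Function.uncurry, ContinuousMap.coe_mk]; fun_prop)
  have hc := (continuous_const (y := hg.toLp g)).compMeasurePreservingLp hT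
    (fun y => hmp y) hq
  let B := ContinuousLinearMap.lpPairing μ p q (ContinuousLinearMap.mul ℝ ℝ)
  have hB := (B (hf.toLp f)).continuous.comp hc
  refine hB.congr fun y => ?_
  simp only [Function.comp, B]
  rw [ContinuousLinearMap.lpPairing_eq_integral]
  refine integral_congr_ae ?_
  filter_upwards [hf.coeFn_toLp, Lp.coeFn_compMeasurePreserving (hg.toLp g) (hmp y),
    (hmp y).quasiMeasurePreserving.ae_eq_comp hg.coeFn_toLp] with z h1 h2 h3
  simp only [ContinuousLinearMap.mul_apply', h1]
  congr 1
  exact h2.trans h3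

/-- If q = ∞ then p = 1, and the translation is moved onto the other factor. -/
lemma continuous_integral_mul_translate {p q : ℝ≥0∞} (hpq : ENNReal.HolderConjugate p q)
    {f g : F → ℝ} (hf : MemLp f p μ) (hg : MemLp g q μ) :
    (∀ y, Integrable (fun z => f z * g (z - y)) μ) ∧
      Continuous fun y => ∫ z, f z * g (z - y) ∂μ := by
  by_cases hq : q = ⊤
  · have hp : p ≠ ⊤ := by
      have := hpq.inv_add_inv_eq_one
      rintro rfl
      simp [hq] at this
    have := hpq.symm
    obtain ⟨h1, h2⟩ := continuous_integral_mul_translate_of_ne_top hp hg hf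
    have e : ∀ y, (fun z => f z * g (z - y)) = fun z => (fun z => g z * f (z - -y)) (z - y) := by
      intro y; ext z; simp [mul_comm]
    refine ⟨fun y => ?_, ?_⟩
    · rw [e]; exact (h1 (-y)).comp_sub_right y
    · simp only [e]
      refine (h2.comp continuous_neg).congr fun y => ?_
      exact (integral_sub_right_eq_self (fun z => g z * f (z - -y)) y).symm
  · exact continuous_integral_mul_translate_of_ne_top hq hf hg

/-- The joint integrability is Tonelli's theorem together with the same continuity for the absolute
values: the inner integral is continuous in y and k has compact support. -/
lemma isTranslationContinuous_mul {p q : ℝ≥0∞} (hpq : ENNReal.HolderConjugate p q)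
    {f g : F → ℝ} (hf : MemLp f p μ) (hg : MemLp g q μ) :
    IsTranslationContinuous μ fun z z' => f z * g z' := by
  obtain ⟨h1, h2⟩ := continuous_integral_mul_translate hpq hf hg
  obtain ⟨h3, h4⟩ := continuous_integral_mul_translate hpq hf.norm hg.norm
  refine ⟨h1, h2, fun k hk hkc => ?_⟩
  have hm : AEStronglyMeasurable (fun q : F × F => k q.2 * (f q.1 * g (q.1 - q.2)))
      (μ.prod μ) :=
    (hk.comp continuous_snd).aestronglyMeasurable.mul (hf.1.comp_fst.mul
      (hg.1.comp_quasiMeasurePreserving (quasiMeasurePreserving_sub μ μ)))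
  rw [integrable_prod_iff' hm]
  refine ⟨.of_forall fun y => (h1 y).const_mul (k y), ?_⟩
  simp only [norm_mul, integral_const_mul]
  exact (hk.norm.mul h4).integrable_of_hasCompactSupport hkc.norm.mul_right

/-- Each monomial splits into a factor at z and a factor at z' in conjugate exponents: (2, 2), (3/2,
3), (a, a') or (1, ∞). This is the only place where p and v must be integrable to dual powers. -/
lemma isTranslationContinuous_khm {K : Set F} (hK : μ K ≠ ⊤) (hV3 : ∀ l, MemLp (V l) 3 μ)
    (hVK : ∀ l, ∀ z ∉ K, V l z = 0) {a a' : ℝ≥0∞} (haa : ENNReal.HolderConjugate a a')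
    (hP : MemLp P a μ) (hVa : ∀ l, MemLp (V l) a' μ) (hφ : ContDiff ℝ ∞ φ)
    (hφc : HasCompactSupport φ) :
    IsTranslationContinuous μ (khmFlux e₀ e V P φ) ∧
      ∀ j, IsTranslationContinuous μ (khmThird V φ j) := by
  have h22 : ENNReal.HolderConjugate 2 2 := by infer_instance
  have c3 : ENNReal.HolderConjugate (3 / 2) 3 := ⟨by
    rw [ENNReal.inv_div (by simp) (by simp), ← one_div, ENNReal.div_add_div_same, inv_one]
    norm_num; exact ENNReal.div_self (by simp) (by simp)⟩
  have t3 : ENNReal.HolderTriple 3 3 (3 / 2) := ⟨by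
    rw [ENNReal.inv_div (by simp) (by simp), ← one_div, ENNReal.div_add_div_same]
    norm_num⟩
  have t0 : ∀ p : ℝ≥0∞, ENNReal.HolderTriple ⊤ p p := fun p => ⟨by simp⟩
  have hD : ∀ w, MemLp (fun z => fderiv ℝ φ z w) ⊤ μ := fun w =>
    ((hφ.continuous_fderiv (by simp)).clm_apply continuous_const).memLp_of_hasCompactSupport
      (hφc.fderiv_apply ℝ w)
  have hφm : MemLp φ ⊤ μ := hφ.continuous.memLp_of_hasCompactSupport hφc
  have hV2 : ∀ l, MemLp (V l) 2 μ := fun l =>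
    (hV3 l).mono_exponent_of_measure_support_ne_top (hVK l) hK (by norm_num)
  have hVV : ∀ j l, MemLp (fun z => V j z * V l z) (3 / 2) μ := fun j l => (hV3 l).mul' (hV3 j)
  have hVVV : ∀ j l, MemLp (fun z => V l z ^ 2 * V j z) 1 μ := fun j l => by
    simp only [sq]
    exact (hV3 j).mul' (hVV l l)
  have hm : ∀ {f k : F → ℝ} {p : ℝ≥0∞}, MemLp f p μ → MemLp k ⊤ μ →
      MemLp (fun z => k z * f z) p μ := fun hf hk => hf.mul' hk
  constructor
  · have hc := ((((IsTranslationContinuous.sum fun l =>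
      isTranslationContinuous_mul h22 (hm (hV2 l) (hD e₀)) (hV2 l)).add
      (IsTranslationContinuous.sum fun l => IsTranslationContinuous.sum fun j =>
        isTranslationContinuous_mul c3 (hm (hVV l j) (hD (e j))) (hV3 l))).add
      (IsTranslationContinuous.sum fun j =>
        isTranslationContinuous_mul haa (hm hP (hD (e j))) (hVa j))).add
      (IsTranslationContinuous.sum fun j =>
        isTranslationContinuous_mul haa.symm (hm (hVa j) (hD (e j))) hP)).add
      ((IsTranslationContinuous.sum fun l => IsTranslationContinuous.sum fun j =>
        (isTranslationContinuous_mul ENNReal.HolderConjugate.one_top.symm (hD (e j))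
          (hVVV j l)).add ((isTranslationContinuous_mul c3.symm (hm (hV3 j) (hD (e j)))
            (hVV l l)).const_mul (-1))).const_mul 2⁻¹)
    convert hc using 3 with z z'
    simp only [khmFlux, Finset.sum_mul, Finset.mul_sum]
    congr 1
    · congr 1
      · congr 1
        · congr 1
          · exact Finset.sum_congr rfl fun j _ => by ring
          · rw [Finset.sum_comm]
            exact Finset.sum_congr rfl fun j _ => Finset.sum_congr rfl fun j _ => by ring
        · exact Finset.sum_congr rfl fun j _ => by ring
      · exact Finset.sum_congr rfl fun j _ => by ring
    · rw [Finset.sum_comm]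
      exact Finset.sum_congr rfl fun j _ => Finset.sum_congr rfl fun j _ => by ring
  · intro j
    have hc := IsTranslationContinuous.sum fun l =>
      (isTranslationContinuous_mul ENNReal.HolderConjugate.one_top.symm hφm (hVVV j l)).add
      (((isTranslationContinuous_mul c3.symm (hm (hV3 j) hφm) (hVV l l)).const_mul (-1)).add
      (((isTranslationContinuous_mul c3.symm (hm (hV3 l) hφm) (hVV l j)).const_mul (-2)).add
      (((isTranslationContinuous_mul c3 (hm (hVV l j) hφm) (hV3 l)).const_mul 2).add
      ((isTranslationContinuous_mul c3 (hm (hVV l l) hφm) (hV3 j)).add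
      -- The monomial that depends on z alone is paired with the constant 1 at z'.
      ((isTranslationContinuous_mul ENNReal.HolderConjugate.one_top (hm (hVVV j l) hφm)
        (memLp_top_const (1 : ℝ))).const_mul (-1))))))
    convert hc using 3 with z z'
    simp only [khmThird, Finset.sum_mul, Finset.mul_sum]
    exact Finset.sum_congr rfl fun l _ => by ring

/-- The Kármán–Howarth–Monin relation, tested with `m` in the increment variable. -/
theorem integral_khm {K : Set F} (hK : μ K ≠ ⊤) (hV3 : ∀ l, MemLp (V l) 3 μ)
    (hVK : ∀ l, ∀ z ∉ K, V l z = 0) (hP : Integrable P μ)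
    (hmom : ∀ ψ : F → ℝ, ContDiff ℝ ∞ ψ → HasCompactSupport ψ → tsupport ψ ⊆ W → ∀ l,
      ∫ z, (V l z * fderiv ℝ ψ z e₀ + ∑ j, V j z * V l z * fderiv ℝ ψ z (e j)
        + P z * fderiv ℝ ψ z (e l)) ∂μ = 0)
    (hinc : ∀ ψ : F → ℝ, ContDiff ℝ ∞ ψ → HasCompactSupport ψ → tsupport ψ ⊆ W →
      ∫ z, ∑ j, V j z * fderiv ℝ ψ z (e j) ∂μ = 0)
    (hφ : ContDiff ℝ ∞ φ) (hφc : HasCompactSupport φ) (hφW : tsupport φ ⊆ W)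
    (hm : ContDiff ℝ ∞ m) (hmc : HasCompactSupport m)
    (hmW : ∀ z ∈ tsupport φ, ∀ y ∈ tsupport m, z - y ∈ W)
    (hflux : IsTranslationContinuous μ (khmFlux e₀ e V P φ))
    (hthird : ∀ j, IsTranslationContinuous μ (khmThird V φ j)) :
    ∫ y, (m y * ∫ z, khmFlux e₀ e V P φ z (z - y) ∂μ) ∂μ
      + 2⁻¹ * ∫ y, (∑ j, fderiv ℝ m y (e j) * ∫ z, khmThird V φ j z (z - y) ∂μ) ∂μ = 0 := by
  have h22 : ENNReal.HolderConjugate 1 ⊤ := ENNReal.HolderConjugate.one_top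
  have t3 : ENNReal.HolderTriple 3 3 (3 / 2) := ⟨by
    rw [ENNReal.inv_div (by simp) (by simp), ← one_div, ENNReal.div_add_div_same]
    norm_num⟩
  have c3 : ENNReal.HolderTriple (3 / 2) 3 1 := ⟨by
    rw [ENNReal.inv_div (by simp) (by simp), ← one_div, ENNReal.div_add_div_same, inv_one]
    norm_num; exact ENNReal.div_self (by simp) (by simp)⟩
  have hV1 : ∀ l, Integrable (V l) μ := fun l => memLp_one_iff_integrable.1
    ((hV3 l).mono_exponent_of_measure_support_ne_top (hVK l) hK (by norm_num))
  have hVV : ∀ j l, MemLp (fun z => V j z * V l z) (3 / 2) μ := fun j l => (hV3 l).mul' (hV3 j)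
  have hV2 : ∀ j l, Integrable (fun z => V j z * V l z) μ := fun j l => memLp_one_iff_integrable.1
    ((hVV j l).mono_exponent_of_measure_support_ne_top (fun z hz => by simp [hVK j z hz]) hK (by
      rw [ENNReal.le_div_iff_mul_le (by simp) (by simp)]; norm_num))
  have hV3' : ∀ j l, Integrable (fun z => V l z ^ 2 * V j z) μ := fun j l =>
    memLp_one_iff_integrable.1 (by
      simp only [sq]
      exact (hV3 j).mul' (hVV l l))
  have key := integral_prod_khm hV1 hV2 hV3' hP hmom hinc hφ hφc hφW hm hmc hmW
  -- The measure-preserving involution that exchanges the second point for the increment y = z - z'.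
  let S : F × F ≃ₜ F × F :=
    { toFun := fun q => (q.1, q.1 - q.2)
      invFun := fun q => (q.1, q.1 - q.2)
      left_inv := fun q => by simp
      right_inv := fun q => by simp
      continuous_toFun := by fun_prop
      continuous_invFun := by fun_prop }
  have hS : MeasurePreserving S (μ.prod μ) (μ.prod μ) := by
    have := ((MeasurePreserving.id μ).prod (Measure.measurePreserving_neg μ)).comp
      (measurePreserving_prod_neg_add μ μ)
    convert this using 1
    ext q <;> simp [S, Prod.map]
    abel
  rw [← hS.integral_comp S.measurableEmbedding] at key
  have hSq : ∀ q, S q = (q.1, q.1 - q.2) := fun _ => rfl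
  simp only [hSq, sub_sub_cancel] at key
  have hDm : ∀ w, Continuous fun z => fderiv ℝ m z w := fun w =>
    (hm.continuous_fderiv (by simp)).clm_apply continuous_const
  have i1 := hflux.2.2 m hm.continuous hmc
  have i2 := fun j => (hthird j).2.2 _ (hDm (e j)) (hmc.fderiv_apply ℝ (e j))
  rw [integral_add i1 ((integrable_finsetSum _ fun j _ => i2 j).const_mul _),
    integral_const_mul, integral_finsetSum _ fun j _ => i2 j, integral_prod_symm _ i1] at key
  simp only [integral_const_mul, fun j => integral_prod_symm _ (i2 j)] at key
  rw [integral_finsetSum]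
  · exact key
  · intro j _
    exact ((hDm (e j)).mul (hthird j).2.1).integrable_of_hasCompactSupport
      (hmc.fderiv_apply ℝ (e j)).mul_right

end

lemma tendsto_integral_mul_of_tendsto_zero {F : Type*} [NormedAddCommGroup F] [MeasurableSpace F]
    [BorelSpace F] {μ : Measure F} [IsFiniteMeasureOnCompacts μ] {k : ℕ → F → ℝ} {r : ℕ → ℝ}
    (hk : ∀ n, Continuous (k n)) (hkc : ∀ n, HasCompactSupport (k n)) (hk0 : ∀ n x, 0 ≤ k n x)
    (hk1 : ∀ n, ∫ x, k n x ∂μ = 1) (hr : Tendsto r atTop (𝓝 0))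
    (hkr : ∀ n, tsupport (k n) ⊆ Metric.closedBall 0 (r n)) {g : F → ℝ} (hg : Continuous g) :
    Tendsto (fun n => ∫ x, k n x * g x ∂μ) atTop (𝓝 (g 0)) := by
  rw [Metric.tendsto_atTop']
  intro ε hε
  obtain ⟨δ, hδ, hgδ⟩ := Metric.continuousAt_iff.1 hg.continuousAt (ε / 2) (by positivity)
  obtain ⟨N, hN⟩ := (hr.eventually (gt_mem_nhds hδ)).exists_forall_of_atTop
  refine ⟨N, fun n hn => ?_⟩
  have i0 : Integrable (k n) μ := (hk n).integrable_of_hasCompactSupport (hkc n)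
  have i1 : Integrable (fun x => k n x * g x) μ :=
    ((hk n).mul hg).integrable_of_hasCompactSupport (hkc n).mul_right
  have h1 : ∫ x, k n x * g x ∂μ - g 0 = ∫ x, k n x * (g x - g 0) ∂μ := by
    simp only [mul_sub]
    rw [integral_sub i1 (i0.mul_const _), integral_mul_const, hk1, one_mul]
  rw [Real.dist_eq, h1, ← Real.norm_eq_abs]
  refine (norm_integral_le_integral_norm _).trans_lt ?_
  calc ∫ x, ‖k n x * (g x - g 0)‖ ∂μ ≤ ∫ x, k n x * (ε / 2) ∂μ := by
        refine integral_mono_of_nonneg (.of_forall fun x => norm_nonneg _) (i0.mul_const _)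
          (.of_forall fun x => ?_)
        simp only [norm_mul, Real.norm_of_nonneg (hk0 n x)]
        by_cases hx : x ∈ tsupport (k n)
        · refine mul_le_mul_of_nonneg_left ?_ (hk0 n x)
          have := hkr n hx
          rw [Metric.mem_closedBall] at this
          exact (hgδ (this.trans_lt (hN n hn.le))).le
        · simp [image_eq_zero_of_notMem_tsupport hx]
    _ < ε := by rw [integral_mul_const, hk1]; linarith

/-- A sequence of time mollifiers. -/
lemma exists_mollifier_seq (F : Type*) [NormedAddCommGroup F] [NormedSpace ℝ F]
    [FiniteDimensional ℝ F] [MeasurableSpace F] [BorelSpace F] (μ : Measure F)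
    [IsLocallyFiniteMeasure μ] [μ.IsOpenPosMeasure] {δ : ℝ} (hδ : 0 < δ) :
    ∃ (k : ℕ → F → ℝ) (r : ℕ → ℝ), (∀ n, ContDiff ℝ ∞ (k n)) ∧ (∀ n, HasCompactSupport (k n)) ∧
      (∀ n x, 0 ≤ k n x) ∧ (∀ n, ∫ x, k n x ∂μ = 1) ∧ Tendsto r atTop (𝓝 0) ∧
      (∀ n, tsupport (k n) ⊆ Metric.closedBall 0 (r n)) ∧ ∀ n, r n ≤ δ := by
  let b : ℕ → ContDiffBump (0 : F) := fun n =>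
    ⟨δ / (n + 1) / 2, δ / (n + 1), by positivity, half_lt_self (by positivity)⟩
  refine ⟨fun n => (b n).normed μ, fun n => δ / (n + 1), fun n => (b n).contDiff_normed,
    fun n => (b n).hasCompactSupport_normed, fun n => (b n).nonneg_normed,
    fun n => (b n).integral_normed, ?_, fun n => (b n).tsupport_normed_eq.subset, fun n => ?_⟩
  · exact ((tendsto_const_div_atTop_nhds_zero_nat δ).comp (tendsto_add_atTop_nat 1)).congr
      fun n => by simp
  · exact div_le_self hδ.le (by linarith [(Nat.cast_nonneg n : (0 : ℝ) ≤ n)])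

/-- The Kármán–Howarth–Monin relation at equal times. -/
theorem integral_khm_equal_time {δ : ℝ} (hδ : 0 < δ)
    {A : ℝ × EuclideanSpace ℝ (Fin d) → ℝ} {B : Fin d → ℝ × EuclideanSpace ℝ (Fin d) → ℝ}
    (hA : Continuous A) (hB : ∀ j, Continuous (B j))
    (h : ∀ m : ℝ × EuclideanSpace ℝ (Fin d) → ℝ, ContDiff ℝ ∞ m → HasCompactSupport m →
      tsupport m ⊆ Metric.closedBall 0 δ →
      (∫ y, m y * A y)
        + 2⁻¹ * ∫ y, ∑ j, fderiv ℝ m y (0, EuclideanSpace.single j 1) * B j y = 0)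
    {ρ : EuclideanSpace ℝ (Fin d) → ℝ} (hρ : ContDiff ℝ ∞ ρ) (hρc : HasCompactSupport ρ)
    (hρδ : tsupport ρ ⊆ Metric.closedBall 0 δ) :
    (∫ h, ρ h * A (0, h)) + 2⁻¹ * ∫ h, ∑ j, partialD j ρ h * B j (0, h) = 0 := by
  obtain ⟨η, r, hη, hηc, hη0, hη1, hr, hηr, hrδ⟩ := exists_mollifier_seq ℝ volume hδ
  have hprod : ∀ (k : EuclideanSpace ℝ (Fin d) → ℝ) (C : ℝ × EuclideanSpace ℝ (Fin d) → ℝ),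
      Continuous k → HasCompactSupport k → Continuous C →
      Tendsto (fun n => ∫ y : ℝ × EuclideanSpace ℝ (Fin d), η n y.1 * k y.2 * C y) atTop
        (𝓝 (∫ h, k h * C (0, h))) := by
    intro k C hk hkc hC
    have hg : Continuous fun τ : ℝ => ∫ h, k h * C (τ, h) := by
      have := continuous_parametric_integral_of_continuous (μ := volume)
        (f := fun (τ : ℝ) h => k h * C (τ, h)) (by unfold Function.uncurry; fun_prop) hkc.isCompact
      refine this.congr fun τ => setIntegral_eq_integral_of_forall_compl_eq_zero fun h hh => ?_
      rw [image_eq_zero_of_notMem_tsupport hh, zero_mul]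
    refine (tendsto_integral_mul_of_tendsto_zero (fun n => (hη n).continuous) hηc hη0 hη1 hr hηr
      hg).congr fun n => ?_
    have hi : Integrable (fun y : ℝ × EuclideanSpace ℝ (Fin d) => η n y.1 * k y.2 * C y) := by
      refine Continuous.integrable_of_hasCompactSupport ?_ ?_
      · have := (hη n).continuous; fun_prop
      · refine HasCompactSupport.intro ((hηc n).isCompact.prod hkc.isCompact) fun y hy => ?_
        rw [mem_prod, not_and_or] at hy
        rcases hy with hy | hy <;> simp [image_eq_zero_of_notMem_tsupport hy]
    rw [Measure.volume_eq_prod, integral_prod _ hi]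
    refine integral_congr_ae (.of_forall fun τ => ?_)
    simp only [mul_assoc, integral_const_mul]
  have l1 := hprod ρ A hρ.continuous hρc hA
  have l2 := fun j => hprod (partialD j ρ) (B j) (contDiff_partialD hρ j).continuous
    (hρc.partialD j) (hB j)
  have l3 := l1.add ((tendsto_finsetSum Finset.univ fun j _ => l2 j).const_mul 2⁻¹)
  have hint : ∀ j, Integrable fun h : EuclideanSpace ℝ (Fin d) => partialD j ρ h * B j (0, h) :=
    fun j => ((contDiff_partialD hρ j).continuous.mul ((hB j).comp (by fun_prop))
      ).integrable_of_hasCompactSupport (hρc.partialD j).mul_right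
  rw [integral_finsetSum _ fun j _ => hint j]
  refine tendsto_nhds_unique l3 (tendsto_const_nhds.congr fun n => ?_)
  -- The tensor kernel η(τ) ρ(h) may be concentrated at τ = 0, since no time derivative of the
  -- kernel occurs in the relation and A, B are continuous in τ.
  have hm : ContDiff ℝ ∞ fun y : ℝ × EuclideanSpace ℝ (Fin d) => η n y.1 * ρ y.2 :=
    ((hη n).comp contDiff_fst).mul (hρ.comp contDiff_snd)
  have hts : tsupport (fun y : ℝ × EuclideanSpace ℝ (Fin d) => η n y.1 * ρ y.2) ⊆
      tsupport (η n) ×ˢ tsupport ρ := by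
    refine closure_minimal (fun y hy => ?_) ((isClosed_tsupport _).prod (isClosed_tsupport _))
    exact ⟨subset_tsupport _ (left_ne_zero_of_mul hy), subset_tsupport _ (right_ne_zero_of_mul hy)⟩
  have hmc : HasCompactSupport fun y : ℝ × EuclideanSpace ℝ (Fin d) => η n y.1 * ρ y.2 :=
    ((hηc n).isCompact.prod hρc.isCompact).of_isClosed_subset (isClosed_tsupport _) hts
  have hd : ∀ (y : ℝ × EuclideanSpace ℝ (Fin d)) j,
      fderiv ℝ (fun y : ℝ × EuclideanSpace ℝ (Fin d) => η n y.1 * ρ y.2) y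
        (0, EuclideanSpace.single j 1) = η n y.1 * partialD j ρ y.2 := by
    intro y j
    have h1 : HasFDerivAt (fun y : ℝ × EuclideanSpace ℝ (Fin d) => η n y.1) _ y :=
      (((hη n).differentiable (by simp) y.1).hasFDerivAt).comp y hasFDerivAt_fst
    have h2 : HasFDerivAt (fun y : ℝ × EuclideanSpace ℝ (Fin d) => ρ y.2) _ y :=
      ((hρ.differentiable (by simp) y.2).hasFDerivAt).comp y hasFDerivAt_snd
    have h3 : HasFDerivAt (fun y : ℝ × EuclideanSpace ℝ (Fin d) => η n y.1 * ρ y.2) _ y :=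
      h1.mul h2
    rw [h3.fderiv]
    simp [partialD]
  have := h _ hm hmc (hts.trans fun y hy => by
    rw [mem_closedBall_zero_iff, Prod.norm_def]
    exact max_le ((mem_closedBall_zero_iff.1 (hηr n hy.1)).trans (hrδ n))
      (mem_closedBall_zero_iff.1 (hρδ hy.2)))
  simp only [hd] at this
  rw [integral_finsetSum] at this
  · exact this.symm
  · intro j _
    refine Continuous.integrable_of_hasCompactSupport ?_ ?_
    · have := (hη n).continuous
      have := (contDiff_partialD hρ j).continuous
      have := hB j
      fun_prop
    · refine HasCompactSupport.intro ((hηc n).isCompact.prod (hρc.partialD j).isCompact)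
        fun y hy => ?_
      rw [mem_prod, not_and_or] at hy
      rcases hy with hy | hy <;> simp [image_eq_zero_of_notMem_tsupport hy]

end DoublingVariables

/-! ### The Duchon–Robert formula on ℝ^d -/

section LocalDissipation

variable {d : ℕ} {I : Set ℝ} {v : ℝ × EuclideanSpace ℝ (Fin d) → EuclideanSpace ℝ (Fin d)}
  {p : ℝ × EuclideanSpace ℝ (Fin d) → ℝ}

lemma isSpaceTimeTest_id_iff {φ : ℝ × EuclideanSpace ℝ (Fin d) → ℝ} :
    IsSpaceTimeTest (id : EuclideanSpace ℝ (Fin d) → _) I φ ↔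
      ContDiff ℝ ∞ φ ∧ HasCompactSupport φ ∧ tsupport φ ⊆ I ×ˢ univ :=
  Iff.rfl

lemma timeDeriv_eq_fderiv {φ : ℝ × EuclideanSpace ℝ (Fin d) → ℝ} (hφ : ContDiff ℝ ∞ φ)
    (z : ℝ × EuclideanSpace ℝ (Fin d)) : timeDeriv φ z = fderiv ℝ φ z (1, 0) := by
  have h : HasFDerivAt φ (fderiv ℝ φ z) (z.1, z.2) :=
    (hφ.differentiable (by simp) z).hasFDerivAt
  have h2 : HasDerivAt (fun s : ℝ => (s, z.2)) (1, 0) z.1 :=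
    (hasDerivAt_id z.1).prodMk (hasDerivAt_const _ _)
  exact (h.comp_hasDerivAt z.1 h2).deriv

lemma spaceDeriv_id_eq_fderiv {φ : ℝ × EuclideanSpace ℝ (Fin d) → ℝ} (hφ : ContDiff ℝ ∞ φ)
    (j : Fin d) (z : ℝ × EuclideanSpace ℝ (Fin d)) :
    spaceDeriv id j φ z = fderiv ℝ φ z (0, EuclideanSpace.single j 1) := by
  have h : HasFDerivAt φ (fderiv ℝ φ z) (z.1, z.2 + (0 : ℝ) • EuclideanSpace.single j (1 : ℝ)) := by
    simpa using (hφ.differentiable (by simp) z).hasFDerivAt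
  have h2 : HasDerivAt (fun s : ℝ => (z.1, z.2 + s • EuclideanSpace.single j (1 : ℝ)))
      (0, (1 : ℝ) • EuclideanSpace.single j (1 : ℝ)) 0 :=
    (hasDerivAt_const _ _).prodMk (((hasDerivAt_id (0 : ℝ)).smul_const _).const_add _)
  rw [one_smul] at h2
  exact (h.comp_hasDerivAt (0 : ℝ) h2).deriv

/-- The `j`-th component of `|δ_h v|² δ_h v`, for the spatial increment `δ_h v` by `-π h`. -/
noncomputable def cubicIncrement {X : Type*} [AddCommGroup X] (π : EuclideanSpace ℝ (Fin d) → X)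
    (v : ℝ × X → EuclideanSpace ℝ (Fin d)) (h : EuclideanSpace ℝ (Fin d)) (j : Fin d)
    (z : ℝ × X) : ℝ :=
  ‖v (z.1, z.2 - π h) - v z‖ ^ 2 * (v (z.1, z.2 - π h) - v z) j

/-- The Duchon–Robert formula for the dissipation of a weak solution. -/
theorem tendsto_dissipation (hI : IsOpen I) (hsol : IsWeakEulerSolution id I v p)
    (hv : ∀ K ⊆ I ×ˢ univ, IsCompact K → MemLp v 3 (volume.restrict K))
    {a a' : ℝ≥0∞} (haa : ENNReal.HolderConjugate a a')
    (hpa : ∀ K ⊆ I ×ˢ univ, IsCompact K → MemLp p a (volume.restrict K))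
    (hva : ∀ K ⊆ I ×ˢ univ, IsCompact K → MemLp v a' (volume.restrict K))
    {ρ : ℕ → EuclideanSpace ℝ (Fin d) → ℝ} {r : ℕ → ℝ}
    (hρ : ∀ n, ContDiff ℝ ∞ (ρ n)) (hρc : ∀ n, HasCompactSupport (ρ n))
    (hρ0 : ∀ n x, 0 ≤ ρ n x) (hρ1 : ∀ n, ∫ x, ρ n x = 1) (hr : Tendsto r atTop (𝓝 0))
    (hρr : ∀ n, tsupport (ρ n) ⊆ Metric.closedBall 0 (r n))
    {φ : ℝ × EuclideanSpace ℝ (Fin d) → ℝ} (hφ : IsSpaceTimeTest id I φ) :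
    Tendsto (fun n => -(1 / 4) * ∫ h, ∑ j, partialD j (ρ n) h *
      ∫ z in I ×ˢ univ, φ z * cubicIncrement id v h j z) atTop (𝓝 (dissipation id I v p φ)) := by
  set U : Set (ℝ × EuclideanSpace ℝ (Fin d)) := I ×ˢ univ with hU
  have hUo : IsOpen U := hI.prod isOpen_univ
  obtain ⟨hφs, hφc, hφU⟩ := isSpaceTimeTest_id_iff.1 hφ
  -- A margin δ around the support of φ. Velocity and pressure are cut off to the compact set L,
  -- which makes them globally integrable. The equations persist for test functions supported in L,
  -- and shifts of length at most δ do not leave L.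
  obtain ⟨δ, hδ, hδU⟩ := hφc.isCompact.exists_cthickening_subset_open hUo hφU
  set L := Metric.cthickening δ (tsupport φ) with hL
  have hLc : IsCompact L := hφc.isCompact.cthickening
  have hφL : tsupport φ ⊆ L := Metric.self_subset_cthickening _
  have hLsub : ∀ z ∈ tsupport φ, ∀ y ∈ Metric.closedBall (0 : ℝ × EuclideanSpace ℝ (Fin d)) δ,
      z - y ∈ L := by
    intro z hz y hy
    refine Metric.mem_cthickening_of_dist_le _ z _ _ hz ?_
    simpa [dist_eq_norm] using hy
  set V : Fin d → ℝ × EuclideanSpace ℝ (Fin d) → ℝ := fun l => L.indicator fun z => v z l with hV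
  set P := L.indicator p with hP
  have hcomp : ∀ {q : ℝ≥0∞} l, MemLp v q (volume.restrict L) → MemLp (V l) q volume := by
    intro q l h
    rw [hV, memLp_indicator_iff_restrict hLc.measurableSet]
    refine h.of_le ?_ (.of_forall fun z => PiLp.norm_apply_le (v z) l)
    exact ((EuclideanSpace.proj l : _ →L[ℝ] ℝ).continuous).comp_aestronglyMeasurable h.1
  have hV3 := fun l => hcomp l (hv L hδU hLc)
  have hVa := fun l => hcomp l (hva L hδU hLc)
  have hPa : MemLp P a volume := (memLp_indicator_iff_restrict hLc.measurableSet).2 (hpa L hδU hLc)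
  have hP1 : Integrable P volume := memLp_one_iff_integrable.1
    (hPa.mono_exponent_of_measure_support_ne_top (s := L) (fun z hz => indicator_of_notMem hz _)
      hLc.measure_lt_top.ne haa.one_le)
  have hVL : ∀ l, ∀ z ∉ L, V l z = 0 := fun l z hz => indicator_of_notMem hz _
  have hVm : ∀ z ∈ L, ∀ l, V l z = v z l := fun z hz l => indicator_of_mem hz _
  have hzero : ∀ ψ : ℝ × EuclideanSpace ℝ (Fin d) → ℝ, tsupport ψ ⊆ L → ∀ z ∉ L, ∀ w,
      fderiv ℝ ψ z w = 0 := fun ψ hψ z hz w => by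
    rw [image_eq_zero_of_notMem_tsupport (f := fderiv ℝ ψ)
      fun h => hz (hψ (tsupport_fderiv_subset ℝ h))]; simp
  have hmom : ∀ ψ : ℝ × EuclideanSpace ℝ (Fin d) → ℝ, ContDiff ℝ ∞ ψ → HasCompactSupport ψ →
      tsupport ψ ⊆ L → ∀ l, ∫ z, (V l z * fderiv ℝ ψ z (1, 0)
        + ∑ j, V j z * V l z * fderiv ℝ ψ z (0, EuclideanSpace.single j 1)
        + P z * fderiv ℝ ψ z (0, EuclideanSpace.single l 1)) = 0 := by
    intro ψ hψ hψc hψL l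
    refine Eq.trans ?_ (hsol.momentum ψ (isSpaceTimeTest_id_iff.2 ⟨hψ, hψc, hψL.trans hδU⟩) l)
    rw [← setIntegral_eq_integral_of_forall_compl_eq_zero (s := U)]
    · refine setIntegral_congr_fun hUo.measurableSet fun z _ => ?_
      simp only [timeDeriv_eq_fderiv hψ, spaceDeriv_id_eq_fderiv hψ]
      by_cases hz : z ∈ L
      · simp [hVm z hz, hP, hz]
      · simp [hzero ψ hψL z hz]
    · intro z hz
      simp [hzero ψ hψL z fun h => hz (hδU h)]
  have hinc : ∀ ψ : ℝ × EuclideanSpace ℝ (Fin d) → ℝ, ContDiff ℝ ∞ ψ → HasCompactSupport ψ →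
      tsupport ψ ⊆ L → ∫ z, ∑ j, V j z * fderiv ℝ ψ z (0, EuclideanSpace.single j 1) = 0 := by
    intro ψ hψ hψc hψL
    refine Eq.trans ?_ (hsol.incompressible ψ (isSpaceTimeTest_id_iff.2 ⟨hψ, hψc, hψL.trans hδU⟩))
    rw [← setIntegral_eq_integral_of_forall_compl_eq_zero (s := U)]
    · refine setIntegral_congr_fun hUo.measurableSet fun z _ => ?_
      simp only [spaceDeriv_id_eq_fderiv hψ]
      by_cases hz : z ∈ L
      · simp [hVm z hz]
      · simp [hzero ψ hψL z hz]
    · intro z hz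
      simp [hzero ψ hψL z fun h => hz (hδU h)]
  have : (volume : Measure (ℝ × EuclideanSpace ℝ (Fin d))).IsAddHaarMeasure := by
    rw [Measure.volume_eq_prod]; infer_instance
  obtain ⟨hflux, hthird⟩ := isTranslationContinuous_khm
    (μ := (volume : Measure (ℝ × EuclideanSpace ℝ (Fin d))))
    (e₀ := ((1 : ℝ), (0 : EuclideanSpace ℝ (Fin d))))
    (e := fun j => ((0 : ℝ), EuclideanSpace.single j (1 : ℝ))) hLc.measure_lt_top.ne hV3 hVL haa hPa
    hVa hφs hφc
  have hkhm := fun (m : ℝ × EuclideanSpace ℝ (Fin d) → ℝ) (hm : ContDiff ℝ ∞ m)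
    (hmc : HasCompactSupport m) (hmδ : tsupport m ⊆ Metric.closedBall 0 δ) => integral_khm (m := m) hLc.measure_lt_top.ne hV3 hVL hP1 hmom hinc
    hφs hφc hφL hm hmc (fun z hz y hy => hLsub z hz y (hmδ hy)) hflux hthird
  have htime := fun ρ hρ hρc hρδ => integral_khm_equal_time (ρ := ρ) hδ hflux.2.1
    (fun j => (hthird j).2.1) hkhm hρ hρc hρδ
  have hlim := tendsto_integral_mul_of_tendsto_zero (μ := (volume : Measure (EuclideanSpace ℝ (Fin d))))
    (fun n => (hρ n).continuous) hρc hρ0 hρ1 hr hρr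
    (hflux.2.1.comp (Continuous.prodMk_right (0 : ℝ)))
  -- At coinciding points the flux is exactly twice the integrand that defines the dissipation, and
  -- its last term vanishes.
  have hdis : dissipation id I v p φ = 2⁻¹ * ∫ z, khmFlux ((1 : ℝ), (0 : EuclideanSpace ℝ (Fin d)))
      (fun j => ((0 : ℝ), EuclideanSpace.single j (1 : ℝ))) V P φ z
        (z - ((0 : ℝ), (0 : EuclideanSpace ℝ (Fin d)))) := by
    rw [dissipation, ← integral_const_mul]
    refine Eq.trans ?_ (setIntegral_eq_integral_of_forall_compl_eq_zero (s := U) ?_)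
    · refine setIntegral_congr_fun hUo.measurableSet fun z _ => ?_
      simp only [timeDeriv_eq_fderiv hφs, spaceDeriv_id_eq_fderiv hφs, khmFlux]
      by_cases hz : z ∈ L
      · simp only [Prod.mk_zero_zero, sub_zero, hVm z hz, hP, indicator_of_mem hz, sub_self]
        rw [EuclideanSpace.real_norm_sq_eq]
        simp only [zero_mul, Finset.sum_const_zero, mul_zero, ← sq]
        generalize ∑ i, v z i ^ 2 = S
        simp only [mul_assoc, ← Finset.mul_sum]
        ring
      · simp [hzero φ hφL z hz]
    · intro z hz
      simp [khmFlux, hzero φ hφL z fun h => hz (hδU h)]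
  rw [hdis]
  refine (hlim.const_mul 2⁻¹).congr' ?_
  -- Once r n ≤ δ, the relation equates ∫ ρ · (flux) with -(1/2) times the cubic term. With the
  -- factor 1/2 in `hdis` this gives -(1/4).
  filter_upwards [hr.eventually (ge_mem_nhds hδ)] with n hn
  have hρδ : tsupport (ρ n) ⊆ Metric.closedBall 0 δ :=
    (hρr n).trans (Metric.closedBall_subset_closedBall hn)
  have h1 := htime (ρ n) (hρ n) (hρc n) hρδ
  have h2 : ∫ h, ∑ j, partialD j (ρ n) h * ∫ z in U, φ z * cubicIncrement id v h j z =
      ∫ h, ∑ j, partialD j (ρ n) h * ∫ z, khmThird V φ j z (z - (0, h)) := by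
    refine integral_congr_ae (.of_forall fun h => Finset.sum_congr rfl fun j _ => ?_)
    by_cases hh : h ∈ tsupport (ρ n)
    · congr 1
      refine Eq.trans ?_ (setIntegral_eq_integral_of_forall_compl_eq_zero (s := U) ?_)
      · refine setIntegral_congr_fun hUo.measurableSet fun z _ => ?_
        by_cases hz : z ∈ tsupport φ
        · have hzh : z - (0, h) ∈ L := hLsub z hz _ (by
            rw [mem_closedBall_zero_iff, Prod.norm_def]
            simpa [hδ.le] using hρδ hh)
          simp only [khmThird, cubicIncrement, hVm z (hφL hz), hVm _ hzh]
          rw [EuclideanSpace.real_norm_sq_eq]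
          have : z - (0, h) = (z.1, z.2 - id h) := by ext <;> simp
          simp [this]
        · simp [khmThird, image_eq_zero_of_notMem_tsupport hz]
      · intro z hz
        simp [khmThird, image_eq_zero_of_notMem_tsupport fun h => hz (hφU h)]
    · rw [image_eq_zero_of_notMem_tsupport fun h => hh (tsupport_partialD_subset j h)]
      simp
  rw [h2]
  simp only [Function.comp]
  linarith

end LocalDissipation

/-! ### Dyadic dilates of the mollifier and their scaling -/

section DyadicKernels

variable {d : ℕ}

lemma partialD_comp_smul (f : EuclideanSpace ℝ (Fin d) → ℝ) (c : ℝ) (l : Fin d) :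
    partialD l (fun x => f (c • x)) = fun x => c * partialD l f (c • x) := by
  ext x
  have h : fderiv ℝ (fun x => f (c • x)) x = c • fderiv ℝ f (c • x) := fderiv_comp_smul c
  simp [partialD, h]

lemma partialD_dilate (f : EuclideanSpace ℝ (Fin d) → ℝ) (b c : ℝ) (l : Fin d) :
    partialD l (fun x => b * f (c • x)) = fun x => b * c * partialD l f (c • x) := by
  rw [partialD_const_mul, partialD_comp_smul]
  ext x
  ring

lemma integral_partialD_eq_zero {f : EuclideanSpace ℝ (Fin d) → ℝ} (hf : ContDiff ℝ ∞ f)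
    (hfc : HasCompactSupport f) (l : Fin d) : ∫ x, partialD l f x = 0 :=
  integral_fderiv_apply_eq_zero hf hfc _

/-- A dyadic family of mollifiers on `ℝ^d` whose successive differences are Laplacians of
compactly supported functions. -/
structure IsDyadicKernel (ρ Ψ : ℤ → EuclideanSpace ℝ (Fin d) → ℝ) (C : ℝ) : Prop where
  contDiff : ∀ k, ContDiff ℝ ∞ (ρ k)
  contDiff_potential : ∀ k, ContDiff ℝ ∞ (Ψ k)
  tsupport_subset : ∀ k, tsupport (ρ k) ⊆ Metric.closedBall 0 (2 ^ k)
  tsupport_potential_subset : ∀ k, tsupport (Ψ k) ⊆ Metric.closedBall 0 (2 * 2 ^ k)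
  nonneg : ∀ k x, 0 ≤ ρ k x
  integral_eq_one : ∀ k, ∫ x, ρ k x = 1
  sub_succ : ∀ k x, ρ k x - ρ (k + 1) x = -laplacian (Ψ k) x
  le : ∀ k x, ρ k x ≤ C * ((2 : ℝ) ^ k)⁻¹ ^ d
  abs_partialD_le : ∀ k l x, |partialD l (ρ k) x| ≤ C * ((2 : ℝ) ^ k)⁻¹ ^ (d + 1)
  integral_abs_partialD_le : ∀ k i j, ∫ x, |partialD i (partialD j (Ψ k)) x| ≤ C
  abs_partialD_potential_le : ∀ k i j l x,
    |partialD i (partialD j (partialD l (Ψ k))) x| ≤ C * ((2 : ℝ) ^ k)⁻¹ ^ (d + 1)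

lemma tsupport_dilate_subset {f : EuclideanSpace ℝ (Fin d) → ℝ} {R s : ℝ} (hs : 0 < s) (b : ℝ)
    (hf : tsupport f ⊆ Metric.closedBall 0 R) :
    tsupport (fun x => b * f (s⁻¹ • x)) ⊆ Metric.closedBall 0 (R * s) := by
  refine closure_minimal (fun x hx => ?_) Metric.isClosed_closedBall
  have : f (s⁻¹ • x) ≠ 0 := fun h => hx (by simp [h])
  have := hf (subset_tsupport _ this)
  rw [mem_closedBall_zero_iff, norm_smul, norm_inv, Real.norm_of_nonneg hs.le] at this
  rw [mem_closedBall_zero_iff]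
  calc ‖x‖ = s⁻¹ * ‖x‖ * s := by field_simp
    _ ≤ R * s := by gcongr

theorem exists_isDyadicKernel (hd : d ≠ 0) :
    ∃ (ρ Ψ : ℤ → EuclideanSpace ℝ (Fin d) → ℝ) (C : ℝ), 0 < C ∧ IsDyadicKernel ρ Ψ C := by
  obtain ⟨ρ, Ψ, hρ, hΨ, hρs, hΨs, hρ0, hρ1, hsub⟩ := exists_mollifier_laplacian hd
  have hρc : HasCompactSupport ρ := (isCompact_closedBall _ _).of_isClosed_subset
    (isClosed_tsupport _) hρs
  have hΨc : HasCompactSupport Ψ := (isCompact_closedBall _ _).of_isClosed_subset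
    (isClosed_tsupport _) hΨs
  have hbdd : ∀ f : EuclideanSpace ℝ (Fin d) → ℝ, ContDiff ℝ ∞ f → HasCompactSupport f →
      ∃ C, ∀ x, ‖f x‖ ≤ C := fun f hf hfc => hfc.exists_bound_of_continuous hf.continuous
  have hρ' := fun l => contDiff_partialD hρ l
  have hΨ' := fun l => contDiff_partialD hΨ l
  have hΨ'' := fun j l => contDiff_partialD (hΨ' l) j
  have hΨ3 := fun i j l => contDiff_partialD (hΨ'' j l) i
  obtain ⟨C₀, hC₀⟩ := hbdd ρ hρ hρc
  choose C₁ hC₁ using fun l => hbdd _ (hρ' l) (hρc.partialD l)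
  choose C₃ hC₃ using fun i j l => hbdd _ (hΨ3 i j l) (((hΨc.partialD l).partialD j).partialD i)
  set C₂ : Fin d → Fin d → ℝ := fun i j => ∫ x, |partialD i (partialD j Ψ) x|
  have hle : ∀ {ι : Type} [Fintype ι] (f : ι → ℝ) (i : ι), f i ≤ ∑ i, |f i| := fun f i =>
    (le_abs_self _).trans (Finset.single_le_sum (f := fun i => |f i|) (fun _ _ => abs_nonneg _)
      (Finset.mem_univ i))
  -- One constant that dominates the finitely many bounds at unit scale.
  set C := 1 + |C₀| + ∑ l, |C₁ l| + ∑ i : Fin d × Fin d, |C₂ i.1 i.2|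
    + ∑ i : Fin d × Fin d × Fin d, |C₃ i.1 i.2.1 i.2.2|
  have n1 : 0 ≤ ∑ l, |C₁ l| := Finset.sum_nonneg fun _ _ => abs_nonneg _
  have n2 : 0 ≤ ∑ i : Fin d × Fin d, |C₂ i.1 i.2| := Finset.sum_nonneg fun _ _ => abs_nonneg _
  have n3 : 0 ≤ ∑ i : Fin d × Fin d × Fin d, |C₃ i.1 i.2.1 i.2.2| :=
    Finset.sum_nonneg fun _ _ => abs_nonneg _
  have n0 := abs_nonneg C₀
  have b0 : C₀ ≤ C := by have := le_abs_self C₀; simp only [C]; linarith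
  have b1 : ∀ l, C₁ l ≤ C := fun l => by have := hle C₁ l; simp only [C]; linarith
  have b2 : ∀ i j, C₂ i j ≤ C := fun i j => by
    have := hle (fun i : Fin d × Fin d => C₂ i.1 i.2) (i, j); simp only [C]; linarith
  have b3 : ∀ i j l, C₃ i j l ≤ C := fun i j l => by
    have := hle (fun i : Fin d × Fin d × Fin d => C₃ i.1 i.2.1 i.2.2) (i, j, l)
    simp only [C]; linarith
  have hint : ∀ (f : EuclideanSpace ℝ (Fin d) → ℝ) {s : ℝ}, 0 < s →
      ∫ x, s⁻¹ ^ d * f (s⁻¹ • x) = ∫ x, f x := by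
    intro f s hs
    rw [integral_const_mul, Measure.integral_comp_inv_smul_of_nonneg _ _ hs.le]
    simp [← mul_assoc, ← mul_pow, hs.ne']
  -- The potential carries an extra factor 4^k that compensates the two derivatives of the
  -- Laplacian. Hence ∂_i ∂_j Ψ_k has scale-invariant L^1 norm.
  refine ⟨fun k x => ((2 : ℝ) ^ k)⁻¹ ^ d * ρ (((2 : ℝ) ^ k)⁻¹ • x),
    fun k x => (((2 : ℝ) ^ k) ^ 2 * ((2 : ℝ) ^ k)⁻¹ ^ d) * Ψ (((2 : ℝ) ^ k)⁻¹ • x), C,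
    by simp only [C]; linarith, ?_⟩
  constructor
  · intro k; fun_prop
  · intro k; fun_prop
  · intro k
    simpa using tsupport_dilate_subset (s := 2 ^ k) (by positivity) _ hρs
  · intro k
    exact tsupport_dilate_subset (s := 2 ^ k) (by positivity) _ hΨs
  · intro k x
    have := hρ0 (((2 : ℝ) ^ k)⁻¹ • x)
    positivity
  · intro k
    rw [hint _ (by positivity), hρ1]
  · intro k x
    have hk : (0 : ℝ) < 2 ^ k := by positivity
    have h := hsub (((2 : ℝ) ^ k)⁻¹ • x)
    simp only [laplacian, partialD_dilate]
    rw [← Finset.mul_sum]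
    have h2 : ((2 : ℝ) ^ (k + 1))⁻¹ = 2⁻¹ * (2 ^ k)⁻¹ := by
      rw [zpow_add_one₀ (by norm_num), mul_inv, mul_comm]
    rw [h2, mul_pow, mul_smul]
    have h3 : ((2 : ℝ) ^ k) ^ 2 * (2 ^ k)⁻¹ ^ d * (2 ^ k)⁻¹ * (2 ^ k)⁻¹ = (2 ^ k)⁻¹ ^ d := by
      field_simp
    rw [h3]
    simp only [laplacian] at h
    linear_combination ((2 : ℝ) ^ k)⁻¹ ^ d * h
  · intro k x
    have := (le_abs_self _).trans ((hC₀ (((2 : ℝ) ^ k)⁻¹ • x)).trans b0)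
    rw [mul_comm C]
    gcongr
  · intro k l x
    rw [partialD_dilate, abs_mul, ← pow_succ, abs_of_nonneg (by positivity), mul_comm C]
    have := (hC₁ l (((2 : ℝ) ^ k)⁻¹ • x)).trans (b1 l)
    gcongr
    exact this
  · intro k i j
    have hk : (0 : ℝ) < 2 ^ k := by positivity
    simp only [partialD_dilate]
    have h3 : ((2 : ℝ) ^ k) ^ 2 * (2 ^ k)⁻¹ ^ d * (2 ^ k)⁻¹ * (2 ^ k)⁻¹ = (2 ^ k)⁻¹ ^ d := by
      field_simp
    simp only [h3, abs_mul, abs_of_nonneg (show 0 ≤ ((2 : ℝ) ^ k)⁻¹ ^ d by positivity)]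
    rw [hint (fun x => |partialD i (partialD j Ψ) x|) hk]
    exact b2 i j
  · intro k i j l x
    have hk : (0 : ℝ) < 2 ^ k := by positivity
    simp only [partialD_dilate]
    have h3 : ((2 : ℝ) ^ k) ^ 2 * (2 ^ k)⁻¹ ^ d * (2 ^ k)⁻¹ * (2 ^ k)⁻¹ * (2 ^ k)⁻¹
        = (2 ^ k)⁻¹ ^ (d + 1) := by
      rw [pow_succ _ d]
      field_simp
    rw [h3, abs_mul, abs_of_nonneg (by positivity), mul_comm C]
    have := (hC₃ i j l (((2 : ℝ) ^ k)⁻¹ • x)).trans (b3 i j l)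
    gcongr
    exact this

end DyadicKernels

/-! ### Convolution with smooth compactly supported kernels -/

section Mollify

variable {d : ℕ} {k : EuclideanSpace ℝ (Fin d) → ℝ} {f : EuclideanSpace ℝ (Fin d) → ℝ}

/-- The convolution of a kernel `k` with `f` on `ℝ^d`. -/
noncomputable def mollify (k f : EuclideanSpace ℝ (Fin d) → ℝ) (y : EuclideanSpace ℝ (Fin d)) : ℝ :=
  ∫ x, k (y - x) * f x

lemma mollify_eq_convolution (k f : EuclideanSpace ℝ (Fin d) → ℝ) :
    mollify k f = convolution f k (ContinuousLinearMap.mul ℝ ℝ) volume := by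
  ext y
  simp [mollify, convolution_def, mul_comm]

lemma HasCompactSupport.comp_sub_left {G : Type*} [AddCommGroup G] [TopologicalSpace G]
    [IsTopologicalAddGroup G] {k : G → ℝ} (hk : HasCompactSupport k) (y : G) :
    HasCompactSupport fun x => k (y - x) :=
  hk.comp_homeomorph (Homeomorph.subLeft y)

lemma integrable_mollify (hk : Continuous k) (hkc : HasCompactSupport k)
    (hf : LocallyIntegrable f) (y : EuclideanSpace ℝ (Fin d)) :
    Integrable fun x => k (y - x) * f x :=
  hf.integrable_smul_left_of_hasCompactSupport (by fun_prop) (hkc.comp_sub_left y)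

lemma continuous_mollify (hk : Continuous k) (hkc : HasCompactSupport k)
    (hf : LocallyIntegrable f) : Continuous (mollify k f) := by
  rw [mollify_eq_convolution]
  exact hkc.continuous_convolution_right _ hf hk

lemma hasFDerivAt_mollify (hk : ContDiff ℝ ∞ k) (hkc : HasCompactSupport k)
    (hf : LocallyIntegrable f) (y : EuclideanSpace ℝ (Fin d)) :
    ∃ f' : EuclideanSpace ℝ (Fin d) →L[ℝ] ℝ, HasFDerivAt (mollify k f) f' y ∧
      ∀ l, f' (EuclideanSpace.single l 1) = mollify (partialD l k) f y := by
  refine ⟨_, by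
    rw [mollify_eq_convolution]
    exact hkc.hasFDerivAt_convolution_right (ContinuousLinearMap.mul ℝ ℝ) hf
      (hk.of_le (by simp)) y, fun l => ?_⟩
  rw [convolution_def, ContinuousLinearMap.integral_apply]
  · simp [mollify, partialD, ContinuousLinearMap.precompR_apply, mul_comm]
  · exact (hkc.fderiv ℝ).convolutionExists_right _ hf (hk.continuous_fderiv (by simp)) y

/-- The mean value inequality on the convex ball. The factor d comes from bounding the operator norm
of the derivative by its coordinates. -/
lemma abs_mollify_sub_le (hk : ContDiff ℝ ∞ k) (hkc : HasCompactSupport k)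
    (hf : LocallyIntegrable f) {R M : ℝ}
    (hM : ∀ l, ∀ x ∈ Metric.closedBall 0 R, |mollify (partialD l k) f x| ≤ M)
    {y : EuclideanSpace ℝ (Fin d)} (hy : y ∈ Metric.closedBall 0 R) :
    |mollify k f y - mollify k f 0| ≤ d * M * ‖y‖ := by
  choose f' hf' hf'l using hasFDerivAt_mollify hk hkc hf
  have h0 : (0 : EuclideanSpace ℝ (Fin d)) ∈ Metric.closedBall 0 R := by
    simp only [mem_closedBall_zero_iff, norm_zero] at hy ⊢
    exact (norm_nonneg y).trans hy
  have := (convex_closedBall (0 : EuclideanSpace ℝ (Fin d)) R).norm_image_sub_le_of_norm_hasFDerivWithin_le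
    (f := mollify k f) (C := d * M) (fun x hx => (hf' x).hasFDerivWithinAt) (fun x hx => ?_) h0 hy
  · simpa using this
  -- For d = 0 the hypothesis on M is vacuous and its sign unknown, but then the product vanishes.
  · have hM0 : 0 ≤ d * M := by
      rcases Nat.eq_zero_or_pos d with rfl | hd
      · simp
      · have := (abs_nonneg _).trans (hM ⟨0, hd⟩ x hx)
        positivity
    refine ContinuousLinearMap.opNorm_le_bound _ hM0 fun w => ?_
    have hw : w = ∑ l, w l • EuclideanSpace.single l (1 : ℝ) := by
      ext i; simp [Finset.sum_apply, Pi.single_apply]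
    conv_lhs => rw [hw]
    rw [map_sum]
    refine (norm_sum_le _ _).trans ?_
    calc ∑ l, ‖f' x (w l • EuclideanSpace.single l (1 : ℝ))‖ ≤ ∑ l : Fin d, M * ‖w‖ := by
          refine Finset.sum_le_sum fun l _ => ?_
          rw [map_smul, hf'l, norm_smul, mul_comm]
          have h1 := hM l x hx
          have h2 : ‖w l‖ ≤ ‖w‖ := PiLp.norm_apply_le w l
          have h3 := (abs_nonneg _).trans h1
          rw [Real.norm_eq_abs]
          gcongr
      _ = d * M * ‖w‖ := by simp; ring

lemma abs_mollify_le {B s R : ℝ} (hk : ∀ x, |k x| ≤ B) (hks : tsupport k ⊆ Metric.closedBall 0 s)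
    (hf : LocallyIntegrable f) {y : EuclideanSpace ℝ (Fin d)} (hy : ‖y‖ + s ≤ R) :
    |mollify k f y| ≤ B * ∫ x in Metric.closedBall 0 R, |f x| := by
  have hi : IntegrableOn f (Metric.closedBall 0 R) := hf.integrableOn_isCompact
    (isCompact_closedBall _ _)
  have h0 : ∀ x ∉ Metric.closedBall (0 : EuclideanSpace ℝ (Fin d)) R, k (y - x) = 0 := by
    intro x hx
    refine image_eq_zero_of_notMem_tsupport fun h => hx ?_
    have := hks h
    rw [mem_closedBall_zero_iff] at this ⊢
    calc ‖x‖ = ‖y - (y - x)‖ := by simp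
      _ ≤ ‖y‖ + ‖y - x‖ := norm_sub_le _ _
      _ ≤ R := by linarith
  rw [mollify, ← setIntegral_eq_integral_of_forall_compl_eq_zero
    (s := Metric.closedBall 0 R) fun x hx => by rw [h0 x hx, zero_mul], ← integral_const_mul]
  rw [← Real.norm_eq_abs]
  refine (norm_integral_le_integral_norm _).trans (integral_mono_of_nonneg
    (.of_forall fun x => norm_nonneg _) (hi.norm.const_mul _) (.of_forall fun x => ?_))
  simp only [norm_mul, Real.norm_eq_abs]
  gcongr
  exact hk _

lemma stronglyMeasurable_mollify (hk : Continuous k) {f : ℝ × EuclideanSpace ℝ (Fin d) → ℝ}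
    (hf : StronglyMeasurable f) :
    StronglyMeasurable fun z : ℝ × EuclideanSpace ℝ (Fin d) =>
      mollify k (fun x => f (z.1, x)) z.2 := by
  refine StronglyMeasurable.integral_prod_right'
    (f := fun q : (ℝ × EuclideanSpace ℝ (Fin d)) × EuclideanSpace ℝ (Fin d) =>
      k (q.1.2 - q.2) * f (q.1.1, q.2)) ?_
  exact (Continuous.stronglyMeasurable (by fun_prop)).mul (hf.comp_measurable (by fun_prop))

/-- Lebesgue differentiation on balls: a kernel of mass one, supported in a ball and bounded by a
multiple of the inverse volume of that ball, converges at Lebesgue points. -/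
lemma ae_tendsto_mollify {ρ Ψ : ℤ → EuclideanSpace ℝ (Fin d) → ℝ} {C : ℝ}
    (hρ : IsDyadicKernel ρ Ψ C) (hf : LocallyIntegrable f) :
    ∀ᵐ y, Tendsto (fun n : ℕ => mollify (ρ (-n)) f y) atTop (𝓝 (f y)) := by
  filter_upwards [(Besicovitch.vitaliFamily
    (volume : Measure (EuclideanSpace ℝ (Fin d)))).ae_tendsto_average_norm_sub hf] with y hy
  have hr : Tendsto (fun n : ℕ => (2 : ℝ) ^ (-n : ℤ)) atTop (𝓝[>] 0) := by
    refine tendsto_nhdsWithin_iff.2 ⟨?_, .of_forall fun n => by simp⟩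
    refine (tendsto_pow_atTop_nhds_zero_of_lt_one (r := (2 : ℝ)⁻¹) (by norm_num)
      (by norm_num)).congr fun n => by simp
  have := (hy.comp (Besicovitch.tendsto_filterAt volume y)).comp hr
  refine tendsto_integral_smul_of_tendsto_average_norm_sub
    (C * volume.real (Metric.closedBall (0 : EuclideanSpace ℝ (Fin d)) 1)) this
    (.of_forall fun n => hf.integrableOn_isCompact (isCompact_closedBall _ _)) ?_ ?_ ?_
  · refine tendsto_const_nhds.congr fun n => ?_
    rw [← hρ.integral_eq_one (-n), integral_sub_left_eq_self]
  · refine .of_forall fun n x hx => ?_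
    have := hρ.tsupport_subset _ (subset_tsupport _ hx)
    simpa [dist_eq_norm, norm_sub_rev] using this
  · refine .of_forall fun n x => ?_
    rw [abs_of_nonneg (hρ.nonneg _ _)]
    have h := hρ.le (-n) (y - x)
    have hv : volume.real (Metric.closedBall y ((2 : ℝ) ^ (-n : ℤ))) =
        ((2 : ℝ) ^ (-n : ℤ)) ^ d * volume.real
          (Metric.closedBall (0 : EuclideanSpace ℝ (Fin d)) 1) := by
      have := Measure.addHaar_real_closedBall' (volume : Measure (EuclideanSpace ℝ (Fin d))) y
        (r := (2 : ℝ) ^ (-n : ℤ)) (by positivity)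
      simpa using this
    have hpos : 0 < volume.real (Metric.closedBall (0 : EuclideanSpace ℝ (Fin d)) 1) :=
      ENNReal.toReal_pos (Metric.measure_closedBall_pos _ _ one_pos).ne' measure_closedBall_lt_top.ne
    rw [hv, mul_div_mul_right _ _ hpos.ne']
    simpa [div_eq_mul_inv] using h

end Mollify

/-! ### Slices at almost every time -/

section Slices

variable {X : Type*} [MeasureSpace X] [SFinite (volume : Measure X)]
  {E : Type*} [NormedAddCommGroup E] {I : Set ℝ}

/-- An open subset of ℝ is a countable union of compact sets, so countably many null sets suffice.
-/
lemma ae_mem_of_forall_isCompact (hI : IsOpen I) {P : ℝ → Prop}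
    (h : ∀ J ⊆ I, IsCompact J → ∀ᵐ t, t ∈ J → P t) : ∀ᵐ t, t ∈ I → P t := by
  have := hI.locallyCompactSpace
  have h1 : ∀ n, ∀ᵐ t, t ∈ ((↑) : I → ℝ) '' compactCovering I n → P t := fun n =>
    h _ (by rintro _ ⟨x, -, rfl⟩; exact x.2)
      ((isCompact_compactCovering I n).image continuous_subtype_val)
  filter_upwards [ae_all_iff.2 h1] with t ht htI
  obtain ⟨n, hn⟩ := exists_mem_compactCovering (⟨t, htI⟩ : I)
  exact ht n ⟨_, hn, rfl⟩

lemma ae_integrableOn_slice {J : Set ℝ} (hJ : MeasurableSet J) {B : Set X}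
    {f : ℝ × X → E} (hf : IntegrableOn f (J ×ˢ B) (volume.prod volume)) :
    ∀ᵐ t, t ∈ J → IntegrableOn (fun x => f (t, x)) B := by
  rw [IntegrableOn, ← Measure.prod_restrict] at hf
  exact (ae_restrict_iff' hJ).1 hf.prod_right_ae

lemma ae_locallyIntegrable_slice {d : ℕ} (hI : IsOpen I) {f : ℝ × EuclideanSpace ℝ (Fin d) → E}
    (hf : LocallyIntegrableOn f (I ×ˢ univ)) :
    ∀ᵐ t, t ∈ I → LocallyIntegrable fun x => f (t, x) := by
  have hU : IsOpen (I ×ˢ (univ : Set (EuclideanSpace ℝ (Fin d)))) := hI.prod isOpen_univ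
  refine ae_mem_of_forall_isCompact hI fun J hJI hJ => ?_
  have : ∀ n : ℕ, ∀ᵐ t, t ∈ J → IntegrableOn (fun x => f (t, x)) (Metric.closedBall 0 n) :=
    fun n => ae_integrableOn_slice hJ.measurableSet (hf.integrableOn_compact_subset
      (prod_mono hJI (subset_univ _)) (hJ.prod (isCompact_closedBall _ _)))
  filter_upwards [ae_all_iff.2 this] with t ht htJ
  rw [locallyIntegrable_iff]
  intro K hK
  obtain ⟨R, hR⟩ := hK.isBounded.subset_closedBall 0
  obtain ⟨n, hn⟩ := exists_nat_ge R
  exact (ht n htJ).mono_set (hR.trans (Metric.closedBall_subset_closedBall hn))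

/-- If the integral of `F` against every function of time vanishes, then so does the integral of
almost every slice of `F`. -/
lemma ae_integral_slice_eq_zero (hI : IsOpen I) {F : ℝ × X → ℝ}
    (hF : ∀ J ⊆ I, IsCompact J → IntegrableOn F (J ×ˢ univ) (volume.prod volume))
    (h : ∀ a : ℝ → ℝ, ContDiff ℝ ∞ a → HasCompactSupport a → tsupport a ⊆ I →
      ∫ z in I ×ˢ univ, a z.1 * F z ∂(volume.prod volume) = 0) :
    ∀ᵐ t, t ∈ I → ∫ x, F (t, x) = 0 := by
  refine hI.ae_eq_zero_of_integral_contDiff_smul_eq_zero ?_ fun a ha hac haI => ?_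
  · rw [locallyIntegrableOn_iff hI.isLocallyClosed]
    intro J hJI hJ
    have := hF J hJI hJ
    rw [IntegrableOn, ← Measure.prod_restrict, Measure.restrict_univ] at this
    exact this.integral_prod_left
  -- Only the compact support of a, inside I, contributes. There F is integrable and a is bounded.
  · have hint : IntegrableOn (fun z : ℝ × X => a z.1 * F z) (I ×ˢ univ) (volume.prod volume) := by
      obtain ⟨C, hC⟩ := hac.exists_bound_of_continuous ha.continuous
      have h1 : IntegrableOn (fun z : ℝ × X => a z.1 * F z) (tsupport a ×ˢ univ)
          (volume.prod volume) := by
        refine (hF _ haI hac.isCompact).bdd_mul (c := C) ?_ (.of_forall fun z => hC z.1)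
        exact (ha.continuous.measurable.comp measurable_fst).aestronglyMeasurable
      refine h1.of_forall_sdiff_eq_zero (hI.measurableSet.prod .univ) fun z hz => ?_
      rw [image_eq_zero_of_notMem_tsupport (f := a) fun h => hz.2 ⟨h, trivial⟩, zero_mul]
    have h2 := h a ha hac haI
    rw [setIntegral_prod _ hint, Measure.restrict_univ] at h2
    rw [← setIntegral_eq_integral_of_forall_compl_eq_zero (s := I), ← h2]
    · simp [integral_const_mul]
    · intro t ht
      rw [image_eq_zero_of_notMem_tsupport (f := a) fun h => ht (haI h), zero_smul]

lemma integrableOn_mul_of_locallyIntegrableOn {Y : Type*} [TopologicalSpace Y]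
    [MeasurableSpace Y] [OpensMeasurableSpace Y] [T2Space Y] {μ : Measure Y} {U : Set Y} {f k : Y → ℝ}
    (hU : MeasurableSet U)
    (hf : LocallyIntegrableOn f U μ) (hk : Continuous k) (hkc : HasCompactSupport k)
    (hkU : tsupport k ⊆ U) : IntegrableOn (fun y => f y * k y) U μ := by
  have h1 : IntegrableOn f (tsupport k) μ := hf.integrableOn_compact_subset hkU hkc
  obtain ⟨C, hC⟩ := hkc.exists_bound_of_continuous hk
  have h2 : IntegrableOn (fun y => f y * k y) (tsupport k) μ :=
    h1.mul_bdd (c := C) hk.aestronglyMeasurable (.of_forall hC)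
  refine h2.of_forall_sdiff_eq_zero hU fun y hy => ?_
  rw [image_eq_zero_of_notMem_tsupport hy.2, mul_zero]

end Slices

/-! ### The weak Poisson equation for the pressure -/

section WeakPoisson

variable {d : ℕ} {I : Set ℝ} {v : ℝ × EuclideanSpace ℝ (Fin d) → EuclideanSpace ℝ (Fin d)}
  {p : ℝ × EuclideanSpace ℝ (Fin d) → ℝ} {a : ℝ → ℝ} {θ : EuclideanSpace ℝ (Fin d) → ℝ}

lemma hasCompactSupport_tensor (hac : HasCompactSupport a) (hθc : HasCompactSupport θ) :
    HasCompactSupport fun z : ℝ × EuclideanSpace ℝ (Fin d) => a z.1 * θ z.2 := by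
  refine HasCompactSupport.of_support_subset_isCompact (hac.isCompact.prod hθc.isCompact)
    fun z hz => ⟨subset_tsupport _ ?_, subset_tsupport _ ?_⟩
  · exact left_ne_zero_of_mul hz
  · exact right_ne_zero_of_mul hz

lemma tsupport_tensor_subset (haI : tsupport a ⊆ I) :
    tsupport (fun z : ℝ × EuclideanSpace ℝ (Fin d) => a z.1 * θ z.2) ⊆ I ×ˢ univ := by
  refine (closure_minimal (t := tsupport a ×ˢ univ) (fun z hz => ⟨subset_tsupport _ ?_, trivial⟩)
    ((isClosed_tsupport _).prod isClosed_univ)).trans (prod_mono_left haI)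
  exact left_ne_zero_of_mul hz

lemma isSpaceTimeTest_tensor (ha : ContDiff ℝ ∞ a) (hac : HasCompactSupport a)
    (haI : tsupport a ⊆ I) (hθ : ContDiff ℝ ∞ θ) (hθc : HasCompactSupport θ) :
    IsSpaceTimeTest (id : EuclideanSpace ℝ (Fin d) → _) I fun z => a z.1 * θ z.2 :=
  isSpaceTimeTest_id_iff.2 ⟨by fun_prop, hasCompactSupport_tensor hac hθc,
    tsupport_tensor_subset haI⟩

lemma timeDeriv_tensor (ha : ContDiff ℝ ∞ a) (z : ℝ × EuclideanSpace ℝ (Fin d)) :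
    timeDeriv (fun z => a z.1 * θ z.2) z = deriv a z.1 * θ z.2 := by
  change deriv (fun s => a s * θ z.2) z.1 = _
  exact deriv_mul_const (ha.differentiable (by simp) z.1) _

lemma spaceDeriv_tensor (hθ : ContDiff ℝ ∞ θ) (j : Fin d) (z : ℝ × EuclideanSpace ℝ (Fin d)) :
    spaceDeriv id j (fun z => a z.1 * θ z.2) z = a z.1 * partialD j θ z.2 := by
  have h : HasFDerivAt θ (fderiv ℝ θ z.2) (z.2 + (0 : ℝ) • EuclideanSpace.single j (1 : ℝ)) := by
    simpa using (hθ.differentiable (by simp) z.2).hasFDerivAt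
  have h2 : HasDerivAt (fun s : ℝ => z.2 + s • EuclideanSpace.single j (1 : ℝ))
      ((1 : ℝ) • EuclideanSpace.single j (1 : ℝ)) 0 :=
    ((hasDerivAt_id (0 : ℝ)).smul_const _).const_add _
  rw [one_smul] at h2
  exact ((h.comp_hasDerivAt (0 : ℝ) h2).const_mul (a z.1)).deriv

lemma memLp_one_of_memLp_compact {Y : Type*} [TopologicalSpace Y] [MeasurableSpace Y]
    {μ : Measure Y} [IsFiniteMeasureOnCompacts μ] {F : Type*} [NormedAddCommGroup F] {w : Y → F}
    {q : ℝ≥0∞} (hq : 1 ≤ q) {K : Set Y} (hK : IsCompact K) (h : MemLp w q (μ.restrict K)) :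
    IntegrableOn w K μ := by
  have : IsFiniteMeasure (μ.restrict K) := ⟨by simpa using hK.measure_lt_top⟩
  exact memLp_one_iff_integrable.1 (h.mono_exponent hq)

namespace IsWeakEulerSolution

section General

variable {X : Type*} [AddCommGroup X] [TopologicalSpace X] [MeasureSpace X]
  [OpensMeasurableSpace X] [T2Space X] [SecondCountableTopology X]
  [IsFiniteMeasureOnCompacts (volume : Measure (ℝ × X))]
  {π : EuclideanSpace ℝ (Fin d) → X} {v : ℝ × X → EuclideanSpace ℝ (Fin d)} {p : ℝ × X → ℝ}

lemma memLp_two (h : IsWeakEulerSolution π I v p) {K : Set (ℝ × X)} (hKU : K ⊆ I ×ˢ univ)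
    (hK : IsCompact K) : MemLp v 2 (volume.restrict K) := by
  refine (memLp_two_iff_integrable_sq_norm (h.aestronglyMeasurable.mono_measure
    (Measure.restrict_mono hKU le_rfl))).2 ?_
  exact h.locallyIntegrable_sq.integrableOn_compact_subset hKU hK

lemma integrableOn_velocity (h : IsWeakEulerSolution π I v p) {K : Set (ℝ × X)}
    (hKU : K ⊆ I ×ˢ univ) (hK : IsCompact K) (l : Fin d) : IntegrableOn (fun z => v z l) K :=
  (memLp_one_of_memLp_compact (by norm_num) hK (h.memLp_two hKU hK)).eval_piLp l

lemma integrableOn_mul (h : IsWeakEulerSolution π I v p) {K : Set (ℝ × X)}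
    (hKU : K ⊆ I ×ˢ univ) (hK : IsCompact K) (i j : Fin d) :
    IntegrableOn (fun z => v z i * v z j) K := by
  have h2 := h.memLp_two hKU hK
  exact (h2.eval_piLp i).integrable_mul (h2.eval_piLp j)

variable [LocallyCompactSpace X]

lemma locallyIntegrableOn_velocity (hI : IsOpen I) (h : IsWeakEulerSolution π I v p) (l : Fin d) :
    LocallyIntegrableOn (fun z => v z l) (I ×ˢ univ) :=
  (locallyIntegrableOn_iff (hI.prod isOpen_univ).isLocallyClosed).2 fun K hKU hK =>
    h.integrableOn_velocity hKU hK l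

lemma locallyIntegrableOn_mul (hI : IsOpen I) (h : IsWeakEulerSolution π I v p) (i j : Fin d) :
    LocallyIntegrableOn (fun z => v z i * v z j) (I ×ˢ univ) :=
  (locallyIntegrableOn_iff (hI.prod isOpen_univ).isLocallyClosed).2 fun K hKU hK =>
    h.integrableOn_mul hKU hK i j

end General

/-- The weak form of -Δp = ∂_i ∂_j (v_i v_j). The l-th momentum equation is tested with a(t) ∂_l
θ(x) and summed over l. The time derivative contributes a'(t) v · ∇θ, which integrates to zero by
incompressibility tested with a'(t) θ(x). -/
theorem integral_poisson (hI : IsOpen I) (h : IsWeakEulerSolution id I v p)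
    (ha : ContDiff ℝ ∞ a) (hac : HasCompactSupport a) (haI : tsupport a ⊆ I)
    (hθ : ContDiff ℝ ∞ θ) (hθc : HasCompactSupport θ) :
    ∫ z in I ×ˢ univ, a z.1 * (p z * laplacian θ z.2
      + ∑ i, ∑ j, v z i * v z j * partialD i (partialD j θ) z.2) = 0 := by
  have hU := (hI.prod isOpen_univ (Y := EuclideanSpace ℝ (Fin d))).measurableSet
  have ha' : ContDiff ℝ ∞ (deriv a) := (contDiff_infty_iff_deriv.1 ha).2
  have hac' : HasCompactSupport (deriv a) := hac.deriv
  have haI' : tsupport (deriv a) ⊆ I := (closure_minimal (support_deriv_subset)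
    (isClosed_tsupport _)).trans haI
  have hθ1 := fun l => contDiff_partialD hθ l
  have hθ2 := fun i l => contDiff_partialD (hθ1 l) i
  have hinc := h.incompressible _ (isSpaceTimeTest_tensor ha' hac' haI' hθ hθc)
  have hmom := fun l => h.momentum _
    (isSpaceTimeTest_tensor ha hac haI (hθ1 l) (hθc.partialD l)) l
  simp only [timeDeriv_tensor ha, spaceDeriv_tensor hθ, spaceDeriv_tensor (hθ1 _)] at hinc hmom
  have i1 : ∀ {b : ℝ → ℝ} {κ : EuclideanSpace ℝ (Fin d) → ℝ}
      {f : ℝ × EuclideanSpace ℝ (Fin d) → ℝ}, LocallyIntegrableOn f (I ×ˢ univ) →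
      ContDiff ℝ ∞ b → HasCompactSupport b → tsupport b ⊆ I →
      ContDiff ℝ ∞ κ → HasCompactSupport κ →
      IntegrableOn (fun z => f z * (b z.1 * κ z.2)) (I ×ˢ univ) :=
    fun hf hb hbc hbI hκ hκc => integrableOn_mul_of_locallyIntegrableOn hU hf
      (by fun_prop) (hasCompactSupport_tensor hbc hκc) (tsupport_tensor_subset hbI)
  have e1 : ∀ l, IntegrableOn (fun z => v z l * (deriv a z.1 * partialD l θ z.2)) (I ×ˢ univ) :=
    fun l => i1 (h.locallyIntegrableOn_velocity hI l) ha' hac' haI' (hθ1 l) (hθc.partialD l)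
  have e2 : ∀ l, IntegrableOn (fun z => ∑ j, v z j * v z l *
      (a z.1 * partialD j (partialD l θ) z.2)) (I ×ˢ univ) := fun l =>
    integrable_finsetSum _ fun j _ => i1 (h.locallyIntegrableOn_mul hI j l) ha hac haI (hθ2 j l)
      ((hθc.partialD l).partialD j)
  have e3 : ∀ l, IntegrableOn (fun z => p z * (a z.1 * partialD l (partialD l θ) z.2))
      (I ×ˢ univ) := fun l =>
    i1 h.locallyIntegrable_pressure ha hac haI (hθ2 l l) ((hθc.partialD l).partialD l)
  have e4 : ∀ l, IntegrableOn (fun z => v z l * (deriv a z.1 * partialD l θ z.2)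
      + ∑ j, v z j * v z l * (a z.1 * partialD j (partialD l θ) z.2)
      + p z * (a z.1 * partialD l (partialD l θ) z.2)) (I ×ˢ univ) := fun l =>
    ((e1 l).add (e2 l)).add (e3 l)
  have hsum : ∫ z in I ×ˢ univ, ∑ l, (v z l * (deriv a z.1 * partialD l θ z.2)
      + ∑ j, v z j * v z l * (a z.1 * partialD j (partialD l θ) z.2)
      + p z * (a z.1 * partialD l (partialD l θ) z.2)) = 0 := by
    rw [integral_finsetSum _ fun l _ => e4 l]
    exact Finset.sum_eq_zero fun l _ => hmom l
  have hdiff : ∫ z in I ×ˢ univ, ((∑ l, (v z l * (deriv a z.1 * partialD l θ z.2)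
      + ∑ j, v z j * v z l * (a z.1 * partialD j (partialD l θ) z.2)
      + p z * (a z.1 * partialD l (partialD l θ) z.2)))
      - ∑ l, v z l * (deriv a z.1 * partialD l θ z.2)) = 0 := by
    rw [integral_sub (integrable_finsetSum _ fun l _ => e4 l)
      (integrable_finsetSum _ fun l _ => e1 l), hsum, hinc, sub_zero]
  rw [← hdiff]
  congr 1
  ext z
  rw [Finset.sum_add_distrib, Finset.sum_add_distrib, Finset.sum_comm]
  simp only [laplacian, mul_add, Finset.mul_sum]
  rw [add_assoc, add_sub_cancel_left, add_comm]
  congr 1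
  · exact Finset.sum_congr rfl fun i _ => Finset.sum_congr rfl fun j _ => by ring
  · exact Finset.sum_congr rfl fun i _ => by ring

end IsWeakEulerSolution

end WeakPoisson

/-! ### Differences of consecutive dyadic averages of the pressure -/

section DyadicPressure

variable {d : ℕ} {I : Set ℝ} {v : ℝ × EuclideanSpace ℝ (Fin d) → EuclideanSpace ℝ (Fin d)}
  {p : ℝ × EuclideanSpace ℝ (Fin d) → ℝ} {θ : EuclideanSpace ℝ (Fin d) → ℝ}

lemma partialD_comp_sub_left (hθ : ContDiff ℝ ∞ θ) (y : EuclideanSpace ℝ (Fin d)) (l : Fin d) :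
    partialD l (fun x => θ (y - x)) = fun x => -partialD l θ (y - x) := by
  ext x
  have h : HasFDerivAt (fun x => θ (y - x)) _ x :=
    ((hθ.differentiable (by simp) (y - x)).hasFDerivAt).comp x ((hasFDerivAt_id x).const_sub y)
  simp [partialD, h.fderiv]

lemma partialD_partialD_comp_sub_left (hθ : ContDiff ℝ ∞ θ) (y : EuclideanSpace ℝ (Fin d))
    (i j : Fin d) : partialD i (partialD j fun x => θ (y - x)) =
      fun x => partialD i (partialD j θ) (y - x) := by
  rw [partialD_comp_sub_left hθ]
  have h := partialD_comp_sub_left (contDiff_partialD hθ j) y i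
  have h2 := partialD_const_mul (fun x => partialD j θ (y - x)) (-1) i
  simp only [neg_one_mul] at h2
  rw [h2, h]
  simp

lemma partialD_comm (hθ : ContDiff ℝ ∞ θ) (i j : Fin d) :
    partialD i (partialD j θ) = partialD j (partialD i θ) := by
  have hd : Differentiable ℝ (fderiv ℝ θ) :=
    (hθ.fderiv_right (m := ∞) (by simp)).differentiable (by simp)
  have h : ∀ i j x, partialD i (partialD j θ) x =
      fderiv ℝ (fderiv ℝ θ) x (EuclideanSpace.single i 1) (EuclideanSpace.single j 1) := by
    intro i j x
    have : fderiv ℝ (partialD j θ) x = _ := ((hd x).hasFDerivAt.clm_apply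
      (hasFDerivAt_const (EuclideanSpace.single j (1 : ℝ)) x)).fderiv
    rw [partialD, this]
    simp
  ext x
  rw [h, h]
  exact (hθ.contDiffAt.isSymmSndFDerivAt (by simp; exact WithTop.coe_le_coe.2 le_top)).eq _ _

lemma contDiff_laplacian (hθ : ContDiff ℝ ∞ θ) : ContDiff ℝ ∞ (laplacian θ) := by
  unfold laplacian
  exact ContDiff.sum fun l _ => contDiff_partialD (contDiff_partialD hθ l) l

lemma tsupport_laplacian_subset : tsupport (laplacian θ) ⊆ tsupport θ := by
  refine closure_minimal (fun x hx => ?_) (isClosed_tsupport _)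
  by_contra h
  refine hx (Finset.sum_eq_zero fun l _ => image_eq_zero_of_notMem_tsupport fun h2 => h ?_)
  exact tsupport_partialD_subset l (tsupport_partialD_subset l h2)

lemma hasCompactSupport_laplacian (hθc : HasCompactSupport θ) : HasCompactSupport (laplacian θ) :=
  hθc.isCompact.of_isClosed_subset (isClosed_tsupport _) tsupport_laplacian_subset

/-- The weak Poisson equation with θ(y - ·), localized in time. The null set of bad times depends on
y, so y first runs through a countable dense set and continuity in y gives the rest. -/
theorem IsWeakEulerSolution.ae_mollify_poisson (hI : IsOpen I) (h : IsWeakEulerSolution id I v p)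
    (hθ : ContDiff ℝ ∞ θ) (hθc : HasCompactSupport θ) :
    ∀ᵐ t, t ∈ I → ∀ y, mollify (laplacian θ) (fun x => p (t, x)) y
      + ∑ i, ∑ j, mollify (partialD i (partialD j θ)) (fun x => v (t, x) i * v (t, x) j) y = 0 := by
  have hslice : ∀ y, ∀ᵐ t, t ∈ I → ∫ x, (p (t, x) * laplacian θ (y - x)
      + ∑ i, ∑ j, v (t, x) i * v (t, x) j * partialD i (partialD j θ) (y - x)) = 0 := by
    intro y
    have hθy : ContDiff ℝ ∞ fun x => θ (y - x) := by fun_prop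
    have hθyc : HasCompactSupport fun x => θ (y - x) := hθc.comp_sub_left y
    have hpois := fun (a : ℝ → ℝ) ha hac haI =>
      h.integral_poisson (a := a) hI ha hac haI hθy hθyc
    simp only [laplacian, partialD_partialD_comp_sub_left hθ] at hpois
    refine ae_integral_slice_eq_zero (F := fun z => p z * laplacian θ (y - z.2)
      + ∑ i, ∑ j, v z i * v z j * partialD i (partialD j θ) (y - z.2)) hI (fun J hJI hJ => ?_) hpois
    have hK := hJ.prod hθyc.isCompact
    have hKU : J ×ˢ tsupport (fun x => θ (y - x)) ⊆ I ×ˢ univ := prod_mono hJI (subset_univ _)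
    have hmul : ∀ (f : ℝ × EuclideanSpace ℝ (Fin d) → ℝ) (κ : EuclideanSpace ℝ (Fin d) → ℝ),
        IntegrableOn f (J ×ˢ tsupport fun x => θ (y - x)) (volume.prod volume) → Continuous κ →
        HasCompactSupport κ → tsupport κ ⊆ tsupport θ →
        IntegrableOn (fun z => f z * κ (y - z.2)) (J ×ˢ univ) (volume.prod volume) := by
      intro f κ hf hκ hκc hκθ
      obtain ⟨C, hC⟩ := hκc.exists_bound_of_continuous hκ
      have hb : IntegrableOn (fun z : ℝ × EuclideanSpace ℝ (Fin d) => f z * κ (y - z.2))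
          (J ×ˢ tsupport fun x => θ (y - x)) (volume.prod volume) :=
        hf.mul_bdd (c := C) (by fun_prop) (.of_forall fun z => hC _)
      refine hb.of_forall_sdiff_eq_zero (hJ.measurableSet.prod .univ) fun z hz => ?_
      rw [image_eq_zero_of_notMem_tsupport (f := κ) (x := y - z.2) fun hz2 => hz.2 ⟨hz.1.1,
        (tsupport_comp_eq_preimage θ (Homeomorph.subLeft y)).symm ▸ hκθ hz2⟩, mul_zero]
    refine (hmul p _ ?_ (contDiff_laplacian hθ).continuous (hasCompactSupport_laplacian hθc)
      tsupport_laplacian_subset).add ?_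
    · exact h.locallyIntegrable_pressure.integrableOn_compact_subset hKU hK
    · refine integrable_finsetSum _ fun i _ => integrable_finsetSum _ fun j _ =>
        hmul (fun z => v z i * v z j) _ (h.integrableOn_mul hKU hK i j)
          (contDiff_partialD (contDiff_partialD hθ j) i).continuous
          ((hθc.partialD j).partialD i)
          ((tsupport_partialD_subset i).trans (tsupport_partialD_subset j))
  have hT : ∀ᵐ t, ∀ i j, t ∈ I → LocallyIntegrable fun x => v (t, x) i * v (t, x) j :=
    ae_all_iff.2 fun i => ae_all_iff.2 fun j =>
      ae_locallyIntegrable_slice hI (h.locallyIntegrableOn_mul hI i j)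
  filter_upwards [ae_all_iff.2 fun n => hslice (TopologicalSpace.denseSeq _ n), hT,
    ae_locallyIntegrable_slice hI h.locallyIntegrable_pressure] with t h1 h2 h3 ht
  have hc1 := (contDiff_laplacian hθ).continuous
  have hc2 := fun i j => (contDiff_partialD (contDiff_partialD hθ j) i).continuous
  refine congrFun ((TopologicalSpace.denseRange_denseSeq _).equalizer ?_ continuous_const
    (funext fun n => ?_))
  · exact (continuous_mollify hc1 (hasCompactSupport_laplacian hθc) (h3 ht)).add
      (continuous_finsetSum _ fun i _ => continuous_finsetSum _ fun j _ =>
        continuous_mollify (hc2 i j) ((hθc.partialD j).partialD i) (h2 i j ht))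
  · have e1 := integrable_mollify hc1 (hasCompactSupport_laplacian hθc) (h3 ht)
      (TopologicalSpace.denseSeq (EuclideanSpace ℝ (Fin d)) n)
    have e2 := fun i j => integrable_mollify (hc2 i j) ((hθc.partialD j).partialD i) (h2 i j ht)
      (TopologicalSpace.denseSeq (EuclideanSpace ℝ (Fin d)) n)
    have h4 := h1 n ht
    simp only [mul_comm (p _), mul_comm (_ * _) (partialD _ _ _)] at h4
    rw [integral_add e1 (integrable_finsetSum _ fun i _ => integrable_finsetSum _ fun j _ => e2 i j),
      integral_finsetSum _ fun i _ => integrable_finsetSum _ fun j _ => e2 i j] at h4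
    simp only [integral_finsetSum _ fun j _ => e2 _ j] at h4
    exact h4

lemma mollify_sub {k k' f : EuclideanSpace ℝ (Fin d) → ℝ} {y : EuclideanSpace ℝ (Fin d)}
    (hk : Continuous k) (hkc : HasCompactSupport k) (hk' : Continuous k')
    (hkc' : HasCompactSupport k') (hf : LocallyIntegrable f) :
    mollify k f y - mollify k' f y = mollify (fun x => k x - k' x) f y := by
  rw [mollify, mollify, ← integral_sub (integrable_mollify hk hkc hf y)
    (integrable_mollify hk' hkc' hf y)]
  simp only [mollify, sub_mul]

lemma mollify_neg (k f : EuclideanSpace ℝ (Fin d) → ℝ) (y : EuclideanSpace ℝ (Fin d)) :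
    mollify (fun x => -k x) f y = -mollify k f y := by
  simp [mollify, integral_neg]

lemma partialD_sub {f g : EuclideanSpace ℝ (Fin d) → ℝ} (hf : ContDiff ℝ ∞ f)
    (hg : ContDiff ℝ ∞ g) (l : Fin d) :
    partialD l (fun x => f x - g x) = fun x => partialD l f x - partialD l g x := by
  ext x
  unfold partialD
  rw [fderiv_fun_sub (hf.differentiable (by simp) x) (hg.differentiable (by simp) x)]
  simp

lemma partialD_laplacian (hθ : ContDiff ℝ ∞ θ) (l : Fin d) :
    partialD l (laplacian θ) = laplacian (partialD l θ) := by
  have h1 := fun l => contDiff_partialD hθ l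
  have h2 := fun i l => contDiff_partialD (h1 l) i
  ext x
  have : partialD l (laplacian θ) x = ∑ i, partialD l (partialD i (partialD i θ)) x := by
    unfold partialD laplacian
    rw [fderiv_fun_sum fun i _ => ((h2 i i).differentiable (by simp) x)]
    exact ContinuousLinearMap.sum_apply _ _ _
  rw [this, laplacian]
  refine Finset.sum_congr rfl fun i _ => ?_
  rw [partialD_comm (h1 i), partialD_comm hθ l]

variable {ρ Ψ : ℤ → EuclideanSpace ℝ (Fin d) → ℝ} {C : ℝ}

lemma IsDyadicKernel.hasCompactSupport (hρ : IsDyadicKernel ρ Ψ C) (k : ℤ) :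
    HasCompactSupport (ρ k) :=
  (isCompact_closedBall _ _).of_isClosed_subset (isClosed_tsupport _) (hρ.tsupport_subset k)

lemma IsDyadicKernel.hasCompactSupport_potential (hρ : IsDyadicKernel ρ Ψ C) (k : ℤ) :
    HasCompactSupport (Ψ k) :=
  (isCompact_closedBall _ _).of_isClosed_subset (isClosed_tsupport _)
    (hρ.tsupport_potential_subset k)

/-- The difference of consecutive dyadic averages of the pressure, in terms of the velocity. -/
noncomputable def dyadicStress (Ψ : EuclideanSpace ℝ (Fin d) → ℝ)
    (w : EuclideanSpace ℝ (Fin d) → EuclideanSpace ℝ (Fin d)) (y : EuclideanSpace ℝ (Fin d)) : ℝ :=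
  ∑ i, ∑ j, mollify (partialD i (partialD j Ψ)) (fun x => w x i * w x j) y

/-- The kernels differ by -Δ Ψ_k, and the Poisson equation transfers this Laplacian into second
derivatives of Ψ_k acting on v_i v_j. -/
theorem IsWeakEulerSolution.ae_mollify_sub (hI : IsOpen I) (h : IsWeakEulerSolution id I v p)
    (hρ : IsDyadicKernel ρ Ψ C) (k : ℤ) :
    ∀ᵐ t, t ∈ I → ∀ y, mollify (ρ k) (fun x => p (t, x)) y
      - mollify (ρ (k + 1)) (fun x => p (t, x)) y = dyadicStress (Ψ k) (fun x => v (t, x)) y := by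
  filter_upwards [h.ae_mollify_poisson hI (hρ.contDiff_potential k)
    (hρ.hasCompactSupport_potential k),
    ae_locallyIntegrable_slice hI h.locallyIntegrable_pressure] with t h1 h2 ht y
  rw [mollify_sub (hρ.contDiff _).continuous (hρ.hasCompactSupport _) (hρ.contDiff _).continuous
    (hρ.hasCompactSupport _) (h2 ht)]
  simp only [hρ.sub_succ]
  rw [mollify_neg, dyadicStress]
  linarith [h1 ht y]

/-- The same identity with potential ∂_l Ψ_k. The extra derivative provides the gain 2^{-k} at large
scales. -/
theorem IsWeakEulerSolution.ae_mollify_partialD_sub (hI : IsOpen I)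
    (h : IsWeakEulerSolution id I v p) (hρ : IsDyadicKernel ρ Ψ C) (k : ℤ) (l : Fin d) :
    ∀ᵐ t, t ∈ I → ∀ y, mollify (partialD l (ρ k)) (fun x => p (t, x)) y
      - mollify (partialD l (ρ (k + 1))) (fun x => p (t, x)) y =
        dyadicStress (partialD l (Ψ k)) (fun x => v (t, x)) y := by
  filter_upwards [h.ae_mollify_poisson hI (contDiff_partialD (hρ.contDiff_potential k) l)
    ((hρ.hasCompactSupport_potential k).partialD l),
    ae_locallyIntegrable_slice hI h.locallyIntegrable_pressure] with t h1 h2 ht y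
  rw [mollify_sub (contDiff_partialD (hρ.contDiff _) _).continuous
    ((hρ.hasCompactSupport _).partialD l) (contDiff_partialD (hρ.contDiff _) _).continuous
    ((hρ.hasCompactSupport _).partialD l) (h2 ht),
    ← partialD_sub (hρ.contDiff _) (hρ.contDiff _)]
  have : partialD l (fun x => ρ k x - ρ (k + 1) x) =
      fun x => -laplacian (partialD l (Ψ k)) x := by
    simp only [hρ.sub_succ]
    have h3 := partialD_const_mul (laplacian (Ψ k)) (-1) l
    simp only [neg_one_mul] at h3
    rw [h3, partialD_laplacian (hρ.contDiff_potential k)]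
  rw [this, mollify_neg, dyadicStress]
  linarith [h1 ht y]

end DyadicPressure

/-! ### Small scales: L^{3/2} bounds from increments of the velocity -/

section NearBound

/-- Minkowski's integral inequality for a finite measure and a uniformly bounded family. -/
lemma lintegral_lintegral_rpow_le {H Z : Type*} [MeasurableSpace H] [MeasurableSpace Z]
    {ν : Measure H} {μ : Measure Z} [SFinite ν] [SFinite μ] {G : Z × H → ℝ≥0∞}
    (hG : Measurable G) {q : ℝ} (hq : 1 ≤ q) {B : ℝ≥0∞}
    (hB : ∀ᵐ h ∂ν, ∫⁻ z, G (z, h) ^ q ∂μ ≤ B ^ q) :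
    ∫⁻ z, (∫⁻ h, G (z, h) ∂ν) ^ q ∂μ ≤ (ν univ * B) ^ q := by
  have hq0 : 0 < q := zero_lt_one.trans_le hq
  -- Hölder against the constant 1 for the finite measure ν, that is, Jensen's inequality. Tonelli
  -- then finishes the estimate.
  have hJ : ∀ z, (∫⁻ h, G (z, h) ∂ν) ^ q ≤ ν univ ^ (q - 1) * ∫⁻ h, G (z, h) ^ q ∂ν := by
    intro z
    have hm : Measurable fun h => G (z, h) := hG.comp measurable_prodMk_left
    rcases hq.eq_or_lt with rfl | hq1
    · simp
    have h := ENNReal.lintegral_mul_le_Lp_mul_Lq ν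
      (Real.HolderConjugate.conjExponent hq1) hm.aemeasurable (g := fun _ => 1) (by fun_prop)
    simp only [Pi.mul_apply, mul_one, ENNReal.one_rpow, lintegral_const, one_mul] at h
    refine (ENNReal.rpow_le_rpow h hq0.le).trans_eq ?_
    rw [ENNReal.mul_rpow_of_nonneg _ _ hq0.le, ← ENNReal.rpow_mul, ← ENNReal.rpow_mul,
      one_div_mul_cancel hq0.ne', ENNReal.rpow_one, mul_comm]
    congr 2
    rw [Real.conjExponent]
    have : q - 1 ≠ 0 := by linarith
    field_simp
  calc ∫⁻ z, (∫⁻ h, G (z, h) ∂ν) ^ q ∂μ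
      ≤ ∫⁻ z, ν univ ^ (q - 1) * ∫⁻ h, G (z, h) ^ q ∂ν ∂μ := lintegral_mono hJ
    _ = ν univ ^ (q - 1) * ∫⁻ h, ∫⁻ z, G (z, h) ^ q ∂μ ∂ν := by
        rw [lintegral_const_mul _ (hG.pow_const q).lintegral_prod_right', lintegral_lintegral_swap]
        exact (hG.pow_const q).aemeasurable
    _ ≤ ν univ ^ (q - 1) * ∫⁻ h, B ^ q ∂ν := by
        gcongr 1
        exact lintegral_mono_ae hB
    _ = (ν univ * B) ^ q := by
        rw [lintegral_const, ENNReal.mul_rpow_of_nonneg _ _ hq0.le, mul_comm (B ^ q), ← mul_assoc]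
        congr 1
        nth_rewrite 2 [← ENNReal.rpow_one (ν univ)]
        rw [← ENNReal.rpow_add_of_nonneg _ _ (by linarith) (by norm_num)]
        simp

variable {d : ℕ}

/-- A kernel of mean zero does not see the constant f(y), so only increments of f enter. -/
lemma mollify_eq_integral_sub {κ f : EuclideanSpace ℝ (Fin d) → ℝ} (hκ : Continuous κ)
    (hκc : HasCompactSupport κ) (hκ0 : ∫ h, κ h = 0) (hf : LocallyIntegrable f)
    (y : EuclideanSpace ℝ (Fin d)) : mollify κ f y = ∫ h, κ h * (f (y - h) - f y) := by
  have h1 : mollify κ f y = ∫ h, κ h * f (y - h) := by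
    rw [mollify, ← integral_sub_left_eq_self _ volume y]
    simp
  have h2 : Integrable fun h => κ h * f (y - h) := by
    have := (integrable_mollify hκ hκc hf y).comp_sub_left y
    simpa using this
  simp only [mul_sub]
  rw [integral_sub h2 ((hκ.integrable_of_hasCompactSupport hκc).mul_const _), integral_mul_const,
    hκ0, zero_mul, sub_zero, h1]

/-- Minkowski's inequality for the measure |κ(h)| dh, which charges only the h in the support of κ.
Hence increments of length at most R suffice. -/
lemma eLpNorm_mollify_le {κ : EuclideanSpace ℝ (Fin d) → ℝ} (hκ : Continuous κ)
    (hκc : HasCompactSupport κ) (hκ0 : ∫ h, κ h = 0) {C R : ℝ} (hC : ∫ h, |κ h| ≤ C)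
    (hκR : tsupport κ ⊆ Metric.closedBall 0 R) {F : ℝ × EuclideanSpace ℝ (Fin d) → ℝ}
    (hF : StronglyMeasurable F) {μ : Measure (ℝ × EuclideanSpace ℝ (Fin d))} [SFinite μ]
    (hl : ∀ᵐ z ∂μ, LocallyIntegrable fun x => F (z.1, x)) {q B : ℝ≥0∞} (hq : 1 ≤ q) (hq' : q ≠ ⊤)
    (hB : ∀ h ∈ Metric.closedBall 0 R, eLpNorm (fun z => F (z.1, z.2 - h) - F z) q μ ≤ B) :
    eLpNorm (fun z => mollify κ (fun x => F (z.1, x)) z.2) q μ ≤ ENNReal.ofReal C * B := by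
  have hq0 : q ≠ 0 := (zero_lt_one.trans_le hq).ne'
  have hq1 : 1 ≤ q.toReal := by
    rw [← ENNReal.toReal_one]; exact ENNReal.toReal_mono hq' hq
  set ν := volume.withDensity fun h => ‖κ h‖ₑ
  have hκm : Measurable fun h => ‖κ h‖ₑ := hκ.measurable.enorm
  have hν : ν univ ≤ ENNReal.ofReal C := by
    rw [withDensity_apply _ .univ, Measure.restrict_univ]
    rw [← ofReal_integral_norm_eq_lintegral_enorm (hκ.integrable_of_hasCompactSupport hκc)]
    exact ENNReal.ofReal_le_ofReal hC
  set G : (ℝ × EuclideanSpace ℝ (Fin d)) × EuclideanSpace ℝ (Fin d) → ℝ≥0∞ :=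
    fun w => ‖F (w.1.1, w.1.2 - w.2) - F w.1‖ₑ
  have hG : Measurable G := by
    refine Measurable.enorm (Measurable.sub ?_ ?_)
    · exact hF.measurable.comp (by fun_prop)
    · exact hF.measurable.comp (by fun_prop)
  rw [eLpNorm_eq_lintegral_rpow_enorm_toReal hq0 hq']
  have hle : ∫⁻ z, ‖mollify κ (fun x => F (z.1, x)) z.2‖ₑ ^ q.toReal ∂μ ≤
      (ν univ * B) ^ q.toReal := by
    refine (lintegral_mono_ae ?_).trans (lintegral_lintegral_rpow_le hG hq1 ?_)
    · filter_upwards [hl] with z hz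
      refine ENNReal.rpow_le_rpow ?_ (by positivity)
      rw [mollify_eq_integral_sub hκ hκc hκ0 hz]
      refine (enorm_integral_le_lintegral_enorm _).trans ?_
      have hGz : Measurable fun h => G (z, h) := hG.comp measurable_prodMk_left
      rw [lintegral_withDensity_eq_lintegral_mul _ hκm hGz]
      simp [G, enorm_mul]
    · refine (ae_withDensity_iff hκm).2 (.of_forall fun h hh => ?_)
      have hhR : h ∈ Metric.closedBall 0 R := hκR (subset_tsupport _ fun h0 => hh (by simp [h0]))
      have := hB h hhR
      rw [eLpNorm_eq_lintegral_rpow_enorm_toReal hq0 hq', one_div,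
        ENNReal.rpow_inv_le_iff (by positivity)] at this
      exact this
  rw [one_div, ENNReal.rpow_inv_le_iff (by positivity)]
  exact hle.trans (by gcongr)

instance holderTriple_three_three : ENNReal.HolderTriple 3 3 (3 / 2) := ⟨by
  rw [ENNReal.inv_div (by simp) (by simp), ← one_div, ENNReal.div_add_div_same]
  norm_num⟩

/-- The expansion f'g' - fg = (f' - f) g + (f' - f)(g' - g) + (g' - g) f uses norms of f and g at
the unshifted point only. Norms of the shifted functions, whose points may leave the compact set
under consideration, are thus not needed. -/
lemma eLpNorm_mul_sub_mul_le {Z : Type*} [MeasurableSpace Z] {μ : Measure Z}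
    {f g f' g' : Z → ℝ} (hf : AEStronglyMeasurable f μ) (hg : AEStronglyMeasurable g μ)
    (hf' : AEStronglyMeasurable f' μ) (hg' : AEStronglyMeasurable g' μ) {M D : ℝ≥0∞}
    (hfM : eLpNorm f 3 μ ≤ M) (hgM : eLpNorm g 3 μ ≤ M)
    (hfD : eLpNorm (fun z => f' z - f z) 3 μ ≤ D) (hgD : eLpNorm (fun z => g' z - g z) 3 μ ≤ D) :
    eLpNorm (fun z => f' z * g' z - f z * g z) (3 / 2) μ ≤ D * (2 * M + D) := by
  have hq : (1 : ℝ≥0∞) ≤ 3 / 2 := by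
    rw [ENNReal.le_div_iff_mul_le (by simp) (by simp)]; norm_num
  have h1 : (fun z => f' z * g' z - f z * g z) =
      ((fun z => f' z - f z) • fun z => g z) + ((fun z => f' z - f z) • fun z => g' z - g z)
        + ((fun z => g' z - g z) • fun z => f z) := by
    ext z
    simp
    ring
  rw [h1]
  have e1 := eLpNorm_smul_le_mul_eLpNorm (p := 3) (q := 3) (r := 3 / 2) hg (hf'.sub hf)
  have e2 := eLpNorm_smul_le_mul_eLpNorm (p := 3) (q := 3) (r := 3 / 2) (hg'.sub hg) (hf'.sub hf)
  have e3 := eLpNorm_smul_le_mul_eLpNorm (p := 3) (q := 3) (r := 3 / 2) hf (hg'.sub hg)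
  refine (eLpNorm_add_le (((hf'.sub hf).smul hg).add ((hf'.sub hf).smul (hg'.sub hg)))
    ((hg'.sub hg).smul hf) hq).trans ?_
  refine (add_le_add_left (eLpNorm_add_le ((hf'.sub hf).smul hg)
    ((hf'.sub hf).smul (hg'.sub hg)) hq) _).trans ?_
  calc _ ≤ D * M + D * D + D * M := by
        refine add_le_add (add_le_add (e1.trans ?_) (e2.trans ?_)) (e3.trans ?_)
        · exact mul_le_mul' hfD hgM
        · exact mul_le_mul' hfD hgD
        · exact mul_le_mul' hgD hfM
    _ = D * (2 * M + D) := by ring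

variable {v : ℝ × EuclideanSpace ℝ (Fin d) → EuclideanSpace ℝ (Fin d)}

/-- The kernel ∂_i ∂_j Ψ has mean zero, so only increments of v_i v_j matter. The bound vanishes
linearly with the size D of the velocity increments, which makes the dyadic sum converge. -/
lemma eLpNorm_dyadicStress_le {Ψ : EuclideanSpace ℝ (Fin d) → ℝ} (hΨ : ContDiff ℝ ∞ Ψ)
    (hΨc : HasCompactSupport Ψ) {C R : ℝ} (hΨR : tsupport Ψ ⊆ Metric.closedBall 0 R)
    (hC : ∀ i j, ∫ x, |partialD i (partialD j Ψ) x| ≤ C) (hv : StronglyMeasurable v)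
    {μ : Measure (ℝ × EuclideanSpace ℝ (Fin d))} [SFinite μ]
    (hl : ∀ᵐ z ∂μ, ∀ i j, LocallyIntegrable fun x => v (z.1, x) i * v (z.1, x) j)
    {M D : ℝ≥0∞} (hM : eLpNorm v 3 μ ≤ M)
    (hD : ∀ h ∈ Metric.closedBall 0 R, eLpNorm (fun z => v (z.1, z.2 - h) - v z) 3 μ ≤ D) :
    eLpNorm (fun z => dyadicStress Ψ (fun x => v (z.1, x)) z.2) (3 / 2) μ ≤
      d * (d * (ENNReal.ofReal C * (D * (2 * M + D)))) := by
  have hq : (1 : ℝ≥0∞) ≤ 3 / 2 := by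
    rw [ENNReal.le_div_iff_mul_le (by simp) (by simp)]; norm_num
  have hc : ∀ l, Measurable fun z => v z l := fun l =>
    ((EuclideanSpace.proj l : _ →L[ℝ] ℝ).continuous).measurable.comp hv.measurable
  have hsh : ∀ h : EuclideanSpace ℝ (Fin d),
      Measurable fun z : ℝ × EuclideanSpace ℝ (Fin d) => (z.1, z.2 - h) := fun h => by fun_prop
  have hcomp : ∀ (w : ℝ × EuclideanSpace ℝ (Fin d) → EuclideanSpace ℝ (Fin d)) (l : Fin d),
      eLpNorm (fun z => w z l) 3 μ ≤ eLpNorm w 3 μ := fun w l =>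
    eLpNorm_mono fun z => PiLp.norm_apply_le (w z) l
  have hk := fun i j => (contDiff_partialD (contDiff_partialD hΨ j) i).continuous
  have hbound : ∀ i j, eLpNorm (fun z => mollify (partialD i (partialD j Ψ))
      (fun x => v (z.1, x) i * v (z.1, x) j) z.2) (3 / 2) μ ≤
      ENNReal.ofReal C * (D * (2 * M + D)) := by
    intro i j
    refine eLpNorm_mollify_le (F := fun z => v z i * v z j) (hk i j)
      ((hΨc.partialD j).partialD i)
      (integral_partialD_eq_zero (contDiff_partialD hΨ j) (hΨc.partialD j) i)
      (hC i j) ((tsupport_partialD_subset i).trans ((tsupport_partialD_subset j).trans hΨR))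
      ((hc i).mul (hc j)).stronglyMeasurable (hl.mono fun z hz => hz i j) hq
      (ENNReal.div_ne_top (by simp) (by simp)) fun h hh => ?_
    exact eLpNorm_mul_sub_mul_le (hc i).aestronglyMeasurable (hc j).aestronglyMeasurable
      ((hc i).comp (hsh h)).aestronglyMeasurable ((hc j).comp (hsh h)).aestronglyMeasurable
      ((hcomp v i).trans hM) ((hcomp v j).trans hM)
      ((hcomp (fun z => v (z.1, z.2 - h) - v z) i).trans (hD h hh))
      ((hcomp (fun z => v (z.1, z.2 - h) - v z) j).trans (hD h hh))
  have hmeas : ∀ i j, AEStronglyMeasurable (fun z => mollify (partialD i (partialD j Ψ))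
      (fun x => v (z.1, x) i * v (z.1, x) j) z.2) μ := fun i j =>
    (stronglyMeasurable_mollify (hk i j) (f := fun z => v z i * v z j)
      ((hc i).mul (hc j)).stronglyMeasurable).aestronglyMeasurable
  have h1 : (fun z => dyadicStress Ψ (fun x => v (z.1, x)) z.2) = ∑ i, ∑ j,
      fun z : ℝ × EuclideanSpace ℝ (Fin d) => mollify (partialD i (partialD j Ψ)) (fun x => v (z.1, x) i * v (z.1, x) j) z.2 := by
    ext z
    simp [dyadicStress, Finset.sum_apply]
  rw [h1]
  refine (eLpNorm_sum_le (fun i _ => Finset.aestronglyMeasurable_sum _ fun j _ => hmeas i j)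
    hq).trans ((Finset.sum_le_card_nsmul _ _ _ fun i _ =>
    (eLpNorm_sum_le (fun j _ => hmeas i j) hq).trans
      (Finset.sum_le_card_nsmul _ _ _ fun j _ => hbound i j)).trans_eq ?_)
  simp

end NearBound

/-! ### Large scales: pointwise bounds and telescoping in time-dependent functions -/

section FarBound

variable {d : ℕ} {I : Set ℝ}

/-- No cancellation is used here: the supremum of the kernel times the energy in a ball that
contains its translated support. -/
lemma abs_dyadicStress_le {Ψ : EuclideanSpace ℝ (Fin d) → ℝ} {B s R : ℝ}
    (hB : ∀ i j x, |partialD i (partialD j Ψ) x| ≤ B)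
    (hΨs : tsupport Ψ ⊆ Metric.closedBall 0 s)
    {w : EuclideanSpace ℝ (Fin d) → EuclideanSpace ℝ (Fin d)}
    (hw : ∀ i j, LocallyIntegrable fun x => w x i * w x j)
    {y : EuclideanSpace ℝ (Fin d)} (hy : ‖y‖ + s ≤ R) :
    |dyadicStress Ψ w y| ≤ d * (d * (B * ∫ x in Metric.closedBall 0 R, ‖w x‖ ^ 2)) := by
  have hsq : IntegrableOn (fun x => ‖w x‖ ^ 2)
      (Metric.closedBall (0 : EuclideanSpace ℝ (Fin d)) R) := by
    simp only [EuclideanSpace.real_norm_sq_eq]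
    simp only [sq]
    exact integrable_finsetSum _ fun i _ =>
      (hw i i).integrableOn_isCompact (isCompact_closedBall _ _)
  have h : ∀ i j, |mollify (partialD i (partialD j Ψ)) (fun x => w x i * w x j) y| ≤
      B * ∫ x in Metric.closedBall 0 R, ‖w x‖ ^ 2 := by
    intro i j
    refine (abs_mollify_le (hB i j) ((tsupport_partialD_subset i).trans
      ((tsupport_partialD_subset j).trans hΨs)) (hw i j) hy).trans ?_
    have hB0 := (abs_nonneg _).trans (hB i j 0)
    refine mul_le_mul_of_nonneg_left ?_ hB0
    refine integral_mono_of_nonneg (.of_forall fun x => abs_nonneg _) hsq (.of_forall fun x => ?_)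
    simp only [abs_mul, sq]
    gcongr <;> exact PiLp.norm_apply_le (w x) _
  refine (Finset.abs_sum_le_sum_abs _ _).trans ((Finset.sum_le_card_nsmul _ _ _ fun i _ =>
    (Finset.abs_sum_le_sum_abs _ _).trans (Finset.sum_le_card_nsmul _ _ _ fun j _ => h i j)).trans_eq
      ?_)
  simp

/-- A sequence of functions of time that tends weakly to zero and whose increments are dominated
by a geometric series has a first term dominated by the sum of the series. -/
lemma ae_abs_le_of_geometric (hI : IsOpen I) {g : ℕ → ℝ → ℝ} {M : ℝ → ℝ}
    (hg : ∀ n, LocallyIntegrableOn (g n) I) (hM : LocallyIntegrableOn M I)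
    (hgM : ∀ᵐ t, t ∈ I → ∀ n, |g n t - g (n + 1) t| ≤ M t / 2 / 2 ^ n)
    (hlim : ∀ a : ℝ → ℝ, ContDiff ℝ ∞ a → HasCompactSupport a → tsupport a ⊆ I →
      Tendsto (fun n => ∫ t in I, g n t * a t) atTop (𝓝 0)) :
    ∀ᵐ t, t ∈ I → |g 0 t| ≤ M t := by
  -- The geometric increments force a pointwise limit. The weak convergence then identifies it as
  -- zero, after which |g 0| ≤ M is the sum of the series.
  set W : ℝ → ℝ := fun t => limUnder atTop fun n => g n t
  have hW : ∀ᵐ t, t ∈ I → Tendsto (fun n => g n t) atTop (𝓝 (W t)) := by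
    filter_upwards [hgM] with t ht htI
    exact (cauchySeq_of_le_geometric_two (C := M t) fun n => by
      simpa [Real.dist_eq] using ht htI n).tendsto_limUnder
  have hWn : ∀ᵐ t, t ∈ I → ∀ n, |g n t - W t| ≤ M t / 2 ^ n := by
    filter_upwards [hgM, hW] with t h1 h2 htI n
    have := dist_le_of_le_geometric_two_of_tendsto (C := M t)
      (fun n => by simpa [Real.dist_eq] using h1 htI n) (h2 htI) n
    simpa [Real.dist_eq] using this
  have hWI : LocallyIntegrableOn W I := by
    rw [locallyIntegrableOn_iff hI.isLocallyClosed]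
    intro J hJI hJ
    have hm : AEStronglyMeasurable W (volume.restrict J) := by
      refine aestronglyMeasurable_of_tendsto_ae atTop (f := g)
        (fun n => ((hg n).integrableOn_compact_subset hJI hJ).1) ?_
      exact (ae_restrict_iff' hJ.measurableSet).2 (hW.mono fun t ht htJ => ht (hJI htJ))
    refine (((hg 0).integrableOn_compact_subset hJI hJ).norm.add
      (hM.integrableOn_compact_subset hJI hJ)).mono' hm
      ((ae_restrict_iff' hJ.measurableSet).2 (hWn.mono fun t ht htJ => ?_))
    have := ht (hJI htJ) 0
    simp only [pow_zero, div_one] at this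
    rw [abs_sub_comm] at this
    simp only [Pi.add_apply, Real.norm_eq_abs]
    calc |W t| = |W t - g 0 t + g 0 t| := by ring_nf
      _ ≤ |W t - g 0 t| + |g 0 t| := abs_add_le _ _
      _ ≤ _ := by linarith
  have hW0 : ∀ᵐ t, t ∈ I → W t = 0 := by
    refine hI.ae_eq_zero_of_integral_contDiff_smul_eq_zero hWI fun a ha hac haI => ?_
    have hint : ∀ {f : ℝ → ℝ}, LocallyIntegrableOn f I →
        IntegrableOn (fun t => f t * a t) I := fun hf =>
      integrableOn_mul_of_locallyIntegrableOn hI.measurableSet hf ha.continuous hac haI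
    have hMa : IntegrableOn (fun t => M t * |a t|) I := by
      refine integrableOn_mul_of_locallyIntegrableOn hI.measurableSet hM ha.continuous.abs
        (hac.comp_left abs_zero) ?_
      exact (closure_mono fun t ht => by simpa using ht).trans haI
    have h1 : Tendsto (fun n : ℕ => (∫ t in I, M t * |a t|) / 2 ^ n + |∫ t in I, g n t * a t|)
        atTop (𝓝 0) := by
      have h2 := ((hlim a ha hac haI).abs)
      have h3 : Tendsto (fun n : ℕ => (∫ t in I, M t * |a t|) * (2⁻¹ : ℝ) ^ n) atTop
          (𝓝 ((∫ t in I, M t * |a t|) * 0)) :=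
        (tendsto_pow_atTop_nhds_zero_of_lt_one (by norm_num) (by norm_num)).const_mul _
      simpa [div_eq_mul_inv] using h3.add h2
    -- The pairing with W is compared with the pairing with g n. The error is geometric in n,
    -- weighted by the locally integrable M.
    have h4 : ∀ n, |∫ t in I, W t * a t| ≤
        (∫ t in I, M t * |a t|) / 2 ^ n + |∫ t in I, g n t * a t| := by
      intro n
      have h5 : ∫ t in I, W t * a t = -(∫ t in I, (g n t - W t) * a t)
          + ∫ t in I, g n t * a t := by
        simp only [sub_mul]
        rw [integral_sub (hint (hg n)) (hint hWI)]
        ring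
      rw [h5]
      refine (abs_add_le _ _).trans ?_
      rw [abs_neg]
      gcongr
      rw [← integral_div, ← Real.norm_eq_abs]
      refine (norm_integral_le_integral_norm _).trans (integral_mono_of_nonneg
        (.of_forall fun t => norm_nonneg _) (hMa.div_const _)
        ((ae_restrict_iff' hI.measurableSet).2 (hWn.mono fun t ht htI => ?_)))
      have := ht htI n
      simp only [norm_mul, Real.norm_eq_abs]
      rw [mul_div_right_comm]
      gcongr
    have h6 : |∫ t in I, W t * a t| ≤ 0 := ge_of_tendsto' h1 h4
    have h7 : ∫ t in I, W t * a t = 0 := abs_nonpos_iff.1 h6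
    rw [← setIntegral_eq_integral_of_forall_compl_eq_zero (s := I)]
    · simpa [mul_comm] using h7
    · intro t ht
      rw [image_eq_zero_of_notMem_tsupport (f := a) fun h => ht (haI h), zero_smul]
  filter_upwards [hWn, hW0] with t h1 h2 htI
  simpa [h2 htI] using h1 htI 0

end FarBound

/-! ### Gradient bound for the unit-scale average of the pressure -/

section Pressure

variable {d : ℕ} {I : Set ℝ} {v : ℝ × EuclideanSpace ℝ (Fin d) → EuclideanSpace ℝ (Fin d)}
  {p : ℝ × EuclideanSpace ℝ (Fin d) → ℝ} {ρ Ψ : ℤ → EuclideanSpace ℝ (Fin d) → ℝ} {C : ℝ}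

lemma integrableOn_mul_kernel {f : ℝ × EuclideanSpace ℝ (Fin d) → ℝ}
    {κ : EuclideanSpace ℝ (Fin d) → ℝ} (hf : LocallyIntegrableOn f (I ×ˢ univ))
    (hκ : Continuous κ) (hκc : HasCompactSupport κ) {J : Set ℝ} (hJI : J ⊆ I) (hJ : IsCompact J)
    (y : EuclideanSpace ℝ (Fin d)) :
    IntegrableOn (fun z => f z * κ (y - z.2)) (J ×ˢ univ) (volume.prod volume) := by
  obtain ⟨B, hB⟩ := hκc.exists_bound_of_continuous hκ
  have hb : IntegrableOn (fun z : ℝ × EuclideanSpace ℝ (Fin d) => f z * κ (y - z.2))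
      (J ×ˢ tsupport fun x => κ (y - x)) (volume.prod volume) :=
    (hf.integrableOn_compact_subset (prod_mono hJI (subset_univ _))
      (hJ.prod (hκc.comp_sub_left y))).mul_bdd (c := B) (by fun_prop) (.of_forall fun z => hB _)
  refine hb.of_forall_sdiff_eq_zero (hJ.measurableSet.prod .univ) fun z hz => ?_
  have : z.2 ∉ tsupport fun x => κ (y - x) := fun h => hz.2 ⟨hz.1.1, h⟩
  rw [image_eq_zero_of_notMem_tsupport (f := fun x => κ (y - x)) this, mul_zero]

lemma locallyIntegrableOn_mollify {f : ℝ × EuclideanSpace ℝ (Fin d) → ℝ}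
    {κ : EuclideanSpace ℝ (Fin d) → ℝ} (hI : IsOpen I) (hf : LocallyIntegrableOn f (I ×ˢ univ))
    (hκ : Continuous κ) (hκc : HasCompactSupport κ) (y : EuclideanSpace ℝ (Fin d)) :
    LocallyIntegrableOn (fun t => mollify κ (fun x => f (t, x)) y) I := by
  rw [locallyIntegrableOn_iff hI.isLocallyClosed]
  intro J hJI hJ
  have := integrableOn_mul_kernel hf hκ hκc hJI hJ y
  rw [IntegrableOn, ← Measure.prod_restrict, Measure.restrict_univ] at this
  simp only [mollify, mul_comm (κ _)]
  exact this.integral_prod_left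

lemma integral_mollify_mul {f : ℝ × EuclideanSpace ℝ (Fin d) → ℝ}
    {κ : EuclideanSpace ℝ (Fin d) → ℝ} (hI : IsOpen I) (hf : LocallyIntegrableOn f (I ×ˢ univ))
    (hκ : Continuous κ) (hκc : HasCompactSupport κ) (y : EuclideanSpace ℝ (Fin d)) {a : ℝ → ℝ}
    (ha : Continuous a) (hac : HasCompactSupport a) (haI : tsupport a ⊆ I) :
    ∫ t in I, mollify κ (fun x => f (t, x)) y * a t =
      ∫ z in I ×ˢ univ, f z * (a z.1 * κ (y - z.2)) := by
  have hF : IntegrableOn (fun z : ℝ × EuclideanSpace ℝ (Fin d) => f z * (a z.1 * κ (y - z.2)))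
      (I ×ˢ univ) := integrableOn_mul_of_locallyIntegrableOn
    (hI.prod isOpen_univ).measurableSet hf (by fun_prop)
    (hasCompactSupport_tensor (θ := fun x => κ (y - x)) hac (hκc.comp_sub_left y))
    (tsupport_tensor_subset (θ := fun x => κ (y - x)) haI)
  rw [Measure.volume_eq_prod] at hF ⊢
  rw [setIntegral_prod _ hF, Measure.restrict_univ]
  refine setIntegral_congr_fun hI.measurableSet fun t _ => ?_
  simp only [mollify, ← integral_mul_const]
  congr 1
  ext x
  ring

lemma ae_restrict_of_ae_time {X : Type*} [MeasureSpace X] {K : Set (ℝ × X)}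
    (hK : MeasurableSet K) (hKI : K ⊆ I ×ˢ univ) {P : ℝ → Prop} (h : ∀ᵐ t, t ∈ I → P t) :
    ∀ᵐ z ∂((volume.prod volume).restrict K : Measure (ℝ × X)), P z.1 :=
  (ae_restrict_iff' hK).2 ((Measure.quasiMeasurePreserving_fst.ae h).mono
    fun _ hz hzK => hz (hKI hzK).1)

/-- The energy of the velocity in balls grows at most like their volume. -/
def IsEnergyDensityBound (I : Set ℝ) (v : ℝ × EuclideanSpace ℝ (Fin d) → EuclideanSpace ℝ (Fin d))
    (N : ℝ → ℝ) : Prop :=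
  (∀ J ⊆ I, IsCompact J → MemLp N (3 / 2) (volume.restrict J)) ∧
    ∀ᵐ t, t ∈ I → ∀ s : ℝ, 1 ≤ s → ∫ x in Metric.closedBall 0 s, ‖v (t, x)‖ ^ 2 ≤ s ^ d * N t

/-- The averages of the pressure gradient over large balls vanish in the limit. -/
def IsPressureGradientDecaying (I : Set ℝ) (p : ℝ × EuclideanSpace ℝ (Fin d) → ℝ)
    (ρ : ℤ → EuclideanSpace ℝ (Fin d) → ℝ) : Prop :=
  ∀ (a : ℝ → ℝ), ContDiff ℝ ∞ a → HasCompactSupport a → tsupport a ⊆ I → ∀ y l,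
    Tendsto (fun n : ℕ => ∫ z in I ×ˢ univ, p z * (a z.1 * partialD l (ρ n) (y - z.2)))
      atTop (𝓝 0)

lemma IsEnergyDensityBound.locallyIntegrableOn {N : ℝ → ℝ} (hI : IsOpen I)
    (hN : IsEnergyDensityBound I v N) : LocallyIntegrableOn N I :=
  (locallyIntegrableOn_iff hI.isLocallyClosed).2 fun J hJI hJ =>
    memLp_one_of_memLp_compact (by
      rw [ENNReal.le_div_iff_mul_le (by simp) (by simp)]; norm_num) hJ (hN.1 J hJI hJ)

lemma IsWeakEulerSolution.ae_locallyIntegrable_mul (hI : IsOpen I)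
    (h : IsWeakEulerSolution id I v p) :
    ∀ᵐ t, t ∈ I → ∀ i j, LocallyIntegrable fun x => v (t, x) i * v (t, x) j := by
  have : ∀ᵐ t, ∀ i j, t ∈ I → LocallyIntegrable fun x => v (t, x) i * v (t, x) j :=
    ae_all_iff.2 fun i => ae_all_iff.2 fun j =>
      ae_locallyIntegrable_slice hI (h.locallyIntegrableOn_mul hI i j)
  exact this.mono fun t ht htI i j => ht i j htI

/-- The gradient averages are telescoped towards large scales. At scale 2^n the third derivatives of
the potential are O(2^{-n(d+1)}), while the energy in a ball of radius O(2^n) is O(2^{nd} N(t)), so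
the differences are O(2^{-n} N(t)). The decay hypothesis excludes a nonzero limit. -/
theorem IsWeakEulerSolution.ae_abs_mollify_partialD_le (hI : IsOpen I)
    (h : IsWeakEulerSolution id I v p) (hρ : IsDyadicKernel ρ Ψ C) {N : ℝ → ℝ}
    (hN : IsEnergyDensityBound I v N) (hdec : IsPressureGradientDecaying I p ρ) :
    ∀ᵐ t, t ∈ I → ∀ l y, |mollify (partialD l (ρ 0)) (fun x => p (t, x)) y| ≤
      2 * (d * (d * (C * ((‖y‖ + 2) ^ d * N t)))) := by
  have hκ := fun k l => (contDiff_partialD (hρ.contDiff k) l).continuous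
  have hκc := fun k l => (hρ.hasCompactSupport k).partialD l
  have hpt : ∀ y l, ∀ᵐ t, t ∈ I → |mollify (partialD l (ρ 0)) (fun x => p (t, x)) y| ≤
      2 * (d * (d * (C * ((‖y‖ + 2) ^ d * N t)))) := by
    intro y l
    refine ae_abs_le_of_geometric hI
      (g := fun n t => mollify (partialD l (ρ n)) (fun x => p (t, x)) y)
      (fun n => locallyIntegrableOn_mollify hI h.locallyIntegrable_pressure (hκ _ l) (hκc _ l) y)
      ?_ ?_ ?_
    · have := (hN.locallyIntegrableOn hI).smul (2 * (d * (d * (C * (‖y‖ + 2) ^ d))))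
      refine this.congr (.of_forall fun t => ?_)
      simp only [Pi.smul_apply, smul_eq_mul]
      ring
    · have hall : ∀ᵐ t, ∀ n : ℕ, t ∈ I → ∀ y, mollify (partialD l (ρ n)) (fun x => p (t, x)) y
          - mollify (partialD l (ρ (n + 1))) (fun x => p (t, x)) y =
          dyadicStress (partialD l (Ψ n)) (fun x => v (t, x)) y :=
        ae_all_iff.2 fun n => h.ae_mollify_partialD_sub hI hρ n l
      filter_upwards [hall, hN.2, h.ae_locallyIntegrable_mul hI] with t h1 h2 h3 htI n
      have e := h1 n htI y
      push_cast
      rw [e]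
      have hs : (1 : ℝ) ≤ 2 ^ n := one_le_pow₀ (by norm_num)
      -- The kernel centred at y is supported in the ball of this radius about the origin. Factoring
      -- out 2^n exposes the exact scaling.
      have hyn : ‖y‖ + 2 * 2 ^ n ≤ (‖y‖ + 2) * 2 ^ n := by
        nlinarith [norm_nonneg y]
      have hΨs : tsupport (partialD l (Ψ n)) ⊆ Metric.closedBall 0 (2 * 2 ^ n) := by
        simpa using (tsupport_partialD_subset l).trans (hρ.tsupport_potential_subset n)
      refine (abs_dyadicStress_le (fun i j x => hρ.abs_partialD_potential_le n i j l x) hΨs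
        (h3 htI) hyn).trans ?_
      have h4 := h2 htI ((‖y‖ + 2) * 2 ^ n) (by nlinarith [norm_nonneg y])
      have hC0 : 0 ≤ C * ((2 : ℝ) ^ (n : ℤ))⁻¹ ^ (d + 1) :=
        (abs_nonneg _).trans (hρ.abs_partialD_potential_le n l l l 0)
      calc _ ≤ d * (d * (C * ((2 : ℝ) ^ (n : ℤ))⁻¹ ^ (d + 1)
            * (((‖y‖ + 2) * 2 ^ n) ^ d * N t))) := by gcongr
        _ = _ := by
          rw [zpow_natCast, pow_succ _ d, mul_pow]
          have : ((2 : ℝ) ^ n)⁻¹ ^ d * (2 ^ n) ^ d = 1 := by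
            rw [← mul_pow, inv_mul_cancel₀ (by positivity), one_pow]
          rw [div_eq_mul_inv _ ((2 : ℝ) ^ n)]
          linear_combination (d : ℝ) ^ 2 * C * (‖y‖ + 2) ^ d * N t * ((2 : ℝ) ^ n)⁻¹ * this
    · intro a ha hac haI
      refine (hdec a ha hac haI y l).congr fun n => ?_
      rw [integral_mollify_mul hI h.locallyIntegrable_pressure (hκ _ l) (hκc _ l) y ha.continuous
        hac haI]
  -- A dense sequence of y yields one null set of times. Both sides are continuous in y.
  have hall : ∀ᵐ t, ∀ (l : Fin d) (n : ℕ), t ∈ I →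
      |mollify (partialD l (ρ 0)) (fun x => p (t, x))
        (TopologicalSpace.denseSeq (EuclideanSpace ℝ (Fin d)) n)| ≤
      2 * (d * (d * (C * ((‖TopologicalSpace.denseSeq (EuclideanSpace ℝ (Fin d)) n‖ + 2) ^ d
        * N t)))) := ae_all_iff.2 fun l => ae_all_iff.2 fun n => hpt _ l
  filter_upwards [hall, ae_locallyIntegrable_slice hI h.locallyIntegrable_pressure]
    with t h1 h2 htI l y
  refine (TopologicalSpace.denseRange_denseSeq (EuclideanSpace ℝ (Fin d))).induction_on
    (p := fun y => |mollify (partialD l (ρ 0)) (fun x => p (t, x)) y| ≤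
      2 * (d * (d * (C * ((‖y‖ + 2) ^ d * N t))))) y ?_ fun n => h1 l n htI
  exact isClosed_le (continuous_mollify (hκ 0 l) (hκc 0 l) (h2 htI)).abs (by fun_prop)

end Pressure

/-! ### Local L^{3/2} integrability of the pressure modulo functions of time -/

section Pressure

variable {d : ℕ} {I : Set ℝ} {v : ℝ × EuclideanSpace ℝ (Fin d) → EuclideanSpace ℝ (Fin d)}
  {p : ℝ × EuclideanSpace ℝ (Fin d) → ℝ} {ρ Ψ : ℤ → EuclideanSpace ℝ (Fin d) → ℝ} {C : ℝ}

/-- Local regularity of order `1/3` in `L^3`, with respect to translations in space. -/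
def HasCubicRegularity (I : Set ℝ)
    (v : ℝ × EuclideanSpace ℝ (Fin d) → EuclideanSpace ℝ (Fin d)) : Prop :=
  ∀ K ⊆ I ×ˢ univ, IsCompact K → MemLp v 3 (volume.restrict K) ∧
    ∃ D : ℝ≥0∞, D ≠ ⊤ ∧ ∀ h, ‖h‖ ≤ 1 →
      eLpNorm (fun z => v (z.1, z.2 - h) - v z) 3 (volume.restrict K) ≤
        D * ENNReal.ofReal (‖h‖ ^ (1 / 3 : ℝ))

/-- By Lebesgue differentiation p is the limit of its averages at scales 2^{-n}, and these telescope
into dyadic stresses. The velocity increments of order 2^{-m/3} give a geometric series in L^{3/2},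
and Fatou's lemma passes to the limit. -/
theorem IsWeakEulerSolution.memLp_pressure_sub_mollify (hI : IsOpen I)
    (h : IsWeakEulerSolution id I v p) (hv : StronglyMeasurable v) (hp : StronglyMeasurable p)
    (hρ : IsDyadicKernel ρ Ψ C) (hreg : HasCubicRegularity I v)
    {K : Set (ℝ × EuclideanSpace ℝ (Fin d))} (hKU : K ⊆ I ×ˢ univ) (hK : IsCompact K) :
    MemLp (fun z => p z - mollify (ρ 0) (fun x => p (z.1, x)) z.2) (3 / 2) (volume.restrict K) := by
  obtain ⟨hM, D, hD, hDh⟩ := hreg K hKU hK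
  set μ : Measure (ℝ × EuclideanSpace ℝ (Fin d)) := volume.restrict K
  set M := eLpNorm v 3 μ
  set q : ℝ≥0∞ := ENNReal.ofReal ((2⁻¹ : ℝ) ^ (1 / 3 : ℝ))
  have hq1 : q < 1 := by
    rw [← ENNReal.ofReal_one]
    exact (ENNReal.ofReal_lt_ofReal_iff one_pos).2
      (Real.rpow_lt_one (by norm_num) (by norm_num) (by norm_num))
  have hqle : ∀ m : ℕ, q ^ m ≤ 1 := fun m => pow_le_one₀ (by simp) hq1.le
  have hEm : ∀ k, StronglyMeasurable fun z : ℝ × EuclideanSpace ℝ (Fin d) =>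
      mollify (ρ k) (fun x => p (z.1, x)) z.2 := fun k =>
    stronglyMeasurable_mollify (hρ.contDiff k).continuous hp
  set A : ℝ≥0∞ := d * (d * (ENNReal.ofReal C * (D * (2 * M + D))))
  have hA : A ≠ ⊤ := by
    have := hM.2.ne
    finiteness
  -- The potential at scale 2^{-(m+1)} has support radius 2 · 2^{-(m+1)} = 2^{-m} ≤ 1, so the
  -- regularity hypothesis, stated for increments of length at most 1, applies from m = 0 on.
  have hstress : ∀ m : ℕ, eLpNorm (fun z => dyadicStress (Ψ (-(m + 1 : ℕ))) (fun x => v (z.1, x))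
      z.2) (3 / 2) μ ≤ A * q ^ m := by
    intro m
    have h2 : (2 : ℝ) * 2 ^ (-(m + 1 : ℕ) : ℤ) = 2⁻¹ ^ m := by
      rw [zpow_neg, zpow_natCast, pow_succ]
      field_simp
      simp
    refine (eLpNorm_dyadicStress_le (D := D * q ^ m) (hρ.contDiff_potential _)
      (hρ.hasCompactSupport_potential _) (hρ.tsupport_potential_subset _)
      (hρ.integral_abs_partialD_le _) hv ?_ le_rfl fun w hw => ?_).trans ?_
    · exact ae_restrict_of_ae_time hK.measurableSet hKU (h.ae_locallyIntegrable_mul hI)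
    · rw [mem_closedBall_zero_iff, h2] at hw
      refine (hDh w (hw.trans (pow_le_one₀ (by norm_num) (by norm_num)))).trans ?_
      gcongr
      rw [← ENNReal.ofReal_pow (by positivity), ← Real.rpow_natCast, ← Real.rpow_mul (by norm_num),
        mul_comm (1 / 3 : ℝ), Real.rpow_mul (by norm_num), Real.rpow_natCast]
      gcongr
    · calc (d : ℝ≥0∞) * (d * (ENNReal.ofReal C * (D * q ^ m * (2 * M + D * q ^ m))))
          ≤ d * (d * (ENNReal.ofReal C * (D * q ^ m * (2 * M + D * 1)))) := by
            gcongr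
            exact hqle m
        _ = A * q ^ m := by simp only [A]; ring
  have hstress_meas : ∀ k, AEStronglyMeasurable (fun z : ℝ × EuclideanSpace ℝ (Fin d) =>
      dyadicStress (Ψ k) (fun x => v (z.1, x)) z.2) μ := by
    intro k
    have hc : ∀ l, StronglyMeasurable fun z => v z l := fun l =>
      ((EuclideanSpace.proj l : _ →L[ℝ] ℝ).continuous).comp_stronglyMeasurable hv
    refine (Finset.stronglyMeasurable_fun_sum _ fun i _ => Finset.stronglyMeasurable_fun_sum _
      fun j _ => stronglyMeasurable_mollify (f := fun z => v z i * v z j)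
        (contDiff_partialD (contDiff_partialD (hρ.contDiff_potential k) j) i).continuous
        ((hc i).mul (hc j))).aestronglyMeasurable
  have hall : ∀ᵐ t, t ∈ I → ∀ k y, mollify (ρ k) (fun x => p (t, x)) y
      - mollify (ρ (k + 1)) (fun x => p (t, x)) y = dyadicStress (Ψ k) (fun x => v (t, x)) y := by
    have := ae_all_iff.2 fun k => h.ae_mollify_sub hI hρ k
    exact this.mono fun t ht htI k => ht k htI
  have hsum : ∀ᵐ z ∂μ, ∀ n : ℕ, mollify (ρ (-n)) (fun x => p (z.1, x)) z.2
      - mollify (ρ 0) (fun x => p (z.1, x)) z.2 =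
      ∑ m ∈ Finset.range n, dyadicStress (Ψ (-(m + 1 : ℕ))) (fun x => v (z.1, x)) z.2 := by
    filter_upwards [ae_restrict_of_ae_time hK.measurableSet hKU hall] with z hz n
    have h1 := Finset.sum_range_sub (fun m : ℕ => mollify (ρ (-m)) (fun x => p (z.1, x)) z.2) n
    simp only [Nat.cast_zero, neg_zero] at h1
    rw [← h1]
    refine Finset.sum_congr rfl fun m _ => ?_
    rw [← hz]
    congr 3
    push_cast
    ring
  have hbound : ∀ n : ℕ, eLpNorm (fun z => mollify (ρ (-n)) (fun x => p (z.1, x)) z.2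
      - mollify (ρ 0) (fun x => p (z.1, x)) z.2) (3 / 2) μ ≤ A * (1 - q)⁻¹ := by
    intro n
    rw [eLpNorm_congr_ae (g := ∑ m ∈ Finset.range n, fun z : ℝ × EuclideanSpace ℝ (Fin d) =>
      dyadicStress (Ψ (-(m + 1 : ℕ))) (fun x => v (z.1, x)) z.2)
      (hsum.mono fun z hz => by rw [hz n, Finset.sum_apply])]
    refine (eLpNorm_sum_le (fun m _ => hstress_meas _) (by
      rw [ENNReal.le_div_iff_mul_le (by simp) (by simp)]; norm_num)).trans ?_
    refine (Finset.sum_le_sum fun m _ => hstress m).trans ?_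
    rw [← Finset.mul_sum]
    gcongr
    rw [← ENNReal.tsum_geometric]
    exact ENNReal.sum_le_tsum _
  have hlim : ∀ᵐ z ∂μ, Tendsto (fun n : ℕ => mollify (ρ (-n)) (fun x => p (z.1, x)) z.2) atTop
      (𝓝 (p z)) := by
    have hms : MeasurableSet {z : ℝ × EuclideanSpace ℝ (Fin d) |
        Tendsto (fun n : ℕ => mollify (ρ (-n)) (fun x => p (z.1, x)) z.2) atTop (𝓝 (p z))} :=
      measurableSet_tendsto_fun (fun n => (hEm _).measurable) hp.measurable
    have hU : ∀ᵐ z ∂((volume.restrict I).prod volume : Measure (ℝ × EuclideanSpace ℝ (Fin d))),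
        Tendsto (fun n : ℕ => mollify (ρ (-n)) (fun x => p (z.1, x)) z.2) atTop (𝓝 (p z)) := by
      rw [Measure.ae_prod_iff_ae_ae hms, ae_restrict_iff' hI.measurableSet]
      filter_upwards [ae_locallyIntegrable_slice hI h.locallyIntegrable_pressure] with t ht htI
      exact ae_tendsto_mollify hρ (ht htI)
    have hres : ((volume.restrict I).prod volume : Measure (ℝ × EuclideanSpace ℝ (Fin d))) =
        volume.restrict (I ×ˢ univ) := by
      rw [Measure.volume_eq_prod, ← Measure.prod_restrict, Measure.restrict_univ]
    rw [hres] at hU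
    exact ae_mono (Measure.restrict_mono hKU le_rfl) hU
  refine ⟨(hp.sub (hEm 0)).aestronglyMeasurable, ?_⟩
  have hlim' : ∀ᵐ z ∂μ, Tendsto (fun n : ℕ => mollify (ρ (-n)) (fun x => p (z.1, x)) z.2
      - mollify (ρ 0) (fun x => p (z.1, x)) z.2) atTop
      (𝓝 (p z - mollify (ρ 0) (fun x => p (z.1, x)) z.2)) :=
    hlim.mono fun z hz => hz.sub_const _
  have hfatou := Lp.eLpNorm_lim_le_liminf_eLpNorm (p := 3 / 2)
    (fun n : ℕ => ((hEm (-n)).sub (hEm 0)).aestronglyMeasurable) _ hlim'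
  refine hfatou.trans_lt ?_
  refine lt_of_le_of_lt (liminf_le_of_le ⟨0, by simp⟩ fun b hb => ?_)
    (ENNReal.mul_lt_top hA.lt_top (ENNReal.inv_lt_top.2 (tsub_pos_of_lt hq1)))
  obtain ⟨n, hn⟩ := hb.exists
  exact hn.trans (hbound n)

/-- The function c is the unit-scale average of p at the origin. Then p - c splits into p minus its
unit-scale average, treated by small scales, and the oscillation of that average between x and 0,
bounded on compact sets by a multiple of N(t). -/
theorem IsWeakEulerSolution.exists_memLp_pressure_sub (hd : d ≠ 0) (hI : IsOpen I)
    (h : IsWeakEulerSolution id I v p) (hv : StronglyMeasurable v) (hp : StronglyMeasurable p)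
    (hρ : IsDyadicKernel ρ Ψ C) (hC : 0 < C) (hreg : HasCubicRegularity I v) {N : ℝ → ℝ}
    (hN : IsEnergyDensityBound I v N) (hdec : IsPressureGradientDecaying I p ρ) :
    ∃ c : ℝ → ℝ, LocallyIntegrableOn c I ∧ ∀ K ⊆ I ×ˢ univ, IsCompact K →
      MemLp (fun z => p z - c z.1) (3 / 2) (volume.restrict K) := by
  refine ⟨fun t => mollify (ρ 0) (fun x => p (t, x)) 0,
    locallyIntegrableOn_mollify hI h.locallyIntegrable_pressure (hρ.contDiff 0).continuous
      (hρ.hasCompactSupport 0) 0, fun K hKU hK => ?_⟩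
  have hE := stronglyMeasurable_mollify (hρ.contDiff 0).continuous hp
  have hfar : MemLp (fun z => mollify (ρ 0) (fun x => p (z.1, x)) z.2
      - mollify (ρ 0) (fun x => p (z.1, x)) 0) (3 / 2) (volume.restrict K) := by
    obtain ⟨R, hR, hKR⟩ := hK.isBounded.exists_pos_norm_le
    set J := Prod.fst '' K
    have hJ : IsCompact J := hK.image continuous_fst
    have hJI : J ⊆ I := by rintro _ ⟨z, hz, rfl⟩; exact (hKU hz).1
    have hKJ : K ⊆ J ×ˢ Metric.closedBall 0 R := fun z hz =>
      ⟨⟨z, hz, rfl⟩, mem_closedBall_zero_iff.2 ((norm_snd_le z).trans (hKR z hz))⟩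
    have hNK : MemLp (fun z : ℝ × EuclideanSpace ℝ (Fin d) => N z.1) (3 / 2)
        (volume.restrict K) := by
      have : IsFiniteMeasure ((volume : Measure (EuclideanSpace ℝ (Fin d))).restrict
          (Metric.closedBall 0 R)) := ⟨by simpa using measure_closedBall_lt_top⟩
      have h1 := (hN.1 J hJI hJ).comp_fst
        ((volume : Measure (EuclideanSpace ℝ (Fin d))).restrict (Metric.closedBall 0 R))
      rw [Measure.prod_restrict] at h1
      exact h1.mono_measure (Measure.restrict_mono hKJ le_rfl)
    refine (hNK.const_mul (d * (2 * (d * (d * (C * (R + 2) ^ d)))) * R)).of_le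
      (hE.sub (hE.comp_measurable (g := fun z : ℝ × EuclideanSpace ℝ (Fin d) => (z.1, 0))
        (by fun_prop))).aestronglyMeasurable ?_
    have hsl := ae_locallyIntegrable_slice hI h.locallyIntegrable_pressure
    filter_upwards [ae_restrict_of_ae_time hK.measurableSet hKU
      (h.ae_abs_mollify_partialD_le hI hρ hN hdec),
      ae_restrict_of_ae_time hK.measurableSet hKU hN.2,
      ae_restrict_of_ae_time hK.measurableSet hKU hsl, ae_restrict_mem hK.measurableSet]
      with z h1 h2 h3 hz
    -- The energy bound on the unit ball forces N to be nonnegative.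
    have hN0 : 0 ≤ N z.1 := by
      have := h2 1 le_rfl
      rw [one_pow, one_mul] at this
      exact le_trans (integral_nonneg fun _ => by positivity) this
    have hzR : ‖z.2‖ ≤ R := mem_closedBall_zero_iff.1 (hKJ hz).2
    have h4 := abs_mollify_sub_le (hρ.contDiff 0) (hρ.hasCompactSupport 0) h3 (R := R)
      (M := 2 * (d * (d * (C * ((R + 2) ^ d * N z.1))))) (fun l x hx => (h1 l x).trans ?_)
      (mem_closedBall_zero_iff.2 hzR)
    · rw [Real.norm_eq_abs, Real.norm_eq_abs]
      refine h4.trans (le_trans ?_ (le_abs_self _))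
      calc _ ≤ d * (2 * (d * (d * (C * ((R + 2) ^ d * N z.1))))) * R := by gcongr
        _ = _ := by ring
    · have := mem_closedBall_zero_iff.1 hx
      gcongr
  refine ((h.memLp_pressure_sub_mollify hI hv hp hρ hreg hKU hK).add hfar).ae_eq
    (.of_forall fun z => ?_)
  simp

end Pressure

/-! ### Space-time norms from the Besov norms of slices -/

section BesovSlices

/-- The majorant b need not be measurable. This matters because the Besov norm is a supremum over
uncountably many h. -/
lemma eLpNorm_prod_le {T X E : Type*} [MeasurableSpace T] [MeasurableSpace X]
    [NormedAddCommGroup E] {ν : Measure T} {μ : Measure X} [SFinite ν] [SFinite μ]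
    {f : T × X → E} (hf : StronglyMeasurable f) {r : ℝ≥0∞} (hr : r ≠ 0) {b : T → ℝ≥0∞}
    (hb : ∀ t, eLpNorm (fun x => f (t, x)) r μ ≤ b t) :
    eLpNorm f r (ν.prod μ) ≤ eLpNorm b r ν := by
  by_cases hr' : r = ⊤
  · subst hr'
    refine eLpNormEssSup_le_of_ae_enorm_bound ?_
    rw [Measure.ae_prod_iff_ae_ae (measurableSet_le hf.enorm measurable_const)]
    filter_upwards [ae_le_eLpNormEssSup (f := b) (μ := ν)] with t ht
    filter_upwards [ae_le_eLpNormEssSup (f := fun x => f (t, x)) (μ := μ)] with x hx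
    exact hx.trans ((hb t).trans ht)
  · rw [eLpNorm_eq_lintegral_rpow_enorm_toReal hr hr', eLpNorm_eq_lintegral_rpow_enorm_toReal hr hr']
    have hr0 : 0 < r.toReal := ENNReal.toReal_pos hr hr'
    gcongr
    rw [lintegral_prod _ (hf.enorm.pow_const _).aemeasurable]
    refine lintegral_mono fun t => ?_
    have := hb t
    rw [eLpNorm_eq_lintegral_rpow_enorm_toReal hr hr', one_div, ENNReal.rpow_inv_le_iff hr0] at this
    exact this

variable {d : ℕ} {X : Type*} [AddCommGroup X] [MeasureSpace X]
  [SFinite (volume : Measure X)] [MeasurableSub₂ X] {π : EuclideanSpace ℝ (Fin d) → X}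
  {I : Set ℝ} {r : ℝ≥0∞} {v : ℝ × X → EuclideanSpace ℝ (Fin d)}

lemma eLpNorm_le_besov (hr : r ≠ 0) (hv : StronglyMeasurable v) (s : ℝ) :
    eLpNorm v r (volume.restrict (I ×ˢ univ)) ≤
      eLpNorm (fun t => besovNorm π s r fun x => v (t, x)) r (volume.restrict I) := by
  rw [Measure.volume_eq_prod, ← Measure.prod_restrict, Measure.restrict_univ]
  exact eLpNorm_prod_le hv hr fun t => le_self_add

lemma eLpNorm_sub_le_besov (hr : r ≠ 0) (hv : StronglyMeasurable v) (hπ : π 0 = 0) {s : ℝ}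
    (h : EuclideanSpace ℝ (Fin d)) :
    eLpNorm (fun z => v (z.1, z.2 - π h) - v z) r (volume.restrict (I ×ˢ univ)) ≤
      ENNReal.ofReal (‖h‖ ^ s) *
        eLpNorm (fun t => besovNorm π s r fun x => v (t, x)) r (volume.restrict I) := by
  by_cases hh : h = 0
  · simp [hh, hπ]
  have hpos : 0 < ‖h‖ := norm_pos_iff.2 hh
  have hm : StronglyMeasurable fun z : ℝ × X => v (z.1, z.2 - π h) - v z :=
    (hv.comp_measurable (measurable_fst.prodMk (measurable_snd.sub_const _))).sub hv
  have h1 : eLpNorm (fun z => ‖h‖ ^ (-s) • (v (z.1, z.2 - π h) - v z)) r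
      (volume.restrict (I ×ˢ univ)) ≤
      eLpNorm (fun t => besovNorm π s r fun x => v (t, x)) r (volume.restrict I) := by
    rw [Measure.volume_eq_prod, ← Measure.prod_restrict, Measure.restrict_univ]
    have hm2 : StronglyMeasurable fun z : ℝ × X => ‖h‖ ^ (-s) • (v (z.1, z.2 - π h) - v z) :=
      hm.const_smul (‖h‖ ^ (-s))
    refine eLpNorm_prod_le hm2 hr fun t => ?_
    have h3 := eLpNorm_const_smul (‖h‖ ^ (-s)) (fun x => v (t, x - π h) - v (t, x)) r
      (volume : Measure X)
    rw [← ofReal_norm, Real.norm_of_nonneg (by positivity)] at h3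
    refine h3.le.trans ?_
    exact (le_iSup₂ (f := fun (h : EuclideanSpace ℝ (Fin d)) (_ : h ≠ 0) =>
      ENNReal.ofReal (‖h‖ ^ (-s)) * eLpNorm (fun x => v (t, x - π h) - v (t, x)) r volume)
      h hh).trans le_add_self
  have h2 : (fun z : ℝ × X => v (z.1, z.2 - π h) - v z) =
      ‖h‖ ^ s • fun z => ‖h‖ ^ (-s) • (v (z.1, z.2 - π h) - v z) := by
    ext1 z
    simp only [Pi.smul_apply, smul_smul]
    rw [← Real.rpow_add hpos, add_neg_cancel, Real.rpow_zero, one_smul]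
  rw [h2, eLpNorm_const_smul, ← ofReal_norm, Real.norm_of_nonneg (by positivity)]
  gcongr

end BesovSlices

/-! ### Scale-invariant bounds for the local energy flux -/

section IncrementFlux

variable {d : ℕ} {Ω : Type*} [MeasurableSpace Ω] {m : Measure Ω} [SFinite m]

/-- The local energy flux through the scale of the kernel `ρ`, for a family of increments `w`. -/
noncomputable def incrementFlux (ρ : EuclideanSpace ℝ (Fin d) → ℝ)
    (w : EuclideanSpace ℝ (Fin d) → Ω → EuclideanSpace ℝ (Fin d)) (z : Ω) : ℝ :=
  ∫ h, ∑ j, partialD j ρ h * (‖w h z‖ ^ 2 * w h z j)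

variable {ρ : EuclideanSpace ℝ (Fin d) → ℝ}
  {w : EuclideanSpace ℝ (Fin d) → Ω → EuclideanSpace ℝ (Fin d)}

lemma measurable_flux_integrand (hρ : ContDiff ℝ ∞ ρ) (hw : Measurable (Function.uncurry w))
    (j : Fin d) :
    Measurable fun q : EuclideanSpace ℝ (Fin d) × Ω =>
      partialD j ρ q.1 * (‖w q.1 q.2‖ ^ 2 * w q.1 q.2 j) := by
  have h1 : Measurable fun q : EuclideanSpace ℝ (Fin d) × Ω => w q.1 q.2 := hw
  have h2 : Measurable fun q : EuclideanSpace ℝ (Fin d) × Ω => w q.1 q.2 j :=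
    ((EuclideanSpace.proj j : _ →L[ℝ] ℝ).continuous).measurable.comp h1
  exact (((contDiff_partialD hρ j).continuous.measurable).comp measurable_fst).mul
    ((h1.norm.pow_const 2).mul h2)

lemma stronglyMeasurable_incrementFlux (hρ : ContDiff ℝ ∞ ρ)
    (hw : Measurable (Function.uncurry w)) : StronglyMeasurable (incrementFlux ρ w) := by
  refine StronglyMeasurable.integral_prod_left' (f := fun q : EuclideanSpace ℝ (Fin d) × Ω =>
    ∑ j, partialD j ρ q.1 * (‖w q.1 q.2‖ ^ 2 * w q.1 q.2 j)) ?_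
  exact (Finset.measurable_fun_sum _ fun j _ => measurable_flux_integrand hρ hw j).stronglyMeasurable

/-- Cubing turns L^r into L^q, q = r / 3, and |h|^{1/3} into |h|; Hölder pairs the result with g.
The exponent 1/3 is the one for which this factor |h| exactly offsets the derivative on the kernel.
-/
lemma lintegral_mul_increment_le {p q r B : ℝ≥0∞} (hpq : ENNReal.HolderConjugate p q)
    (hqr : q * 3 = r) (hρ : ContDiff ℝ ∞ ρ) (hw : Measurable (Function.uncurry w))
    (hB : ∀ h, eLpNorm (w h) r m ≤ ENNReal.ofReal (‖h‖ ^ (1 / 3 : ℝ)) * B)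
    {g : Ω → ℝ} (hg : AEStronglyMeasurable g m) :
    ∑ j, ∫⁻ h, ∫⁻ z, ‖g z * (partialD j ρ h * (‖w h z‖ ^ 2 * w h z j))‖ₑ ∂m ≤
      (∑ j, ∫⁻ h, ‖partialD j ρ h‖ₑ * ENNReal.ofReal ‖h‖) * B ^ 3 * eLpNorm g p m := by
  rw [Finset.sum_mul, Finset.sum_mul]
  refine Finset.sum_le_sum fun j _ => ?_
  have hpm : Measurable fun h => ‖partialD j ρ h‖ₑ * ENNReal.ofReal ‖h‖ :=
    ((contDiff_partialD hρ j).continuous.measurable.enorm).mul (by fun_prop)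
  rw [mul_assoc, ← lintegral_mul_const _ hpm]
  refine lintegral_mono fun h => ?_
  have hwh : Measurable (w h) := hw.comp measurable_prodMk_left
  have h1 : eLpNorm (fun z => ‖w h z‖ ^ (3 : ℝ)) q m ≤ ENNReal.ofReal ‖h‖ * B ^ 3 := by
    rw [eLpNorm_norm_rpow _ (by norm_num)]
    have : q * ENNReal.ofReal 3 = r := by rw [← hqr]; norm_num
    rw [this]
    refine (ENNReal.rpow_le_rpow (hB h) (by norm_num)).trans_eq ?_
    rw [ENNReal.mul_rpow_of_nonneg _ _ (by norm_num), ENNReal.ofReal_rpow_of_nonneg (by positivity)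
      (by norm_num), ← Real.rpow_mul (norm_nonneg h)]
    norm_num
  have h2 : ∫⁻ z, ‖g z * (‖w h z‖ ^ (3 : ℝ))‖ₑ ∂m ≤ eLpNorm g p m * (ENNReal.ofReal ‖h‖ * B ^ 3) := by
    have : ENNReal.HolderTriple p q 1 := hpq
    have h3 := eLpNorm_smul_le_mul_eLpNorm (p := p) (q := q) (r := 1)
      (f := fun z => ‖w h z‖ ^ (3 : ℝ)) (φ := g) (μ := m)
      (hwh.norm.pow_const _).aestronglyMeasurable hg
    rw [eLpNorm_one_eq_lintegral_enorm] at h3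
    exact h3.trans (by gcongr)
  calc ∫⁻ z, ‖g z * (partialD j ρ h * (‖w h z‖ ^ 2 * w h z j))‖ₑ ∂m
      ≤ ∫⁻ z, ‖partialD j ρ h‖ₑ * ‖g z * (‖w h z‖ ^ (3 : ℝ))‖ₑ ∂m := by
        refine lintegral_mono fun z => ?_
        rw [← enorm_mul, enorm_le_iff_norm_le, norm_mul, norm_mul, norm_mul, norm_mul, norm_mul]
        have h4 : ‖w h z j‖ ≤ ‖w h z‖ := PiLp.norm_apply_le _ _
        have h5 : ‖‖w h z‖ ^ (3 : ℝ)‖ = ‖w h z‖ ^ 2 * ‖w h z‖ := by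
          rw [Real.norm_of_nonneg (by positivity)]
          norm_cast
        have h6 : ‖‖w h z‖ ^ 2‖ = ‖w h z‖ ^ 2 := Real.norm_of_nonneg (by positivity)
        rw [h5, h6]
        calc ‖g z‖ * (‖partialD j ρ h‖ * (‖w h z‖ ^ 2 * ‖w h z j‖))
            ≤ ‖g z‖ * (‖partialD j ρ h‖ * (‖w h z‖ ^ 2 * ‖w h z‖)) := by gcongr
          _ = _ := by ring
    _ = ‖partialD j ρ h‖ₑ * ∫⁻ z, ‖g z * (‖w h z‖ ^ (3 : ℝ))‖ₑ ∂m :=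
        lintegral_const_mul' _ _ enorm_ne_top
    _ ≤ ‖partialD j ρ h‖ₑ * (eLpNorm g p m * (ENNReal.ofReal ‖h‖ * B ^ 3)) := by gcongr
    _ = _ := by ring

lemma lintegral_mul_incrementFlux_le (hρ : ContDiff ℝ ∞ ρ) (hw : Measurable (Function.uncurry w))
    {g : Ω → ℝ} (hg : Measurable g) :
    ∫⁻ z, ‖g z * incrementFlux ρ w z‖ₑ ∂m ≤
      ∑ j, ∫⁻ h, ∫⁻ z, ‖g z * (partialD j ρ h * (‖w h z‖ ^ 2 * w h z j))‖ₑ ∂m := by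
  have hm := measurable_flux_integrand hρ hw
  have hgm : ∀ j, Measurable fun q : EuclideanSpace ℝ (Fin d) × Ω =>
      ‖g q.2 * (partialD j ρ q.1 * (‖w q.1 q.2‖ ^ 2 * w q.1 q.2 j))‖ₑ := fun j =>
    ((hg.comp measurable_snd).mul (hm j)).enorm
  calc ∫⁻ z, ‖g z * incrementFlux ρ w z‖ₑ ∂m
      ≤ ∫⁻ z, ∑ j, (∫⁻ h, ‖g z * (partialD j ρ h * (‖w h z‖ ^ 2 * w h z j))‖ₑ) ∂m := by
        refine lintegral_mono fun z => ?_
        rw [← lintegral_finsetSum (μ := volume) (f := fun j (h : EuclideanSpace ℝ (Fin d)) =>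
          ‖g z * (partialD j ρ h * (‖w h z‖ ^ 2 * w h z j))‖ₑ) _ fun j _ =>
          (hgm j).comp measurable_prodMk_right, incrementFlux, ← integral_const_mul]
        refine (enorm_integral_le_lintegral_enorm _).trans (lintegral_mono fun h => ?_)
        rw [Finset.mul_sum]
        exact enorm_sum_le _ _
    _ = _ := by
        rw [lintegral_finsetSum (f := fun j z => ∫⁻ (h : EuclideanSpace ℝ (Fin d)),
          ‖g z * (partialD j ρ h * (‖w h z‖ ^ 2 * w h z j))‖ₑ) _
          fun j _ => (hgm j).lintegral_prod_left']
        exact Finset.sum_congr rfl fun j _ => lintegral_lintegral_swap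
          ((hgm j).comp measurable_swap).aemeasurable

/-- Fubini, identifying the tested flux with the expression in the Duchon–Robert formula.
`lintegral_mul_increment_le` supplies the finiteness. -/
lemma integral_mul_incrementFlux (hρ : ContDiff ℝ ∞ ρ) (hw : Measurable (Function.uncurry w))
    {g : Ω → ℝ} (hg : Measurable g)
    (hfin : ∑ j, ∫⁻ h, ∫⁻ z, ‖g z * (partialD j ρ h * (‖w h z‖ ^ 2 * w h z j))‖ₑ ∂m < ⊤) :
    ∫ z, g z * incrementFlux ρ w z ∂m =
      ∫ h, ∑ j, partialD j ρ h * ∫ z, g z * (‖w h z‖ ^ 2 * w h z j) ∂m := by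
  have hm := measurable_flux_integrand hρ hw
  have hint : ∀ j, Integrable (fun q : EuclideanSpace ℝ (Fin d) × Ω =>
      g q.2 * (partialD j ρ q.1 * (‖w q.1 q.2‖ ^ 2 * w q.1 q.2 j))) (volume.prod m) := by
    intro j
    have hgm : Measurable fun q : EuclideanSpace ℝ (Fin d) × Ω =>
        g q.2 * (partialD j ρ q.1 * (‖w q.1 q.2‖ ^ 2 * w q.1 q.2 j)) :=
      (hg.comp measurable_snd).mul (hm j)
    refine ⟨hgm.aestronglyMeasurable, ?_⟩
    rw [HasFiniteIntegral, lintegral_prod _ hgm.enorm.aemeasurable]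
    exact (ENNReal.sum_lt_top.1 hfin) j (Finset.mem_univ j)
  have hint' : Integrable (fun q : EuclideanSpace ℝ (Fin d) × Ω =>
      ∑ j, g q.2 * (partialD j ρ q.1 * (‖w q.1 q.2‖ ^ 2 * w q.1 q.2 j))) (volume.prod m) :=
    integrable_finsetSum _ fun j _ => hint j
  simp only [incrementFlux, ← integral_const_mul, Finset.mul_sum]
  rw [← integral_integral_swap (f := fun h z =>
    ∑ j, g z * (partialD j ρ h * (‖w h z‖ ^ 2 * w h z j))) hint']
  refine integral_congr_ae ?_
  filter_upwards [ae_all_iff.2 fun j => (hint j).prod_right_ae] with h hh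
  rw [integral_finsetSum _ fun j _ => hh j]
  refine Finset.sum_congr rfl fun j _ => ?_
  congr 1
  ext z
  ring

/-- On the support |∇ρ_k| ≤ C 2^{-k(d+1)}, |h| ≤ 2^k, and the volume is of order 2^{kd}: the powers
cancel, so the bound does not depend on k. -/
lemma IsDyadicKernel.lintegral_partialD_le {ρ Ψ : ℤ → EuclideanSpace ℝ (Fin d) → ℝ} {C : ℝ}
    (hρ : IsDyadicKernel ρ Ψ C) (hC : 0 < C) (k : ℤ) (j : Fin d) :
    ∫⁻ h, ‖partialD j (ρ k) h‖ₑ * ENNReal.ofReal ‖h‖ ≤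
      ENNReal.ofReal C * volume (Metric.closedBall (0 : EuclideanSpace ℝ (Fin d)) 1) := by
  have hs : (0 : ℝ) < 2 ^ k := by positivity
  calc ∫⁻ h, ‖partialD j (ρ k) h‖ₑ * ENNReal.ofReal ‖h‖
      ≤ ∫⁻ h, (Metric.closedBall (0 : EuclideanSpace ℝ (Fin d)) (2 ^ k)).indicator
          (fun _ => ENNReal.ofReal (C * ((2 : ℝ) ^ k)⁻¹ ^ (d + 1) * 2 ^ k)) h := by
        refine lintegral_mono fun h => ?_
        by_cases hh : h ∈ Metric.closedBall (0 : EuclideanSpace ℝ (Fin d)) (2 ^ k)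
        · rw [indicator_of_mem hh, ← ofReal_norm, ← ENNReal.ofReal_mul (norm_nonneg _)]
          have h1 := hρ.abs_partialD_le k j h
          have h2 := mem_closedBall_zero_iff.1 hh
          rw [Real.norm_eq_abs]
          gcongr
        · rw [indicator_of_notMem hh, image_eq_zero_of_notMem_tsupport fun h2 =>
            hh (hρ.tsupport_subset k (tsupport_partialD_subset j h2))]
          simp
    _ = ENNReal.ofReal C * volume (Metric.closedBall (0 : EuclideanSpace ℝ (Fin d)) 1) := by
        rw [lintegral_indicator Metric.isClosed_closedBall.measurableSet, setLIntegral_const,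
          Measure.addHaar_closedBall' _ _ hs.le, finrank_euclideanSpace_fin, ← mul_assoc,
          ← ENNReal.ofReal_mul (by positivity)]
        congr 2
        rw [pow_succ]
        have : ((2 : ℝ) ^ k)⁻¹ ^ d * (2 ^ k) ^ d = 1 := by
          rw [← mul_pow, inv_mul_cancel₀ hs.ne', one_pow]
        field_simp
        linear_combination this

end IncrementFlux

/-! ### From measures on an open set to measures on the ambient space -/

section SubtypeMeasure

variable {Y : Type*} [TopologicalSpace Y] [MeasurableSpace Y] [BorelSpace Y] {U : Set Y}

lemma absolutelyContinuous_map_subtype (hU : MeasurableSet U) {vol : Measure Y} {ν : Measure U}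
    (h : ν ≪ vol.comap (↑)) : ν.map (↑) ≪ vol := by
  have h1 := h.map (f := ((↑) : U → Y)) measurable_subtype_coe
  rw [map_comap_subtype_coe hU] at h1
  exact h1.trans Measure.restrict_le_self.absolutelyContinuous

/-- The density of the pushed-forward measure is the old density extended by zero. -/
lemma eLpNorm_rnDeriv_map_subtype (hU : MeasurableSet U) {vol : Measure Y} [SigmaFinite vol]
    {ν : Measure U} [SigmaFinite ν] (h : ν ≪ vol.comap (↑)) (q : ℝ≥0∞) :
    eLpNorm ((ν.map (↑)).rnDeriv vol) q (vol.restrict U) =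
      eLpNorm (ν.rnDeriv (vol.comap (↑))) q (vol.comap (↑)) := by
  have he : MeasurableEmbedding ((↑) : U → Y) := .subtype_coe hU
  have : SigmaFinite (vol.comap ((↑) : U → Y)) :=
    SigmaFinite.of_map _ measurable_subtype_coe.aemeasurable (by
      rw [map_comap_subtype_coe hU]; infer_instance)
  set F := ν.rnDeriv (vol.comap (↑)) with hF
  have hFm : Measurable F := Measure.measurable_rnDeriv _ _
  set G : Y → ℝ≥0∞ := Function.extend (↑) F 0
  have hGm : Measurable G := he.measurable_extend hFm measurable_const
  have hGF : ∀ x : U, G x = F x := fun x => Subtype.val_injective.extend_apply _ _ _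
  have hmap : ν.map (↑) = vol.withDensity G := by
    ext A hA
    rw [he.map_apply, withDensity_apply _ hA, ← Measure.withDensity_rnDeriv_eq _ _ h,
      withDensity_apply _ (he.measurable hA), ← hF]
    have h1 : ∫⁻ y in A, G y ∂vol = ∫⁻ y in A ∩ U, G y ∂vol := by
      rw [← lintegral_indicator hA, ← lintegral_indicator (hA.inter hU)]
      congr 1
      ext y
      by_cases hy : y ∈ U
      · by_cases hyA : y ∈ A <;> simp [hy, hyA]
      · have : G y = 0 := Function.extend_apply' _ _ _ (by rintro ⟨x, rfl⟩; exact hy x.2)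
        by_cases hyA : y ∈ A <;> simp [hy, hyA, this]
    rw [h1, ← Measure.restrict_restrict hA, ← map_comap_subtype_coe hU,
      he.restrict_map, he.lintegral_map]
    simp [hGF]
  have h2 : (ν.map (↑)).rnDeriv vol =ᵐ[vol.restrict U] G := by
    rw [hmap]
    exact ae_restrict_of_ae (Measure.rnDeriv_withDensity vol hGm)
  rw [eLpNorm_congr_ae h2, ← map_comap_subtype_coe hU,
    eLpNorm_map_measure hGm.aestronglyMeasurable measurable_subtype_coe.aemeasurable]
  congr 1
  ext x
  exact hGF x

lemma memLp_toReal {Z : Type*} [MeasurableSpace Z] {μ : Measure Z} {f : Z → ℝ≥0∞} {q : ℝ≥0∞}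
    (hf : Measurable f) (h : eLpNorm f q μ < ⊤) : MemLp (fun z => (f z).toReal) q μ := by
  refine ⟨hf.ennreal_toReal.aestronglyMeasurable, (eLpNorm_mono_enorm fun z => ?_).trans_lt h⟩
  rw [Real.enorm_of_nonneg ENNReal.toReal_nonneg]
  exact ENNReal.ofReal_toReal_le

/-- A pair of mutually singular locally finite measures on an open set, as a signed Radon
measure. -/
lemma exists_signedRadonMeasure_of_subtype (hU : IsOpen U) {vol : Measure Y} [SigmaFinite vol]
    {ν₁ ν₂ : Measure U} [SigmaFinite ν₁] [SigmaFinite ν₂] [IsFiniteMeasureOnCompacts ν₁]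
    [IsFiniteMeasureOnCompacts ν₂] (hs : ν₁ ⟂ₘ ν₂) :
    ∃ ν : SignedRadonMeasure U, (∀ φ, ν.integral φ = ∫ x, φ x ∂ν₁ - ∫ x, φ x ∂ν₂) ∧
      ∀ q C, C ≠ ⊤ →
        (ν₁ ≪ vol.comap (↑) ∧ eLpNorm (ν₁.rnDeriv (vol.comap (↑))) q (vol.comap (↑)) ≤ C) →
        (ν₂ ≪ vol.comap (↑) ∧ eLpNorm (ν₂.rnDeriv (vol.comap (↑))) q (vol.comap (↑)) ≤ C) →
        ν.IsAbsolutelyContinuous vol ∧ MemLp (ν.density vol) q (vol.restrict U) := by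
  have he : MeasurableEmbedding ((↑) : U → Y) := .subtype_coe hU.measurableSet
  have hcompl : ∀ ν : Measure U, ν.map (↑) Uᶜ = 0 := fun ν => by
    rw [he.map_apply]; simp
  have hcomp : ∀ (ν : Measure U) [IsFiniteMeasureOnCompacts ν] (K : Set Y), IsCompact K → K ⊆ U →
      ν.map (↑) K < ⊤ := fun ν _ K hK hKU => by
    rw [he.map_apply]
    refine IsCompact.measure_lt_top ?_
    rw [Subtype.isCompact_iff, Subtype.image_preimage_coe, inter_eq_right.2 hKU]
    exact hK
  refine ⟨⟨ν₁.map (↑), ν₂.map (↑), hcompl _, hcompl _, hcomp _, hcomp _, ?_⟩, ?_, ?_⟩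
  · obtain ⟨S, hS, h1, h2⟩ := hs
    refine ⟨(↑) '' S, he.measurableSet_image.2 hS, ?_, ?_⟩
    · rw [he.map_apply, preimage_image_eq _ Subtype.val_injective, h1]
    · rw [he.map_apply, preimage_compl, preimage_image_eq _ Subtype.val_injective, h2]
  · intro φ
    simp only [SignedRadonMeasure.integral, he.integral_map]
  · rintro q C hC ⟨h1, h2⟩ ⟨h3, h4⟩
    refine ⟨⟨absolutelyContinuous_map_subtype hU.measurableSet h1,
      absolutelyContinuous_map_subtype hU.measurableSet h3⟩, MemLp.sub ?_ ?_⟩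
    · refine memLp_toReal (Measure.measurable_rnDeriv _ _) ?_
      rw [eLpNorm_rnDeriv_map_subtype hU.measurableSet h1]
      exact h2.trans_lt hC.lt_top
    · refine memLp_toReal (Measure.measurable_rnDeriv _ _) ?_
      rw [eLpNorm_rnDeriv_map_subtype hU.measurableSet h3]
      exact h4.trans_lt hC.lt_top

end SubtypeMeasure

/-! ### The dissipation as a signed Radon measure -/

section DissipationMeasure

variable {d : ℕ} {X : Type*} [AddCommGroup X] [TopologicalSpace X] [T2Space X]
  [LocallyCompactSpace X] [SecondCountableTopology X] [MeasureSpace X] [BorelSpace X]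
  [SigmaFinite (volume : Measure X)] [IsFiniteMeasureOnCompacts (volume : Measure (ℝ × X))]
  [MeasurableSub₂ X] {π : EuclideanSpace ℝ (Fin d) → X} {I : Set ℝ} {r : ℝ≥0∞}
  {v : ℝ × X → EuclideanSpace ℝ (Fin d)} {p : ℝ × X → ℝ}
  {ρ Ψ : ℤ → EuclideanSpace ℝ (Fin d) → ℝ} {C : ℝ}

/-- If the dissipation of a velocity field with `1/3` of a derivative in `L^r` is the limit of its
local energy fluxes, then it is a signed Radon measure, with a density in `L^{r/3}` if `r > 3`. -/
theorem exists_signedRadonMeasure_of_tendsto (hI : IsOpen I) (hr : 3 ≤ r)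
    (hv : StronglyMeasurable v) (hB : MemLtBesov π I (1 / 3) r v) (hπ : Measurable π)
    (hπ0 : π 0 = 0) (hcont : ∀ φ, IsSpaceTimeTest π I φ → Continuous φ)
    (hρ : IsDyadicKernel ρ Ψ C) (hC : 0 < C)
    (hlim : ∀ φ, IsSpaceTimeTest π I φ → Tendsto (fun n : ℕ => -(1 / 4) * ∫ h, ∑ j,
      partialD j (ρ (-n)) h * ∫ z in I ×ˢ univ, φ z * cubicIncrement π v h j z) atTop
      (𝓝 (dissipation π I v p φ))) :
    ∃ ν : SignedRadonMeasure (I ×ˢ (univ : Set X)),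
      (∀ φ, IsSpaceTimeTest π I φ → dissipation π I v p φ = ν.integral φ) ∧
      (3 < r → ν.IsAbsolutelyContinuous volume ∧
        MemLp (ν.density volume) (r / 3) (volume.restrict (I ×ˢ univ))) := by
  set U : Set (ℝ × X) := I ×ˢ univ with hU
  have hUo : IsOpen U := hI.prod isOpen_univ
  have hUm := hUo.measurableSet
  have : LocallyCompactSpace U := hUo.locallyCompactSpace
  have he : MeasurableEmbedding ((↑) : U → ℝ × X) := .subtype_coe hUm
  -- The weak limit is taken on U as a space of its own, so that only compact subsets of I × X
  -- matter and no finiteness up to the boundary of I is claimed.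
  set m : Measure U := (volume : Measure (ℝ × X)).comap (↑) with hm
  have hmap : m.map (↑) = (volume : Measure (ℝ × X)).restrict U := map_comap_subtype_coe hUm _
  have : SigmaFinite m := SigmaFinite.of_map _ measurable_subtype_coe.aemeasurable (by
    rw [hmap]; infer_instance)
  have : IsFiniteMeasureOnCompacts m := ⟨fun K hK => by
    rw [hm, he.comap_apply]
    exact (hK.image continuous_subtype_val).measure_lt_top⟩
  have hr0 : r ≠ 0 := (lt_of_lt_of_le (by norm_num) hr).ne'
  have hq : 1 ≤ r / 3 := by
    rw [ENNReal.le_div_iff_mul_le (by simp) (by simp)]; simpa using hr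
  set q := r / 3 with hqdef
  set B := eLpNorm (fun t => besovNorm π (1 / 3) r fun x => v (t, x)) r (volume.restrict I)
  have hBt : B ≠ ⊤ := hB.2.ne
  set w : EuclideanSpace ℝ (Fin d) → U → EuclideanSpace ℝ (Fin d) := fun h z =>
    v (z.1.1, z.1.2 - π h) - v z with hwdef
  have hw : Measurable (Function.uncurry w) := by
    refine Measurable.sub (hv.measurable.comp ?_) (hv.measurable.comp ?_)
    · exact ((measurable_fst.comp measurable_subtype_coe).comp measurable_snd).prodMk
        (((measurable_snd.comp measurable_subtype_coe).comp measurable_snd).sub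
          (hπ.comp measurable_fst))
    · exact measurable_subtype_coe.comp measurable_snd
  have hwB : ∀ h, eLpNorm (w h) r m ≤ ENNReal.ofReal (‖h‖ ^ (1 / 3 : ℝ)) * B := by
    intro h
    refine le_trans (le_of_eq ?_) (eLpNorm_sub_le_besov hr0 hv hπ0 h)
    rw [← hmap, eLpNorm_map_measure _ measurable_subtype_coe.aemeasurable]
    · rfl
    · exact ((hv.comp_measurable (measurable_fst.prodMk (measurable_snd.sub_const _))).sub
        hv).aestronglyMeasurable
  have hqr : q * 3 = r := ENNReal.div_mul_cancel (by simp) (by simp)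
  set V := volume (Metric.closedBall (0 : EuclideanSpace ℝ (Fin d)) 1)
  have hV : V ≠ ⊤ := measure_closedBall_lt_top.ne
  set A : ℝ≥0∞ := (d * (ENNReal.ofReal C * V)) * B ^ 3
  have hA : A ≠ ⊤ := by finiteness
  -- The test functions are measured in the exponent dual to r / 3. It is infinite exactly when r =
  -- 3, and then the limit is only a measure.
  have hpq : ENNReal.HolderConjugate q.conjExponent q :=
    (ENNReal.HolderConjugate.conjExponent hq).symm
  have hbound : ∀ n : ℕ, ∀ g : C_c(U, ℝ), ∑ j, ∫⁻ h, ∫⁻ z,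
      ‖g z * (partialD j (ρ (-n)) h * (‖w h z‖ ^ 2 * w h z j))‖ₑ ∂m ≤
      A * eLpNorm g q.conjExponent m := by
    intro n g
    refine (lintegral_mul_increment_le hpq hqr (hρ.contDiff _) hw hwB
      g.continuous.aestronglyMeasurable).trans ?_
    have hsum : ∑ j, ∫⁻ h, ‖partialD j (ρ (-n)) h‖ₑ * ENNReal.ofReal ‖h‖ ≤
        d * (ENNReal.ofReal C * V) :=
      (Finset.sum_le_card_nsmul _ _ _ fun j _ =>
        hρ.lintegral_partialD_le hC (-n) j).trans_eq (by simp [V])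
    simp only [A]
    gcongr
    exact le_rfl
  set f : ℕ → U → ℝ := fun n z => -(1 / 4) * incrementFlux (ρ (-n)) w z
  have hfm : ∀ n, Measurable (f n) := fun n =>
    ((stronglyMeasurable_incrementFlux (hρ.contDiff _) hw).measurable).const_mul _
  obtain ⟨ν₁, ν₂, hν₁, hν₂, hs, hD, hac⟩ := exists_mutuallySingular_tendsto_integral_mul
    (vol := m) hA hpq f hfm (by
      intro n g
      refine le_trans (lintegral_mono fun z => ?_) ((lintegral_mul_incrementFlux_le
        (hρ.contDiff (-n)) hw g.continuous.measurable).trans (hbound n g))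
      rw [enorm_le_iff_norm_le, norm_mul, norm_mul, norm_mul]
      have h1 : ‖(-(1 / 4) : ℝ)‖ ≤ 1 := by norm_num
      exact mul_le_mul_of_nonneg_left (mul_le_of_le_one_left (norm_nonneg _) h1) (norm_nonneg _))
  have : IsLocallyFiniteMeasure ν₁ := isLocallyFiniteMeasure_of_isFiniteMeasureOnCompacts
  have : IsLocallyFiniteMeasure ν₂ := isLocallyFiniteMeasure_of_isFiniteMeasureOnCompacts
  obtain ⟨ν, hνint, hνac⟩ := exists_signedRadonMeasure_of_subtype hUo
    (vol := (volume : Measure (ℝ × X))) hs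
  refine ⟨ν, fun φ hφ => ?_, fun hr3 => ?_⟩
  · have hφc := hcont φ hφ
    have hgc : HasCompactSupport fun z : U => φ z := by
      refine HasCompactSupport.intro (K := ((↑) : U → ℝ × X) ⁻¹' tsupport φ) ?_ fun z hz =>
        image_eq_zero_of_notMem_tsupport (f := φ) hz
      rw [Subtype.isCompact_iff, Subtype.image_preimage_coe, inter_eq_right.2 hφ.2.2]
      exact hφ.2.1
    set g : C_c(U, ℝ) := ⟨⟨fun z => φ z, hφc.comp continuous_subtype_val⟩, hgc⟩
    rw [hνint]
    refine hD g _ ((hlim φ hφ).congr fun n => ?_)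
    have h1 := integral_mul_incrementFlux (m := m) (hρ.contDiff (-n)) hw (g := g) g.continuous.measurable
      ((hbound n g).trans_lt (ENNReal.mul_lt_top hA.lt_top
        (eLpNorm_lt_top_of_compactlySupported _ g)))
    have h2 : ∀ z, g z * f n z = -(1 / 4) * (g z * incrementFlux (ρ (-n)) w z) := fun z => by
      simp only [f]; ring
    simp only [h2]
    rw [integral_const_mul, h1]
    congr 2
    ext h
    refine Finset.sum_congr rfl fun j _ => ?_
    rw [← hmap, he.integral_map]
    rfl
  · have hp : q.conjExponent ≠ ⊤ := by
      have : 1 < q := by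
        rw [hqdef, ENNReal.lt_div_iff_mul_lt (by simp) (by simp)]; simpa using hr3
      exact ((ENNReal.HolderConjugate.lt_top_iff_one_lt _ q).2 this).ne
    exact hνac q A hA (hac hp).1 (hac hp).2

end DissipationMeasure

/-! ### Subtracting a function of time from the pressure -/

section SubTime

variable {d : ℕ} {I : Set ℝ} {v : ℝ × EuclideanSpace ℝ (Fin d) → EuclideanSpace ℝ (Fin d)}
  {p : ℝ × EuclideanSpace ℝ (Fin d) → ℝ} {c : ℝ → ℝ}

lemma locallyIntegrableOn_comp_fst {X : Type*} [TopologicalSpace X] [MeasureSpace X]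
    [OpensMeasurableSpace X] [LocallyCompactSpace X] [T2Space X]
    [SFinite (volume : Measure X)]
    [IsFiniteMeasureOnCompacts (volume : Measure X)] (hI : IsOpen I)
    (hc : LocallyIntegrableOn c I) :
    LocallyIntegrableOn (fun z : ℝ × X => c z.1) (I ×ˢ univ) := by
  rw [locallyIntegrableOn_iff (hI.prod isOpen_univ).isLocallyClosed]
  intro K hKU hK
  have hJ : IsCompact (Prod.fst '' K) := hK.image continuous_fst
  have hJI : Prod.fst '' K ⊆ I := by rintro _ ⟨z, hz, rfl⟩; exact (hKU hz).1
  have hB : IsCompact (Prod.snd '' K) := hK.image continuous_snd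
  have : IsFiniteMeasure ((volume : Measure X).restrict (Prod.snd '' K)) :=
    ⟨by simpa using hB.measure_lt_top⟩
  have h1 := (hc.integrableOn_compact_subset hJI hJ).comp_fst
    ((volume : Measure X).restrict (Prod.snd '' K))
  rw [Measure.prod_restrict] at h1
  have hsub : K ⊆ (Prod.fst '' K) ×ˢ (Prod.snd '' K) := fun z hz => ⟨⟨z, hz, rfl⟩, ⟨z, hz, rfl⟩⟩
  exact h1.mono_measure (Measure.restrict_mono hsub le_rfl)

lemma IsSpaceTimeTest.continuous_spaceDeriv {φ : ℝ × EuclideanSpace ℝ (Fin d) → ℝ}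
    (hφ : IsSpaceTimeTest id I φ) (j : Fin d) : Continuous (spaceDeriv id j φ) := by
  have h := isSpaceTimeTest_id_iff.1 hφ
  rw [show spaceDeriv id j φ = fun z => fderiv ℝ φ z (0, EuclideanSpace.single j 1) from
    funext fun z => spaceDeriv_id_eq_fderiv h.1 j z]
  exact (h.1.continuous_fderiv (by simp)).clm_apply continuous_const

lemma IsSpaceTimeTest.tsupport_spaceDeriv_subset {φ : ℝ × EuclideanSpace ℝ (Fin d) → ℝ}
    (hφ : IsSpaceTimeTest id I φ) (j : Fin d) : tsupport (spaceDeriv id j φ) ⊆ tsupport φ := by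
  have h := isSpaceTimeTest_id_iff.1 hφ
  rw [show spaceDeriv id j φ = fun z => fderiv ℝ φ z (0, EuclideanSpace.single j 1) from
    funext fun z => spaceDeriv_id_eq_fderiv h.1 j z]
  exact tsupport_fderiv_apply_subset ℝ _

lemma IsSpaceTimeTest.hasCompactSupport_spaceDeriv {φ : ℝ × EuclideanSpace ℝ (Fin d) → ℝ}
    (hφ : IsSpaceTimeTest id I φ) (j : Fin d) : HasCompactSupport (spaceDeriv id j φ) :=
  hφ.2.1.isCompact.of_isClosed_subset (isClosed_tsupport _) (hφ.tsupport_spaceDeriv_subset j)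

lemma IsSpaceTimeTest.integral_spaceDeriv {φ : ℝ × EuclideanSpace ℝ (Fin d) → ℝ}
    (hφ : IsSpaceTimeTest id I φ) (j : Fin d) (t : ℝ) : ∫ x, spaceDeriv id j φ (t, x) = 0 := by
  have h := isSpaceTimeTest_id_iff.1 hφ
  have hs : ContDiff ℝ ∞ fun x : EuclideanSpace ℝ (Fin d) => φ (t, x) :=
    h.1.comp (contDiff_const.prodMk contDiff_id)
  have hc : HasCompactSupport fun x : EuclideanSpace ℝ (Fin d) => φ (t, x) := by
    refine HasCompactSupport.intro (h.2.1.isCompact.image continuous_snd) fun x hx => ?_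
    exact image_eq_zero_of_notMem_tsupport (f := φ) fun h2 => hx ⟨_, h2, rfl⟩
  rw [← integral_partialD_eq_zero hs hc j]
  congr 1
  ext x
  have h1 := (h.1.differentiable (by simp) (t, x)).hasFDerivAt
  have h2 : HasFDerivAt (fun x : EuclideanSpace ℝ (Fin d) => φ (t, x)) _ x :=
    h1.comp x (hasFDerivAt_prodMk_right t x)
  rw [spaceDeriv_id_eq_fderiv h.1, partialD, h2.fderiv]
  simp

/-- Subtracting a function of time from the pressure preserves the Euler equations. -/
theorem IsWeakEulerSolution.sub_time (hI : IsOpen I) (h : IsWeakEulerSolution id I v p)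
    (hc : LocallyIntegrableOn c I) : IsWeakEulerSolution id I v fun z => p z - c z.1 where
  aestronglyMeasurable := h.aestronglyMeasurable
  locallyIntegrable_sq := h.locallyIntegrable_sq
  locallyIntegrable_pressure := h.locallyIntegrable_pressure.sub (locallyIntegrableOn_comp_fst hI hc)
  incompressible := h.incompressible
  momentum φ hφ l := by
    have hU := (hI.prod isOpen_univ (Y := EuclideanSpace ℝ (Fin d))).measurableSet
    have hφ' := isSpaceTimeTest_id_iff.1 hφ
    have hk := hφ.continuous_spaceDeriv
    have hkc := hφ.hasCompactSupport_spaceDeriv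
    have hkU := fun j => (hφ.tsupport_spaceDeriv_subset j).trans hφ.2.2
    have htd : timeDeriv φ = fun z => fderiv ℝ φ z (1, 0) := funext (timeDeriv_eq_fderiv hφ'.1)
    have i0 : IntegrableOn (fun z => v z l * timeDeriv φ z) (I ×ˢ univ) := by
      rw [htd]
      exact integrableOn_mul_of_locallyIntegrableOn hU (h.locallyIntegrableOn_velocity hI l)
        ((hφ'.1.continuous_fderiv (by simp)).clm_apply continuous_const)
        (hφ.2.1.fderiv_apply ℝ _) ((tsupport_fderiv_apply_subset ℝ _).trans hφ.2.2)
    have i1 : IntegrableOn (fun z => ∑ j, v z j * v z l * spaceDeriv id j φ z) (I ×ˢ univ) :=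
      integrable_finsetSum _ fun j _ => integrableOn_mul_of_locallyIntegrableOn hU
        (h.locallyIntegrableOn_mul hI j l) (hk j) (hkc j) (hkU j)
    have i2 : IntegrableOn (fun z => p z * spaceDeriv id l φ z) (I ×ˢ univ) :=
      integrableOn_mul_of_locallyIntegrableOn hU h.locallyIntegrable_pressure (hk l) (hkc l) (hkU l)
    have i3 : IntegrableOn (fun z => c z.1 * spaceDeriv id l φ z) (I ×ˢ univ) :=
      integrableOn_mul_of_locallyIntegrableOn hU (locallyIntegrableOn_comp_fst hI hc) (hk l)
        (hkc l) (hkU l)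
    -- At each fixed time the spatial derivative of φ integrates to zero.
    have h3 : ∫ z in I ×ˢ univ, c z.1 * spaceDeriv id l φ z = 0 := by
      rw [Measure.volume_eq_prod] at i3 ⊢
      rw [setIntegral_prod _ i3]
      simp [integral_const_mul, hφ.integral_spaceDeriv]
    have h4 := h.momentum φ hφ l
    have i4 : IntegrableOn (fun z => v z l * timeDeriv φ z
        + (∑ j, v z j * v z l * spaceDeriv id j φ z) + p z * spaceDeriv id l φ z)
        (I ×ˢ univ) := (i0.add i1).add i2
    have h5 := integral_sub i4 i3
    rw [h4, h3, sub_zero] at h5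
    rw [← h5]
    congr 1
    ext z
    ring

/-- Subtracting a function of time from the pressure does not change the dissipation. -/
theorem IsWeakEulerSolution.dissipation_sub_time (hI : IsOpen I)
    (h : IsWeakEulerSolution id I v p) (hv : LocallyIntegrableOn (fun z => ‖v z‖ ^ 2 • v z) (I ×ˢ univ))
    (hpv : LocallyIntegrableOn (fun z => p z • v z) (I ×ˢ univ))
    (hcv : LocallyIntegrableOn (fun z => c z.1 • v z) (I ×ˢ univ))
    {φ : ℝ × EuclideanSpace ℝ (Fin d) → ℝ} (hφ : IsSpaceTimeTest id I φ) :
    dissipation id I v (fun z => p z - c z.1) φ = dissipation id I v p φ := by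
  have hU := (hI.prod isOpen_univ (Y := EuclideanSpace ℝ (Fin d))).measurableSet
  have hUl := (hI.prod isOpen_univ (Y := EuclideanSpace ℝ (Fin d))).isLocallyClosed
  have hφ' := isSpaceTimeTest_id_iff.1 hφ
  have hk := hφ.continuous_spaceDeriv
  have hkc := hφ.hasCompactSupport_spaceDeriv
  have hkU := fun j => (hφ.tsupport_spaceDeriv_subset j).trans hφ.2.2
  have htd : timeDeriv φ = fun z => fderiv ℝ φ z (1, 0) := funext (timeDeriv_eq_fderiv hφ'.1)
  have hcomp : ∀ {w : ℝ × EuclideanSpace ℝ (Fin d) → EuclideanSpace ℝ (Fin d)} (j : Fin d),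
      LocallyIntegrableOn w (I ×ˢ univ) → LocallyIntegrableOn (fun z => w z j) (I ×ˢ univ) := by
    intro w j hw
    rw [locallyIntegrableOn_iff hUl] at hw ⊢
    exact fun K hKU hK => (hw K hKU hK).eval_piLp j
  have i0 : IntegrableOn (fun z => ‖v z‖ ^ 2 / 2 * timeDeriv φ z) (I ×ˢ univ) := by
    rw [htd]
    refine integrableOn_mul_of_locallyIntegrableOn hU ?_
      ((hφ'.1.continuous_fderiv (by simp)).clm_apply continuous_const)
      (hφ.2.1.fderiv_apply ℝ _) ((tsupport_fderiv_apply_subset ℝ _).trans hφ.2.2)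
    rw [locallyIntegrableOn_iff hUl]
    exact fun K hKU hK => (h.locallyIntegrable_sq.integrableOn_compact_subset hKU hK).div_const _
  have i1 : ∀ j, IntegrableOn (fun z => (‖v z‖ ^ 2 / 2 + p z) * v z j * spaceDeriv id j φ z)
      (I ×ˢ univ) := by
    intro j
    have h1 := integrableOn_mul_of_locallyIntegrableOn hU (hcomp j hv) (hk j) (hkc j) (hkU j)
    have h2 := integrableOn_mul_of_locallyIntegrableOn hU (hcomp j hpv) (hk j) (hkc j) (hkU j)
    refine ((h1.div_const 2).add h2).congr (.of_forall fun z => ?_)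
    simp
    ring
  have i2 : IntegrableOn (fun z => ∑ j, (‖v z‖ ^ 2 / 2 + p z) * v z j * spaceDeriv id j φ z)
      (I ×ˢ univ) := integrable_finsetSum _ fun j _ => i1 j
  have i3 : IntegrableOn (fun z => c z.1 * ∑ j, v z j * spaceDeriv id j φ z) (I ×ˢ univ) := by
    have : IntegrableOn (fun z => ∑ j, (c z.1 • v z) j * spaceDeriv id j φ z) (I ×ˢ univ) :=
      integrable_finsetSum _ fun j _ =>
        integrableOn_mul_of_locallyIntegrableOn hU (hcomp j hcv) (hk j) (hkc j) (hkU j)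
    refine this.congr (.of_forall fun z => ?_)
    simp [Finset.mul_sum, mul_assoc]
  -- Since c is merely locally integrable, c(t) φ is not a test function. Incompressibility is first
  -- localized to almost every time with smooth a(t) φ, and only then multiplied by c.
  have hslice : ∀ᵐ t, t ∈ I → ∫ x, ∑ j, v (t, x) j * spaceDeriv id j φ (t, x) = 0 := by
    refine ae_integral_slice_eq_zero (F := fun z => ∑ j, v z j * spaceDeriv id j φ z) hI
      (fun J hJI hJ => ?_) fun a ha hac haI => ?_
    · have : IntegrableOn (fun z => ∑ j, v z j * spaceDeriv id j φ z) (I ×ˢ univ) :=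
        integrable_finsetSum _ fun j _ => integrableOn_mul_of_locallyIntegrableOn hU
          (h.locallyIntegrableOn_velocity hI j) (hk j) (hkc j) (hkU j)
      exact this.mono_set (prod_mono_left hJI)
    · have hφa : IsSpaceTimeTest id I fun z : ℝ × EuclideanSpace ℝ (Fin d) => a z.1 * φ z := by
        refine isSpaceTimeTest_id_iff.2 ⟨by have := hφ'.1; fun_prop, hφ.2.1.mul_left,
          (tsupport_mul_subset_right).trans hφ.2.2⟩
      have h1 := h.incompressible _ hφa
      rw [← h1]
      congr 1
      ext z
      rw [Finset.mul_sum]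
      refine Finset.sum_congr rfl fun j _ => ?_
      have : spaceDeriv id j (fun z => a z.1 * φ z) z = a z.1 * spaceDeriv id j φ z := by
        simp only [spaceDeriv]
        exact deriv_const_mul_field _
      rw [this]
      ring
  have h3 : ∫ z in I ×ˢ univ, c z.1 * ∑ j, v z j * spaceDeriv id j φ z = 0 := by
    rw [Measure.volume_eq_prod] at i3 ⊢
    rw [setIntegral_prod _ i3, Measure.restrict_univ]
    refine setIntegral_eq_zero_of_ae_eq_zero ?_
    filter_upwards [hslice] with t ht htI
    rw [integral_const_mul, ht htI, mul_zero]
  have i4 : IntegrableOn (fun z => ‖v z‖ ^ 2 / 2 * timeDeriv φ z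
      + ∑ j, (‖v z‖ ^ 2 / 2 + p z) * v z j * spaceDeriv id j φ z) (I ×ˢ univ) := i0.add i2
  rw [dissipation, dissipation, ← sub_zero (∫ z in I ×ˢ univ, (‖v z‖ ^ 2 / 2 * timeDeriv φ z
      + ∑ j, (‖v z‖ ^ 2 / 2 + p z) * v z j * spaceDeriv id j φ z)), ← h3, ← integral_sub i4 i3]
  congr 1
  ext z
  rw [Finset.mul_sum, add_sub_assoc, ← Finset.sum_sub_distrib]
  congr 1
  refine Finset.sum_congr rfl fun j _ => ?_
  ring

/-- The Duchon–Robert formula, when the pressure is regular up to a function of time. -/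
theorem IsWeakEulerSolution.tendsto_dissipation_sub_time (hI : IsOpen I)
    (h : IsWeakEulerSolution id I v p)
    (hv : ∀ K ⊆ I ×ˢ univ, IsCompact K → MemLp v 3 (volume.restrict K))
    {a a' : ℝ≥0∞} (haa : ENNReal.HolderConjugate a a') (hc : LocallyIntegrableOn c I)
    (hpa : ∀ K ⊆ I ×ˢ univ, IsCompact K → MemLp (fun z => p z - c z.1) a (volume.restrict K))
    (hva : ∀ K ⊆ I ×ˢ univ, IsCompact K → MemLp v a' (volume.restrict K))
    (hpv : LocallyIntegrableOn (fun z => p z • v z) (I ×ˢ univ))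
    {ρ : ℕ → EuclideanSpace ℝ (Fin d) → ℝ} {r : ℕ → ℝ}
    (hρ : ∀ n, ContDiff ℝ ∞ (ρ n)) (hρc : ∀ n, HasCompactSupport (ρ n))
    (hρ0 : ∀ n x, 0 ≤ ρ n x) (hρ1 : ∀ n, ∫ x, ρ n x = 1) (hr : Tendsto r atTop (𝓝 0))
    (hρr : ∀ n, tsupport (ρ n) ⊆ Metric.closedBall 0 (r n))
    {φ : ℝ × EuclideanSpace ℝ (Fin d) → ℝ} (hφ : IsSpaceTimeTest id I φ) :
    Tendsto (fun n => -(1 / 4) * ∫ h, ∑ j, partialD j (ρ n) h *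
      ∫ z in I ×ˢ univ, φ z * cubicIncrement id v h j z) atTop (𝓝 (dissipation id I v p φ)) := by
  have hUl := (hI.prod isOpen_univ (Y := EuclideanSpace ℝ (Fin d))).isLocallyClosed
  have hpcv : LocallyIntegrableOn (fun z => (p z - c z.1) • v z) (I ×ˢ univ) := by
    rw [locallyIntegrableOn_iff hUl]
    intro K hKU hK
    have : ENNReal.HolderTriple a' a 1 := haa.symm
    exact memLp_one_iff_integrable.1 ((hva K hKU hK).smul (hpa K hKU hK))
  -- Integrability of c v follows by difference from that of p v and of (p - c) v, the latter by
  -- Hölder.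
  have hcv : LocallyIntegrableOn (fun z => c z.1 • v z) (I ×ˢ univ) :=
    (hpv.sub hpcv).congr (.of_forall fun z => by simp [sub_smul])
  have hv3 : LocallyIntegrableOn (fun z => ‖v z‖ ^ 2 • v z) (I ×ˢ univ) := by
    rw [locallyIntegrableOn_iff hUl]
    intro K hKU hK
    have h1 := hv K hKU hK
    have h2 := h1.integrable_norm_pow (p := 3) (by norm_num)
    have hn : AEStronglyMeasurable (fun z => ‖v z‖ ^ 2) (volume.restrict K) := h1.1.norm.pow 2
    refine h2.mono' (hn.smul h1.1) (.of_forall fun z => ?_)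
    rw [norm_smul, Real.norm_of_nonneg (by positivity)]
    exact (by ring : ‖v z‖ ^ 2 * ‖v z‖ = ‖v z‖ ^ 3).le
  rw [← h.dissipation_sub_time hI hv3 hpv hcv hφ]
  exact tendsto_dissipation hI (h.sub_time hI hc) hv haa hpa hva hρ hρc hρ0 hρ1 hr hρr hφ

end SubTime

/-! ### Change of representatives, and dimension zero -/

section Congr

variable {d : ℕ} {X : Type*} [AddCommGroup X] [TopologicalSpace X] [MeasureSpace X]
  {π : EuclideanSpace ℝ (Fin d) → X} {I : Set ℝ} {r : ℝ≥0∞}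
  {v v' : ℝ × X → EuclideanSpace ℝ (Fin d)} {p p' : ℝ × X → ℝ}

lemma locallyIntegrableOn_congr_ae {Y E : Type*} [TopologicalSpace Y] [MeasurableSpace Y]
    [NormedAddCommGroup E] {μ : Measure Y} {f g : Y → E} {s : Set Y} (hf : LocallyIntegrableOn f s μ)
    (hfg : f =ᵐ[μ.restrict s] g) (hs : MeasurableSet s) : LocallyIntegrableOn g s μ := by
  intro x hx
  obtain ⟨t, ht, hft⟩ := hf x hx
  refine ⟨t ∩ s, inter_mem ht self_mem_nhdsWithin, ?_⟩
  exact (hft.mono_set inter_subset_left).congr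
    (ae_mono (Measure.restrict_mono inter_subset_right le_rfl) hfg)

lemma dissipation_congr_ae (hv : v =ᵐ[volume.restrict (I ×ˢ univ)] v')
    (hp : p =ᵐ[volume.restrict (I ×ˢ univ)] p') (φ : ℝ × X → ℝ) :
    dissipation π I v p φ = dissipation π I v' p' φ := by
  refine integral_congr_ae ?_
  filter_upwards [hv, hp] with z h1 h2
  rw [h1, h2]

lemma IsWeakEulerSolution.congr_ae [OpensMeasurableSpace X] [SecondCountableTopology X]
    (h : IsWeakEulerSolution π I v p) (hI : IsOpen I)
    (hv : v =ᵐ[volume.restrict (I ×ˢ univ)] v') (hp : p =ᵐ[volume.restrict (I ×ˢ univ)] p') :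
    IsWeakEulerSolution π I v' p' where
  aestronglyMeasurable := h.aestronglyMeasurable.congr hv
  locallyIntegrable_sq := locallyIntegrableOn_congr_ae h.locallyIntegrable_sq
    (hv.fun_comp fun x => ‖x‖ ^ 2) (hI.prod isOpen_univ).measurableSet
  locallyIntegrable_pressure := locallyIntegrableOn_congr_ae h.locallyIntegrable_pressure
    hp (hI.prod isOpen_univ).measurableSet
  momentum φ hφ l := by
    rw [← h.momentum φ hφ l]
    refine integral_congr_ae ?_
    filter_upwards [hv, hp] with z h1 h2
    rw [h1, h2]
  incompressible φ hφ := by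
    rw [← h.incompressible φ hφ]
    refine integral_congr_ae ?_
    filter_upwards [hv] with z h1
    rw [h1]

/-- The Besov norm involves all translates of a slice. Translations preserve null sets, so for
almost every t the norms agree simultaneously for all h. -/
lemma MemLtBesov.congr_ae [SFinite (volume : Measure X)] [MeasurableAdd X]
    [(volume : Measure X).IsAddRightInvariant] {s : ℝ} (h : MemLtBesov π I s r v)
    (hv : v =ᵐ[volume.restrict (I ×ˢ univ)] v') : MemLtBesov π I s r v' := by
  refine ⟨h.1.congr hv, lt_of_eq_of_lt (eLpNorm_congr_ae ?_) h.2⟩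
  rw [Measure.volume_eq_prod, ← Measure.prod_restrict, Measure.restrict_univ] at hv
  filter_upwards [Measure.ae_ae_of_ae_prod hv] with t ht
  have h1 : ∀ᵐ x, v (t, x) = v' (t, x) := ht
  have h2 : ∀ h, eLpNorm (fun x => v (t, x - π h) - v (t, x)) r volume =
      eLpNorm (fun x => v' (t, x - π h) - v' (t, x)) r volume := fun h => eLpNorm_congr_ae <| by
    have h3 := (measurePreserving_sub_right (volume : Measure X) (π h)).quasiMeasurePreserving.ae h1
    filter_upwards [h1, h3] with x hx hx'
    rw [hx, hx']
  simp only [besovNorm, h2, eLpNorm_congr_ae h1]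

/-- In dimension zero the velocity vanishes. -/
lemma exists_signedRadonMeasure_of_dim_eq_zero (hd : d = 0) :
    (∃ c : ℝ → ℝ, LocallyIntegrableOn c I ∧
      LocallyIntegrableOn (fun z => (p z - c z.1) • v z) (I ×ˢ univ)) ∧
    ∃ ν : SignedRadonMeasure (I ×ˢ (univ : Set X)),
      (∀ φ, IsSpaceTimeTest π I φ → dissipation π I v p φ = ν.integral φ) ∧
      (3 < r → ν.IsAbsolutelyContinuous volume ∧
        MemLp (ν.density volume) (r / 3) (volume.restrict (I ×ˢ univ))) := by
  subst hd
  have hv : ∀ z, v z = 0 := fun z => Subsingleton.elim _ _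
  refine ⟨⟨0, locallyIntegrableOn_zero, by simpa [hv] using locallyIntegrableOn_zero⟩,
    ⟨0, 0, rfl, rfl, by simp, by simp, Measure.MutuallySingular.zero_left⟩, fun φ _ => ?_, fun _ =>
      ⟨⟨Measure.AbsolutelyContinuous.refl _ |>.trans (Measure.AbsolutelyContinuous.zero _),
        Measure.AbsolutelyContinuous.zero _⟩, ?_⟩⟩
  · simp [dissipation, SignedRadonMeasure.integral, hv]
  · refine (memLp_congr_ae ?_).2 (MemLp.zero (ε := ℝ))
    have h0 := Measure.rnDeriv_zero (volume : Measure (ℝ × X))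
    refine ae_mono Measure.restrict_le_self ?_
    filter_upwards [h0] with z hz
    simp [SignedRadonMeasure.density]

end Congr

/-! ### Local regularity and energy growth for velocities in L^r -/

section EuclideanBounds

lemma MeasureTheory.MemLp.setIntegral_norm_pow_le {α F : Type*} [MeasurableSpace α]
    [NormedAddCommGroup F]
    {μ : Measure α} {f : α → F} {r : ℝ≥0∞} (hf : MemLp f r μ) {q : ℕ} (hq : q ≠ 0) (hqr : q ≤ r)
    {S : Set α} (hS : μ S ≠ ⊤) :
    ∫ x in S, ‖f x‖ ^ q ∂μ ≤
      (eLpNorm f r μ).toReal ^ q * μ.real S ^ (1 - q / r.toReal) := by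
  have : IsFiniteMeasure (μ.restrict S) := ⟨by simpa using hS.lt_top⟩
  have hq0 : (0 : ℝ) < q := by positivity
  have hqS : MemLp f q (μ.restrict S) := (hf.restrict S).mono_exponent hqr
  have h1 := hqS.eLpNorm_eq_integral_rpow_norm (by simpa using hq) (by simp)
  have h2 := eLpNorm_le_eLpNorm_mul_rpow_measure_univ hqr (hf.restrict S).1
  have h3 : eLpNorm f q (μ.restrict S) ≤ eLpNorm f r μ * μ S ^ (1 / (q : ℝ) - 1 / r.toReal) := by
    refine h2.trans ?_
    simp only [Measure.restrict_apply_univ, ENNReal.toReal_natCast]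
    gcongr
    exact Measure.restrict_le_self
  have he : 0 ≤ 1 / (q : ℝ) - 1 / r.toReal := by
    rcases eq_or_ne r ⊤ with rfl | hr
    · simp
    · rw [sub_nonneg]
      have : (q : ℝ) ≤ r.toReal := by
        simpa using ENNReal.toReal_mono hr hqr
      exact one_div_le_one_div_of_le hq0 this
  have hI0 : 0 ≤ ∫ x in S, ‖f x‖ ^ q ∂μ := integral_nonneg fun x => by positivity
  have h4 : (∫ x in S, ‖f x‖ ^ q ∂μ) ^ (q : ℝ)⁻¹ ≤
      (eLpNorm f r μ).toReal * μ.real S ^ (1 / (q : ℝ) - 1 / r.toReal) := by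
    have h5 := ENNReal.toReal_mono (ENNReal.mul_ne_top hf.2.ne (ENNReal.rpow_ne_top_of_nonneg he hS))
      (h1 ▸ h3)
    simp only [ENNReal.toReal_natCast, Real.rpow_natCast] at h5
    rwa [ENNReal.toReal_ofReal (by positivity), ENNReal.toReal_mul, ← ENNReal.toReal_rpow] at h5
  calc ∫ x in S, ‖f x‖ ^ q ∂μ = ((∫ x in S, ‖f x‖ ^ q ∂μ) ^ (q : ℝ)⁻¹) ^ q := by
        rw [Real.rpow_inv_natCast_pow hI0 hq]
    _ ≤ ((eLpNorm f r μ).toReal * μ.real S ^ (1 / (q : ℝ) - 1 / r.toReal)) ^ q := by gcongr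
    _ = _ := by
        rw [mul_pow, ← Real.rpow_natCast (μ.real S ^ _), ← Real.rpow_mul (by positivity)]
        congr 2
        field_simp

variable {d : ℕ} {I : Set ℝ} {v : ℝ × EuclideanSpace ℝ (Fin d) → EuclideanSpace ℝ (Fin d)}
  {p : ℝ × EuclideanSpace ℝ (Fin d) → ℝ} {r : ℝ≥0∞}

lemma hasCubicRegularity_of_eLpNorm_le (hr : 3 ≤ r) (hv : StronglyMeasurable v)
    (hB : ∀ K ⊆ I ×ˢ univ, IsCompact K → eLpNorm v r (volume.restrict K) < ⊤ ∧
      ∃ D : ℝ≥0∞, D ≠ ⊤ ∧ ∀ h, ‖h‖ ≤ 1 →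
        eLpNorm (fun z => v (z.1, z.2 - h) - v z) r (volume.restrict K) ≤
          D * ENNReal.ofReal (‖h‖ ^ (1 / 3 : ℝ))) : HasCubicRegularity I v := by
  intro K hKU hK
  obtain ⟨h1, D, hD, h2⟩ := hB K hKU hK
  have : IsFiniteMeasure (volume.restrict K) := ⟨by simpa using hK.measure_lt_top⟩
  refine ⟨MemLp.mono_exponent ⟨hv.aestronglyMeasurable, h1⟩ hr,
    D * volume K ^ (1 / (3 : ℝ≥0∞).toReal - 1 / r.toReal), ?_, fun h hh => ?_⟩
  · refine ENNReal.mul_ne_top hD (ENNReal.rpow_ne_top_of_nonneg ?_ hK.measure_lt_top.ne)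
    rcases eq_or_ne r ⊤ with rfl | hr'
    · simp
    · rw [sub_nonneg]
      exact one_div_le_one_div_of_le (by norm_num) (ENNReal.toReal_mono hr' hr)
  · have hm : StronglyMeasurable fun z : ℝ × EuclideanSpace ℝ (Fin d) =>
        v (z.1, z.2 - h) - v z :=
      (hv.comp_measurable (measurable_fst.prodMk (measurable_snd.sub_const _))).sub hv
    refine (eLpNorm_le_eLpNorm_mul_rpow_measure_univ hr hm.aestronglyMeasurable).trans ?_
    rw [Measure.restrict_apply_univ, mul_right_comm]
    gcongr
    exact h2 h hh

lemma memLp_const_mul_sq {J : Set ℝ} {n : ℝ → ℝ} (hn : MemLp n 3 (volume.restrict J)) (M : ℝ) :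
    MemLp (fun t => M * n t ^ 2) (3 / 2) (volume.restrict J) := by
  simp only [sq]
  exact (hn.mul hn : MemLp (n * n) (3 / 2) (volume.restrict J)).const_mul M

lemma measure_closedBall_toReal (s : ℝ) (hs : 0 ≤ s) (y : EuclideanSpace ℝ (Fin d)) :
    (volume : Measure (EuclideanSpace ℝ (Fin d))).real (Metric.closedBall y s) =
      s ^ d * volume.real (Metric.ball (0 : EuclideanSpace ℝ (Fin d)) 1) := by
  rw [Measure.real, Measure.addHaar_closedBall _ _ hs, ENNReal.toReal_mul,
    ENNReal.toReal_ofReal (by positivity)]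
  simp [Measure.real]

/-- By Hölder the energy in a ball is at most ‖v(t)‖_r² times the volume to the power 1 - 2/r ≤ 1.
The square of an L^r function of time, r ≥ 3, is locally in L^{3/2}. -/
lemma exists_isEnergyDensityBound (hI : IsOpen I) (hr : 3 ≤ r) (hr' : r ≠ ⊤)
    (hv : StronglyMeasurable v) (hvr : eLpNorm v r (volume.restrict (I ×ˢ univ)) < ⊤) :
    ∃ N, IsEnergyDensityBound I v N := by
  have hr0 : r ≠ 0 := (lt_of_lt_of_le (by norm_num) hr).ne'
  have hrpos : 0 < r.toReal := ENNReal.toReal_pos hr0 hr'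
  set n : ℝ → ℝ≥0∞ := fun t => eLpNorm (fun x => v (t, x)) r volume with hn
  have hnr : ∀ t, n t ^ r.toReal = ∫⁻ x, ‖v (t, x)‖ₑ ^ r.toReal := by
    intro t
    rw [hn]
    simp only
    rw [eLpNorm_eq_lintegral_rpow_enorm_toReal hr0 hr', ← ENNReal.rpow_mul,
      one_div, inv_mul_cancel₀ hrpos.ne', ENNReal.rpow_one]
  have hmr : Measurable fun t => n t ^ r.toReal := by
    simp only [hnr]
    exact (hv.enorm.pow_const _).lintegral_prod_right'
  have hnm : Measurable n := by
    have : n = fun t => (n t ^ r.toReal) ^ r.toReal⁻¹ := by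
      ext t
      rw [ENNReal.rpow_rpow_inv hrpos.ne']
    rw [this]
    exact hmr.pow_const _
  have hint : ∫⁻ t in I, n t ^ r.toReal < ⊤ := by
    simp only [hnr]
    rw [← lintegral_prod (fun z : ℝ × EuclideanSpace ℝ (Fin d) => ‖v z‖ₑ ^ r.toReal)
      (hv.enorm.pow_const _).aemeasurable]
    rw [Measure.volume_eq_prod, ← Measure.prod_restrict, Measure.restrict_univ] at hvr
    exact lintegral_rpow_enorm_lt_top_of_eLpNorm_lt_top hr0 hr' hvr
  have hfin : ∀ᵐ t, t ∈ I → n t < ⊤ := by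
    rw [← ae_restrict_iff' hI.measurableSet]
    filter_upwards [ae_lt_top' hmr.aemeasurable hint.ne] with t ht
    rwa [ENNReal.rpow_lt_top_iff_of_pos hrpos] at ht
  have hnL : MemLp (fun t => (n t).toReal) r (volume.restrict I) := by
    refine ⟨hnm.ennreal_toReal.aestronglyMeasurable, ?_⟩
    rw [eLpNorm_lt_top_iff_lintegral_rpow_enorm_lt_top hr0 hr']
    refine lt_of_le_of_lt (lintegral_mono fun t => ?_) hint
    gcongr
    rw [Real.enorm_of_nonneg ENNReal.toReal_nonneg]
    exact ENNReal.ofReal_toReal_le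
  set V := volume.real (Metric.ball (0 : EuclideanSpace ℝ (Fin d)) 1)
  have hV : 0 ≤ V := measureReal_nonneg
  -- With 1 + V in place of V the base of the power is at least 1, so its exponent may be raised to
  -- 1.
  refine ⟨fun t => (1 + V) * (n t).toReal ^ 2, fun J hJI hJ => ?_, ?_⟩
  · have : IsFiniteMeasure (volume.restrict J) := ⟨by simpa using hJ.measure_lt_top⟩
    exact memLp_const_mul_sq
      ((hnL.mono_measure (Measure.restrict_mono hJI le_rfl)).mono_exponent hr) _
  · filter_upwards [hfin] with t ht htI s hs
    have hvt : MemLp (fun x => v (t, x)) r volume :=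
      ⟨(hv.comp_measurable measurable_prodMk_left).aestronglyMeasurable, ht htI⟩
    have h1 := hvt.setIntegral_norm_pow_le (q := 2) (by simp)
      (le_trans (by norm_num) hr) (isCompact_closedBall (0 : EuclideanSpace ℝ (Fin d)) s).measure_lt_top.ne
    refine h1.trans ?_
    rw [measure_closedBall_toReal s (by linarith)]
    have hs1 : 1 ≤ s ^ d := one_le_pow₀ hs
    have hle : (s ^ d * V) ^ (1 - (2 : ℕ) / r.toReal) ≤ s ^ d * (1 + V) := by
      have h3 : 3 ≤ r.toReal := ENNReal.toReal_mono hr' hr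
      calc (s ^ d * V) ^ (1 - (2 : ℕ) / r.toReal) ≤ (s ^ d * (1 + V)) ^ (1 - (2 : ℕ) / r.toReal) := by
            gcongr
            · rw [sub_nonneg, div_le_one hrpos]; push_cast; linarith
            · linarith
        _ ≤ (s ^ d * (1 + V)) ^ (1 : ℝ) := by
            refine Real.rpow_le_rpow_of_exponent_le (by nlinarith) ?_
            rw [sub_le_self_iff]
            positivity
        _ = _ := Real.rpow_one _
    calc _ ≤ (n t).toReal ^ 2 * (s ^ d * (1 + V)) := by gcongr
      _ = _ := by ring

end EuclideanBounds

/-! ### Vanishing of the averaged pressure gradient on ℝ^d -/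

section EuclideanDecay

variable {d : ℕ} {I : Set ℝ} {v : ℝ × EuclideanSpace ℝ (Fin d) → EuclideanSpace ℝ (Fin d)}
  {p : ℝ × EuclideanSpace ℝ (Fin d) → ℝ} {r : ℝ≥0∞}
  {ρ Ψ : ℤ → EuclideanSpace ℝ (Fin d) → ℝ} {C : ℝ}

/-- The momentum equation trades the averaged pressure gradient for averages of v and of v_j v_l,
whose size is controlled by the integrability of v. -/
lemma IsWeakEulerSolution.integral_pressure_eq (hI : IsOpen I) (h : IsWeakEulerSolution id I v p)
    {a : ℝ → ℝ} (ha : ContDiff ℝ ∞ a) (hac : HasCompactSupport a) (haI : tsupport a ⊆ I)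
    {κ : EuclideanSpace ℝ (Fin d) → ℝ} (hκ : ContDiff ℝ ∞ κ) (hκc : HasCompactSupport κ)
    (y : EuclideanSpace ℝ (Fin d)) (l : Fin d) :
    ∫ z in I ×ˢ univ, p z * (a z.1 * partialD l κ (y - z.2)) =
      ∫ z in I ×ˢ univ, (v z l * (deriv a z.1 * κ (y - z.2)) -
        ∑ j, v z j * v z l * (a z.1 * partialD j κ (y - z.2))) := by
  have hU := (hI.prod isOpen_univ (Y := EuclideanSpace ℝ (Fin d))).measurableSet
  have hθ : ContDiff ℝ ∞ fun x => κ (y - x) := by fun_prop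
  have hθc := hκc.comp_sub_left y
  have hφ := isSpaceTimeTest_tensor ha hac haI hθ hθc
  have hm := h.momentum _ hφ l
  have hsd : ∀ j (z : ℝ × EuclideanSpace ℝ (Fin d)),
      spaceDeriv id j (fun z => a z.1 * κ (y - z.2)) z = -(a z.1 * partialD j κ (y - z.2)) := by
    intro j z
    rw [spaceDeriv_tensor (θ := fun x => κ (y - x)) hθ, partialD_comp_sub_left hκ, mul_neg]
  simp only [timeDeriv_tensor (θ := fun x => κ (y - x)) ha, hsd] at hm
  have ha' : ContDiff ℝ ∞ (deriv a) := (contDiff_infty_iff_deriv.1 ha).2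
  have hac' : HasCompactSupport (deriv a) := hac.deriv
  have haI' : tsupport (deriv a) ⊆ I := (closure_minimal (support_deriv_subset)
    (isClosed_tsupport a)).trans haI
  have hkc : ∀ j, Continuous (partialD j κ) := fun j => (contDiff_partialD hκ j).continuous
  have hks : ∀ j, HasCompactSupport (partialD j κ) := fun j =>
    hκc.isCompact.of_isClosed_subset (isClosed_tsupport _) (tsupport_partialD_subset j)
  have i0 : IntegrableOn (fun z => v z l * (deriv a z.1 * κ (y - z.2))) (I ×ˢ univ) :=
    integrableOn_mul_of_locallyIntegrableOn hU (h.locallyIntegrableOn_velocity hI l)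
      (by have := ha'.continuous; have := hκ.continuous; fun_prop)
      (hasCompactSupport_tensor (θ := fun x => κ (y - x)) hac' hθc)
      (tsupport_tensor_subset (θ := fun x => κ (y - x)) haI')
  have iw : ∀ {w : ℝ × EuclideanSpace ℝ (Fin d) → ℝ} (j : Fin d),
      LocallyIntegrableOn w (I ×ˢ univ) →
      IntegrableOn (fun z => w z * (a z.1 * partialD j κ (y - z.2))) (I ×ˢ univ) :=
    fun {w} j hw => integrableOn_mul_of_locallyIntegrableOn hU hw
      (by have := ha.continuous; have := hkc j; fun_prop)
      (hasCompactSupport_tensor (θ := fun x => partialD j κ (y - x)) hac ((hks j).comp_sub_left y))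
      (tsupport_tensor_subset (θ := fun x => partialD j κ (y - x)) haI)
  have i1 : IntegrableOn (fun z => ∑ j, v z j * v z l * (a z.1 * partialD j κ (y - z.2)))
      (I ×ˢ univ) := integrable_finsetSum _ fun j _ => iw j (h.locallyIntegrableOn_mul hI j l)
  have i2 := iw l h.locallyIntegrable_pressure
  have h3 : ∫ z in I ×ˢ univ, ((v z l * (deriv a z.1 * κ (y - z.2)) -
        ∑ j, v z j * v z l * (a z.1 * partialD j κ (y - z.2)))
        - p z * (a z.1 * partialD l κ (y - z.2))) = 0 := by
    rw [← hm]
    congr 1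
    ext z
    simp only [mul_neg, Finset.sum_neg_distrib]
    ring
  have h4 := integral_sub (i0.sub i1) i2
  simp only [Pi.sub_apply] at h4
  rw [h4] at h3
  linarith

/-- For a velocity in `L^r`, `r < ∞`, the mean of the pressure gradient over large balls is
negligible. -/
lemma IsWeakEulerSolution.isPressureGradientDecaying (hd : d ≠ 0) (hI : IsOpen I)
    (h : IsWeakEulerSolution id I v p) (hρ : IsDyadicKernel ρ Ψ C) (hC : 0 < C)
    (hr : 3 ≤ r) (hr' : r ≠ ⊤) (hvr : MemLp v r (volume.restrict (I ×ˢ univ))) :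
    IsPressureGradientDecaying I p ρ := by
  intro a ha hac haI y l
  have hr0 : r ≠ 0 := (lt_of_lt_of_le (by norm_num) hr).ne'
  have h3r : 3 ≤ r.toReal := ENNReal.toReal_mono hr' hr
  have hU := (hI.prod isOpen_univ (Y := EuclideanSpace ℝ (Fin d))).measurableSet
  obtain ⟨A₀, hA₀⟩ := ha.continuous.bounded_above_of_compact_support hac
  have ha' : ContDiff ℝ ∞ (deriv a) := (contDiff_infty_iff_deriv.1 ha).2
  obtain ⟨A₁, hA₁⟩ := ha'.continuous.bounded_above_of_compact_support hac.deriv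
  set A := max A₀ A₁
  have hA0 : ∀ t, |a t| ≤ A := fun t => (hA₀ t).trans (le_max_left _ _)
  have hA1 : ∀ t, |deriv a t| ≤ A := fun t => (hA₁ t).trans (le_max_right _ _)
  have hA : 0 ≤ A := (abs_nonneg _).trans (hA0 0)
  set S : ℕ → Set (ℝ × EuclideanSpace ℝ (Fin d)) := fun n =>
    tsupport a ×ˢ Metric.closedBall y (2 ^ n)
  have hSc : ∀ n, IsCompact (S n) := fun n => hac.isCompact.prod (isCompact_closedBall _ _)
  have hSU : ∀ n, S n ⊆ I ×ˢ univ := fun n z hz => ⟨haI hz.1, trivial⟩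
  set V := volume.real (tsupport a) * volume.real (Metric.ball (0 : EuclideanSpace ℝ (Fin d)) 1)
  have hV : 0 ≤ V := by positivity
  set x : ℕ → ℝ := fun n => (2 ^ n : ℝ) ^ d with hx
  have hx1 : ∀ n, 1 ≤ x n := fun n => one_le_pow₀ (one_le_pow₀ (by norm_num))
  have hx0 : ∀ n, 0 < x n := fun n => zero_lt_one.trans_le (hx1 n)
  have hvol : ∀ n, (volume.restrict (I ×ˢ univ)).real (S n) = x n * V := by
    intro n
    rw [measureReal_restrict_apply ((hSc n).measurableSet), inter_eq_left.2 (hSU n),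
      Measure.volume_eq_prod, measureReal_prod_prod, measure_closedBall_toReal _ (by positivity)]
    ring
  set M := (eLpNorm v r (volume.restrict (I ×ˢ univ))).toReal
  have hM : 0 ≤ M := ENNReal.toReal_nonneg
  have hint : ∀ (q : ℕ), q ≠ 0 → (q : ℝ≥0∞) ≤ r → ∀ n, ∫ z in S n, ‖v z‖ ^ q ≤
      M ^ q * (x n * V) ^ (1 - q / r.toReal) := by
    intro q hq hqr n
    have h1 := hvr.setIntegral_norm_pow_le hq hqr (S := S n)
      (lt_of_le_of_lt (Measure.restrict_apply_le _ _) (hSc n).measure_lt_top).ne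
    rwa [hvol, Measure.restrict_restrict_of_subset (hSU n)] at h1
  have hvS : ∀ n, MemLp v r (volume.restrict (S n)) := fun n =>
    hvr.mono_measure (Measure.restrict_mono (hSU n) le_rfl)
  have hfm : ∀ n, IsFiniteMeasure (volume.restrict (S n)) := fun n =>
    ⟨by simpa using (hSc n).measure_lt_top⟩
  have j1 : ∀ n, IntegrableOn (fun z => ‖v z‖) (S n) := fun n =>
    (memLp_one_iff_integrable.1 ((hvS n).mono_exponent (le_trans (by norm_num) hr))).norm
  have j2 : ∀ n, IntegrableOn (fun z => ‖v z‖ ^ 2) (S n) := fun n =>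
    ((hvS n).mono_exponent (le_trans (by norm_num) hr) : MemLp v (2 : ℕ) _).integrable_norm_pow
      (by norm_num)
  have hmain : ∀ n : ℕ, |∫ z in I ×ˢ univ, p z * (a z.1 * partialD l (ρ n) (y - z.2))| ≤
      A * (C * (x n)⁻¹) * (∫ z in S n, ‖v z‖) +
        d * (A * (C * ((x n)⁻¹ * (2 ^ n : ℝ)⁻¹))) * ∫ z in S n, ‖v z‖ ^ 2 := by
    intro n
    have hk : ∀ w, |ρ n w| ≤ C * (x n)⁻¹ := by
      intro w
      rw [abs_of_nonneg (hρ.nonneg _ _)]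
      simpa [inv_pow, hx] using hρ.le n w
    have hk' : ∀ j w, |partialD j (ρ n) w| ≤ C * ((x n)⁻¹ * (2 ^ n : ℝ)⁻¹) := by
      intro j w
      have := hρ.abs_partialD_le n j w
      rw [pow_succ] at this
      simpa [inv_pow, hx] using this
    have hout : ∀ z ∉ S n, ∀ j, (a z.1 = 0 ∧ deriv a z.1 = 0) ∨
        (ρ n (y - z.2) = 0 ∧ partialD j (ρ n) (y - z.2) = 0) := by
      intro z hz j
      by_cases hzt : z.1 ∈ tsupport a
      · right
        have hz2 : y - z.2 ∉ tsupport (ρ n) := fun h2 => hz ⟨hzt, by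
          have := hρ.tsupport_subset n h2
          simpa [dist_eq_norm, norm_sub_rev] using this⟩
        exact ⟨image_eq_zero_of_notMem_tsupport hz2,
          image_eq_zero_of_notMem_tsupport fun h2 => hz2 (tsupport_partialD_subset j h2)⟩
      · left
        exact ⟨image_eq_zero_of_notMem_tsupport hzt, image_eq_zero_of_notMem_tsupport fun h2 =>
          hzt (closure_minimal (support_deriv_subset) (isClosed_tsupport a) h2)⟩
    rw [h.integral_pressure_eq hI ha hac haI (hρ.contDiff n) (hρ.hasCompactSupport n),
      setIntegral_eq_of_subset_of_forall_sdiff_eq_zero hU (hSU n), ← integral_const_mul,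
      ← integral_const_mul, ← integral_add ((j1 n).const_mul _) ((j2 n).const_mul _)]
    · have ji := ((j1 n).const_mul (A * (C * (x n)⁻¹))).add
        ((j2 n).const_mul (d * (A * (C * ((x n)⁻¹ * (2 ^ n : ℝ)⁻¹)))))
      rw [← Real.norm_eq_abs]
      refine norm_integral_le_of_norm_le ji (.of_forall fun z => ?_)
      simp only [Pi.add_apply]
      refine (norm_sub_le _ _).trans (add_le_add ?_ ?_)
      · rw [norm_mul, norm_mul, mul_comm]
        exact mul_le_mul (mul_le_mul (hA1 _) (hk _) (abs_nonneg _) hA) (PiLp.norm_apply_le (v z) l)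
          (norm_nonneg _) (by have := hx0 n; positivity)
      · refine (norm_sum_le _ _).trans ((Finset.sum_le_card_nsmul _ _
          (A * (C * ((x n)⁻¹ * (2 ^ n : ℝ)⁻¹)) * ‖v z‖ ^ 2) fun j _ => ?_).trans_eq ?_)
        · rw [norm_mul, norm_mul, norm_mul, mul_comm]
          refine mul_le_mul (mul_le_mul (hA0 _) (hk' j _) (abs_nonneg _) hA) ?_
            (by positivity) (by have := hx0 n; positivity)
          rw [sq]
          exact mul_le_mul (PiLp.norm_apply_le (v z) j) (PiLp.norm_apply_le (v z) l)
            (norm_nonneg _) (norm_nonneg _)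
        · simp [mul_assoc]
    · intro z hz
      have h1 : ∀ j, a z.1 * partialD j (ρ n) (y - z.2) = 0 := fun j => by
        rcases hout z hz.2 j with h2 | h2 <;> simp [h2]
      have h2 : deriv a z.1 * ρ n (y - z.2) = 0 := by
        rcases hout z hz.2 l with h2 | h2 <;> simp [h2]
      simp [h1, h2]
  have hpow : ∀ (e : ℝ) n, 0 ≤ e → e ≤ 1 → (x n * V) ^ e ≤ x n ^ e * (1 + V) := by
    intro e n he0 he1
    rw [Real.mul_rpow (hx0 n).le hV]
    gcongr
    calc V ^ e ≤ (1 + V) ^ e := by gcongr; linarith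
      _ ≤ (1 + V) ^ (1 : ℝ) := Real.rpow_le_rpow_of_exponent_le (by linarith) he1
      _ = 1 + V := Real.rpow_one _
  have hrpos : 0 < r.toReal := by linarith
  have hxtop : Tendsto x atTop atTop :=
    (tendsto_pow_atTop hd).comp (tendsto_pow_atTop_atTop_of_one_lt (by norm_num))
  -- With x n = 2^{nd}, the integral of |v| over S n is O(x^{1-1/r}) against a kernel of size 1/x,
  -- so that term decays like x^{-1/r}; this needs r finite and d ≠ 0. The quadratic term is bounded
  -- by a multiple of 2^{-n} because its kernel carries a derivative.
  refine squeeze_zero_norm (a := fun n => A * C * (M * (1 + V)) * x n ^ (-(1 / r.toReal)) +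
    d * (A * C) * (M ^ 2 * (1 + V)) * (2 ^ n : ℝ)⁻¹) (fun n => (hmain n).trans ?_) ?_
  · refine add_le_add ?_ ?_
    · have h1 := hint 1 (by simp) (le_trans (by norm_num) hr) n
      simp only [pow_one, Nat.cast_one] at h1
      have h2 := hpow (1 - 1 / r.toReal) n (by rw [sub_nonneg, div_le_one hrpos]; linarith)
        (by simp)
      calc _ ≤ A * (C * (x n)⁻¹) * (M * (x n ^ (1 - 1 / r.toReal) * (1 + V))) := by
            have := hx0 n
            gcongr
            exact h1.trans (by gcongr)
        _ = _ := by
            rw [sub_eq_add_neg, Real.rpow_add (hx0 n), Real.rpow_one]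
            field_simp [(hx0 n).ne']
    · have h1 := hint 2 (by simp) (le_trans (by norm_num) hr) n
      have h2 := hpow (1 - (2 : ℕ) / r.toReal) n
        (by rw [sub_nonneg, div_le_one hrpos]; push_cast; linarith) (by simp; positivity)
      have h3 : x n ^ (1 - (2 : ℕ) / r.toReal) ≤ x n := by
        conv_rhs => rw [← Real.rpow_one (x n)]
        exact Real.rpow_le_rpow_of_exponent_le (hx1 n) (by simp; positivity)
      calc _ ≤ d * (A * (C * ((x n)⁻¹ * (2 ^ n : ℝ)⁻¹))) * (M ^ 2 * (x n * (1 + V))) := by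
            have := hx0 n
            gcongr
            exact h1.trans (by gcongr; exact h2.trans (by gcongr))
        _ = _ := by
            field_simp [(hx0 n).ne']
  · have t1 : Tendsto (fun n => x n ^ (-(1 / r.toReal))) atTop (𝓝 0) :=
      (tendsto_rpow_neg_atTop (by positivity)).comp hxtop
    have t2 : Tendsto (fun n : ℕ => (2 ^ n : ℝ)⁻¹) atTop (𝓝 0) :=
      tendsto_inv_atTop_zero.comp (tendsto_pow_atTop_atTop_of_one_lt (by norm_num))
    simpa using (t1.const_mul _).add (t2.const_mul _)

end EuclideanDecay

/-! ### The theorem on ℝ^d -/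

section EuclideanCase

variable {d : ℕ} {I : Set ℝ} {v : ℝ × EuclideanSpace ℝ (Fin d) → EuclideanSpace ℝ (Fin d)}
  {p : ℝ × EuclideanSpace ℝ (Fin d) → ℝ} {r : ℝ≥0∞}
  {ρ Ψ : ℤ → EuclideanSpace ℝ (Fin d) → ℝ} {C : ℝ}

instance holderConjugate_three_halves_three : ENNReal.HolderConjugate (3 / 2) 3 := ⟨by
  rw [ENNReal.inv_div (by simp) (by simp), ← one_div, ENNReal.div_add_div_same, inv_one]
  norm_num
  exact ENNReal.div_self (by simp) (by simp)⟩

/-- Up to a function of time, the pressure lies locally in an exponent conjugate to that of the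
velocity. -/
def IsPressureNormalizer (I : Set ℝ)
    (v : ℝ × EuclideanSpace ℝ (Fin d) → EuclideanSpace ℝ (Fin d))
    (p : ℝ × EuclideanSpace ℝ (Fin d) → ℝ) (c : ℝ → ℝ) : Prop :=
  LocallyIntegrableOn c I ∧ ∃ a a' : ℝ≥0∞, ENNReal.HolderConjugate a a' ∧
    ∀ K ⊆ I ×ˢ univ, IsCompact K → MemLp (fun z => p z - c z.1) a (volume.restrict K) ∧
      MemLp v a' (volume.restrict K)

lemma IsPressureNormalizer.locallyIntegrableOn (hI : IsOpen I) {c : ℝ → ℝ}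
    (h : IsPressureNormalizer I v p c) :
    LocallyIntegrableOn (fun z => (p z - c z.1) • v z) (I ×ˢ univ) := by
  obtain ⟨hc, a, a', haa, h⟩ := h
  rw [locallyIntegrableOn_iff (hI.prod isOpen_univ).isLocallyClosed]
  intro K hKU hK
  have : ENNReal.HolderTriple a' a 1 := haa.symm
  exact memLp_one_iff_integrable.1 ((h K hKU hK).2.smul (h K hKU hK).1)

lemma IsWeakEulerSolution.exists_isPressureNormalizer (hd : d ≠ 0) (hI : IsOpen I)
    (h : IsWeakEulerSolution id I v p) (hv : StronglyMeasurable v) (hp : StronglyMeasurable p)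
    (hρ : IsDyadicKernel ρ Ψ C) (hC : 0 < C) (hreg : HasCubicRegularity I v) {N : ℝ → ℝ}
    (hN : IsEnergyDensityBound I v N) (hdec : IsPressureGradientDecaying I p ρ) :
    ∃ c, IsPressureNormalizer I v p c := by
  obtain ⟨c, hc, hpc⟩ := h.exists_memLp_pressure_sub hd hI hv hp hρ hC hreg hN hdec
  exact ⟨c, hc, 3 / 2, 3, inferInstance, fun K hKU hK => ⟨hpc K hKU hK, (hreg K hKU hK).1⟩⟩

lemma IsWeakEulerSolution.tendsto_dissipation_of_isPressureNormalizer (hI : IsOpen I)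
    (h : IsWeakEulerSolution id I v p) (hρ : IsDyadicKernel ρ Ψ C)
    (hreg : HasCubicRegularity I v) {c : ℝ → ℝ} (hc : IsPressureNormalizer I v p c)
    (hpv : LocallyIntegrableOn (fun z => p z • v z) (I ×ˢ univ))
    {φ : ℝ × EuclideanSpace ℝ (Fin d) → ℝ} (hφ : IsSpaceTimeTest id I φ) :
    Tendsto (fun n : ℕ => -(1 / 4) * ∫ h, ∑ j, partialD j (ρ (-n)) h *
      ∫ z in I ×ˢ univ, φ z * cubicIncrement id v h j z) atTop (𝓝 (dissipation id I v p φ)) := by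
  obtain ⟨hc, a, a', haa, hpc⟩ := hc
  refine h.tendsto_dissipation_sub_time hI (fun K hKU hK => (hreg K hKU hK).1) haa hc
    (fun K hKU hK => (hpc K hKU hK).1) (fun K hKU hK => (hpc K hKU hK).2) hpv
    (fun n => hρ.contDiff _) (fun n => hρ.hasCompactSupport _) (fun n => hρ.nonneg _)
    (fun n => hρ.integral_eq_one _) (r := fun n : ℕ => (2 : ℝ) ^ (-(n : ℤ))) ?_
    (fun n => hρ.tsupport_subset _) hφ
  simp only [zpow_neg, zpow_natCast]
  exact tendsto_inv_atTop_zero.comp (tendsto_pow_atTop_atTop_of_one_lt (by norm_num))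

lemma exists_dissipation_euclidean_of_stronglyMeasurable (hd : d ≠ 0) (hI : IsOpen I) (hr : 3 ≤ r)
    (h : IsWeakEulerSolution id I v p) (hB : MemLtBesov id I (1 / 3) r v)
    (hv : StronglyMeasurable v) (hp : StronglyMeasurable p) :
    (∃ c : ℝ → ℝ, LocallyIntegrableOn c I ∧
        LocallyIntegrableOn (fun z => (p z - c z.1) • v z) (I ×ˢ univ)) ∧
    (LocallyIntegrableOn (fun z => p z • v z) (I ×ˢ univ) →
      ∃ ν : SignedRadonMeasure (I ×ˢ (univ : Set (EuclideanSpace ℝ (Fin d)))),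
        (∀ φ, IsSpaceTimeTest id I φ → dissipation id I v p φ = ν.integral φ) ∧
        (3 < r → ν.IsAbsolutelyContinuous volume ∧
          MemLp (ν.density volume) (r / 3) (volume.restrict (I ×ˢ univ)))) := by
  obtain ⟨ρ, Ψ, C, hC, hρ⟩ := exists_isDyadicKernel hd
  have hr0 : r ≠ 0 := (lt_of_lt_of_le (by norm_num) hr).ne'
  have hvr : MemLp v r (volume.restrict (I ×ˢ univ)) :=
    ⟨hv.aestronglyMeasurable, (eLpNorm_le_besov hr0 hv _).trans_lt hB.2⟩
  have hreg : HasCubicRegularity I v := by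
    have h1 := fun y => eLpNorm_sub_le_besov (π := id) (s := 1 / 3) (I := I) hr0 hv rfl y
    simp only [id] at h1
    refine hasCubicRegularity_of_eLpNorm_le hr hv fun K hKU hK =>
      ⟨(hvr.mono_measure (Measure.restrict_mono hKU le_rfl)).2, _, hB.2.ne, fun y _ => ?_⟩
    refine (eLpNorm_mono_measure _ (Measure.restrict_mono hKU le_rfl)).trans ?_
    exact (h1 y).trans_eq (mul_comm _ _)
  obtain ⟨c, hc⟩ : ∃ c, IsPressureNormalizer I v p c := by
    -- For r = ∞ the exponents (1, ∞) and c = 0 suffice. The decay used for finite r can fail here: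
    -- v = f(t), p = -f'(t) · x has a constant pressure gradient at each time.
    by_cases hr' : r = ⊤
    · subst hr'
      refine ⟨0, locallyIntegrableOn_zero, 1, ⊤, inferInstance, fun K hKU hK => ⟨?_,
        hvr.mono_measure (Measure.restrict_mono hKU le_rfl)⟩⟩
      simp only [Pi.zero_apply, sub_zero]
      exact memLp_one_iff_integrable.2 <|
        h.locallyIntegrable_pressure.integrableOn_compact_subset hKU hK
    · obtain ⟨N, hN⟩ := exists_isEnergyDensityBound hI hr hr' hv hvr.2
      exact h.exists_isPressureNormalizer hd hI hv hp hρ hC hreg hN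
        (h.isPressureGradientDecaying hd hI hρ hC hr hr' hvr)
  refine ⟨⟨c, hc.1, hc.locallyIntegrableOn hI⟩, fun hpv => ?_⟩
  exact exists_signedRadonMeasure_of_tendsto hI hr hv hB measurable_id rfl
    (fun φ hφ => hφ.1.continuous) hρ hC fun φ hφ =>
      h.tendsto_dissipation_of_isPressureNormalizer hI hρ hreg hc hpv hφ

/-- It suffices to treat everywhere measurable representatives. -/
lemma exists_dissipation_of_stronglyMeasurable {X : Type*} [AddCommGroup X] [TopologicalSpace X]
    [SecondCountableTopology X] [MeasureSpace X] [OpensMeasurableSpace X]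
    [SFinite (volume : Measure X)] [MeasurableAdd X] [(volume : Measure X).IsAddRightInvariant]
    {π : EuclideanSpace ℝ (Fin d) → X} (hI : IsOpen I)
    {v : ℝ × X → EuclideanSpace ℝ (Fin d)} {p : ℝ × X → ℝ}
    (H : ∀ v p, d ≠ 0 → IsWeakEulerSolution π I v p → MemLtBesov π I (1 / 3) r v →
      StronglyMeasurable v → StronglyMeasurable p →
      (∃ c : ℝ → ℝ, LocallyIntegrableOn c I ∧
        LocallyIntegrableOn (fun z => (p z - c z.1) • v z) (I ×ˢ univ)) ∧
      (LocallyIntegrableOn (fun z => p z • v z) (I ×ˢ univ) →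
        ∃ ν : SignedRadonMeasure (I ×ˢ (univ : Set X)),
          (∀ φ, IsSpaceTimeTest π I φ → dissipation π I v p φ = ν.integral φ) ∧
          (3 < r → ν.IsAbsolutelyContinuous volume ∧
            MemLp (ν.density volume) (r / 3) (volume.restrict (I ×ˢ univ)))))
    (h : IsWeakEulerSolution π I v p) (hB : MemLtBesov π I (1 / 3) r v) :
      (∃ c : ℝ → ℝ, LocallyIntegrableOn c I ∧
        LocallyIntegrableOn (fun z => (p z - c z.1) • v z) (I ×ˢ univ)) ∧
      (LocallyIntegrableOn (fun z => p z • v z) (I ×ˢ univ) →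
        ∃ ν : SignedRadonMeasure (I ×ˢ (univ : Set X)),
          (∀ φ, IsSpaceTimeTest π I φ → dissipation π I v p φ = ν.integral φ) ∧
          (3 < r → ν.IsAbsolutelyContinuous volume ∧
            MemLp (ν.density volume) (r / 3) (volume.restrict (I ×ˢ univ)))) := by
  by_cases hd : d = 0
  · exact (exists_signedRadonMeasure_of_dim_eq_zero hd).imp_right fun h _ => h
  have hU : MeasurableSet (I ×ˢ (univ : Set X)) := (hI.prod isOpen_univ).measurableSet
  have hv := h.aestronglyMeasurable
  have hp := h.locallyIntegrable_pressure.aestronglyMeasurable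
  obtain ⟨⟨c, hc, hpc⟩, hν⟩ := H _ _ hd (h.congr_ae hI hv.ae_eq_mk hp.ae_eq_mk)
    (hB.congr_ae hv.ae_eq_mk) hv.stronglyMeasurable_mk hp.stronglyMeasurable_mk
  refine ⟨⟨c, hc, locallyIntegrableOn_congr_ae hpc ?_ hU⟩, fun hpv => ?_⟩
  · filter_upwards [hv.ae_eq_mk, hp.ae_eq_mk] with z h1 h2
    rw [h1, h2]
  · obtain ⟨ν, hν, hν'⟩ := hν (locallyIntegrableOn_congr_ae hpv (by
      filter_upwards [hv.ae_eq_mk, hp.ae_eq_mk] with z h1 h2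
      rw [h1, h2]) hU)
    exact ⟨ν, fun φ hφ => (dissipation_congr_ae hv.ae_eq_mk hp.ae_eq_mk φ).trans (hν φ hφ), hν'⟩

theorem exists_dissipation_euclidean (hI : IsOpen I) (hr : 3 ≤ r)
    (h : IsWeakEulerSolution id I v p) (hB : MemLtBesov id I (1 / 3) r v) :
    (∃ c : ℝ → ℝ, LocallyIntegrableOn c I ∧
        LocallyIntegrableOn (fun z => (p z - c z.1) • v z) (I ×ˢ univ)) ∧
    (LocallyIntegrableOn (fun z => p z • v z) (I ×ˢ univ) →
      ∃ ν : SignedRadonMeasure (I ×ˢ (univ : Set (EuclideanSpace ℝ (Fin d)))),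
        (∀ φ, IsSpaceTimeTest id I φ → dissipation id I v p φ = ν.integral φ) ∧
        (3 < r → ν.IsAbsolutelyContinuous volume ∧
          MemLp (ν.density volume) (r / 3) (volume.restrict (I ×ˢ univ)))) :=
  exists_dissipation_of_stronglyMeasurable hI (fun _ _ hd h hB hv hp =>
    exists_dissipation_euclidean_of_stronglyMeasurable hd hI hr h hB hv hp) h hB

end EuclideanCase

/-! ### The projection to the torus and Lebesgue measure -/

section TorusProjection

variable {d : ℕ}

lemma torusProj_add (x y : EuclideanSpace ℝ (Fin d)) :
    torusProj d (x + y) = torusProj d x + torusProj d y := by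
  ext i
  simp [torusProj]

lemma torusProj_sub (x y : EuclideanSpace ℝ (Fin d)) :
    torusProj d (x - y) = torusProj d x - torusProj d y := by
  ext i
  simp [torusProj]

lemma torusProj_zero : torusProj d 0 = 0 := by
  ext i
  simp [torusProj]

lemma isOpenQuotientMap_torusProj : IsOpenQuotientMap (torusProj d) :=
  (IsOpenQuotientMap.piMap fun _ : Fin d =>
    (QuotientAddGroup.isOpenQuotientMap_mk : IsOpenQuotientMap ((↑) : ℝ → UnitAddCircle))).comp
    (PiLp.homeomorph 2 fun _ : Fin d => ℝ).isOpenQuotientMap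

lemma measurable_torusProj : Measurable (torusProj d) :=
  isOpenQuotientMap_torusProj.continuous.measurable

/-- The point of the lattice `ℤ^d` with given coordinates. -/
noncomputable def latticePoint (k : Fin d → ℤ) : EuclideanSpace ℝ (Fin d) :=
  WithLp.toLp 2 fun i => (k i : ℝ)

@[simp] lemma latticePoint_apply (k : Fin d → ℤ) (i : Fin d) : latticePoint k i = k i := rfl

lemma torusProj_latticePoint (k : Fin d → ℤ) : torusProj d (latticePoint k) = 0 := by
  ext i
  exact (AddCircle.coe_eq_zero_iff (1 : ℝ)).2 ⟨k i, by simp⟩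

lemma torusProj_add_latticePoint (x : EuclideanSpace ℝ (Fin d)) (k : Fin d → ℤ) :
    torusProj d (x + latticePoint k) = torusProj d x := by
  rw [torusProj_add, torusProj_latticePoint, add_zero]

lemma exists_eq_add_latticePoint {x y : EuclideanSpace ℝ (Fin d)}
    (h : torusProj d x = torusProj d y) : ∃ k, x = y + latticePoint k := by
  have h1 : ∀ i, ∃ n : ℤ, n • (1 : ℝ) = (x - y) i := fun i =>
    (AddCircle.coe_eq_zero_iff (1 : ℝ)).1 (congrFun (by rw [torusProj_sub, h, sub_self] :
      torusProj d (x - y) = 0) i)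
  choose k hk using h1
  refine ⟨k, ?_⟩
  ext i
  have := hk i
  simp at this
  simp [this]

/-- The half-open unit cube. -/
def unitCube (d : ℕ) : Set (EuclideanSpace ℝ (Fin d)) := {x | ∀ i, x i ∈ Ioc (0 : ℝ) 1}

lemma measurableSet_unitCube : MeasurableSet (unitCube d) := by
  simp only [unitCube, setOf_forall]
  exact MeasurableSet.iInter fun i => measurableSet_Ioc.preimage (by fun_prop)

/-- Each point has exactly one lattice translate in the cube: the interval (0, 1] is where the
ceiling equals 1. -/
lemma add_latticePoint_mem_unitCube_iff (x : EuclideanSpace ℝ (Fin d)) (k : Fin d → ℤ) :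
    x + latticePoint k ∈ unitCube d ↔ k = fun i => 1 - ⌈x i⌉ := by
  simp only [unitCube, mem_setOf_eq, PiLp.add_apply, latticePoint_apply, funext_iff]
  refine forall_congr' fun i => ?_
  have : k i = 1 - ⌈x i⌉ ↔ ⌈x i⌉ = 1 - k i := by omega
  rw [this, Int.ceil_eq_iff]
  simp only [mem_Ioc]
  push_cast
  constructor <;> intro h <;> constructor <;> linarith [h.1, h.2]

/-- The crude bound √d ≤ d avoids square roots later. -/
lemma norm_le_of_mem_unitCube {x : EuclideanSpace ℝ (Fin d)} (hx : x ∈ unitCube d) :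
    ‖x‖ ≤ d := by
  refine abs_le_of_sq_le_sq' ?_ (by positivity) |>.2
  rw [EuclideanSpace.real_norm_sq_eq]
  refine (Finset.sum_le_card_nsmul _ _ 1 fun i _ => ?_).trans ?_
  · exact pow_le_one₀ (hx i).1.le (hx i).2
  · simp only [Finset.card_univ, Fintype.card_fin, nsmul_eq_mul, mul_one]
    exact_mod_cast Nat.le_self_pow two_ne_zero d

lemma measurePreserving_torusProj :
    MeasurePreserving (torusProj d) (volume.restrict (unitCube d)) volume := by
  have h1 : MeasurePreserving (fun x : Fin d → ℝ => fun i => (x i : UnitAddCircle))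
      (Measure.pi fun _ : Fin d => volume.restrict (Ioc (0 : ℝ) (0 + 1))) volume :=
    measurePreserving_pi _ _ fun _ => UnitAddCircle.measurePreserving_mk 0
  rw [← Measure.restrict_pi_pi (fun _ : Fin d => volume) (fun _ => Ioc (0 : ℝ) (0 + 1)),
    zero_add] at h1
  have h2 := (PiLp.volume_preserving_ofLp (Fin d)).restrict_preimage
    (s := univ.pi fun _ : Fin d => Ioc (0 : ℝ) 1) (MeasurableSet.univ_pi fun _ => measurableSet_Ioc)
  have h3 : (WithLp.ofLp ⁻¹' (univ.pi fun _ : Fin d => Ioc (0 : ℝ) 1) :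
    Set (EuclideanSpace ℝ (Fin d))) = unitCube d := by
    ext x
    simp [unitCube]
  rw [h3] at h2
  exact h1.comp h2

lemma measure_preimage_torusProj_inter (A : Set (UnitAddTorus (Fin d))) (hA : MeasurableSet A)
    (k : Fin d → ℤ) :
    volume (torusProj d ⁻¹' A ∩ {x | x + latticePoint k ∈ unitCube d}) = volume A := by
  rw [← measurePreserving_torusProj.measure_preimage hA.nullMeasurableSet,
    Measure.restrict_apply (measurable_torusProj hA),
    ← (measurePreserving_add_right volume (latticePoint k)).measure_preimage
      ((measurable_torusProj hA).inter measurableSet_unitCube).nullMeasurableSet]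
  congr 1
  ext x
  simp [torusProj_add_latticePoint]

/-- The image of Lebesgue measure on a ball is bounded by the number of unit cubes around it. -/
lemma map_torusProj_restrict_closedBall_le {R : ℝ} (hR : 0 ≤ R) :
    Measure.map (torusProj d) (volume.restrict (Metric.closedBall 0 R)) ≤
      ENNReal.ofReal ((2 * R + 5) ^ d) • (volume : Measure (UnitAddTorus (Fin d))) := by
  refine Measure.le_iff.2 fun A hA => ?_
  rw [Measure.map_apply measurable_torusProj hA, Measure.restrict_apply (measurable_torusProj hA)]
  -- For |x_i| ≤ R the integer 1 - ⌈x_i⌉ lies in [-N, N], and 2N + 1 = 2⌈R⌉ + 3 < 2R + 5.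
  set N : ℤ := ⌈R⌉ + 1
  set S : Finset (Fin d → ℤ) := Finset.Icc (fun _ => -N) (fun _ => N)
  have hsub : torusProj d ⁻¹' A ∩ Metric.closedBall 0 R ⊆
      ⋃ k ∈ S, torusProj d ⁻¹' A ∩ {x | x + latticePoint k ∈ unitCube d} := by
    intro x hx
    simp only [mem_iUnion]
    refine ⟨fun i => 1 - ⌈x i⌉, ?_, hx.1, (add_latticePoint_mem_unitCube_iff _ _).2 rfl⟩
    have h1 : ∀ i, |x i| ≤ R := fun i =>
      (PiLp.norm_apply_le x i).trans (mem_closedBall_zero_iff.1 hx.2)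
    simp only [S, Finset.mem_Icc, Pi.le_def]
    refine ⟨fun i => ?_, fun i => ?_⟩
    · have : ⌈x i⌉ ≤ ⌈R⌉ := Int.ceil_mono (le_of_abs_le (h1 i))
      simp only [N]; omega
    · have h2 := neg_le_of_abs_le (h1 i)
      have h3 : -⌈R⌉ ≤ ⌈x i⌉ := by
        have h4 := Int.le_ceil R
        have h5 := Int.le_ceil (x i)
        rw [← @Int.cast_le ℝ]
        push_cast
        linarith
      simp only [N]; omega
  refine (measure_mono hsub).trans ((measure_biUnion_finset_le _ _).trans ?_)
  simp only [measure_preimage_torusProj_inter A hA, Finset.sum_const, nsmul_eq_mul,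
    Measure.smul_apply, smul_eq_mul]
  gcongr
  have hcard : (S.card : ℝ) = (2 * N + 1) ^ d := by
    have hN : 0 ≤ N := by have := Int.ceil_nonneg hR; omega
    have h1 : ((N + 1 - -N).toNat : ℝ) = 2 * N + 1 := by
      have : ((N + 1 - -N).toNat : ℤ) = 2 * N + 1 := by omega
      exact_mod_cast this
    simp only [S, Pi.card_Icc, Int.card_Icc, Finset.prod_const, Finset.card_univ, Fintype.card_fin]
    push_cast [h1]
    rfl
  rw [← ENNReal.ofReal_natCast, hcard]
  have := Int.ceil_lt_add_one R
  have h0 : (0 : ℝ) ≤ ⌈R⌉ := by exact_mod_cast Int.ceil_nonneg hR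
  refine ENNReal.ofReal_le_ofReal (pow_le_pow_left₀ ?_ ?_ _) <;> simp only [N] <;> push_cast <;>
    linarith

end TorusProjection

/-! ### Periodization and unfolding of integrals -/

section Periodization

variable {d : ℕ}

lemma latticePoint_add (j k : Fin d → ℤ) :
    latticePoint (j + k) = latticePoint j + latticePoint k := by
  ext i
  simp

/-- The sum of the lattice translates of `g` in the space variable. -/
noncomputable def periodize (g : ℝ × EuclideanSpace ℝ (Fin d) → ℝ)
    (z : ℝ × EuclideanSpace ℝ (Fin d)) : ℝ :=
  ∑' k, g (z.1, z.2 + latticePoint k)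

/-- The lattice points with coordinates of absolute value at most `N`. -/
noncomputable def latticeBox (d : ℕ) (N : ℤ) : Finset (Fin d → ℤ) := Finset.Icc (fun _ => -N) fun _ => N

/-- Translations by points outside the box push the ball of radius M beyond radius R. For z.2 in
that ball this reduces periodization to one fixed finite sum, so smoothness is inherited. -/
lemma lt_norm_of_notMem_latticeBox {R M : ℝ} {k : Fin d → ℤ} (hk : k ∉ latticeBox d ⌈R + M⌉)
    {x : EuclideanSpace ℝ (Fin d)} (hx : ‖x‖ ≤ M) : R < ‖x + latticePoint k‖ := by
  have h1 : R + M < ‖latticePoint k‖ := by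
    by_contra! h
    refine hk ?_
    have h2 : ∀ i, |(k i : ℝ)| ≤ ⌈R + M⌉ := fun i =>
      (PiLp.norm_apply_le (latticePoint k) i).trans (h.trans (Int.le_ceil _))
    simp only [latticeBox, Finset.mem_Icc, Pi.le_def]
    refine ⟨fun i => ?_, fun i => ?_⟩
    · have := neg_le_of_abs_le (h2 i)
      exact_mod_cast this
    · exact_mod_cast le_of_abs_le (h2 i)
  have h3 := norm_sub_le (x + latticePoint k) x
  rw [add_sub_cancel_left] at h3
  linarith

variable {g : ℝ × EuclideanSpace ℝ (Fin d) → ℝ} {R : ℝ}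

lemma periodize_eq_sum (hg : ∀ z, R < ‖z.2‖ → g z = 0) {M : ℝ}
    {z : ℝ × EuclideanSpace ℝ (Fin d)} (hz : ‖z.2‖ ≤ M) :
    periodize g z = ∑ k ∈ latticeBox d ⌈R + M⌉, g (z.1, z.2 + latticePoint k) :=
  tsum_eq_sum fun _ hk => hg _ (lt_norm_of_notMem_latticeBox hk hz)

lemma periodize_eventuallyEq (hg : ∀ z, R < ‖z.2‖ → g z = 0)
    (z : ℝ × EuclideanSpace ℝ (Fin d)) :
    periodize g =ᶠ[𝓝 z] fun w => ∑ k ∈ latticeBox d ⌈R + (‖z.2‖ + 1)⌉,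
      g (w.1, w.2 + latticePoint k) := by
  have : ∀ᶠ w : ℝ × EuclideanSpace ℝ (Fin d) in 𝓝 z, ‖w.2‖ < ‖z.2‖ + 1 :=
    (continuous_snd.norm.tendsto z).eventually_lt_const (by simp)
  filter_upwards [this] with w hw
  exact periodize_eq_sum hg hw.le

lemma continuous_periodize (hg : ∀ z, R < ‖z.2‖ → g z = 0) (hgc : Continuous g) :
    Continuous (periodize g) :=
  continuous_iff_continuousAt.2 fun z => ContinuousAt.congr
    (by fun_prop) (periodize_eventuallyEq hg z).symm

lemma contDiff_periodize (hg : ∀ z, R < ‖z.2‖ → g z = 0) (hgc : ContDiff ℝ ∞ g) :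
    ContDiff ℝ ∞ (periodize g) :=
  contDiff_iff_contDiffAt.2 fun z => ContDiffAt.congr_of_eventuallyEq
    (ContDiff.contDiffAt (by fun_prop)) (periodize_eventuallyEq hg z)

lemma fderiv_periodize (hg : ∀ z, R < ‖z.2‖ → g z = 0) (hgc : ContDiff ℝ ∞ g)
    (z w : ℝ × EuclideanSpace ℝ (Fin d)) :
    fderiv ℝ (periodize g) z w = periodize (fun z => fderiv ℝ g z w) z := by
  have hg' : ∀ z, R < ‖z.2‖ → fderiv ℝ g z w = 0 := fun z hz => by
    have : g =ᶠ[𝓝 z] fun _ => 0 := by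
      filter_upwards [(continuous_snd.norm.tendsto z).eventually_const_lt hz] with w hw
      exact hg w hw
    rw [this.fderiv_eq]
    simp
  rw [(periodize_eventuallyEq hg z).fderiv_eq,
    periodize_eq_sum hg' (M := ‖z.2‖ + 1) (by simp)]
  have h1 : ∀ k : Fin d → ℤ, HasFDerivAt
      (fun w : ℝ × EuclideanSpace ℝ (Fin d) => g (w.1, w.2 + latticePoint k))
      (fderiv ℝ g (z.1, z.2 + latticePoint k)) z := fun k => by
    have h2 := (hgc.differentiable (by simp) (z + (0, latticePoint k))).hasFDerivAt
    have h3 := (hasFDerivAt_comp_add_right (0, latticePoint k)).2 h2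
    simpa [Prod.add_def] using h3
  rw [(HasFDerivAt.fun_sum fun k _ => h1 k).fderiv]
  simp

lemma periodize_add_latticePoint (t : ℝ) (x : EuclideanSpace ℝ (Fin d)) (k : Fin d → ℤ) :
    periodize g (t, x + latticePoint k) = periodize g (t, x) := by
  simp only [periodize]
  rw [← (Equiv.addLeft k).tsum_eq fun j => g (t, x + latticePoint j)]
  simp [latticePoint_add, add_assoc]

lemma HasCompactSupport.exists_eq_zero_of_lt_norm (hg : HasCompactSupport g) :
    ∃ R, ∀ z : ℝ × EuclideanSpace ℝ (Fin d), R < ‖z.2‖ → g z = 0 := by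
  obtain ⟨R, hR⟩ := (hg.isCompact.image continuous_snd).isBounded.exists_norm_le
  exact ⟨R, fun z hz => image_eq_zero_of_notMem_tsupport fun h =>
    (hR _ ⟨z, h, rfl⟩).not_gt hz⟩

/-- The function on the torus obtained by summing the lattice translates of `g`. -/
noncomputable def torusPeriodize (g : ℝ × EuclideanSpace ℝ (Fin d) → ℝ)
    (z : ℝ × UnitAddTorus (Fin d)) : ℝ :=
  periodize g (z.1, Function.surjInv isOpenQuotientMap_torusProj.surjective z.2)

/-- The lift chosen in `torusPeriodize` is irrelevant because two lifts differ by a lattice point.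
-/
lemma torusPeriodize_torusProj (g : ℝ × EuclideanSpace ℝ (Fin d) → ℝ) (t : ℝ)
    (x : EuclideanSpace ℝ (Fin d)) : torusPeriodize g (t, torusProj d x) = periodize g (t, x) := by
  obtain ⟨k, hk⟩ := exists_eq_add_latticePoint (Function.surjInv_eq
    isOpenQuotientMap_torusProj.surjective (torusProj d x))
  rw [torusPeriodize, hk, periodize_add_latticePoint]

lemma isOpenQuotientMap_prodMap_torusProj :
    IsOpenQuotientMap (Prod.map id (torusProj d) : ℝ × _ → ℝ × UnitAddTorus (Fin d)) :=
  IsOpenQuotientMap.id.prodMap isOpenQuotientMap_torusProj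

lemma continuous_torusPeriodize (hg : ∀ z, R < ‖z.2‖ → g z = 0) (hgc : Continuous g) :
    Continuous (torusPeriodize g) := by
  rw [← isOpenQuotientMap_prodMap_torusProj.continuous_comp_iff]
  exact (continuous_periodize hg hgc).congr fun z => (torusPeriodize_torusProj g z.1 z.2).symm

lemma measurable_prodMap_torusProj :
    Measurable (Prod.map id (torusProj d) : ℝ × _ → ℝ × UnitAddTorus (Fin d)) :=
  measurable_id.prodMap measurable_torusProj

lemma measurePreserving_prodMap_torusProj (J : Set ℝ) :
    MeasurePreserving (Prod.map id (torusProj d)) (volume.restrict (J ×ˢ unitCube d))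
      (volume.restrict (J ×ˢ univ)) := by
  rw [Measure.volume_eq_prod, Measure.volume_eq_prod, ← Measure.prod_restrict,
    ← Measure.prod_restrict, Measure.restrict_univ]
  exact (MeasurePreserving.id _).prod measurePreserving_torusProj

lemma map_prodMap_torusProj_le (J : Set ℝ) {R : ℝ} (hR : 0 ≤ R) :
    Measure.map (Prod.map id (torusProj d)) (volume.restrict (J ×ˢ Metric.closedBall 0 R)) ≤
      ENNReal.ofReal ((2 * R + 5) ^ d) • volume.restrict (J ×ˢ univ) := by
  rw [Measure.volume_eq_prod, Measure.volume_eq_prod, ← Measure.prod_restrict,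
    ← Measure.prod_restrict, Measure.restrict_univ,
    ← Measure.map_prod_map _ _ measurable_id measurable_torusProj, Measure.map_id,
    ← Measure.prod_smul_right]
  exact Measure.prod_mono le_rfl (map_torusProj_restrict_closedBall_le hR)

variable {F : Type*} [NormedAddCommGroup F] {I : Set ℝ}

/-- One direction uses a single unit cube, on which the projection preserves measure. The other
covers a ball by finitely many translated cubes. -/
lemma locallyIntegrableOn_comp_torusProj_iff (hI : IsOpen I) {f : ℝ × UnitAddTorus (Fin d) → F}
    (hf : StronglyMeasurable f) :
    LocallyIntegrableOn (fun z : ℝ × EuclideanSpace ℝ (Fin d) => f (z.1, torusProj d z.2))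
      (I ×ˢ univ) ↔ LocallyIntegrableOn f (I ×ˢ univ) := by
  rw [locallyIntegrableOn_iff (hI.prod isOpen_univ).isLocallyClosed,
    locallyIntegrableOn_iff (hI.prod isOpen_univ).isLocallyClosed]
  refine ⟨fun h K hKU hK => ?_, fun h K hKU hK => ?_⟩
  · have hJ : IsCompact (Prod.fst '' K) := hK.image continuous_fst
    have hJI : Prod.fst '' K ⊆ I := by rintro _ ⟨z, hz, rfl⟩; exact (hKU hz).1
    have h1 := (h ((Prod.fst '' K) ×ˢ Metric.closedBall 0 d) (Set.prod_mono hJI (subset_univ _))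
      (hJ.prod (isCompact_closedBall _ _))).mono_set (Set.prod_mono_right (t₁ := unitCube d) fun x hx =>
        mem_closedBall_zero_iff.2 (norm_le_of_mem_unitCube hx))
    have h2 := ((measurePreserving_prodMap_torusProj (Prod.fst '' K)).integrable_comp
      hf.aestronglyMeasurable).1 h1
    exact IntegrableOn.mono_set h2 fun z hz => ⟨⟨z, hz, rfl⟩, trivial⟩
  · have hJ : IsCompact (Prod.fst '' K) := hK.image continuous_fst
    have hJI : Prod.fst '' K ⊆ I := by rintro _ ⟨z, hz, rfl⟩; exact (hKU hz).1
    obtain ⟨R, hR0, hR⟩ := (hK.image continuous_snd).isBounded.subset_closedBall_lt 0 0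
    have h1 := h ((Prod.fst '' K) ×ˢ univ) (prod_mono_left hJI) (hJ.prod isCompact_univ)
    have h2 : Integrable f (Measure.map (Prod.map id (torusProj d))
        (volume.restrict ((Prod.fst '' K) ×ˢ Metric.closedBall 0 R))) :=
      (h1.smul_measure ENNReal.ofReal_ne_top).mono_measure (map_prodMap_torusProj_le _ hR0.le)
    rw [integrable_map_measure hf.aestronglyMeasurable
      measurable_prodMap_torusProj.aemeasurable] at h2
    exact IntegrableOn.mono_set h2 fun z hz => ⟨⟨z, hz, rfl⟩, hR ⟨z, hz, rfl⟩⟩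

/-- Unfolding of an integral over the torus. -/
theorem integral_mul_torusPeriodize (hI : IsOpen I) {f : ℝ × UnitAddTorus (Fin d) → ℝ}
    (hf : StronglyMeasurable f) (hfl : LocallyIntegrableOn f (I ×ˢ univ))
    (hg : Continuous g) (hgc : HasCompactSupport g) (hgI : tsupport g ⊆ I ×ˢ univ) :
    ∫ z in I ×ˢ univ, f (z.1, torusProj d z.2) * g z =
      ∫ z in I ×ˢ univ, f z * torusPeriodize g z := by
  obtain ⟨R, hR⟩ := hgc.exists_eq_zero_of_lt_norm
  set H : ℝ × EuclideanSpace ℝ (Fin d) → ℝ := fun z => f (z.1, torusProj d z.2) * g z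
  have hH : IntegrableOn H (I ×ˢ univ) :=
    integrableOn_mul_of_locallyIntegrableOn (hI.prod isOpen_univ).measurableSet
      ((locallyIntegrableOn_comp_torusProj_iff hI hf).2 hfl) hg hgc hgI
  -- The lattice translates of the cube partition I × ℝ^d. With the sign -k, moving the cell back to
  -- the unit cube turns H into f(t, πx) g(t, x + k), the k-th term of the periodization.
  set A : (Fin d → ℤ) → Set (ℝ × EuclideanSpace ℝ (Fin d)) := fun k =>
    (fun z => z + (0, latticePoint (-k))) ⁻¹' (I ×ˢ unitCube d)
  have hQ : MeasurableSet (I ×ˢ unitCube d) := hI.measurableSet.prod measurableSet_unitCube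
  have hAm : ∀ k, MeasurableSet (A k) := fun k => hQ.preimage (by fun_prop)
  have hmem : ∀ k z, z ∈ A k ↔ z.1 ∈ I ∧ -k = fun i => 1 - ⌈z.2 i⌉ := fun k z => by
    simp [A, add_latticePoint_mem_unitCube_iff]
  have hAU : (⋃ k, A k) = I ×ˢ univ := by
    ext z
    simp only [mem_iUnion, hmem, mem_prod, mem_univ, and_true]
    exact ⟨fun ⟨k, hk⟩ => hk.1, fun h => ⟨-fun i => 1 - ⌈z.2 i⌉, h, neg_neg _⟩⟩
  have hAd : Pairwise (Function.onFun Disjoint A) := fun j k hjk => disjoint_left.2 fun z hj hk =>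
    hjk (neg_injective (((hmem j z).1 hj).2.trans ((hmem k z).1 hk).2.symm))
  have hmp : ∀ k : Fin d → ℤ, MeasurePreserving
      (fun z : ℝ × EuclideanSpace ℝ (Fin d) => z + (0, latticePoint (-k))) volume volume :=
    fun k => (measurePreserving_add_right volume (0 : ℝ)).prod
      (measurePreserving_add_right volume (latticePoint (-k)))
  have hme : ∀ k : Fin d → ℤ, MeasurableEmbedding
      (fun z : ℝ × EuclideanSpace ℝ (Fin d) => z + (0, latticePoint (-k))) :=
    fun k => (MeasurableEquiv.addRight _).measurableEmbedding
  set G : (Fin d → ℤ) → ℝ × EuclideanSpace ℝ (Fin d) → ℝ := fun k z =>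
    f (z.1, torusProj d z.2) * g (z.1, z.2 + latticePoint k)
  have hHG : ∀ k z, H z = G k (z + (0, latticePoint (-k))) := fun k z => by
    simp only [H, G, Prod.fst_add, Prod.snd_add, add_zero, torusProj_add_latticePoint, add_assoc,
      ← latticePoint_add]
    congr 2
    ext i
    · rfl
    · simp
  have hGi : ∀ k, IntegrableOn (G k) (I ×ˢ unitCube d) := fun k => by
    rw [← (hmp k).integrableOn_comp_preimage (hme k)]
    exact (hH.mono_set (hAU ▸ subset_iUnion A k)).congr (.of_forall fun z => hHG k z)
  rw [← hAU, integral_iUnion hAm hAd (hAU ▸ hH)]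
  have h1 : ∀ k, ∫ z in A k, H z = ∫ z in I ×ˢ unitCube d, G k z := fun k => by
    rw [← (hmp k).setIntegral_preimage_emb (hme k) (G k)]
    exact integral_congr_ae (.of_forall fun z => hHG k z)
  rw [tsum_congr h1]
  rw [tsum_eq_sum (s := latticeBox d ⌈R + d⌉), ← integral_finsetSum _ fun k _ => hGi k]
  · have hm : StronglyMeasurable fun z => f z * torusPeriodize g z :=
      hf.mul (continuous_torusPeriodize hR hg).stronglyMeasurable
    rw [← (measurePreserving_prodMap_torusProj I).map_eq,
      integral_map measurable_prodMap_torusProj.aemeasurable hm.aestronglyMeasurable]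
    refine setIntegral_congr_fun hQ fun z hz => ?_
    simp only [G, Prod.map, id]
    rw [torusPeriodize_torusProj, periodize_eq_sum (z := z) hR (norm_le_of_mem_unitCube hz.2),
      Finset.mul_sum]
  · intro k hk
    refine setIntegral_eq_zero_of_forall_eq_zero fun z hz => ?_
    have h0 : ‖z.2‖ ≤ (d : ℝ) := norm_le_of_mem_unitCube hz.2
    have h2 : g (z.1, z.2 + latticePoint k) = 0 :=
      hR (z.1, z.2 + latticePoint k) (lt_norm_of_notMem_latticeBox hk h0)
    exact mul_eq_zero_of_right _ h2

end Periodization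

/-! ### Test functions on the torus -/

section TestFunctions

variable {d : ℕ} {I : Set ℝ} {φ : ℝ × UnitAddTorus (Fin d) → ℝ}
  {ψ g : ℝ × EuclideanSpace ℝ (Fin d) → ℝ}

lemma IsSpaceTimeTest.continuous_of_torus (hφ : IsSpaceTimeTest (torusProj d) I φ) :
    Continuous φ := by
  rw [← isOpenQuotientMap_prodMap_torusProj.continuous_comp_iff]
  exact hφ.1.continuous

lemma timeDeriv_torusProj (φ : ℝ × UnitAddTorus (Fin d) → ℝ) (t : ℝ)
    (x : EuclideanSpace ℝ (Fin d)) : timeDeriv φ (t, torusProj d x) =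
      timeDeriv (fun z : ℝ × EuclideanSpace ℝ (Fin d) => φ (z.1, torusProj d z.2)) (t, x) := rfl

lemma spaceDeriv_torusProj (φ : ℝ × UnitAddTorus (Fin d) → ℝ) (j : Fin d) (t : ℝ)
    (x : EuclideanSpace ℝ (Fin d)) : spaceDeriv (torusProj d) j φ (t, torusProj d x) =
      spaceDeriv id j (fun z : ℝ × EuclideanSpace ℝ (Fin d) => φ (z.1, torusProj d z.2)) (t, x) := by
  simp only [spaceDeriv, torusProj_add, id]

lemma eq_of_forall_torusProj {f g : ℝ × UnitAddTorus (Fin d) → ℝ}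
    (h : ∀ t x, f (t, torusProj d x) = g (t, torusProj d x)) : f = g := by
  ext ⟨t, q⟩
  obtain ⟨x, rfl⟩ := isOpenQuotientMap_torusProj.surjective q
  exact h t x

lemma tsupport_torusPeriodize_subset (hg : HasCompactSupport g) :
    tsupport (torusPeriodize g) ⊆ (Prod.fst '' tsupport g) ×ˢ univ := by
  refine closure_minimal (fun z hz => ⟨?_, trivial⟩)
    ((hg.isCompact.image continuous_fst).isClosed.prod isClosed_univ)
  by_contra h
  refine hz ?_
  have : ∀ x, g (z.1, x) = 0 := fun x => image_eq_zero_of_notMem_tsupport fun h2 => h ⟨_, h2, rfl⟩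
  simp [torusPeriodize, periodize, this]

lemma hasCompactSupport_torusPeriodize (hg : HasCompactSupport g) :
    HasCompactSupport (torusPeriodize g) :=
  ((hg.isCompact.image continuous_fst).prod isCompact_univ).of_isClosed_subset
    (isClosed_tsupport _) (tsupport_torusPeriodize_subset hg)

lemma tsupport_torusPeriodize_subset_prod (hg : HasCompactSupport g)
    (hgI : tsupport g ⊆ I ×ˢ univ) : tsupport (torusPeriodize g) ⊆ I ×ˢ univ :=
  (tsupport_torusPeriodize_subset hg).trans (Set.prod_mono_left (by
    rintro _ ⟨z, hz, rfl⟩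
    exact (hgI hz).1))

lemma IsSpaceTimeTest.torusPeriodize (hψ : IsSpaceTimeTest id I ψ) :
    IsSpaceTimeTest (torusProj d) I (torusPeriodize ψ) := by
  have h := isSpaceTimeTest_id_iff.1 hψ
  obtain ⟨R, hR⟩ := h.2.1.exists_eq_zero_of_lt_norm
  refine ⟨?_, hasCompactSupport_torusPeriodize h.2.1,
    tsupport_torusPeriodize_subset_prod h.2.1 h.2.2⟩
  simp only [torusPeriodize_torusProj]
  exact contDiff_periodize hR h.1

lemma IsSpaceTimeTest.timeDeriv_torusPeriodize (hψ : IsSpaceTimeTest id I ψ) :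
    timeDeriv (_root_.torusPeriodize ψ) = _root_.torusPeriodize (timeDeriv ψ) := by
  have h := isSpaceTimeTest_id_iff.1 hψ
  obtain ⟨R, hR⟩ := h.2.1.exists_eq_zero_of_lt_norm
  refine eq_of_forall_torusProj fun t x => ?_
  simp only [timeDeriv_torusProj, torusPeriodize_torusProj]
  rw [timeDeriv_eq_fderiv (contDiff_periodize hR h.1), funext (timeDeriv_eq_fderiv h.1)]
  exact fderiv_periodize hR h.1 _ _

lemma IsSpaceTimeTest.spaceDeriv_torusPeriodize (hψ : IsSpaceTimeTest id I ψ) (j : Fin d) :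
    spaceDeriv (torusProj d) j (_root_.torusPeriodize ψ) =
      _root_.torusPeriodize (spaceDeriv id j ψ) := by
  have h := isSpaceTimeTest_id_iff.1 hψ
  obtain ⟨R, hR⟩ := h.2.1.exists_eq_zero_of_lt_norm
  refine eq_of_forall_torusProj fun t x => ?_
  simp only [spaceDeriv_torusProj, torusPeriodize_torusProj]
  rw [spaceDeriv_id_eq_fderiv (contDiff_periodize hR h.1), funext (spaceDeriv_id_eq_fderiv h.1 j)]
  exact fderiv_periodize hR h.1 _ _

/-- Every test function on the torus is the periodization of a test function on `ℝ^d`. -/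
lemma IsSpaceTimeTest.exists_torusPeriodize_eq (hφ : IsSpaceTimeTest (torusProj d) I φ) :
    ∃ ψ, IsSpaceTimeTest id I ψ ∧ _root_.torusPeriodize ψ = φ := by
  -- The bump is positive on the ball of radius d + 2, which contains the unit cube, so its
  -- periodization is positive everywhere. Dividing by it gives a partition of unity under lattice
  -- translation.
  let b : ContDiffBump (0 : EuclideanSpace ℝ (Fin d)) :=
    ⟨d + 1, d + 2, by positivity, by linarith⟩
  set β : ℝ × EuclideanSpace ℝ (Fin d) → ℝ := fun z => b z.2
  have hβ : ContDiff ℝ ∞ β := b.contDiff.comp contDiff_snd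
  have hR : ∀ z, (d + 2 : ℝ) < ‖z.2‖ → β z = 0 := fun z hz =>
    b.zero_of_le_dist (by simpa using hz.le)
  have hpos : ∀ z, 0 < periodize β z := by
    intro z
    rw [periodize_eq_sum hR le_rfl]
    refine Finset.sum_pos' (fun k _ => b.nonneg) ⟨fun i => 1 - ⌈z.2 i⌉, ?_, ?_⟩
    · by_contra hk
      have h1 := lt_norm_of_notMem_latticeBox hk (le_refl ‖z.2‖)
      have h2 := norm_le_of_mem_unitCube ((add_latticePoint_mem_unitCube_iff z.2 _).2 rfl)
      linarith
    · refine b.pos_of_mem_ball ?_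
      have h2 := norm_le_of_mem_unitCube ((add_latticePoint_mem_unitCube_iff z.2 _).2 rfl)
      rw [mem_ball_zero_iff]
      exact h2.trans_lt (show (d : ℝ) < d + 2 by linarith)
  set ψ : ℝ × EuclideanSpace ℝ (Fin d) → ℝ := fun z =>
    β z / periodize β z * φ (z.1, torusProj d z.2)
  have hψs : tsupport ψ ⊆ (Prod.fst '' tsupport φ) ×ˢ Metric.closedBall 0 (d + 2) := by
    refine closure_minimal (fun z hz => ⟨?_, ?_⟩)
      ((hφ.2.1.isCompact.image continuous_fst).isClosed.prod Metric.isClosed_closedBall)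
    · exact ⟨_, subset_tsupport φ (right_ne_zero_of_mul hz), rfl⟩
    · rw [mem_closedBall_zero_iff]
      by_contra! h
      exact left_ne_zero_of_mul hz (by rw [hR z h, zero_div])
  refine ⟨ψ, isSpaceTimeTest_id_iff.2 ⟨?_, ?_, ?_⟩, ?_⟩
  · exact (hβ.div (contDiff_periodize hR hβ) fun z => (hpos z).ne').mul hφ.1
  · exact ((hφ.2.1.isCompact.image continuous_fst).prod
      (isCompact_closedBall _ _)).of_isClosed_subset (isClosed_tsupport _) hψs
  · exact hψs.trans (Set.prod_mono (by rintro _ ⟨z, hz, rfl⟩; exact (hφ.2.2 hz).1) (subset_univ _))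
  · refine eq_of_forall_torusProj fun t x => ?_
    rw [torusPeriodize_torusProj]
    simp only [periodize, ψ, torusProj_add_latticePoint]
    have h1 : ∀ k, ∑' j : Fin d → ℤ, β (t, x + latticePoint k + latticePoint j) = periodize β (t, x) :=
      fun k => periodize_add_latticePoint t x k
    simp only [h1]
    rw [tsum_mul_right, tsum_div_const]
    change periodize β (t, x) / periodize β (t, x) * _ = _
    rw [div_self (hpos _).ne', one_mul]

end TestFunctions

/-! ### Unfolding of tested fluxes -/

section Unfolding

variable {d : ℕ} {I : Set ℝ} {ψ : ℝ × EuclideanSpace ℝ (Fin d) → ℝ}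

/-- Testing a periodic flux against `ψ` amounts to testing the flux on the torus against the
periodization of `ψ`. -/
theorem integral_flux_torusPeriodize (hI : IsOpen I) {A : ℝ × UnitAddTorus (Fin d) → ℝ}
    {B : Fin d → ℝ × UnitAddTorus (Fin d) → ℝ} (hA : StronglyMeasurable A)
    (hB : ∀ j, StronglyMeasurable (B j)) (hAl : LocallyIntegrableOn A (I ×ˢ univ))
    (hBl : ∀ j, LocallyIntegrableOn (B j) (I ×ˢ univ)) (hψ : IsSpaceTimeTest id I ψ) :
    ∫ z in I ×ˢ univ, (A (z.1, torusProj d z.2) * timeDeriv ψ z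
      + ∑ j, B j (z.1, torusProj d z.2) * spaceDeriv id j ψ z) =
    ∫ z in I ×ˢ univ, (A z * timeDeriv (torusPeriodize ψ) z
      + ∑ j, B j z * spaceDeriv (torusProj d) j (torusPeriodize ψ) z) := by
  have h := isSpaceTimeTest_id_iff.1 hψ
  have hUE := (hI.prod isOpen_univ (Y := EuclideanSpace ℝ (Fin d))).measurableSet
  have hUT := (hI.prod isOpen_univ (Y := UnitAddTorus (Fin d))).measurableSet
  have key : ∀ {f : ℝ × UnitAddTorus (Fin d) → ℝ} {g : ℝ × EuclideanSpace ℝ (Fin d) → ℝ},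
      StronglyMeasurable f → LocallyIntegrableOn f (I ×ˢ univ) → Continuous g →
      HasCompactSupport g → tsupport g ⊆ I ×ˢ univ →
      IntegrableOn (fun z => f (z.1, torusProj d z.2) * g z) (I ×ˢ univ) ∧
      IntegrableOn (fun z => f z * torusPeriodize g z) (I ×ˢ univ) ∧
      ∫ z in I ×ˢ univ, f (z.1, torusProj d z.2) * g z =
        ∫ z in I ×ˢ univ, f z * torusPeriodize g z := by
    intro f g hf hfl hg hgc hgI
    obtain ⟨R, hR⟩ := hgc.exists_eq_zero_of_lt_norm
    exact ⟨integrableOn_mul_of_locallyIntegrableOn hUE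
      ((locallyIntegrableOn_comp_torusProj_iff hI hf).2 hfl) hg hgc hgI,
      integrableOn_mul_of_locallyIntegrableOn hUT hfl (continuous_torusPeriodize hR hg)
        (hasCompactSupport_torusPeriodize hgc) (tsupport_torusPeriodize_subset_prod hgc hgI),
      integral_mul_torusPeriodize hI hf hfl hg hgc hgI⟩
  have htd : timeDeriv ψ = fun z => fderiv ℝ ψ z (1, 0) := funext (timeDeriv_eq_fderiv h.1)
  have kA := key hA hAl (g := timeDeriv ψ)
    (htd ▸ (h.1.continuous_fderiv (by simp)).clm_apply continuous_const)
    (htd ▸ h.2.1.fderiv_apply ℝ _) (htd ▸ (tsupport_fderiv_apply_subset ℝ _).trans h.2.2)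
  have kB := fun j => key (hB j) (hBl j) (hψ.continuous_spaceDeriv j)
    (hψ.hasCompactSupport_spaceDeriv j) ((hψ.tsupport_spaceDeriv_subset j).trans h.2.2)
  rw [hψ.timeDeriv_torusPeriodize]
  simp only [hψ.spaceDeriv_torusPeriodize]
  rw [integral_add kA.1 (integrable_finsetSum _ fun j _ => (kB j).1),
    integral_add kA.2.1 (integrable_finsetSum _ fun j _ => (kB j).2.1),
    integral_finsetSum _ fun j _ => (kB j).1, integral_finsetSum _ fun j _ => (kB j).2.1, kA.2.2]
  congr 1
  exact Finset.sum_congr rfl fun j _ => (kB j).2.2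

end Unfolding

/-! ### Periodic extension of weak solutions and its bounds -/

section Lift

variable {d : ℕ} {I : Set ℝ} {v : ℝ × UnitAddTorus (Fin d) → EuclideanSpace ℝ (Fin d)}
  {p : ℝ × UnitAddTorus (Fin d) → ℝ} {r : ℝ≥0∞} {ρ Ψ : ℤ → EuclideanSpace ℝ (Fin d) → ℝ} {C : ℝ}

instance isProbabilityMeasure_unitAddTorus :
    IsProbabilityMeasure (volume : Measure (UnitAddTorus (Fin d))) :=
  ⟨by simp [volume_pi, Measure.pi_univ]⟩

lemma MeasureTheory.StronglyMeasurable.apply_euclidean {α : Type*} [MeasurableSpace α]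
    {w : α → EuclideanSpace ℝ (Fin d)} (hw : StronglyMeasurable w) (j : Fin d) :
    StronglyMeasurable fun z => w z j :=
  (EuclideanSpace.proj j : _ →L[ℝ] ℝ).continuous.comp_stronglyMeasurable hw

/-- The periodic extension of a weak solution on the torus is a weak solution on `ℝ^d`. -/
theorem IsWeakEulerSolution.comp_torusProj (hI : IsOpen I)
    (h : IsWeakEulerSolution (torusProj d) I v p) (hv : StronglyMeasurable v)
    (hp : StronglyMeasurable p) :
    IsWeakEulerSolution id I (fun z => v (z.1, torusProj d z.2))
      fun z => p (z.1, torusProj d z.2) where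
  aestronglyMeasurable := (hv.comp_measurable measurable_prodMap_torusProj).aestronglyMeasurable
  locallyIntegrable_sq := (locallyIntegrableOn_comp_torusProj_iff hI (hv.norm.pow 2)).2
    h.locallyIntegrable_sq
  locallyIntegrable_pressure := (locallyIntegrableOn_comp_torusProj_iff hI hp).2
    h.locallyIntegrable_pressure
  momentum ψ hψ l := by
    -- The pressure is absorbed into the flux as v_j v_l + δ_{jl} p.
    have h1 := integral_flux_torusPeriodize hI (A := fun z => v z l)
      (B := fun j z => v z j * v z l + if j = l then p z else 0)
      (hv.apply_euclidean l) (fun j => ((hv.apply_euclidean j).mul (hv.apply_euclidean l)).add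
        (by split_ifs; exacts [hp, stronglyMeasurable_const]))
      (h.locallyIntegrableOn_velocity hI l) (fun j => (h.locallyIntegrableOn_mul hI j l).add
        (by split_ifs; exacts [h.locallyIntegrable_pressure, locallyIntegrableOn_zero])) hψ
    have h2 := h.momentum _ hψ.torusPeriodize l
    simp only [add_mul, ite_mul, zero_mul, Finset.sum_add_distrib, Finset.sum_ite_eq',
      Finset.mem_univ, if_true, ← add_assoc] at h1
    exact h1.trans h2
  incompressible ψ hψ := by
    have h1 := integral_flux_torusPeriodize hI (A := fun _ => (0 : ℝ)) (B := fun j z => v z j)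
      stronglyMeasurable_const (fun j => hv.apply_euclidean j) locallyIntegrableOn_zero
      (h.locallyIntegrableOn_velocity hI) hψ
    simp only [zero_mul, zero_add] at h1
    exact h1.trans (h.incompressible _ hψ.torusPeriodize)

lemma eLpNorm_comp_torusProj_le {F : Type*} [NormedAddCommGroup F]
    {f : ℝ × UnitAddTorus (Fin d) → F} (hf : StronglyMeasurable f) (r : ℝ≥0∞) (J : Set ℝ) {R : ℝ}
    (hR : 0 ≤ R) :
    eLpNorm (fun z : ℝ × EuclideanSpace ℝ (Fin d) => f (z.1, torusProj d z.2)) r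
      (volume.restrict (J ×ˢ Metric.closedBall 0 R)) ≤
      ENNReal.ofReal ((2 * R + 5) ^ d) ^ (1 / r).toReal *
        eLpNorm f r (volume.restrict (J ×ˢ univ)) := by
  rw [← smul_eq_mul, ← eLpNorm_smul_measure_of_ne_zero (by simp; positivity)]
  refine le_trans ?_ (eLpNorm_mono_measure f (map_prodMap_torusProj_le J hR))
  rw [eLpNorm_map_measure hf.aestronglyMeasurable measurable_prodMap_torusProj.aemeasurable]
  rfl

lemma hasCubicRegularity_comp_torusProj (hr : 3 ≤ r) (hv : StronglyMeasurable v)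
    (hB : MemLtBesov (torusProj d) I (1 / 3) r v) :
    HasCubicRegularity I fun z => v (z.1, torusProj d z.2) := by
  have hr0 : r ≠ 0 := (lt_of_lt_of_le (by norm_num) hr).ne'
  refine hasCubicRegularity_of_eLpNorm_le hr (hv.comp_measurable measurable_prodMap_torusProj)
    fun K hKU hK => ?_
  obtain ⟨R, hR0, hR⟩ := (hK.image continuous_snd).isBounded.subset_closedBall_lt 0 0
  have hKR : K ⊆ I ×ˢ Metric.closedBall 0 R := fun z hz => ⟨(hKU hz).1, hR ⟨z, hz, rfl⟩⟩
  set c := ENNReal.ofReal ((2 * R + 5) ^ d) ^ (1 / r).toReal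
  have hc : c ≠ ⊤ := ENNReal.rpow_ne_top_of_nonneg ENNReal.toReal_nonneg ENNReal.ofReal_ne_top
  have hmain : ∀ {w : ℝ × UnitAddTorus (Fin d) → EuclideanSpace ℝ (Fin d)}, StronglyMeasurable w →
      eLpNorm (fun z : ℝ × EuclideanSpace ℝ (Fin d) => w (z.1, torusProj d z.2)) r
        (volume.restrict K) ≤ c * eLpNorm w r (volume.restrict (I ×ˢ univ)) := fun hw =>
    (eLpNorm_mono_measure _ (Measure.restrict_mono hKR le_rfl)).trans
      (eLpNorm_comp_torusProj_le hw r I hR0.le)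
  refine ⟨(hmain hv).trans_lt (ENNReal.mul_lt_top hc.lt_top
    ((eLpNorm_le_besov hr0 hv _).trans_lt hB.2)), _, ENNReal.mul_ne_top hc hB.2.ne, fun y _ => ?_⟩
  have hm : StronglyMeasurable fun z : ℝ × UnitAddTorus (Fin d) =>
      v (z.1, z.2 - torusProj d y) - v z :=
    (hv.comp_measurable (measurable_fst.prodMk (measurable_snd.sub_const _))).sub hv
  simp only [torusProj_sub]
  refine (hmain hm).trans ?_
  rw [mul_assoc]
  gcongr
  exact (eLpNorm_sub_le_besov hr0 hv torusProj_zero y).trans_eq (mul_comm _ _)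

lemma exists_isEnergyDensityBound_comp_torusProj (hI : IsOpen I) (hr : 3 ≤ r)
    (h : IsWeakEulerSolution (torusProj d) I v p) (hv : StronglyMeasurable v)
    (hB : MemLtBesov (torusProj d) I (1 / 3) r v) :
    ∃ N, IsEnergyDensityBound I (fun z => v (z.1, torusProj d z.2)) N := by
  set n : ℝ → ℝ≥0∞ := fun t => eLpNorm (fun x => v (t, x)) 2 volume with hn
  have hnm : Measurable n := by
    have : n = fun t => (∫⁻ x, ‖v (t, x)‖ₑ ^ (2 : ℝ)) ^ (1 / 2 : ℝ) := by
      ext t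
      rw [hn]
      simp only
      rw [eLpNorm_eq_lintegral_rpow_enorm_toReal (by simp) (by simp)]
      simp
    rw [this]
    exact ((hv.enorm.pow_const _).lintegral_prod_right').pow_const _
  have hnL : MemLp (fun t => (n t).toReal) r (volume.restrict I) := by
    refine ⟨hnm.ennreal_toReal.aestronglyMeasurable, lt_of_le_of_lt ?_ hB.2⟩
    refine eLpNorm_mono_enorm fun t => ?_
    rw [Real.enorm_of_nonneg ENNReal.toReal_nonneg, enorm_eq_self]
    refine ENNReal.ofReal_toReal_le.trans (le_trans ?_ le_self_add)
    exact eLpNorm_le_eLpNorm_of_exponent_le (le_trans (by norm_num) hr)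
      (hv.comp_measurable measurable_prodMk_left).aestronglyMeasurable
  have hslice : ∀ᵐ t, t ∈ I → IntegrableOn (fun x => ‖v (t, x)‖ ^ 2) univ :=
    ae_mem_of_forall_isCompact hI fun J hJI hJ => ae_integrableOn_slice (f := fun z => ‖v z‖ ^ 2)
      hJ.measurableSet (h.locallyIntegrable_sq.integrableOn_compact_subset (Set.prod_mono_left hJI)
        (hJ.prod isCompact_univ))
  -- A ball of radius s ≥ 1 covers the torus at most (2s + 5)^d ≤ (7s)^d times.
  refine ⟨fun t => 7 ^ d * (n t).toReal ^ 2, fun J hJI hJ => ?_, ?_⟩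
  · have : IsFiniteMeasure (volume.restrict J) := ⟨by simpa using hJ.measure_lt_top⟩
    exact memLp_const_mul_sq
      ((hnL.mono_measure (Measure.restrict_mono hJI le_rfl)).mono_exponent hr) _
  · filter_upwards [hslice] with t ht htI s hs
    have hvm : StronglyMeasurable fun x => v (t, x) := hv.comp_measurable measurable_prodMk_left
    have ht2 : Integrable (fun x => ‖v (t, x)‖ ^ 2) := by simpa using ht htI
    have hvt : MemLp (fun x => v (t, x)) 2 volume :=
      (memLp_two_iff_integrable_sq_norm hvm.aestronglyMeasurable).2 ht2
    have h1 := hvt.setIntegral_norm_pow_le (q := 2) (by simp) le_rfl (S := univ)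
      (measure_ne_top _ _)
    rw [Measure.restrict_univ, ENNReal.toReal_ofNat, Nat.cast_ofNat, div_self two_ne_zero, sub_self,
      Real.rpow_zero, mul_one] at h1
    have hmap := map_torusProj_restrict_closedBall_le (d := d) (R := s) (by linarith)
    have h2 : ∫ x in Metric.closedBall 0 s, ‖v (t, torusProj d x)‖ ^ 2 ≤
        (2 * s + 5) ^ d * ∫ x, ‖v (t, x)‖ ^ 2 := by
      have h3 := integral_mono_measure hmap (.of_forall fun x => by positivity)
        (ht2.smul_measure ENNReal.ofReal_ne_top)
      have hm : AEStronglyMeasurable (fun x => ‖v (t, x)‖ ^ 2) (Measure.map (torusProj d)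
        (volume.restrict (Metric.closedBall 0 s))) := (hvm.norm.pow 2).aestronglyMeasurable
      rw [integral_map measurable_torusProj.aemeasurable hm,
        integral_smul_measure, ENNReal.toReal_ofReal (by positivity), smul_eq_mul] at h3
      exact h3
    calc _ ≤ (2 * s + 5) ^ d * ∫ x, ‖v (t, x)‖ ^ 2 := h2
      _ ≤ (7 * s) ^ d * (n t).toReal ^ 2 := by gcongr; linarith
      _ = s ^ d * (7 ^ d * (n t).toReal ^ 2) := by rw [mul_pow]; ring

/-- The mean over large balls of the gradient of a periodic function is negligible. -/
lemma isPressureGradientDecaying_comp_torusProj (hI : IsOpen I) (hp : StronglyMeasurable p)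
    (hpl : LocallyIntegrableOn p (I ×ˢ univ)) (hρ : IsDyadicKernel ρ Ψ C) (hC : 0 < C) :
    IsPressureGradientDecaying I (fun z => p (z.1, torusProj d z.2)) ρ := by
  intro a ha hac haI y l
  obtain ⟨A, hA⟩ := ha.continuous.bounded_above_of_compact_support hac
  have hA0 : 0 ≤ A := (norm_nonneg _).trans (hA 0)
  have hU := (hI.prod isOpen_univ (Y := EuclideanSpace ℝ (Fin d))).measurableSet
  have hpJ : IntegrableOn p (tsupport a ×ˢ univ) :=
    hpl.integrableOn_compact_subset (Set.prod_mono_left haI) (hac.isCompact.prod isCompact_univ)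
  set P := ∫ z in tsupport a ×ˢ univ, |p z|
  have hP : 0 ≤ P := integral_nonneg fun z => abs_nonneg _
  -- The integral of |p| over a ball of radius O(2^n) is O(2^{nd}) by periodicity, against a kernel
  -- of size O(2^{-n(d+1)}). Neither the equation nor the value of r enters.
  refine squeeze_zero_norm (a := fun n : ℕ => A * C * (2 * ‖y‖ + 7) ^ d * P * (2 ^ n : ℝ)⁻¹)
    (fun n => ?_) ?_
  · set R := ‖y‖ + 2 ^ n
    have hR : 0 ≤ R := by positivity
    set S := tsupport a ×ˢ Metric.closedBall (0 : EuclideanSpace ℝ (Fin d)) R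
    have hmap := map_prodMap_torusProj_le (d := d) (tsupport a) hR
    have hi : IntegrableOn (fun z : ℝ × EuclideanSpace ℝ (Fin d) => |p (z.1, torusProj d z.2)|) S ∧
        ∫ z in S, |p (z.1, torusProj d z.2)| ≤ (2 * R + 5) ^ d * P := by
      have h0 := hpJ.abs.smul_measure (c := ENNReal.ofReal ((2 * R + 5) ^ d)) ENNReal.ofReal_ne_top
      have h2 := h0.mono_measure hmap
      have h3 := integral_mono_measure hmap (.of_forall fun x => abs_nonneg _) h0
      have hm : AEStronglyMeasurable (fun z => |p z|) (Measure.map (Prod.map id (torusProj d))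
        (volume.restrict S)) := hp.norm.aestronglyMeasurable
      refine ⟨(integrable_map_measure hm measurable_prodMap_torusProj.aemeasurable).1 h2, ?_⟩
      rw [integral_map measurable_prodMap_torusProj.aemeasurable hm, integral_smul_measure,
        ENNReal.toReal_ofReal (by positivity), smul_eq_mul] at h3
      exact h3
    have hSU : S ⊆ I ×ˢ univ := fun z hz => ⟨haI hz.1, trivial⟩
    have hx0 : (0 : ℝ) < 2 ^ n := by positivity
    rw [setIntegral_eq_of_subset_of_forall_sdiff_eq_zero hU hSU]
    · refine (norm_integral_le_of_norm_le (hi.1.const_mul (A * (C * ((2 : ℝ) ^ n)⁻¹ ^ (d + 1))))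
        (.of_forall fun z => ?_)).trans ?_
      · rw [norm_mul, norm_mul, mul_comm]
        have := hρ.abs_partialD_le n l (y - z.2)
        rw [zpow_natCast] at this
        exact mul_le_mul_of_nonneg_right (mul_le_mul (hA _) this (abs_nonneg _) hA0)
          (norm_nonneg _)
      · rw [integral_const_mul]
        have h1 : 2 * R + 5 ≤ (2 * ‖y‖ + 7) * 2 ^ n := by
          have : (1 : ℝ) ≤ 2 ^ n := one_le_pow₀ (by norm_num)
          simp only [R]
          nlinarith [norm_nonneg y]
        calc _ ≤ A * (C * ((2 : ℝ) ^ n)⁻¹ ^ (d + 1)) * (((2 * ‖y‖ + 7) * 2 ^ n) ^ d * P) := by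
              gcongr
              exact hi.2.trans (by gcongr)
          _ = _ := by
              rw [mul_pow, pow_succ, inv_pow]
              field_simp
    · intro z hz
      by_cases hzt : z.1 ∈ tsupport a
      · have hz2 : y - z.2 ∉ tsupport (ρ n) := fun h2 => hz.2 ⟨hzt, by
          have h3 := hρ.tsupport_subset n h2
          rw [mem_closedBall_zero_iff, zpow_natCast] at h3
          rw [mem_closedBall_zero_iff]
          have := norm_sub_le y (y - z.2)
          rw [sub_sub_cancel] at this
          linarith⟩
        rw [image_eq_zero_of_notMem_tsupport fun h2 => hz2 (tsupport_partialD_subset l h2)]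
        simp
      · rw [image_eq_zero_of_notMem_tsupport hzt]
        simp
  · have t2 : Tendsto (fun n : ℕ => (2 ^ n : ℝ)⁻¹) atTop (𝓝 0) :=
      tendsto_inv_atTop_zero.comp (tendsto_pow_atTop_atTop_of_one_lt (by norm_num))
    simpa using t2.const_mul _

end Lift

/-! ### The theorem on the torus -/

section TorusCase

variable {d : ℕ} {I : Set ℝ} {v : ℝ × UnitAddTorus (Fin d) → EuclideanSpace ℝ (Fin d)}
  {p : ℝ × UnitAddTorus (Fin d) → ℝ} {r : ℝ≥0∞} {ρ Ψ : ℤ → EuclideanSpace ℝ (Fin d) → ℝ} {C : ℝ}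

lemma stronglyMeasurable_sub_torusProj (hv : StronglyMeasurable v)
    (y : EuclideanSpace ℝ (Fin d)) :
    StronglyMeasurable fun z => v (z.1, z.2 - torusProj d y) - v z :=
  (hv.comp_measurable (measurable_fst.prodMk (measurable_snd.sub_const _))).sub hv

lemma locallyIntegrableOn_cubicIncrement (hI : IsOpen I) (hr : 3 ≤ r) (hv : StronglyMeasurable v)
    (hB : MemLtBesov (torusProj d) I (1 / 3) r v) (y : EuclideanSpace ℝ (Fin d)) (j : Fin d) :
    LocallyIntegrableOn (cubicIncrement (torusProj d) v y j) (I ×ˢ univ) := by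
  have hr0 : r ≠ 0 := (lt_of_lt_of_le (by norm_num) hr).ne'
  rw [locallyIntegrableOn_iff (hI.prod isOpen_univ).isLocallyClosed]
  intro K hKU hK
  have : IsFiniteMeasure (volume.restrict K) := ⟨by simpa using hK.measure_lt_top⟩
  have hw := stronglyMeasurable_sub_torusProj hv y
  have h3 : MemLp (fun z => v (z.1, z.2 - torusProj d y) - v z) (3 : ℕ) (volume.restrict K) := by
    refine MemLp.mono_exponent (q := r) ⟨hw.aestronglyMeasurable, ?_⟩ (by exact_mod_cast hr)
    refine (eLpNorm_mono_measure _ (Measure.restrict_mono hKU le_rfl)).trans_lt ?_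
    exact (eLpNorm_sub_le_besov hr0 hv torusProj_zero y).trans_lt
      (ENNReal.mul_lt_top ENNReal.ofReal_lt_top hB.2)
  refine (h3.integrable_norm_pow (by norm_num)).mono'
    ((hw.norm.pow 2).mul (hw.apply_euclidean j)).aestronglyMeasurable (.of_forall fun z => ?_)
  rw [cubicIncrement, norm_mul, norm_pow, norm_norm, pow_succ _ 2]
  exact mul_le_mul_of_nonneg_left (PiLp.norm_apply_le _ j) (by positivity)

/-- The pressure normalization and the Duchon–Robert limit are obtained for the periodic extension.
The flux bounds are applied on the torus, where the Besov norm is finite, whereas the extension is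
not globally in L^r in general. -/
lemma exists_dissipation_torus_of_stronglyMeasurable (hd : d ≠ 0) (hI : IsOpen I) (hr : 3 ≤ r)
    (h : IsWeakEulerSolution (torusProj d) I v p) (hB : MemLtBesov (torusProj d) I (1 / 3) r v)
    (hv : StronglyMeasurable v) (hp : StronglyMeasurable p) :
    (∃ c : ℝ → ℝ, LocallyIntegrableOn c I ∧
        LocallyIntegrableOn (fun z => (p z - c z.1) • v z) (I ×ˢ univ)) ∧
    (LocallyIntegrableOn (fun z => p z • v z) (I ×ˢ univ) →
      ∃ ν : SignedRadonMeasure (I ×ˢ (univ : Set (UnitAddTorus (Fin d)))),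
        (∀ φ, IsSpaceTimeTest (torusProj d) I φ →
          dissipation (torusProj d) I v p φ = ν.integral φ) ∧
        (3 < r → ν.IsAbsolutelyContinuous volume ∧
          MemLp (ν.density volume) (r / 3) (volume.restrict (I ×ˢ univ)))) := by
  obtain ⟨ρ, Ψ, C, hC, hρ⟩ := exists_isDyadicKernel hd
  have hr0 : r ≠ 0 := (lt_of_lt_of_le (by norm_num) hr).ne'
  have hlift := h.comp_torusProj hI hv hp
  have hreg := hasCubicRegularity_comp_torusProj hr hv hB
  obtain ⟨N, hN⟩ := exists_isEnergyDensityBound_comp_torusProj hI hr h hv hB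
  obtain ⟨c, hc⟩ := hlift.exists_isPressureNormalizer hd hI
    (hv.comp_measurable measurable_prodMap_torusProj)
    (hp.comp_measurable measurable_prodMap_torusProj) hρ hC hreg hN
    (isPressureGradientDecaying_comp_torusProj hI hp h.locallyIntegrable_pressure hρ hC)
  refine ⟨?_, fun hpv => ?_⟩
  -- A measurable representative of c is needed to descend local integrability to the torus.
  · have hcm := hc.1.aestronglyMeasurable
    have hpc := hc.locallyIntegrableOn hI
    refine ⟨hcm.mk c, locallyIntegrableOn_congr_ae hc.1 hcm.ae_eq_mk hI.measurableSet, ?_⟩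
    refine (locallyIntegrableOn_comp_torusProj_iff hI ((hp.sub
      (hcm.stronglyMeasurable_mk.comp_measurable measurable_fst)).smul hv)).1 ?_
    refine locallyIntegrableOn_congr_ae hpc ?_
      (hI.prod isOpen_univ (Y := EuclideanSpace ℝ (Fin d))).measurableSet
    rw [Measure.volume_eq_prod, ← Measure.prod_restrict, Measure.restrict_univ]
    filter_upwards [Measure.quasiMeasurePreserving_fst.ae hcm.ae_eq_mk] with z hz
    simp only [hz, Pi.smul_apply', Pi.sub_apply, Function.comp_apply]
  · refine exists_signedRadonMeasure_of_tendsto hI hr hv hB measurable_torusProj torusProj_zero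
      (fun φ hφ => hφ.continuous_of_torus) hρ hC fun φ hφ => ?_
    -- Writing φ as a periodization of ψ, both the dissipation (`h2`) and each tested cubic
    -- increment (`h3`) unfold to integrals on I × ℝ^d, where the limit is known.
    obtain ⟨ψ, hψ, rfl⟩ := hφ.exists_torusPeriodize_eq
    have hψ' := isSpaceTimeTest_id_iff.1 hψ
    have hm2 : StronglyMeasurable fun z => ‖v z‖ ^ 2 / 2 :=
      (hv.norm.pow 2).mul stronglyMeasurable_const
    have hUl := (hI.prod isOpen_univ (Y := UnitAddTorus (Fin d))).isLocallyClosed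
    have hA : LocallyIntegrableOn (fun z => ‖v z‖ ^ 2 / 2) (I ×ˢ univ) :=
      (locallyIntegrableOn_iff hUl).2 fun K hKU hK =>
        (h.locallyIntegrable_sq.integrableOn_compact_subset hKU hK).div_const 2
    have hBl : ∀ j, LocallyIntegrableOn (fun z => (‖v z‖ ^ 2 / 2 + p z) * v z j) (I ×ˢ univ) := by
      refine fun j => (locallyIntegrableOn_iff hUl).2 fun K hKU hK => ?_
      have : IsFiniteMeasure (volume.restrict K) := ⟨by simpa using hK.measure_lt_top⟩
      have hv3 : MemLp v (3 : ℕ) (volume.restrict K) := MemLp.mono_exponent (q := r)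
        ⟨hv.aestronglyMeasurable, ((eLpNorm_mono_measure _ (Measure.restrict_mono hKU le_rfl)).trans
          (eLpNorm_le_besov hr0 hv _)).trans_lt hB.2⟩ (by exact_mod_cast hr)
      have i1 : IntegrableOn (fun z => ‖v z‖ ^ 2 / 2 * v z j) K := by
        refine (hv3.integrable_norm_pow (by norm_num)).mono'
          (hm2.mul (hv.apply_euclidean j)).aestronglyMeasurable (.of_forall fun z => ?_)
        rw [norm_mul, Real.norm_of_nonneg (by positivity), pow_succ _ 2]
        exact mul_le_mul (half_le_self (by positivity)) (PiLp.norm_apply_le _ j) (norm_nonneg _)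
          (by positivity)
      have i2 : IntegrableOn (fun z => p z * v z j) K :=
        (hpv.integrableOn_compact_subset hKU hK).eval_piLp j
      simp only [add_mul]
      exact i1.add i2
    have h1 := hlift.tendsto_dissipation_of_isPressureNormalizer hI hρ hreg hc
      ((locallyIntegrableOn_comp_torusProj_iff hI (hp.smul hv)).2 hpv) hψ
    have h2 : dissipation id I (fun z => v (z.1, torusProj d z.2))
        (fun z => p (z.1, torusProj d z.2)) ψ =
        dissipation (torusProj d) I v p (torusPeriodize ψ) :=
      integral_flux_torusPeriodize hI hm2
        (fun j => (hm2.add hp).mul (hv.apply_euclidean j)) hA hBl hψ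
    have h3 : ∀ y j, ∫ z in I ×ˢ univ, ψ z *
        cubicIncrement id (fun z => v (z.1, torusProj d z.2)) y j z =
        ∫ z in I ×ˢ univ, torusPeriodize ψ z * cubicIncrement (torusProj d) v y j z := by
      intro y j
      have hw := stronglyMeasurable_sub_torusProj hv y
      have h4 := integral_mul_torusPeriodize hI (f := cubicIncrement (torusProj d) v y j)
        ((hw.norm.pow 2).mul (hw.apply_euclidean j))
        (locallyIntegrableOn_cubicIncrement hI hr hv hB y j) hψ'.1.continuous hψ'.2.1 hψ'.2.2
      simp only [mul_comm (ψ _), mul_comm (torusPeriodize ψ _)]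
      rw [← h4]
      simp only [cubicIncrement, torusProj_sub, id]
    rw [h2] at h1
    simpa only [h3] using h1

theorem exists_dissipation_torus (hI : IsOpen I) (hr : 3 ≤ r)
    (h : IsWeakEulerSolution (torusProj d) I v p) (hB : MemLtBesov (torusProj d) I (1 / 3) r v) :
    (∃ c : ℝ → ℝ, LocallyIntegrableOn c I ∧
        LocallyIntegrableOn (fun z => (p z - c z.1) • v z) (I ×ˢ univ)) ∧
    (LocallyIntegrableOn (fun z => p z • v z) (I ×ˢ univ) →
      ∃ ν : SignedRadonMeasure (I ×ˢ (univ : Set (UnitAddTorus (Fin d)))),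
        (∀ φ, IsSpaceTimeTest (torusProj d) I φ →
          dissipation (torusProj d) I v p φ = ν.integral φ) ∧
        (3 < r → ν.IsAbsolutelyContinuous volume ∧
          MemLp (ν.density volume) (r / 3) (volume.restrict (I ×ˢ univ)))) :=
  exists_dissipation_of_stronglyMeasurable hI (fun _ _ hd h hB hv hp =>
    exists_dissipation_torus_of_stronglyMeasurable hd hI hr h hB hv hp) h hB

end TorusCase

theorem mainTheorem5 (d : ℕ) (I : Set ℝ) (hI : IsOpen I) (hI' : I.OrdConnected)
    (r : ℝ≥0∞) (hr : 3 ≤ r) :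
    -- the case of `I × ℝ^d`
    (∀ (v : ℝ × EuclideanSpace ℝ (Fin d) → EuclideanSpace ℝ (Fin d))
        (p : ℝ × EuclideanSpace ℝ (Fin d) → ℝ),
      IsWeakEulerSolution id I v p → MemLtBesov id I (1 / 3) r v →
      -- up to a function of time, the pressure is such that `D[v,p]` is defined
      (∃ c : ℝ → ℝ, LocallyIntegrableOn c I ∧
        LocallyIntegrableOn (fun z => (p z - c z.1) • v z) (I ×ˢ univ)) ∧
      -- whenever it is defined, it is a signed Radon measure
      (LocallyIntegrableOn (fun z => p z • v z) (I ×ˢ univ) →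
        ∃ ν : SignedRadonMeasure (I ×ˢ (univ : Set (EuclideanSpace ℝ (Fin d)))),
          (∀ φ, IsSpaceTimeTest id I φ → dissipation id I v p φ = ν.integral φ) ∧
          (3 < r → ν.IsAbsolutelyContinuous volume ∧
            MemLp (ν.density volume) (r / 3) (volume.restrict (I ×ˢ univ))))) ∧
    -- the case of `I × 𝕋^d`
    (∀ (v : ℝ × UnitAddTorus (Fin d) → EuclideanSpace ℝ (Fin d))
        (p : ℝ × UnitAddTorus (Fin d) → ℝ),
      IsWeakEulerSolution (torusProj d) I v p → MemLtBesov (torusProj d) I (1 / 3) r v →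
      (∃ c : ℝ → ℝ, LocallyIntegrableOn c I ∧
        LocallyIntegrableOn (fun z => (p z - c z.1) • v z) (I ×ˢ univ)) ∧
      (LocallyIntegrableOn (fun z => p z • v z) (I ×ˢ univ) →
        ∃ ν : SignedRadonMeasure (I ×ˢ (univ : Set (UnitAddTorus (Fin d)))),
          (∀ φ, IsSpaceTimeTest (torusProj d) I φ →
            dissipation (torusProj d) I v p φ = ν.integral φ) ∧
          (3 < r → ν.IsAbsolutelyContinuous volume ∧
            MemLp (ν.density volume) (r / 3) (volume.restrict (I ×ˢ univ))))) :=
  ⟨fun _ _ h hB => exists_dissipation_euclidean hI hr h hB,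
    fun _ _ h hB => exists_dissipation_torus hI hr h hB⟩
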